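/- **Definitions.** A *double bubble* in $\mathbb R^2$ is a pair $\mathcal E=\{\mathcal E(1),\mathcal E(2)\}$ of sets of finite perimeter with $0<|\mathcal E(h)|<\infty$ ($h=1,2$) and $|\mathcal E(1)\cap\mathcal E(2)|=0$. Set $\mathcal E(0)=\mathbb R^2\setminus(\mathcal E(1)\cup\mathcal E(2))$, $\mathrm{vol}(\mathcal E)=(|\mathcal E(1)|,|\mathcal E(2)|)$, $\partial\mathcal E=\partial\mathcal E(1)\cup\partial\mathcal E(2)$ and $P(\mathcal E)=\frac12\sum_{h=0}^2P(\mathcal E(h))$, where $P(E)=\sup\{\int_E\operatorname{div}T:\ T\in C^1_c(\mathbb R^2;\mathbb R^2),\ |T|\le1\}$ is the distributional perimeter. A *standard double bubble* is a double bubble whose chambers are the two bounded regions enclosed by three circular arcs (the arc between the chambers being possibly a segment) that meet at $120$ degree angles at their two common endpoints. The interfaces of a standard double bubble $\mathcal E_0$ are these three closed arcs $\gamma_0,\gamma_1,\gamma_2$, so that $\partial\mathcal E_0=\gamma_0\cup\gamma_1\cup\gamma_2$. If $\mathrm{vol}(\mathcal E)=\mathrm{vol}(\mathcal E_0)=(m_1,m_2)$,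 define the isoperimetric deficit and the Fraenkel asymmetry $$\delta(\mathcal E)=\frac{P(\mathcal E)}{P(\mathcal E_0)}-1,\qquad \alpha(\mathcal E)=\inf\Big\{\sum_{h=1}^2\frac{|\mathcal E(h)\,\Delta\, g(\mathcal E_0(h))|}{m_h}:\ g:\mathbb R^2\to\mathbb R^2\text{ an isometry}\Big\}.$$ A $C^{1,1}$-*diffeomorphism* $f:\partial\mathcal E_0\to\partial\mathcal E$ is a homeomorphism such that $f$ is of class $C^{1,1}$ up to the endpoints along each $\gamma_k$, and $f^{-1}$ is of class $C^{1,1}$ up to the endpoints along each $f(\gamma_k)$. For $u:\partial\mathcal E_0\to\mathbb R^2$ of this class, $\|u\|_{C^1(\partial\mathcal E_0)}=\sup_{\partial\mathcal E_0}|u|+\max_k\sup_{\gamma_k}|\nabla^{\gamma_k}u|$, where $\nabla^{\gamma_k}$ is the tangential gradient along $\gamma_k$. **Theorem 2.1.** If $m_2\ge m_1>0$, then there exist $\kappa>0$ and $\eta>0$, depending on $m_1$ and $m_2$ only, with the following property. If $\mathcal E_0$ is a standard double bubble in $\mathbb R^2$ with $\mathrm{vol}(\mathcal E_0)=(m_1,m_2)$,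 then $$\delta(\mathcal E)\ \ge\ \kappa\,\alpha(\mathcal E)^2$$ whenever $\mathcal E$ is a planar double bubble with $\mathrm{vol}(\mathcal E)=\mathrm{vol}(\mathcal E_0)$ and $\partial\mathcal E=f(\partial\mathcal E_0)$ for a $C^{1,1}$-diffeomorphism $f:\partial\mathcal E_0\to\partial\mathcal E$ with $\|f-\mathrm{Id}\|_{C^1(\partial\mathcal E_0)}<\eta$. -/

import Mathlib

open MeasureTheory
open scoped ENNReal symmDiff

noncomputable section

namespace PlanarBubble

/-- The Euclidean plane. -/
abbrev Plane : Type := EuclideanSpace ℝ (Fin 2)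

/-! ### Sets of finite perimeter -/

/-- The divergence of a vector field of the plane. -/
def divergence (T : Plane → Plane) (x : Plane) : ℝ :=
  ∑ i : Fin 2, (fderiv ℝ T x (EuclideanSpace.single i 1)) i

/-- The distributional perimeter of `E`: the supremum of `∫_E div T` over all compactly supported
`C¹` vector fields `T` with `|T| ≤ 1`. -/
def perimeter (E : Set Plane) : ℝ≥0∞ :=
  ⨆ (T : Plane → Plane) (_ : ContDiff ℝ 1 T) (_ : HasCompactSupport T) (_ : ∀ x, ‖T x‖ ≤ 1),
    ENNReal.ofReal (∫ x in E, divergence T x)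

/-- Lebesgue measurable sets of finite perimeter. -/
def HasFinitePerimeter (E : Set Plane) : Prop :=
  NullMeasurableSet E volume ∧ perimeter E < ∞

/-! ### Double bubbles -/

/-- A pair of chambers; the chambers of `E` are `E.1` and `E.2`. -/
abbrev Chambers : Type := Set Plane × Set Plane

/-- A planar double bubble: two essentially disjoint sets of finite perimeter with positive and
finite area. -/
structure IsDoubleBubble (E : Chambers) : Prop where
  finitePerimeter₁ : HasFinitePerimeter E.1
  finitePerimeter₂ : HasFinitePerimeter E.2
  area₁_pos : 0 < volume E.1
  area₂_pos : 0 < volume E.2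
  area₁_lt_top : volume E.1 < ∞
  area₂_lt_top : volume E.2 < ∞
  area_inter : volume (E.1 ∩ E.2) = 0

/-- The areas of the two chambers. -/
def vol (E : Chambers) : ℝ≥0∞ × ℝ≥0∞ := (volume E.1, volume E.2)

/-- The exterior chamber. -/
def exterior (E : Chambers) : Set Plane := (E.1 ∪ E.2)ᶜ

/-- The perimeter of a double bubble: half the sum of the perimeters of its three chambers. -/
def totalPerimeter (E : Chambers) : ℝ≥0∞ :=
  (perimeter (exterior E) + perimeter E.1 + perimeter E.2) / 2

/-- The boundary of a double bubble: the union of the boundaries of its chambers. -/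
def boundary (E : Chambers) : Set Plane := frontier E.1 ∪ frontier E.2

/-- The three (closed) interfaces: the one between the two chambers (`0`), and those between the
first (`1`), respectively the second (`2`), chamber and the exterior. -/
def interface (E : Chambers) : Fin 3 → Set Plane :=
  ![frontier E.1 ∩ frontier E.2, closure (frontier E.1 \ frontier E.2),
    closure (frontier E.2 \ frontier E.1)]

/-! ### Standard double bubbles -/

/-- One open side of the circle (the line, if `θ = 0`) through `(0, h)` and `(0, -h)` whose unit
normal at `(0, h)` is `(cos θ, sin θ)`. For `0 < θ < π` it is the open disc of radius `h / sin θ` centred at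
`(-h cot θ, 0)`; for `θ = 0` it is the half plane `x₁ < 0`; for `-π < θ < 0` it is the exterior of
a closed disc. -/
def arcSide (h θ : ℝ) : Set Plane :=
  {x | Real.sin θ * (‖x‖ ^ 2 - h ^ 2) + 2 * h * Real.cos θ * x 0 < 0}

/-- The opposite open side of the same circle or line. -/
def arcOtherSide (h θ : ℝ) : Set Plane :=
  {x | 0 < Real.sin θ * (‖x‖ ^ 2 - h ^ 2) + 2 * h * Real.cos θ * x 0}

/-- The two chambers bounded by three circular arcs with common endpoints `(0, h)` and `(0, -h)`
that meet there at 120 degrees. The arc towards the left and the arc towards the right have radii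
`r₁ = h / sin θ₁`, `r₂ = h / sin θ₂` and half-opening angles `θ₁ = 2π/3 - θ₀`, `θ₂ = 2π/3 + θ₀`; the
middle arc has half-opening angle `|θ₀|` (radius `h / sin |θ₀|`), is a segment when `θ₀ = 0`, and
bulges to the right when `θ₀ > 0`. The tangent vectors at `(0, h)` pointing into the three arcs are
`(-sin θ₁, -cos θ₁)`, `(sin θ₂, -cos θ₂)`, `(sin θ₀, -cos θ₀)`. -/
def modelDoubleBubble (h θ₀ : ℝ) : Chambers :=
  let θ₁ : ℝ := 2 * Real.pi / 3 - θ₀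
  let θ₂ : ℝ := 2 * Real.pi / 3 + θ₀
  (Metric.ball (!₂[h * Real.cos θ₁ / Real.sin θ₁, 0] : Plane) (h / Real.sin θ₁) ∩ arcSide h θ₀,
   Metric.ball (!₂[-(h * Real.cos θ₂ / Real.sin θ₂), 0] : Plane) (h / Real.sin θ₂) ∩
    arcOtherSide h θ₀)

/-- The image of a pair of chambers under an isometry of the plane. -/
def isometryImage (g : Plane ≃ᵢ Plane) (E : Chambers) : Chambers := (g '' E.1, g '' E.2)

/-- Standard double bubbles: the regions enclosed by three circular arcs (one of them possibly a
segment) meeting at 120 degrees at two points, in any position. -/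
def IsStandardDoubleBubble (E : Chambers) : Prop :=
  ∃ (h θ₀ : ℝ) (g : Plane ≃ᵢ Plane), 0 < h ∧ |θ₀| < Real.pi / 3 ∧
    E = isometryImage g (modelDoubleBubble h θ₀)

/-! ### Deficit and asymmetry -/

/-- The isoperimetric deficit of `E` with respect to the reference double bubble `E₀`. -/
def deficit (E₀ E : Chambers) : ℝ :=
  (totalPerimeter E).toReal / (totalPerimeter E₀).toReal - 1

/-- The normalized `L¹` distance of two double bubbles (of the same areas). -/
def bubbleDist (E F : Chambers) : ℝ :=
  volume.real (E.1 ∆ F.1) / volume.real E.1 + volume.real (E.2 ∆ F.2) / volume.real E.2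

/-- The Fraenkel asymmetry of `E` with respect to the reference double bubble `E₀`. -/
def asymmetry (E₀ E : Chambers) : ℝ :=
  ⨅ g : Plane ≃ᵢ Plane, bubbleDist E (isometryImage g E₀)

/-! ### Maps of class `C^{1,1}` on networks of curves -/

/-- The tangential gradient at `x` of a map `u` along a curve `γ`: the derivative of `u` along `γ`
on the tangent line of `γ` at `x`, and zero on the normal line. (Two derivatives of `u` at `x`
within `γ` agree on the tangent line, so this does not depend on the one that is chosen.) -/
def tangentialGradient (γ : Set Plane) (u : Plane → Plane) (x : Plane) : Plane →L[ℝ] Plane :=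
  (fderivWithin ℝ u γ x).comp (Submodule.span ℝ (tangentConeAt ℝ γ x)).starProjection

/-- `u` is of class `C^{1,1}` along the compact curve `γ`, up to its endpoints: it is differentiable
along `γ` with Lipschitz continuous tangential gradient. -/
def IsC11On (γ : Set Plane) (u : Plane → Plane) : Prop :=
  DifferentiableOn ℝ u γ ∧ ∃ K, LipschitzOnWith K (tangentialGradient γ u) γ

/-- The `C¹` norm of `u` on the network formed by the interfaces of `E`: the supremum of `|u|` plus
the supremum of the norm of the tangential gradient of `u` along the interfaces. -/
def c1Norm (E : Chambers) (u : Plane → Plane) : ℝ≥0∞ :=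
  (⨆ x ∈ boundary E, ‖u x‖ₑ) + ⨆ k, ⨆ x ∈ interface E k, ‖tangentialGradient (interface E k) u x‖ₑ

/-- `f` restricts to a `C^{1,1}` diffeomorphism of `∂E₀` onto `∂E`: a homeomorphism which is
`C^{1,1}` along each interface of `E₀`, with inverse `C^{1,1}` along the image of each interface. -/
def IsC11Diffeo (E₀ E : Chambers) (f : Plane → Plane) : Prop :=
  ContinuousOn f (boundary E₀) ∧ Set.BijOn f (boundary E₀) (boundary E) ∧
  (∀ k, IsC11On (interface E₀ k) f) ∧
  ∃ g : Plane → Plane, Set.LeftInvOn g f (boundary E₀) ∧ ContinuousOn g (boundary E) ∧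
    ∀ k, IsC11On (f '' interface E₀ k) g

end PlanarBubble

end

noncomputable section

open MeasureTheory Set Filter Topology
open scoped ENNReal symmDiff ContDiff Pointwise Manifold

namespace PlanarBubble

/-! Everything is computed in `ℂ`. Up to an isometry a standard double bubble is a model with two
parameters: the half chord `h` and the half-opening angle `θ` of the middle arc; the outer arcs then
have half-opening angles `2π/3 - θ` and `2π/3 + θ`. The two areas determine `(h, θ)`
(`eq_of_chamberArea_eq`), because the area of a circular segment has a derivative, `segmentSlope`,
that is even and increases with the absolute value of the angle. It is therefore enough to find
constants for one model in arbitrary position (`exists_stability_placed`).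

Geometry. The map `f` carries the three arcs to three `C¹` curves with common endpoints. A
similarity of ratio `r` close to 1 brings these endpoints back to `±ih` (`exists_curves`). In the
new coordinates the areas `Mᵢ` become `Mᵢ r⁻²`, and the perimeter of `E` is `r` times the length of
the normalised curves. The arcs around each reference chamber turn strictly around a point of the
real axis. This is an open condition in `C¹`, so the normalised curves still enclose two star-shaped
regions. The divergence theorem on these regions follows by coning over the arcs. A chamber whose
frontier lies on the curves contains or misses each region, and finite area excludes the exterior;
so the chambers of `E` are the two regions up to null sets (`StarTrio.ae_eq_or_ae_eq`), and
perimeter is length (`StarPair.perimC_eq`).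

Analysis. When an arc of signed curvature `κ` is deformed with fixed endpoints and gains the signed
area `b`, its length grows by at least `κ b + (Λ - ε) b² / 2 + c G²`, where `G` bounds the area
swept by the deformation (`ArcStable`). For the outer arcs this comes from logarithmic polar
coordinates and Wirtinger's inequality, for the middle arc from graph coordinates and
Cauchy–Schwarz. The number `Λ` is negative for an arc longer than a half circle, so the three arcs
cannot be treated separately. Put `x = r⁻² - 1` and let `B` be the gain of the middle arc; the area
constraints turn the gains of the outer arcs into `B - M₁ x` and `B + M₂ x`. By the 120 degree
condition the linear terms add up to `L x / 2`, `L` being the reference length, and multiplication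
by `r` converts this into a gain of about `L x² / 8` (`scaling_gain`). There remains a quadratic
form in `(x, B)`. Its determinant factorises (`det_identity`), and is positive because
`segmentSlope` is smallest on the middle arc and `sin (4π/3) < 0` (`second_variation_pos`).

Hence the deficit is at least a multiple of the square of `|r - 1|` plus the swept areas, while the
asymmetry is at most a multiple of that sum, by comparison with a congruent copy of the model. If
the two chambers come out exchanged, their areas force `θ = 0`, and a reflection repairs the order.
-/

/-! ### Fluxes through plane curves, and Green's formula for a linear homotopy. -/

/-- The cross product of two vectors of the complex plane. -/
def cross (a b : ℂ) : ℝ := a.re * b.im - a.im * b.re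

/-- The divergence of a vector field of the complex plane. -/
def divC (T : ℂ → ℂ) (z : ℂ) : ℝ := (fderiv ℝ T z 1).re + (fderiv ℝ T z Complex.I).im

/-- The flux of the field `T` through the curve `β`, with the normal pointing to the right. -/
def flux (T : ℂ → ℂ) (β : ℝ → ℂ) (a b : ℝ) : ℝ := ∫ s in a..b, cross (T (β s)) (deriv β s)

@[fun_prop]
lemma continuous_cross {X : Type*} [TopologicalSpace X] {f g : X → ℂ} (hf : Continuous f)
    (hg : Continuous g) : Continuous fun x => cross (f x) (g x) := by
  unfold cross; fun_prop

lemma hasDerivAt_cross {f g : ℝ → ℂ} {f' g' : ℂ} {t : ℝ} (hf : HasDerivAt f f' t)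
    (hg : HasDerivAt g g' t) :
    HasDerivAt (fun t => cross (f t) (g t)) (cross f' (g t) + cross (f t) g') t := by
  have re {f : ℝ → ℂ} {f' : ℂ} (h : HasDerivAt f f' t) :
      HasDerivAt (fun t => (f t).re) f'.re t :=
    (Complex.reCLM.hasFDerivAt.comp_hasDerivAt t h)
  have im {f : ℝ → ℂ} {f' : ℂ} (h : HasDerivAt f f' t) :
      HasDerivAt (fun t => (f t).im) f'.im t :=
    (Complex.imCLM.hasFDerivAt.comp_hasDerivAt t h)
  unfold cross
  exact (((re hf).mul (im hg)).sub ((im hf).mul (re hg))).congr_deriv (by ring)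

/-- A linear map changes oriented area at the rate of its trace; for the differential of a field the
trace is the divergence. -/
lemma cross_apply_sub (M : ℂ →L[ℝ] ℂ) (a b : ℂ) :
    cross (M a) b - cross (M b) a = ((M 1).re + (M Complex.I).im) * cross a b := by
  have h (a : ℂ) : M a = a.re • M 1 + a.im • M Complex.I := by
    conv_lhs => rw [← Complex.re_add_im a]
    rw [map_add, ← map_smul, ← map_smul]
    simp
  rw [h a, h b]
  simp [cross]
  ring

lemma det_eq_cross (M : ℂ →L[ℝ] ℂ) : M.det = cross (M 1) (M Complex.I) := by
  rw [ContinuousLinearMap.det, ← LinearMap.det_toMatrix Complex.basisOneI, Matrix.det_fin_two]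
  simp [LinearMap.toMatrix_apply, cross]
  ring

lemma contDiff_deriv {β : ℝ → ℂ} (h : ContDiff ℝ 1 β) : Continuous (deriv β) :=
  h.continuous_deriv le_rfl

lemma contDiff_hasDerivAt {β : ℝ → ℂ} (h : ContDiff ℝ 1 β) (s : ℝ) :
    HasDerivAt β (deriv β s) s :=
  (h.differentiable one_ne_zero s).hasDerivAt

lemma integral_integral_comm_of_continuous {f : ℝ → ℝ → ℝ} (hf : Continuous (Function.uncurry f))
    {a b c d : ℝ} (hcd : c ≤ d) :
    ∫ x in a..b, ∫ y in c..d, f x y = ∫ y in c..d, ∫ x in a..b, f x y := by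
  simp_rw [intervalIntegral.integral_of_le hcd]
  apply MeasureTheory.intervalIntegral_integral_swap
  rw [Measure.prod_restrict, Measure.volume_eq_prod ℝ ℝ |>.symm]
  exact (hf.continuousOn.integrableOn_compact (isCompact_uIcc.prod isCompact_Icc)).mono_set
    (prod_mono uIoc_subset_uIcc Ioc_subset_Icc_self)

/-- The linear homotopy between two curves. -/
def homotopy (β₀ β₁ : ℝ → ℂ) (s t : ℝ) : ℂ := β₀ s + t • (β₁ s - β₀ s)

/-- The derivative of the linear homotopy along the curves. -/
def homotopyDeriv (β₀ β₁ : ℝ → ℂ) (s t : ℝ) : ℂ := deriv β₀ s + t • (deriv β₁ s - deriv β₀ s)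

lemma hasDerivAt_homotopy_left {β₀ β₁ : ℝ → ℂ} (h₀ : ContDiff ℝ 1 β₀) (h₁ : ContDiff ℝ 1 β₁)
    (s t : ℝ) : HasDerivAt (fun s => homotopy β₀ β₁ s t) (homotopyDeriv β₀ β₁ s t) s :=
  (contDiff_hasDerivAt h₀ s).add
    (((contDiff_hasDerivAt h₁ s).sub (contDiff_hasDerivAt h₀ s)).const_smul t)

lemma hasDerivAt_homotopy_right (β₀ β₁ : ℝ → ℂ) (s t : ℝ) :
    HasDerivAt (fun t => homotopy β₀ β₁ s t) (β₁ s - β₀ s) t :=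
  (((hasDerivAt_id t).smul_const (β₁ s - β₀ s)).const_add (β₀ s)).congr_deriv (one_smul _ _)

lemma continuous_homotopy {β₀ β₁ : ℝ → ℂ} (h₀ : Continuous β₀) (h₁ : Continuous β₁) :
    Continuous fun p : ℝ × ℝ => homotopy β₀ β₁ p.1 p.2 := by
  unfold homotopy; fun_prop

lemma continuous_homotopyDeriv {β₀ β₁ : ℝ → ℂ} (h₀ : ContDiff ℝ 1 β₀) (h₁ : ContDiff ℝ 1 β₁) :
    Continuous fun p : ℝ × ℝ => homotopyDeriv β₀ β₁ p.1 p.2 := by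
  have := contDiff_deriv h₀
  have := contDiff_deriv h₁
  unfold homotopyDeriv; fun_prop

lemma continuous_divC {T : ℂ → ℂ} (hT : ContDiff ℝ 1 T) : Continuous (divC T) := by
  have := hT.continuous_fderiv one_ne_zero
  unfold divC
  fun_prop

/-- The flux through the path traced by an endpoint under the linear homotopy. -/
def sideFlux (T : ℂ → ℂ) (β₀ β₁ : ℝ → ℂ) (s : ℝ) : ℝ :=
  ∫ t in (0 : ℝ)..1, cross (T (homotopy β₀ β₁ s t)) (β₁ s - β₀ s)

/-- Green's formula on the strip `H(s, t)`. The `t`-derivative of `cross (T H) H_s` and the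
`s`-derivative of `cross (T H) H_t` share the term with the mixed derivative `H_st`, and differ by
`div T` times `cross H_t H_s`. For a linear homotopy `H_st` is `β₁' - β₀'`, so `C¹` curves suffice;
the homotopy need not be injective. -/
theorem flux_sub_flux {T : ℂ → ℂ} (hT : ContDiff ℝ 1 T) {β₀ β₁ : ℝ → ℂ} (h₀ : ContDiff ℝ 1 β₀)
    (h₁ : ContDiff ℝ 1 β₁) (a b : ℝ) :
    flux T β₁ a b - flux T β₀ a b =
      (∫ s in a..b, ∫ t in (0 : ℝ)..1, divC T (homotopy β₀ β₁ s t) *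
        cross (β₁ s - β₀ s) (homotopyDeriv β₀ β₁ s t)) +
      (sideFlux T β₀ β₁ b - sideFlux T β₀ β₁ a) := by
  have cD := hT.continuous_fderiv one_ne_zero
  have cT := hT.continuous
  have c₀ := h₀.continuous
  have c₁ := h₁.continuous
  have d₀ := contDiff_deriv h₀
  have d₁ := contDiff_deriv h₁
  have cH := continuous_homotopy c₀ c₁
  have cH' := continuous_homotopyDeriv h₀ h₁
  have cdiv := continuous_divC hT
  have hTH (s t : ℝ) := (hT.differentiable one_ne_zero (homotopy β₀ β₁ s t)).hasFDerivAt
  have eT (s : ℝ) : cross (T (β₁ s)) (deriv β₁ s) - cross (T (β₀ s)) (deriv β₀ s) =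
      ∫ t in (0 : ℝ)..1, (cross (fderiv ℝ T (homotopy β₀ β₁ s t) (β₁ s - β₀ s))
        (homotopyDeriv β₀ β₁ s t) +
        cross (T (homotopy β₀ β₁ s t)) (deriv β₁ s - deriv β₀ s)) := by
    rw [intervalIntegral.integral_eq_sub_of_hasDerivAt
      (f := fun t => cross (T (homotopy β₀ β₁ s t)) (homotopyDeriv β₀ β₁ s t))]
    · simp [homotopy, homotopyDeriv]
    · intro t _
      apply hasDerivAt_cross
      · exact (hTH s t).comp_hasDerivAt t (hasDerivAt_homotopy_right β₀ β₁ s t)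
      · exact (((hasDerivAt_id t).smul_const (deriv β₁ s - deriv β₀ s)).const_add
          (deriv β₀ s)).congr_deriv (one_smul _ _)
    · apply Continuous.intervalIntegrable
      have h1 : Continuous fun t => homotopy β₀ β₁ s t := cH.comp (by fun_prop : Continuous fun t => (s, t))
      have h2 : Continuous fun t => homotopyDeriv β₀ β₁ s t := cH'.comp (by fun_prop : Continuous fun t => (s, t))
      have h3 : Continuous fun t => fderiv ℝ T (homotopy β₀ β₁ s t) := cD.comp h1
      fun_prop
  have eS (t : ℝ) : cross (T (homotopy β₀ β₁ b t)) (β₁ b - β₀ b) -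
      cross (T (homotopy β₀ β₁ a t)) (β₁ a - β₀ a) =
      ∫ s in a..b, (cross (fderiv ℝ T (homotopy β₀ β₁ s t) (homotopyDeriv β₀ β₁ s t))
        (β₁ s - β₀ s) +
        cross (T (homotopy β₀ β₁ s t)) (deriv β₁ s - deriv β₀ s)) := by
    rw [intervalIntegral.integral_eq_sub_of_hasDerivAt
      (f := fun s => cross (T (homotopy β₀ β₁ s t)) (β₁ s - β₀ s))]
    · intro s _
      apply hasDerivAt_cross
      · exact (hTH s t).comp_hasDerivAt s (hasDerivAt_homotopy_left h₀ h₁ s t)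
      · exact (contDiff_hasDerivAt h₁ s).sub (contDiff_hasDerivAt h₀ s)
    · apply Continuous.intervalIntegrable
      have h1 : Continuous fun s => homotopy β₀ β₁ s t := cH.comp (by fun_prop : Continuous fun s => (s, t))
      have h2 : Continuous fun s => homotopyDeriv β₀ β₁ s t := cH'.comp (by fun_prop : Continuous fun s => (s, t))
      have h3 : Continuous fun s => fderiv ℝ T (homotopy β₀ β₁ s t) := cD.comp h1
      fun_prop
  have cP : Continuous fun p : ℝ × ℝ => cross (fderiv ℝ T (homotopy β₀ β₁ p.1 p.2) (β₁ p.1 - β₀ p.1))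
        (homotopyDeriv β₀ β₁ p.1 p.2) := by
    have h3 := cD.comp cH
    simp only [Function.comp_def] at h3
    fun_prop
  have cG : Continuous fun p : ℝ × ℝ => cross (T (homotopy β₀ β₁ p.1 p.2))
      (deriv β₁ p.1 - deriv β₀ p.1) := by
    fun_prop
  have cQ : Continuous fun p : ℝ × ℝ => cross (fderiv ℝ T (homotopy β₀ β₁ p.1 p.2)
      (homotopyDeriv β₀ β₁ p.1 p.2)) (β₁ p.1 - β₀ p.1) := by
    have h3 := cD.comp cH
    simp only [Function.comp_def] at h3
    fun_prop
  have slice {f : ℝ → ℝ → ℝ} (hf : Continuous (Function.uncurry f)) (s c d : ℝ) :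
      IntervalIntegrable (f s) volume c d :=
    (hf.comp (by fun_prop : Continuous fun t => (s, t))).intervalIntegrable _ _
  have outer {f : ℝ → ℝ → ℝ} (hf : Continuous (Function.uncurry f)) (c d : ℝ) :
      IntervalIntegrable (fun s => ∫ t in (0 : ℝ)..1, f s t) volume c d :=
    (intervalIntegral.continuous_parametric_intervalIntegral_of_continuous' hf 0 1).intervalIntegrable _ _
  have cPG : Continuous (Function.uncurry fun s t =>
      (cross (fderiv ℝ T (homotopy β₀ β₁ s t) (β₁ s - β₀ s)) (homotopyDeriv β₀ β₁ s t) +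
        cross (T (homotopy β₀ β₁ s t)) (deriv β₁ s - deriv β₀ s))) :=
    cP.add cG
  have cQG : Continuous (Function.uncurry fun s t =>
      (cross (fderiv ℝ T (homotopy β₀ β₁ s t) (homotopyDeriv β₀ β₁ s t)) (β₁ s - β₀ s) +
        cross (T (homotopy β₀ β₁ s t)) (deriv β₁ s - deriv β₀ s))) :=
    cQ.add cG
  have e1 : flux T β₁ a b - flux T β₀ a b = ∫ s in a..b, ∫ t in (0 : ℝ)..1,
      (cross (fderiv ℝ T (homotopy β₀ β₁ s t) (β₁ s - β₀ s)) (homotopyDeriv β₀ β₁ s t) +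
        cross (T (homotopy β₀ β₁ s t)) (deriv β₁ s - deriv β₀ s)) := by
    rw [flux, flux, ← intervalIntegral.integral_sub]
    · simp_rw [eT]
    · exact (by fun_prop : Continuous _).intervalIntegrable _ _
    · exact (by fun_prop : Continuous _).intervalIntegrable _ _
  have e2 : sideFlux T β₀ β₁ b - sideFlux T β₀ β₁ a = ∫ s in a..b, ∫ t in (0 : ℝ)..1,
      (cross (fderiv ℝ T (homotopy β₀ β₁ s t) (homotopyDeriv β₀ β₁ s t)) (β₁ s - β₀ s) +
        cross (T (homotopy β₀ β₁ s t)) (deriv β₁ s - deriv β₀ s)) := by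
    have c (s : ℝ) : Continuous fun t => cross (T (homotopy β₀ β₁ s t)) (β₁ s - β₀ s) := by
      have h1 : Continuous fun t => homotopy β₀ β₁ s t := cH.comp (by fun_prop : Continuous fun t => (s, t))
      fun_prop
    rw [sideFlux, sideFlux, ← intervalIntegral.integral_sub ((c _).intervalIntegrable _ _)
      ((c _).intervalIntegrable _ _)]
    simp_rw [eS]
    rw [← integral_integral_comm_of_continuous cQG zero_le_one]
  rw [e1, e2, ← sub_eq_iff_eq_add, ← intervalIntegral.integral_sub (outer cPG _ _)
    (outer cQG _ _)]
  congr 1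
  ext s
  rw [← intervalIntegral.integral_sub (slice cPG _ _ _) (slice cQG _ _ _)]
  congr 1
  ext t
  rw [add_sub_add_right_eq_sub, cross_apply_sub, divC]

lemma abs_cross_le (a b : ℂ) : |cross a b| ≤ ‖a‖ * ‖b‖ := by
  have h : cross a b = ((starRingEnd ℂ) a * b).im := by
    simp [cross]; ring
  rw [h, ← Complex.norm_conj a, ← norm_mul]
  exact Complex.abs_im_le_norm _

/-- The linear homotopy between two curves, as a map of the complex plane. -/
def homotopyMap (β₀ β₁ : ℝ → ℂ) (z : ℂ) : ℂ := homotopy β₀ β₁ z.re z.im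

/-- The differential of `homotopyMap`. -/
def homotopyMapDeriv (β₀ β₁ : ℝ → ℂ) (z : ℂ) : ℂ →L[ℝ] ℂ :=
  Complex.reCLM.smulRight (homotopyDeriv β₀ β₁ z.re z.im) +
    Complex.imCLM.smulRight (β₁ z.re - β₀ z.re)

lemma hasFDerivAt_homotopyMap {β₀ β₁ : ℝ → ℂ} (h₀ : ContDiff ℝ 1 β₀) (h₁ : ContDiff ℝ 1 β₁)
    (z : ℂ) : HasFDerivAt (homotopyMap β₀ β₁) (homotopyMapDeriv β₀ β₁ z) z := by
  have a (β : ℝ → ℂ) (h : ContDiff ℝ 1 β) :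
      HasFDerivAt (fun z : ℂ => β z.re) (Complex.reCLM.smulRight (deriv β z.re)) z := by
    have := (contDiff_hasDerivAt h z.re).hasFDerivAt.comp z Complex.reCLM.hasFDerivAt
    refine this.congr_fderiv ?_
    ext <;> simp
  have c := (a _ h₁).sub (a _ h₀)
  have := (a _ h₀).add ((Complex.imCLM.hasFDerivAt (x := z)).smul c)
  refine this.congr_fderiv ?_
  ext
  simp [homotopyMapDeriv, homotopyDeriv]
  ring

lemma det_homotopyMapDeriv (β₀ β₁ : ℝ → ℂ) (z : ℂ) : (homotopyMapDeriv β₀ β₁ z).det =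
    - cross (β₁ z.re - β₀ z.re) (homotopyDeriv β₀ β₁ z.re z.im) := by
  rw [det_eq_cross]
  simp [homotopyMapDeriv, cross]
  ring

lemma reProdIm_eq_preimage (s t : Set ℝ) :
    s ×ℂ t = Complex.measurableEquivRealProd ⁻¹' (s ×ˢ t) := by
  ext z; simp [Complex.mem_reProdIm]

lemma setIntegral_reProdIm {f : ℝ → ℝ → ℝ} (hf : Continuous (Function.uncurry f)) {a b c d : ℝ}
    (hab : a ≤ b) (hcd : c ≤ d) :
    ∫ z in Ioo a b ×ℂ Ioo c d, f z.re z.im = ∫ s in a..b, ∫ t in c..d, f s t := by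
  have h := Complex.volume_preserving_equiv_real_prod.setIntegral_preimage_emb
    Complex.measurableEquivRealProd.measurableEmbedding (Function.uncurry f) (Ioo a b ×ˢ Ioo c d)
  rw [reProdIm_eq_preimage]
  simp only [Complex.measurableEquivRealProd_apply, Function.uncurry_apply_pair] at h
  rw [h, Measure.volume_eq_prod, setIntegral_prod]
  · simp_rw [intervalIntegral.integral_of_le hab, intervalIntegral.integral_of_le hcd,
      integral_Ioc_eq_integral_Ioo]
    rfl
  · exact (hf.continuousOn.integrableOn_compact (isCompact_Icc.prod isCompact_Icc)).mono_set
      (prod_mono Ioo_subset_Icc_self Ioo_subset_Icc_self)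

lemma integrableOn_reProdIm {f : ℂ → ℝ} (hf : Continuous f) {a b c d : ℝ} :
    IntegrableOn f (Icc a b ×ℂ Icc c d) :=
  hf.continuousOn.integrableOn_compact (isCompact_Icc.reProdIm isCompact_Icc)

lemma continuous_homotopyMap {β₀ β₁ : ℝ → ℂ} (h₀ : Continuous β₀) (h₁ : Continuous β₁) :
    Continuous (homotopyMap β₀ β₁) :=
  (continuous_homotopy h₀ h₁).comp (by fun_prop : Continuous fun z : ℂ => (z.re, z.im))

lemma continuous_homotopy_cross {β₀ β₁ : ℝ → ℂ} (h₀ : ContDiff ℝ 1 β₀) (h₁ : ContDiff ℝ 1 β₁) :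
    Continuous fun p : ℝ × ℝ => cross (β₁ p.1 - β₀ p.1) (homotopyDeriv β₀ β₁ p.1 p.2) := by
  have := continuous_homotopyDeriv h₀ h₁
  have := h₀.continuous
  have := h₁.continuous
  fun_prop

/-- Integration over the image of an injective linear homotopy. -/
theorem setIntegral_image_homotopyMap {β₀ β₁ : ℝ → ℂ} (h₀ : ContDiff ℝ 1 β₀)
    (h₁ : ContDiff ℝ 1 β₁) {a b : ℝ} (hab : a ≤ b)
    (hinj : InjOn (homotopyMap β₀ β₁) (Ioo a b ×ℂ Ioo 0 1)) {φ : ℂ → ℝ} (hφ : Continuous φ) :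
    ∫ z in homotopyMap β₀ β₁ '' (Ioo a b ×ℂ Ioo 0 1), φ z =
      ∫ s in a..b, ∫ t in (0 : ℝ)..1, φ (homotopy β₀ β₁ s t) *
        |cross (β₁ s - β₀ s) (homotopyDeriv β₀ β₁ s t)| := by
  have hm : MeasurableSet (Ioo a b ×ℂ Ioo (0 : ℝ) 1) := (isOpen_Ioo.reProdIm isOpen_Ioo).measurableSet
  have hc : Continuous (Function.uncurry fun s t => φ (homotopy β₀ β₁ s t) *
      |cross (β₁ s - β₀ s) (homotopyDeriv β₀ β₁ s t)|) := by
    have := continuous_homotopy_cross h₀ h₁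
    have := continuous_homotopy h₀.continuous h₁.continuous
    simp only [Function.uncurry_def]
    fun_prop
  rw [integral_image_eq_integral_abs_det_fderiv_smul volume hm
    (fun z _ => (hasFDerivAt_homotopyMap h₀ h₁ z).hasFDerivWithinAt) hinj,
    ← setIntegral_reProdIm hc hab zero_le_one]
  congr 1
  ext z
  rw [det_homotopyMapDeriv, abs_neg, smul_eq_mul, mul_comm, homotopyMap]

/-- The area of the image of a linear homotopy. -/
theorem volume_image_homotopyMap_le {β₀ β₁ : ℝ → ℂ} (h₀ : ContDiff ℝ 1 β₀)
    (h₁ : ContDiff ℝ 1 β₁) {a b : ℝ} (hab : a ≤ b) {g : ℝ → ℝ} (hg : Continuous g)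
    (hM : ∀ s ∈ Icc a b, ∀ t ∈ Icc (0 : ℝ) 1,
      |cross (β₁ s - β₀ s) (homotopyDeriv β₀ β₁ s t)| ≤ g s) :
    volume (homotopyMap β₀ β₁ '' (Icc a b ×ℂ Icc 0 1)) ≤ ENNReal.ofReal (∫ s in a..b, g s) := by
  have hm : MeasurableSet (Icc a b ×ℂ Icc (0 : ℝ) 1) :=
    (isClosed_Icc.reProdIm isClosed_Icc).measurableSet
  refine (addHaar_image_le_lintegral_abs_det_fderiv volume hm
    fun z _ => (hasFDerivAt_homotopyMap h₀ h₁ z).hasFDerivWithinAt).trans ?_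
  simp_rw [det_homotopyMapDeriv, abs_neg]
  have e : ∫ s in a..b, g s = ∫ z in Icc a b ×ℂ Icc (0 : ℝ) 1, g z.re := by
    have h := Complex.volume_preserving_equiv_real_prod.setIntegral_preimage_emb
      Complex.measurableEquivRealProd.measurableEmbedding (fun p => g p.1) (Icc a b ×ˢ Icc (0 : ℝ) 1)
    rw [reProdIm_eq_preimage]
    simp only [Complex.measurableEquivRealProd_apply] at h
    rw [h, Measure.volume_eq_prod, setIntegral_prod]
    · simp [intervalIntegral.integral_of_le hab, integral_Icc_eq_integral_Ioc]
    · have : Continuous fun p : ℝ × ℝ => g p.1 := by fun_prop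
      exact this.continuousOn.integrableOn_compact (isCompact_Icc.prod isCompact_Icc)
  rw [e, ofReal_integral_eq_lintegral_ofReal]
  · refine setLIntegral_mono (by fun_prop) fun z hz => ?_
    exact ENNReal.ofReal_le_ofReal (hM _ hz.1 _ hz.2)
  · exact integrableOn_reProdIm (by fun_prop)
  · filter_upwards [ae_restrict_mem hm] with z hz
    exact (abs_nonneg _).trans (hM _ hz.1 _ hz.2)

/-- The curve is read as a differentiable map of the plane that depends on the real part only,
restricted to the null set `s × {0}`. -/
lemma volume_image_curve {β : ℝ → ℂ} (h : ContDiff ℝ 1 β) (s : Set ℝ) : volume (β '' s) = 0 := by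
  have h2 : volume (s ×ℂ ({0} : Set ℝ)) = 0 := by
    rw [reProdIm_eq_preimage, Complex.volume_preserving_equiv_real_prod.measure_preimage_equiv,
      Measure.volume_eq_prod, Measure.prod_prod]
    simp
  have := addHaar_image_eq_zero_of_differentiableOn_of_addHaar_eq_zero volume
    (f := fun z : ℂ => β z.re) (s := s ×ℂ ({0} : Set ℝ))
    (((h.differentiable one_ne_zero).comp Complex.reCLM.differentiable).differentiableOn) h2
  refine measure_mono_null ?_ this
  rintro _ ⟨x, hx, rfl⟩
  exact ⟨x, by simp [Complex.mem_reProdIm, hx], by simp⟩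

/-! ### Arcs seen from a centre, and the star-shaped region between two arcs. -/

/-- The reflection of the plane in the imaginary axis. -/
def refl (z : ℂ) : ℂ := -(starRingEnd ℂ) z

@[simp] lemma refl_re (z : ℂ) : (refl z).re = -z.re := by simp [refl]
@[simp] lemma refl_im (z : ℂ) : (refl z).im = z.im := by simp [refl]
@[simp] lemma refl_refl (z : ℂ) : refl (refl z) = z := by simp [refl]
@[simp] lemma refl_sub (z w : ℂ) : refl (z - w) = refl z - refl w := by simp [refl]; ring
@[simp] lemma refl_add (z w : ℂ) : refl (z + w) = refl z + refl w := by simp [refl]; ring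
@[simp] lemma refl_smul (t : ℝ) (w : ℂ) : refl (t • w) = t • refl w := by simp [refl]
@[simp] lemma norm_refl (z : ℂ) : ‖refl z‖ = ‖z‖ := by simp [refl]
lemma refl_injective : Function.Injective refl := fun a b h => by
  rw [← refl_refl a, h, refl_refl]
lemma cross_refl (z w : ℂ) : cross (refl z) (refl w) = - cross z w := by simp [cross]; ring
lemma refl_ofReal (x : ℝ) : refl x = ((-x : ℝ) : ℂ) := by simp [refl]

/-- The left arc may cross the slit, where the argument jumps, but its reflection does not. Absolute
values of arguments pass through the reflection, so the left arc is located in the sector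
complementary to that of the right arc. -/
lemma abs_arg_refl {z : ℂ} (hz : z ≠ 0) : |(refl z).arg| = Real.pi - |z.arg| := by
  have h2 : refl z = -(starRingEnd ℂ) z := rfl
  have h1 : refl z = (starRingEnd ℂ) (-z) := by rw [h2, map_neg]
  have h3 : |(refl z).arg| = |(-z).arg| := by
    rw [h1, Complex.arg_conj]
    split_ifs with h
    · rw [h]
    · rw [abs_neg]
  rw [h3, ← Complex.angle_one_left (neg_ne_zero.2 hz), InnerProductGeometry.angle_neg_right,
    Complex.angle_one_left hz]

lemma hasDerivAt_refl {β : ℝ → ℂ} {β' : ℂ} {s : ℝ} (h : HasDerivAt β β' s) :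
    HasDerivAt (fun s => refl (β s)) (refl β') s :=
  ((Complex.conjCLE.toContinuousLinearMap.hasFDerivAt.comp_hasDerivAt s h).neg)

lemma contDiff_refl {β : ℝ → ℂ} (h : ContDiff ℝ 1 β) : ContDiff ℝ 1 fun s => refl (β s) :=
  (Complex.conjCLE.contDiff.comp h).neg

lemma deriv_refl {β : ℝ → ℂ} (h : ContDiff ℝ 1 β) (s : ℝ) :
    deriv (fun s => refl (β s)) s = refl (deriv β s) :=
  (hasDerivAt_refl (contDiff_hasDerivAt h s)).deriv

/-- A `C¹` arc that turns counterclockwise around `o`, and does not meet the half line that leaves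
`o` to the left. -/
structure IsStarArc (o : ℂ) (β : ℝ → ℂ) (a : ℝ) : Prop where
  contDiff : ContDiff ℝ 1 β
  pos : 0 < a
  slit : ∀ s ∈ Icc (-a) a, β s - o ∈ Complex.slitPlane
  cross_pos : ∀ s ∈ Icc (-a) a, 0 < cross (β s - o) (deriv β s)

namespace IsStarArc

variable {o : ℂ} {β : ℝ → ℂ} {a : ℝ}

lemma ne_zero (H : IsStarArc o β a) {s : ℝ} (hs : s ∈ Icc (-a) a) : β s - o ≠ 0 :=
  Complex.slitPlane_ne_zero (H.slit s hs)

lemma hasDerivAt_arg (H : IsStarArc o β a) {s : ℝ} (hs : s ∈ Icc (-a) a) :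
    HasDerivAt (fun s => (β s - o).arg)
      (cross (β s - o) (deriv β s) / Complex.normSq (β s - o)) s := by
  have h := HasDerivAt.clog_real ((contDiff_hasDerivAt H.contDiff s).sub_const o) (H.slit s hs)
  have h2 := Complex.imCLM.hasFDerivAt.comp_hasDerivAt s h
  have e : (Complex.imCLM ∘ fun t => Complex.log (β t - o)) = fun s => (β s - o).arg := by
    ext t; simp [Complex.log_im]
  rw [e] at h2
  refine h2.congr_deriv ?_
  simp only [Complex.imCLM_apply, Complex.div_im, cross]
  ring

/-- Off the slit the argument has derivative angular momentum over squared distance, which is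
positive along the arc. -/
lemma strictMonoOn_arg (H : IsStarArc o β a) :
    StrictMonoOn (fun s => (β s - o).arg) (Icc (-a) a) := by
  apply strictMonoOn_of_deriv_pos (convex_Icc _ _)
  · exact fun s hs => (H.hasDerivAt_arg hs).continuousAt.continuousWithinAt
  · intro s hs
    have hs' := interior_subset hs
    rw [(H.hasDerivAt_arg hs').deriv]
    exact div_pos (H.cross_pos s hs') (Complex.normSq_pos.2 (H.ne_zero hs'))

lemma eq_of_smul_eq (H : IsStarArc o β a) {s s' t t' : ℝ} (hs : s ∈ Icc (-a) a)
    (hs' : s' ∈ Icc (-a) a) (ht : 0 < t) (ht' : 0 < t')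
    (h : t • (β s - o) = t' • (β s' - o)) : s = s' ∧ t = t' := by
  have h1 : s = s' := by
    apply H.strictMonoOn_arg.injOn hs hs'
    have := congrArg Complex.arg h
    simpa only [Complex.real_smul, Complex.arg_real_mul _ ht, Complex.arg_real_mul _ ht'] using this
  subst h1
  exact ⟨rfl, smul_left_injective ℝ (H.ne_zero hs) h⟩

variable {o h : ℝ}

lemma arg_top_pos (hh : 0 < h) : 0 < (h * Complex.I - o : ℂ).arg := by
  have h1 : 0 ≤ (h * Complex.I - o : ℂ).arg := Complex.arg_nonneg_iff.2 (by simp [hh.le])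
  refine lt_of_le_of_ne h1 fun e => ?_
  have := (Complex.arg_eq_zero_iff.1 e.symm).2
  simp [hh.ne'] at this

lemma arg_top_lt_pi (hh : 0 < h) : (h * Complex.I - o : ℂ).arg < Real.pi := by
  refine lt_of_le_of_ne (Complex.arg_le_pi _) fun e => ?_
  have := (Complex.arg_eq_pi_iff.1 e).2
  simp [hh.ne'] at this

lemma arg_bot (hh : 0 < h) :
    (-(h * Complex.I) - o : ℂ).arg = -(h * Complex.I - o : ℂ).arg := by
  have : (-(h * Complex.I) - o : ℂ) = (starRingEnd ℂ) (h * Complex.I - o) := by simp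
  rw [this, Complex.arg_conj, if_neg (arg_top_lt_pi hh).ne]

variable (H : IsStarArc o β a) (hh : 0 < h) (htop : β a = h * Complex.I)
  (hbot : β (-a) = -(h * Complex.I))

include H hh htop hbot

lemma abs_arg_le {s : ℝ} (hs : s ∈ Icc (-a) a) : |(β s - o).arg| ≤ (h * Complex.I - o : ℂ).arg := by
  have ha := H.pos
  rw [abs_le, ← arg_bot hh, ← hbot, ← htop]
  exact ⟨H.strictMonoOn_arg.monotoneOn ⟨le_rfl, by linarith⟩ hs hs.1,
    H.strictMonoOn_arg.monotoneOn hs ⟨by linarith, le_rfl⟩ hs.2⟩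

lemma abs_arg_lt {s : ℝ} (hs : s ∈ Ioo (-a) a) : |(β s - o).arg| < (h * Complex.I - o : ℂ).arg := by
  have ha := H.pos
  rw [abs_lt, ← arg_bot hh, ← hbot, ← htop]
  exact ⟨H.strictMonoOn_arg ⟨le_rfl, by linarith⟩ (Ioo_subset_Icc_self hs) hs.1,
    H.strictMonoOn_arg (Ioo_subset_Icc_self hs) ⟨by linarith, le_rfl⟩ hs.2⟩

lemma eq_or_eq_of_abs_arg {s : ℝ} (hs : s ∈ Icc (-a) a)
    (e : |(β s - o).arg| = (h * Complex.I - o : ℂ).arg) : s = a ∨ s = -a := by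
  by_contra! hne
  exact (H.abs_arg_lt hh htop hbot ⟨lt_of_le_of_ne hs.1 hne.2.symm, lt_of_le_of_ne hs.2 hne.1⟩).ne e

lemma exists_smul_eq {w : ℂ} (hw : w ≠ 0) (harg : |w.arg| ≤ (h * Complex.I - o : ℂ).arg) :
    ∃ s ∈ Icc (-a) a, ∃ t : ℝ, 0 < t ∧ w = t • (β s - o) := by
  have ha := H.pos
  have hc : ContinuousOn (fun s => (β s - o).arg) (Icc (-a) a) :=
    fun s hs => (H.hasDerivAt_arg hs).continuousAt.continuousWithinAt
  have hmem : w.arg ∈ Icc ((β (-a) - o).arg) ((β a - o).arg) := by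
    rw [htop, hbot, arg_bot hh]
    exact abs_le.1 harg
  obtain ⟨s, hs, e⟩ := intermediate_value_Icc (by linarith) hc hmem
  have hne := H.ne_zero hs
  refine ⟨s, hs, ‖w‖ / ‖β s - o‖, by positivity, ?_⟩
  apply Complex.ext_norm_arg
  · rw [norm_smul, Real.norm_of_nonneg (by positivity)]
    field_simp
  · rw [Complex.real_smul, Complex.arg_real_mul _ (by positivity)]
    exact e.symm

end IsStarArc

/-- Two arcs from `-ih` to `ih` that enclose a region that is star-shaped about `o`. -/
structure StarPair (o h : ℝ) (βl βr : ℝ → ℂ) (al ar : ℝ) : Prop where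
  pos : 0 < h
  right : IsStarArc o βr ar
  left : IsStarArc ((-o : ℝ) : ℂ) (fun s => refl (βl s)) al
  right_top : βr ar = h * Complex.I
  right_bot : βr (-ar) = -(h * Complex.I)
  left_top : βl al = h * Complex.I
  left_bot : βl (-al) = -(h * Complex.I)

/-- The union of two arcs. -/
def curvePair (βl βr : ℝ → ℂ) (al ar : ℝ) : Set ℂ := βl '' Icc (-al) al ∪ βr '' Icc (-ar) ar

/-- The points that are seen from `o` in front of the set `Γ`. -/
def starRegion (o : ℝ) (Γ : Set ℂ) : Set ℂ :=
  {z | ∀ τ ∈ Icc (0 : ℝ) 1, (o : ℂ) + τ • (z - o) ∉ Γ}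

/-- The cone over `Γ` with apex `o`. -/
def starCone (o : ℝ) (Γ : Set ℂ) : Set ℂ :=
  (fun p : ℝ × ℂ => (o : ℂ) + p.1 • (p.2 - o)) '' (Icc 0 1 ×ˢ Γ)

namespace StarPair

variable {o h al ar : ℝ} {βl βr : ℝ → ℂ}

lemma left_contDiff (H : StarPair o h βl βr al ar) : ContDiff ℝ 1 βl := by
  simpa using contDiff_refl H.left.contDiff

lemma refl_top : refl (h * Complex.I) = h * Complex.I := by apply Complex.ext <;> simp
lemma refl_bot : refl (-(h * Complex.I)) = -(h * Complex.I) := by apply Complex.ext <;> simp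

lemma left_refl_top (H : StarPair o h βl βr al ar) : refl (βl al) = h * Complex.I := by
  rw [H.left_top, refl_top]

lemma left_refl_bot (H : StarPair o h βl βr al ar) : refl (βl (-al)) = -(h * Complex.I) := by
  rw [H.left_bot, refl_bot]

lemma refl_sub_center (z : ℂ) (o : ℝ) : refl (z - o) = refl z - ((-o : ℝ) : ℂ) := by
  rw [refl_sub, refl_ofReal]

lemma left_ne (H : StarPair o h βl βr al ar) {s : ℝ} (hs : s ∈ Icc (-al) al) : βl s - o ≠ 0 := by
  intro e
  apply H.left.ne_zero hs
  rw [← refl_sub_center, e]; simp [refl]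

lemma left_cross_neg (H : StarPair o h βl βr al ar) {s : ℝ} (hs : s ∈ Icc (-al) al) :
    cross (βl s - o) (deriv βl s) < 0 := by
  have := H.left.cross_pos s hs
  rw [deriv_refl H.left_contDiff, ← refl_sub_center, cross_refl] at this
  linarith

lemma ne_center (H : StarPair o h βl βr al ar) {x : ℂ} (hx : x ∈ curvePair βl βr al ar) :
    x - o ≠ 0 := by
  rcases hx with ⟨s, hs, rfl⟩ | ⟨s, hs, rfl⟩
  · exact H.left_ne hs
  · exact H.right.ne_zero hs

lemma arg_add (hh : 0 < h) : (h * Complex.I - ((-o : ℝ) : ℂ)).arg =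
    Real.pi - (h * Complex.I - o : ℂ).arg := by
  have h0 : (h * Complex.I - o : ℂ) ≠ 0 := fun e => by
    have := congrArg Complex.im e
    simp [hh.ne'] at this
  rw [← abs_of_pos (IsStarArc.arg_top_pos (o := o) hh), ← abs_arg_refl h0, refl_sub_center,
    refl_top, abs_of_pos (IsStarArc.arg_top_pos hh)]

lemma left_arg_ge (H : StarPair o h βl βr al ar) {s : ℝ} (hs : s ∈ Icc (-al) al) :
    (h * Complex.I - o : ℂ).arg ≤ |(βl s - o).arg| := by
  have := H.left.abs_arg_le H.pos H.left_refl_top H.left_refl_bot hs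
  rw [← refl_sub_center, abs_arg_refl (H.left_ne hs), arg_add H.pos] at this
  linarith

lemma left_arg_gt (H : StarPair o h βl βr al ar) {s : ℝ} (hs : s ∈ Ioo (-al) al) :
    (h * Complex.I - o : ℂ).arg < |(βl s - o).arg| := by
  have := H.left.abs_arg_lt H.pos H.left_refl_top H.left_refl_bot hs
  rw [← refl_sub_center, abs_arg_refl (H.left_ne (Ioo_subset_Icc_self hs)), arg_add H.pos] at this
  linarith

lemma left_eq_of_smul_eq (H : StarPair o h βl βr al ar) {s s' t t' : ℝ} (hs : s ∈ Icc (-al) al)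
    (hs' : s' ∈ Icc (-al) al) (ht : 0 < t) (ht' : 0 < t')
    (e : t • (βl s - o) = t' • (βl s' - o)) : s = s' ∧ t = t' := by
  apply H.left.eq_of_smul_eq hs hs' ht ht'
  rw [← refl_sub_center, ← refl_sub_center, ← refl_smul, ← refl_smul, e]

lemma exists_smul_eq (H : StarPair o h βl βr al ar) {w : ℂ} (hw : w ≠ 0) :
    ∃ x ∈ curvePair βl βr al ar, ∃ t : ℝ, 0 < t ∧ w = t • (x - o) := by
  rcases le_total |w.arg| (h * Complex.I - o : ℂ).arg with hle | hle
  · obtain ⟨s, hs, t, ht, e⟩ := H.right.exists_smul_eq H.pos H.right_top H.right_bot hw hle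
    exact ⟨_, Or.inr ⟨s, hs, rfl⟩, t, ht, e⟩
  · have hw' : refl w ≠ 0 := fun e => hw (by rw [← refl_refl w, e]; simp [refl])
    obtain ⟨s, hs, t, ht, e⟩ := H.left.exists_smul_eq H.pos H.left_refl_top H.left_refl_bot hw'
      (by rw [abs_arg_refl hw, arg_add H.pos]; linarith)
    refine ⟨_, Or.inl ⟨s, hs, rfl⟩, t, ht, ?_⟩
    rw [← refl_sub_center, ← refl_smul] at e
    exact refl_injective e

/-- Let `α` be the argument of `ih` seen from `o`. The left arc lies in `|arg| ≥ α` and the right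
one in `|arg| ≤ α`, so a common ray has `|arg| = α` and meets both arcs at an endpoint; the sign of
the argument shows that it is the same one. -/
lemma mixed_eq (H : StarPair o h βl βr al ar) {s s' t t' : ℝ} (hs : s ∈ Icc (-al) al)
    (hs' : s' ∈ Icc (-ar) ar) (ht : 0 < t) (ht' : 0 < t')
    (e : t • (βl s - o) = t' • (βr s' - o)) :
    βl s = βr s' ∧ (s = al ∨ s = -al) ∧ (s' = ar ∨ s' = -ar) := by
  have harg : (βl s - o).arg = (βr s' - o).arg := by
    have := congrArg Complex.arg e
    simpa only [Complex.real_smul, Complex.arg_real_mul _ ht, Complex.arg_real_mul _ ht'] using this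
  have h1 := H.left_arg_ge hs
  have h2 := H.right.abs_arg_le H.pos H.right_top H.right_bot hs'
  have h3 : |(βr s' - o).arg| = (h * Complex.I - o : ℂ).arg := le_antisymm h2 (harg ▸ h1)
  have h4 := H.right.eq_or_eq_of_abs_arg H.pos H.right_top H.right_bot hs' h3
  have h5 : s = al ∨ s = -al := by
    by_contra! hne
    have := H.left_arg_gt ⟨lt_of_le_of_ne hs.1 hne.2.symm, lt_of_le_of_ne hs.2 hne.1⟩
    rw [harg] at this
    exact this.ne' h3
  have hα := IsStarArc.arg_top_pos (o := o) H.pos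
  have hb := IsStarArc.arg_bot (o := o) H.pos
  refine ⟨?_, h5, h4⟩
  rcases h4 with rfl | rfl <;> rcases h5 with rfl | rfl <;>
    simp only [H.right_top, H.right_bot, H.left_top, H.left_bot] at harg ⊢ <;> linarith

lemma eq_of_smul_eq (H : StarPair o h βl βr al ar) {x x' : ℂ} {t t' : ℝ}
    (hx : x ∈ curvePair βl βr al ar) (hx' : x' ∈ curvePair βl βr al ar) (ht : 0 < t) (ht' : 0 < t')
    (e : t • (x - o) = t' • (x' - o)) : x = x' ∧ t = t' := by
  have key : x = x' := by
    rcases hx with ⟨s, hs, rfl⟩ | ⟨s, hs, rfl⟩ <;> rcases hx' with ⟨s', hs', rfl⟩ | ⟨s', hs', rfl⟩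
    · rw [(H.left_eq_of_smul_eq hs hs' ht ht' e).1]
    · exact (H.mixed_eq hs hs' ht ht' e).1
    · exact (H.mixed_eq hs' hs ht' ht e.symm).1.symm
    · rw [(H.right.eq_of_smul_eq hs hs' ht ht' e).1]
  subst key
  exact ⟨rfl, smul_left_injective ℝ (H.ne_center hx) e⟩

lemma isCompact_curvePair (H : StarPair o h βl βr al ar) : IsCompact (curvePair βl βr al ar) :=
  (isCompact_Icc.image H.left_contDiff.continuous).union
    (isCompact_Icc.image H.right.contDiff.continuous)

lemma isCompact_starCone (H : StarPair o h βl βr al ar) :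
    IsCompact (starCone o (curvePair βl βr al ar)) :=
  (isCompact_Icc.prod H.isCompact_curvePair).image (by fun_prop)

/-- Avoiding the compact set of arcs is an open condition for each `τ`, and `τ` runs over a compact
interval. -/
lemma isOpen_starRegion (H : StarPair o h βl βr al ar) :
    IsOpen (starRegion o (curvePair βl βr al ar)) := by
  rw [isOpen_iff_eventually]
  intro z hz
  apply isCompact_Icc.eventually_forall_of_forall_eventually
  intro τ hτ
  have hc : Continuous fun p : ℂ × ℝ => (o : ℂ) + p.2 • (p.1 - o) := by fun_prop
  exact (hc.continuousAt (x := (z, τ))).eventually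
    (H.isCompact_curvePair.isClosed.isOpen_compl.mem_nhds (hz τ hτ))

lemma center_mem (H : StarPair o h βl βr al ar) :
    (o : ℂ) ∈ starRegion o (curvePair βl βr al ar) := by
  intro τ _ hmem
  exact H.ne_center hmem (by simp)

lemma isPreconnected_starRegion (H : StarPair o h βl βr al ar) :
    IsPreconnected (starRegion o (curvePair βl βr al ar)) := by
  have : StarConvex ℝ (o : ℂ) (starRegion o (curvePair βl βr al ar)) := by
    rw [starConvex_iff_forall_pos H.center_mem]
    intro y hy a b ha hb hab τ hτ hmem
    refine hy (τ * b) ⟨by have := hτ.1; positivity, ?_⟩ ?_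
    · nlinarith [hτ.1, hτ.2]
    · have e : (o : ℂ) + (τ * b) • (y - o) = o + τ • (a • (o : ℂ) + b • y - o) := by
        have : a = 1 - b := by linarith
        rw [this]
        simp only [Complex.real_smul]; push_cast; ring
      rwa [e]
  exact (this.isPathConnected H.center_mem).isConnected.isPreconnected

lemma starRegion_disjoint : Disjoint (starRegion o (curvePair βl βr al ar))
    (curvePair βl βr al ar) := by
  rw [Set.disjoint_left]
  intro z hz hmem
  exact hz 1 (by simp) (by simpa using hmem)

lemma cone_point_mem_starRegion (H : StarPair o h βl βr al ar) {x : ℂ} {t : ℝ}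
    (hx : x ∈ curvePair βl βr al ar) (h0 : 0 ≤ t) (h1 : t < 1) :
    (o : ℂ) + t • (x - o) ∈ starRegion o (curvePair βl βr al ar) := by
  intro τ hτ hmem
  rcases (mul_nonneg hτ.1 h0).eq_or_lt with e | e
  · exact H.ne_center hmem (by
      rw [add_sub_cancel_left, add_sub_cancel_left, smul_smul, ← e, zero_smul])
  · have := (H.eq_of_smul_eq hx hmem e one_pos (by
      rw [add_sub_cancel_left, add_sub_cancel_left, one_smul, smul_smul])).2
    nlinarith [hτ.1, hτ.2]

lemma exists_of_mem_starRegion (H : StarPair o h βl βr al ar) {z : ℂ}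
    (hz : z ∈ starRegion o (curvePair βl βr al ar)) (hzo : z ≠ o) :
    ∃ x ∈ curvePair βl βr al ar, ∃ t ∈ Ioo (0 : ℝ) 1, z = o + t • (x - o) := by
  obtain ⟨x, hx, t, ht, e⟩ := H.exists_smul_eq (sub_ne_zero.2 hzo)
  refine ⟨x, hx, t, ⟨ht, ?_⟩, by rw [← e]; ring⟩
  by_contra! hle
  refine hz t⁻¹ ⟨by positivity, inv_le_one_of_one_le₀ hle⟩ ?_
  rw [e, smul_smul, inv_mul_cancel₀ ht.ne', one_smul, add_sub_cancel]
  exact hx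

lemma starRegion_subset_starCone (H : StarPair o h βl βr al ar) :
    starRegion o (curvePair βl βr al ar) ⊆ starCone o (curvePair βl βr al ar) := by
  intro z hz
  by_cases hzo : z = o
  · exact ⟨(0, βr 0), ⟨by simp, Or.inr ⟨0, by have := H.right.pos; constructor <;> linarith, rfl⟩⟩,
      by simp [hzo]⟩
  · obtain ⟨x, hx, t, ht, e⟩ := H.exists_of_mem_starRegion hz hzo
    exact ⟨(t, x), ⟨⟨ht.1.le, ht.2.le⟩, hx⟩, e.symm⟩

lemma starCone_subset (H : StarPair o h βl βr al ar) :
    starCone o (curvePair βl βr al ar) ⊆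
      starRegion o (curvePair βl βr al ar) ∪ curvePair βl βr al ar := by
  rintro _ ⟨⟨t, x⟩, ⟨ht, hx⟩, rfl⟩
  rcases ht.2.eq_or_lt with rfl | h1
  · right; simpa using hx
  · left; exact H.cone_point_mem_starRegion hx ht.1 h1

lemma curvePair_subset_starCone : curvePair βl βr al ar ⊆ starCone o (curvePair βl βr al ar) :=
  fun x hx => ⟨(1, x), ⟨by simp, hx⟩, by simp⟩

lemma curvePair_subset_closure (H : StarPair o h βl βr al ar) :
    curvePair βl βr al ar ⊆ closure (starRegion o (curvePair βl βr al ar)) := by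
  intro x hx
  have hc : Continuous fun t : ℝ => (o : ℂ) + t • (x - o) := by fun_prop
  have h1 : (1 : ℝ) ∈ closure (Ico (0 : ℝ) 1) := by
    rw [closure_Ico zero_ne_one]; simp
  have := map_mem_closure hc h1 (t := starRegion o (curvePair βl βr al ar))
    (fun t ht => H.cone_point_mem_starRegion hx ht.1 ht.2)
  simpa using this

/-- The complement of a cone is stable under dilations about its apex. Later this gives any set that
reaches into the exterior infinite area. -/
lemma expand_notMem_starCone {Γ : Set ℂ} {z : ℂ} {τ : ℝ} (hz : z ∉ starCone o Γ) (hτ : 1 ≤ τ) :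
    (o : ℂ) + τ • (z - o) ∉ starCone o Γ := by
  rintro ⟨⟨t, x⟩, ⟨ht, hx⟩, e⟩
  have hτ0 : 0 < τ := by linarith
  refine hz ⟨(t / τ, x), ⟨⟨by have := ht.1; positivity, ?_⟩, hx⟩, ?_⟩
  · rw [div_le_one hτ0]; exact ht.2.trans hτ
  · have e2 : t • (x - (o : ℂ)) = τ • (z - o) := add_left_cancel e
    dsimp only
    rw [div_eq_inv_mul, mul_smul, e2, smul_smul, inv_mul_cancel₀ hτ0.ne', one_smul, add_sub_cancel]

lemma measurableSet_starRegion (H : StarPair o h βl βr al ar) :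
    MeasurableSet (starRegion o (curvePair βl βr al ar)) := H.isOpen_starRegion.measurableSet

lemma volume_curvePair (H : StarPair o h βl βr al ar) : volume (curvePair βl βr al ar) = 0 :=
  measure_union_null (volume_image_curve H.left_contDiff _)
    (volume_image_curve H.right.contDiff _)

end StarPair

/-! ### The divergence theorem on star-shaped regions. -/

/-- The region `A` is enclosed by the arcs `βl` (on the left) and `βr` (on the right), in the sense
of the divergence theorem. -/
def HasBoundary (A : Set ℂ) (βl βr : ℝ → ℂ) (al ar : ℝ) : Prop :=
  ∀ T : ℂ → ℂ, ContDiff ℝ 1 T →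
    ∫ z in A, divC T z = flux T βr (-ar) ar - flux T βl (-al) al

lemma homotopyDeriv_const (o : ℂ) (β : ℝ → ℂ) (s t : ℝ) :
    homotopyDeriv (fun _ => o) β s t = t • deriv β s := by
  simp [homotopyDeriv]

lemma flux_const (T : ℂ → ℂ) (o : ℂ) (a b : ℝ) : flux T (fun _ => o) a b = 0 := by
  simp [flux, cross]

lemma cross_smul_right (z w : ℂ) (t : ℝ) : cross z (t • w) = t * cross z w := by
  simp [cross]; ring

lemma sideFlux_congr {T : ℂ → ℂ} {β₀ β₁ β₀' β₁' : ℝ → ℂ} {s s' : ℝ} (h₀ : β₀ s = β₀' s')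
    (h₁ : β₁ s = β₁' s') : sideFlux T β₀ β₁ s = sideFlux T β₀' β₁' s' := by
  simp only [sideFlux, homotopy, h₀, h₁]

/-- The cone is the homotopy from the constant curve `o`, which carries no flux. The sign `σ`
records the sense in which the arc turns around `o`. -/
lemma setIntegral_cone {o : ℂ} {β : ℝ → ℂ} (hβ : ContDiff ℝ 1 β) {a σ : ℝ} (ha : 0 < a)
    (hinj : InjOn (homotopyMap (fun _ => o) β) (Ioo (-a) a ×ℂ Ioo 0 1))
    (hσ : ∀ s ∈ Icc (-a) a, |cross (β s - o) (deriv β s)| = σ * cross (β s - o) (deriv β s))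
    {T : ℂ → ℂ} (hT : ContDiff ℝ 1 T) :
    ∫ z in homotopyMap (fun _ => o) β '' (Ioo (-a) a ×ℂ Ioo 0 1), divC T z =
      σ * (flux T β (-a) a - (sideFlux T (fun _ => o) β a - sideFlux T (fun _ => o) β (-a))) := by
  have h := flux_sub_flux hT (contDiff_const (c := o)) hβ (-a) a
  rw [flux_const, sub_zero] at h
  rw [setIntegral_image_homotopyMap contDiff_const hβ (by linarith) hinj (continuous_divC hT), h,
    add_sub_cancel_right, ← intervalIntegral.integral_const_mul]
  apply intervalIntegral.integral_congr
  intro s hs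
  rw [uIcc_of_le (by linarith)] at hs
  dsimp only
  rw [← intervalIntegral.integral_const_mul]
  apply intervalIntegral.integral_congr
  intro t ht
  rw [uIcc_of_le zero_le_one] at ht
  dsimp only
  rw [homotopyDeriv_const, cross_smul_right, abs_mul, abs_of_nonneg ht.1, hσ s hs]
  ring

namespace StarPair

variable {o h al ar : ℝ} {βl βr : ℝ → ℂ}

lemma injOn_right (H : StarPair o h βl βr al ar) :
    InjOn (homotopyMap (fun _ => (o : ℂ)) βr) (Ioo (-ar) ar ×ℂ Ioo 0 1) := by
  intro z hz w hw e
  have := H.right.eq_of_smul_eq (Ioo_subset_Icc_self hz.1) (Ioo_subset_Icc_self hw.1) hz.2.1 hw.2.1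
    (add_left_cancel e)
  exact Complex.ext this.1 this.2

lemma injOn_left (H : StarPair o h βl βr al ar) :
    InjOn (homotopyMap (fun _ => (o : ℂ)) βl) (Ioo (-al) al ×ℂ Ioo 0 1) := by
  intro z hz w hw e
  have := H.left_eq_of_smul_eq (Ioo_subset_Icc_self hz.1) (Ioo_subset_Icc_self hw.1) hz.2.1 hw.2.1
    (add_left_cancel e)
  exact Complex.ext this.1 this.2

lemma isBounded_starRegion (H : StarPair o h βl βr al ar) :
    Bornology.IsBounded (starRegion o (curvePair βl βr al ar)) :=
  H.isCompact_starCone.isBounded.subset H.starRegion_subset_starCone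

lemma integrableOn_starRegion (H : StarPair o h βl βr al ar) {φ : ℂ → ℝ} (hφ : Continuous φ) :
    IntegrableOn φ (starRegion o (curvePair βl βr al ar)) :=
  (hφ.continuousOn.integrableOn_compact H.isCompact_starCone).mono_set H.starRegion_subset_starCone

/-- Up to the two rays through `±ih`, a null set, the region is the disjoint union of the open cones
over its arcs. The left arc turns clockwise about `o`, hence `σ = -1` there, and the fluxes through
the segments from `o` to `±ih` cancel between the two cones. -/
theorem hasBoundary (H : StarPair o h βl βr al ar) :
    HasBoundary (starRegion o (curvePair βl βr al ar)) βl βr al ar := by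
  intro T hT
  set Cr := homotopyMap (fun _ => (o : ℂ)) βr '' (Ioo (-ar) ar ×ℂ Ioo 0 1) with hCr
  set Cl := homotopyMap (fun _ => (o : ℂ)) βl '' (Ioo (-al) al ×ℂ Ioo 0 1) with hCl
  have subr : Cr ⊆ starRegion o (curvePair βl βr al ar) := by
    rintro _ ⟨z, hz, rfl⟩
    exact H.cone_point_mem_starRegion (Or.inr ⟨_, Ioo_subset_Icc_self hz.1, rfl⟩) hz.2.1.le hz.2.2
  have subl : Cl ⊆ starRegion o (curvePair βl βr al ar) := by
    rintro _ ⟨z, hz, rfl⟩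
    exact H.cone_point_mem_starRegion (Or.inl ⟨_, Ioo_subset_Icc_self hz.1, rfl⟩) hz.2.1.le hz.2.2
  have hdisj : Disjoint Cl Cr := by
    rw [Set.disjoint_left]
    rintro _ ⟨z, hz, rfl⟩ ⟨w, hw, e⟩
    have := H.mixed_eq (Ioo_subset_Icc_self hz.1) (Ioo_subset_Icc_self hw.1) hz.2.1 hw.2.1
      (add_left_cancel e).symm
    rcases this.2.1 with h1 | h1
    · exact hz.1.2.ne h1
    · exact hz.1.1.ne h1.symm
  have hmr : MeasurableSet Cr := measurable_image_of_fderivWithin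
    (isOpen_Ioo.reProdIm isOpen_Ioo).measurableSet
    (fun z _ => (hasFDerivAt_homotopyMap contDiff_const H.right.contDiff z).hasFDerivWithinAt)
    H.injOn_right
  let ray (x : ℂ) : Set ℂ := (fun t : ℝ => (o : ℂ) + t • (x - o)) '' univ
  have ray_null (x : ℂ) : volume (ray x) = 0 := volume_image_curve (by fun_prop) _
  have hcover : starRegion o (curvePair βl βr al ar) ⊆
      (Cl ∪ Cr) ∪ (ray (h * Complex.I) ∪ ray (-(h * Complex.I))) := by
    intro z hz
    by_cases hzo : z = o
    · exact Or.inr (Or.inl ⟨0, trivial, by simp [hzo]⟩)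
    obtain ⟨x, hx, t, ht, rfl⟩ := H.exists_of_mem_starRegion hz hzo
    have hend (hx : x = h * Complex.I ∨ x = -(h * Complex.I)) :
        (o : ℂ) + t • (x - o) ∈ ray (h * Complex.I) ∪ ray (-(h * Complex.I)) := by
      rcases hx with rfl | rfl
      · exact Or.inl ⟨t, trivial, rfl⟩
      · exact Or.inr ⟨t, trivial, rfl⟩
    rcases hx with ⟨s, hs, rfl⟩ | ⟨s, hs, rfl⟩
    · by_cases h1 : s = al
      · exact Or.inr (hend (Or.inl (by rw [h1, H.left_top])))
      by_cases h2 : s = -al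
      · exact Or.inr (hend (Or.inr (by rw [h2, H.left_bot])))
      exact Or.inl (Or.inl ⟨⟨s, t⟩, ⟨⟨lt_of_le_of_ne hs.1 (Ne.symm h2), lt_of_le_of_ne hs.2 h1⟩, ht⟩, rfl⟩)
    · by_cases h1 : s = ar
      · exact Or.inr (hend (Or.inl (by rw [h1, H.right_top])))
      by_cases h2 : s = -ar
      · exact Or.inr (hend (Or.inr (by rw [h2, H.right_bot])))
      exact Or.inl (Or.inr ⟨⟨s, t⟩, ⟨⟨lt_of_le_of_ne hs.1 (Ne.symm h2), lt_of_le_of_ne hs.2 h1⟩, ht⟩, rfl⟩)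
  have hae : starRegion o (curvePair βl βr al ar) =ᵐ[volume] (Cl ∪ Cr : Set ℂ) := by
    apply Filter.EventuallyLE.antisymm
    · rw [ae_le_set]
      refine measure_mono_null ?_ (measure_union_null (ray_null (h * Complex.I))
        (ray_null (-(h * Complex.I))))
      rintro z ⟨hz, hz'⟩
      exact (hcover hz).resolve_left hz'
    · exact LE.le.eventuallyLE (union_subset subl subr)
  have hint := H.integrableOn_starRegion (continuous_divC hT)
  rw [setIntegral_congr_set hae, setIntegral_union hdisj hmr (hint.mono_set subl) (hint.mono_set subr),
    setIntegral_cone (σ := 1) H.right.contDiff H.right.pos H.injOn_right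
      (fun s hs => by rw [abs_of_pos (H.right.cross_pos s hs), one_mul]) hT,
    setIntegral_cone (σ := -1) H.left_contDiff H.left.pos H.injOn_left
      (fun s hs => by rw [abs_of_neg (H.left_cross_neg hs), neg_one_mul]) hT,
    sideFlux_congr (β₀ := fun _ => (o : ℂ)) (β₁ := βr) (s := ar) (β₀' := fun _ => (o : ℂ)) (β₁' := βl)
      (s' := al) rfl (H.right_top.trans H.left_top.symm),
    sideFlux_congr (β₀ := fun _ => (o : ℂ)) (β₁ := βr) (s := -ar) (β₀' := fun _ => (o : ℂ)) (β₁' := βl)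
      (s' := -al) rfl (H.right_bot.trans H.left_bot.symm)]
  ring

end StarPair

/-! ### Regions are determined by their integrals of divergences. -/

/-- Every test function is a divergence on any given ball. -/
lemma exists_divC_eq {φ : ℂ → ℝ} (hφ : ContDiff ℝ ∞ φ) (hc : HasCompactSupport φ) (M : ℝ) :
    ∃ T : ℂ → ℂ, ContDiff ℝ 1 T ∧ ∀ z, ‖z‖ ≤ M → divC T z = φ z := by
  have hφ1 : ContDiff ℝ 1 φ := hφ.of_le (by exact_mod_cast le_top)
  obtain ⟨R, hR⟩ := hc.isCompact.isBounded.exists_norm_le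
  have cD : Continuous (fderiv ℝ φ) := hφ1.continuous_fderiv one_ne_zero
  obtain ⟨C, hC⟩ := (hc.fderiv (𝕜 := ℝ)).exists_bound_of_continuous cD
  have hcont := hφ1.continuous
  -- The support of `φ` lies in the ball of radius `R`, and a point of norm at most `M` leaves that
  -- ball when it is moved by `N` to the left. Hence the integral over the horizontal segment ending
  -- at `z` is a primitive of `φ` there.
  set N := |M| + |R| + 1 with hN
  let u : ℂ → ℝ := fun z => ∫ t in (0 : ℝ)..N, φ (z - t)
  have hD (z : ℂ) : HasFDerivAt u (∫ t in (0 : ℝ)..N, fderiv ℝ φ (z - t)) z := by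
    refine (intervalIntegral.hasFDerivAt_integral_of_dominated_of_fderiv_le (bound := fun _ => C)
      (F' := fun z t => fderiv ℝ φ (z - t)) (Filter.univ_mem (f := 𝓝 z)) ?_ ?_ ?_ ?_ ?_ ?_)
    · exact .of_forall fun z => (by fun_prop : Continuous fun t : ℝ => φ (z - t)).aestronglyMeasurable
    · exact (by fun_prop : Continuous fun t : ℝ => φ (z - t)).intervalIntegrable _ _
    · exact (by fun_prop : Continuous fun t : ℝ => fderiv ℝ φ (z - t)).aestronglyMeasurable
    · exact .of_forall fun t _ z _ => hC _
    · exact intervalIntegrable_const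
    · refine .of_forall fun t _ z _ => ?_
      exact (hφ1.differentiable one_ne_zero (z - t)).hasFDerivAt.comp z
        ((hasFDerivAt_id z).sub_const (t : ℂ))
  have hu : ContDiff ℝ 1 u := by
    rw [contDiff_one_iff_fderiv]
    refine ⟨fun z => (hD z).differentiableAt, ?_⟩
    have e : fderiv ℝ u = fun z => ∫ t in (0 : ℝ)..N, fderiv ℝ φ (z - t) :=
      funext fun z => (hD z).fderiv
    rw [e]
    exact intervalIntegral.continuous_parametric_intervalIntegral_of_continuous'
      (by simp only [Function.uncurry_def]; fun_prop) _ _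
  have hval (z : ℂ) (hz : ‖z‖ ≤ M) : fderiv ℝ u z 1 = φ z := by
    rw [(hD z).fderiv, ContinuousLinearMap.intervalIntegral_apply
      ((by fun_prop : Continuous fun t : ℝ => fderiv ℝ φ (z - t)).intervalIntegrable _ _)]
    have hd (t : ℝ) : HasDerivAt (fun t : ℝ => - φ (z - t)) ((fderiv ℝ φ (z - t)) 1) t := by
      have h1 : HasDerivAt (fun t : ℝ => z - (t : ℂ)) (-1) t := by
        simpa using (Complex.ofRealCLM.hasDerivAt (x := t)).const_sub z
      have h2 := ((hφ1.differentiable one_ne_zero (z - t)).hasFDerivAt.comp_hasDerivAt t h1).neg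
      exact h2.congr_deriv (by simp)
    rw [intervalIntegral.integral_eq_sub_of_hasDerivAt (fun t _ => hd t)
      ((by fun_prop : Continuous fun t : ℝ => (fderiv ℝ φ (z - t)) 1).intervalIntegrable _ _)]
    have h0 : φ (z - N) = 0 := by
      by_contra hne
      have h1 := hR _ (subset_tsupport φ hne)
      have h2 : ‖(N : ℂ)‖ ≤ ‖z - N‖ + ‖z‖ := by
        have := norm_sub_le z (z - N)
        rw [sub_sub_cancel] at this
        linarith
      rw [Complex.norm_real, Real.norm_of_nonneg (by positivity)] at h2
      linarith [le_abs_self M, le_abs_self R]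
    simp [h0]
  refine ⟨fun z => (u z : ℂ), Complex.ofRealCLM.contDiff.comp hu, fun z hz => ?_⟩
  have h3 : HasFDerivAt (fun z => (u z : ℂ)) (Complex.ofRealCLM.comp (fderiv ℝ u z)) z :=
    Complex.ofRealCLM.hasFDerivAt.comp z (hu.differentiable one_ne_zero z).hasFDerivAt
  rw [divC, h3.fderiv]
  simp [hval z hz]

/-- A bounded integrable density whose integrals against divergences vanish is zero. -/
lemma ae_eq_zero_of_integral_divC {f : ℂ → ℝ} (hf : Integrable f) {M : ℝ}
    (hM : ∀ z, M < ‖z‖ → f z = 0) {U : Set ℂ} (hU : IsOpen U)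
    (h : ∀ T : ℂ → ℂ, ContDiff ℝ 1 T → (∀ z, z ∉ U → ‖z‖ ≤ M → divC T z = 0) →
      ∫ z, divC T z * f z = 0) : ∀ᵐ z, z ∈ U → f z = 0 := by
  refine hU.ae_eq_zero_of_integral_contDiff_smul_eq_zero (hf.locallyIntegrable.locallyIntegrableOn _) ?_
  intro φ hφ hc hsupp
  obtain ⟨T, hT, e⟩ := exists_divC_eq hφ hc M
  rw [← h T hT fun z hzU hz => ?_]
  · congr 1
    ext z
    rcases le_or_gt ‖z‖ M with hz | hz
    · rw [e z hz, smul_eq_mul]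
    · rw [hM z hz]; simp
  · rw [e z hz]
    exact image_eq_zero_of_notMem_tsupport fun hmem => hzU (hsupp hmem)

lemma integral_mul_indicator {A : Set ℂ} (hA : MeasurableSet A) (φ : ℂ → ℝ) :
    ∫ z, φ z * A.indicator (fun _ => (1 : ℝ)) z = ∫ z in A, φ z := by
  rw [← integral_indicator hA]
  congr 1
  ext z
  by_cases hz : z ∈ A <;> simp [hz]

lemma integrable_mul_indicator {A : Set ℂ} (hA : MeasurableSet A) (hb : Bornology.IsBounded A)
    {φ : ℂ → ℝ} (hφ : Continuous φ) :
    Integrable fun z => φ z * A.indicator (fun _ => (1 : ℝ)) z := by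
  have : (fun z => φ z * A.indicator (fun _ => (1 : ℝ)) z) = A.indicator φ := by
    ext z
    by_cases hz : z ∈ A <;> simp [hz]
  rw [this, integrable_indicator_iff hA]
  exact (hφ.continuousOn.integrableOn_compact hb.isCompact_closure).mono_set subset_closure

lemma integrable_indicator_one {A : Set ℂ} (hA : MeasurableSet A) (hb : Bornology.IsBounded A) :
    Integrable (A.indicator fun _ => (1 : ℝ)) := by
  simpa using integrable_mul_indicator hA hb (φ := fun _ => 1) (by fun_prop)

/-- The region between the outer arcs is the union of the two regions cut out by a third arc. -/
lemma indicator_eq_add {A B D : Set ℂ} {γ₁ γ₀ γ₂ : ℝ → ℂ} {a₁ a₀ a₂ : ℝ} (hA : MeasurableSet A)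
    (hB : MeasurableSet B) (hD : MeasurableSet D) (bA : Bornology.IsBounded A)
    (bB : Bornology.IsBounded B) (bD : Bornology.IsBounded D)
    (h₁ : HasBoundary A γ₁ γ₀ a₁ a₀) (h₂ : HasBoundary B γ₀ γ₂ a₀ a₂)
    (h : HasBoundary D γ₁ γ₂ a₁ a₂) :
    ∀ᵐ z, D.indicator (fun _ => (1 : ℝ)) z =
      A.indicator (fun _ => (1 : ℝ)) z + B.indicator (fun _ => (1 : ℝ)) z := by
  obtain ⟨M, hM⟩ := ((bA.union bB).union bD).exists_norm_le
  -- The fluxes through `γ₀` cancel between `A` and `B`, so this density is orthogonal to every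
  -- divergence.
  have key := ae_eq_zero_of_integral_divC
    (f := fun z => D.indicator (fun _ => (1 : ℝ)) z - (A.indicator (fun _ => (1 : ℝ)) z +
      B.indicator (fun _ => (1 : ℝ)) z))
    ((integrable_indicator_one hD bD).sub ((integrable_indicator_one hA bA).add
      (integrable_indicator_one hB bB))) (M := M) ?_ isOpen_univ ?_
  · filter_upwards [key] with z hz
    linarith [hz trivial]
  · intro z hz
    have hzA : z ∉ A := fun hmem => (hM z (Or.inl (Or.inl hmem))).not_gt hz
    have hzB : z ∉ B := fun hmem => (hM z (Or.inl (Or.inr hmem))).not_gt hz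
    have hzD : z ∉ D := fun hmem => (hM z (Or.inr hmem)).not_gt hz
    simp [hzA, hzB, hzD]
  · intro T hT _
    have c := continuous_divC hT
    simp_rw [mul_sub, mul_add]
    have iAB : Integrable fun z => divC T z * A.indicator (fun _ => (1 : ℝ)) z +
        divC T z * B.indicator (fun _ => (1 : ℝ)) z :=
      (integrable_mul_indicator hA bA c).add (integrable_mul_indicator hB bB c)
    rw [integral_sub (integrable_mul_indicator hD bD c) iAB, integral_add (integrable_mul_indicator hA bA c) (integrable_mul_indicator hB bB c),
      integral_mul_indicator hA, integral_mul_indicator hB, integral_mul_indicator hD,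
      h T hT, h₁ T hT, h₂ T hT]
    ring

/-- The region swept by the linear homotopy between two arcs. -/
def sweptRegion (β₀ β₁ : ℝ → ℂ) (a : ℝ) : Set ℂ :=
  homotopyMap β₀ β₁ '' (Icc (-a) a ×ℂ Icc 0 1)

/-- Two regions with close boundary arcs differ at most by the regions that are swept in between. -/
lemma volume_symmDiff_le {A B : Set ℂ} {αl αr βl βr : ℝ → ℂ} {al ar : ℝ} (hal : 0 ≤ al)
    (har : 0 ≤ ar) (hA : MeasurableSet A) (hB : MeasurableSet B) (bA : Bornology.IsBounded A)
    (bB : Bornology.IsBounded B) (cαl : ContDiff ℝ 1 αl) (cαr : ContDiff ℝ 1 αr)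
    (cβl : ContDiff ℝ 1 βl) (cβr : ContDiff ℝ 1 βr) (hAb : HasBoundary A αl αr al ar)
    (hBb : HasBoundary B βl βr al ar) (tα : αl al = αr ar) (tβ : βl al = βr ar)
    (lα : αl (-al) = αr (-ar)) (lβ : βl (-al) = βr (-ar)) :
    volume (A ∆ B) ≤ volume (sweptRegion αl βl al) + volume (sweptRegion αr βr ar) := by
  have comp (β₀ β₁ : ℝ → ℂ) (h₀ : ContDiff ℝ 1 β₀) (h₁ : ContDiff ℝ 1 β₁) (a : ℝ) :
      IsCompact (sweptRegion β₀ β₁ a) :=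
    (isCompact_Icc.reProdIm isCompact_Icc).image
      (continuous_homotopyMap h₀.continuous h₁.continuous)
  have hK := (comp _ _ cαl cβl al).union (comp _ _ cαr cβr ar)
  obtain ⟨M, hM⟩ := ((bA.union bB).union hK.isBounded).exists_norm_le
  have key := ae_eq_zero_of_integral_divC
    (f := fun z => B.indicator (fun _ => (1 : ℝ)) z - A.indicator (fun _ => (1 : ℝ)) z)
    ((integrable_indicator_one hB bB).sub (integrable_indicator_one hA bA)) (M := M) ?_
    hK.isClosed.isOpen_compl ?_
  · refine (measure_mono_ae ?_).trans (measure_union_le _ _)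
    filter_upwards [key] with z hz hmem
    by_contra hzK
    have := hz hzK
    rcases hmem with ⟨h1, h2⟩ | ⟨h1, h2⟩ <;> simp [h1, h2] at this
  · intro z hz
    have hzA : z ∉ A := fun hmem => (hM z (Or.inl (Or.inl hmem))).not_gt hz
    have hzB : z ∉ B := fun hmem => (hM z (Or.inl (Or.inr hmem))).not_gt hz
    simp [hzA, hzB]
  · intro T hT hzero
    have c := continuous_divC hT
    -- If `div T` vanishes on the swept sets, the flux changes only by the side fluxes at the
    -- endpoints, and these are the same for the left and the right arc.
    have van (β₀ β₁ : ℝ → ℂ) (h₀ : ContDiff ℝ 1 β₀) (h₁ : ContDiff ℝ 1 β₁) (a : ℝ) (ha : 0 ≤ a)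
        (hsub : sweptRegion β₀ β₁ a ⊆ sweptRegion αl βl al ∪ sweptRegion αr βr ar) :
        flux T β₁ (-a) a - flux T β₀ (-a) a = sideFlux T β₀ β₁ a - sideFlux T β₀ β₁ (-a) := by
      rw [flux_sub_flux hT h₀ h₁]
      have : ∫ s in (-a)..a, ∫ t in (0 : ℝ)..1, divC T (homotopy β₀ β₁ s t) *
          cross (β₁ s - β₀ s) (homotopyDeriv β₀ β₁ s t) = ∫ s in (-a)..a, (0 : ℝ) := by
        apply intervalIntegral.integral_congr
        intro s hs
        rw [uIcc_of_le (by linarith)] at hs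
        have : ∫ t in (0 : ℝ)..1, divC T (homotopy β₀ β₁ s t) *
          cross (β₁ s - β₀ s) (homotopyDeriv β₀ β₁ s t) = ∫ t in (0 : ℝ)..1, (0 : ℝ) := by
          apply intervalIntegral.integral_congr
          intro t ht
          rw [uIcc_of_le zero_le_one] at ht
          have hmem : homotopy β₀ β₁ s t ∈ sweptRegion αl βl al ∪ sweptRegion αr βr ar :=
            hsub ⟨⟨s, t⟩, ⟨hs, ht⟩, rfl⟩
          dsimp only
          rw [hzero _ (fun h => h hmem) (hM _ (Or.inr hmem)), zero_mul]
        dsimp only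
        rw [this, intervalIntegral.integral_zero]
      rw [this, intervalIntegral.integral_zero, zero_add]
    have vl := van αl βl cαl cβl al hal subset_union_left
    have vr := van αr βr cαr cβr ar har subset_union_right
    rw [sideFlux_congr tα tβ, sideFlux_congr lα lβ] at vl
    simp_rw [mul_sub]
    rw [integral_sub (integrable_mul_indicator hB bB c) (integrable_mul_indicator hA bA c),
      integral_mul_indicator hA, integral_mul_indicator hB, hAb T hT, hBb T hT]
    linarith

/-! ### Three arcs with common endpoints, and the chambers they enclose. -/

/-- Off the frontier of `A`, the set `C` is covered by the disjoint open sets `interior A` and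
`(closure A)ᶜ`. -/
lemma _root_.IsPreconnected.subset_of_disjoint_frontier {X : Type*} [TopologicalSpace X]
    {C A : Set X} (hC : IsPreconnected C) (hA : Disjoint C (frontier A)) (hne : (C ∩ A).Nonempty) :
    C ⊆ A := by
  by_contra hsub
  obtain ⟨x, hx, hxA⟩ := Set.not_subset.1 hsub
  obtain ⟨y, hy, hyA⟩ := hne
  have hcl (z : X) (hz : z ∈ C) (h : z ∈ closure A) : z ∈ interior A := by
    by_contra hi
    exact Set.disjoint_left.1 hA hz ⟨h, hi⟩
  obtain ⟨z, -, hz1, hz2⟩ := hC (interior A) (closure A)ᶜ isOpen_interior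
    isClosed_closure.isOpen_compl
    (fun z hz => by
      by_cases h : z ∈ closure A
      · exact Or.inl (hcl z hz h)
      · exact Or.inr h)
    ⟨y, hy, hcl y hy (subset_closure hyA)⟩
    ⟨x, hx, fun h => hxA (interior_subset (hcl x hx h))⟩
  exact hz2 (interior_subset_closure hz1)

/-- Three arcs from `-ih` to `ih` that enclose two regions. -/
structure StarTrio (o₁ o₂ h : ℝ) (γ₁ γ₀ γ₂ : ℝ → ℂ) (a₁ a₀ a₂ : ℝ) : Prop where
  left : StarPair o₁ h γ₁ γ₀ a₁ a₀
  right : StarPair o₂ h γ₀ γ₂ a₀ a₂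
  outer : StarPair 0 h γ₁ γ₂ a₁ a₂

namespace StarTrio

variable {o₁ o₂ h a₁ a₀ a₂ : ℝ} {γ₁ γ₀ γ₂ : ℝ → ℂ}

/-- The union of three arcs. -/
def network (γ₁ γ₀ γ₂ : ℝ → ℂ) (a₁ a₀ a₂ : ℝ) : Set ℂ :=
  γ₁ '' Icc (-a₁) a₁ ∪ γ₀ '' Icc (-a₀) a₀ ∪ γ₂ '' Icc (-a₂) a₂

lemma indicator_eq (H : StarTrio o₁ o₂ h γ₁ γ₀ γ₂ a₁ a₀ a₂) : ∀ᵐ z,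
    (starRegion 0 (curvePair γ₁ γ₂ a₁ a₂)).indicator (fun _ => (1 : ℝ)) z =
      (starRegion o₁ (curvePair γ₁ γ₀ a₁ a₀)).indicator (fun _ => (1 : ℝ)) z +
      (starRegion o₂ (curvePair γ₀ γ₂ a₀ a₂)).indicator (fun _ => (1 : ℝ)) z :=
  indicator_eq_add H.left.measurableSet_starRegion H.right.measurableSet_starRegion
    H.outer.measurableSet_starRegion H.left.isBounded_starRegion H.right.isBounded_starRegion
    H.outer.isBounded_starRegion H.left.hasBoundary H.right.hasBoundary H.outer.hasBoundary

lemma ae_mem_iff (H : StarTrio o₁ o₂ h γ₁ γ₀ γ₂ a₁ a₀ a₂) : ∀ᵐ z,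
    (z ∈ starRegion 0 (curvePair γ₁ γ₂ a₁ a₂) ↔
      z ∈ starRegion o₁ (curvePair γ₁ γ₀ a₁ a₀) ∨ z ∈ starRegion o₂ (curvePair γ₀ γ₂ a₀ a₂)) ∧
    ¬ (z ∈ starRegion o₁ (curvePair γ₁ γ₀ a₁ a₀) ∧ z ∈ starRegion o₂ (curvePair γ₀ γ₂ a₀ a₂)) := by
  filter_upwards [H.indicator_eq] with z hz
  by_cases h0 : z ∈ starRegion 0 (curvePair γ₁ γ₂ a₁ a₂) <;>
  by_cases h1 : z ∈ starRegion o₁ (curvePair γ₁ γ₀ a₁ a₀) <;>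
  by_cases h2 : z ∈ starRegion o₂ (curvePair γ₀ γ₂ a₀ a₂) <;>
  simp [h0, h1, h2] at hz ⊢
  norm_num at hz

/-- The overlap is open, and null because the indicators of the two regions add up to an indicator.
-/
lemma disjoint (H : StarTrio o₁ o₂ h γ₁ γ₀ γ₂ a₁ a₀ a₂) :
    Disjoint (starRegion o₁ (curvePair γ₁ γ₀ a₁ a₀)) (starRegion o₂ (curvePair γ₀ γ₂ a₀ a₂)) := by
  rw [Set.disjoint_iff_inter_eq_empty]
  apply (H.left.isOpen_starRegion.inter H.right.isOpen_starRegion).eq_empty_of_measure_zero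
    (μ := volume)
  refine measure_mono_null ?_ (ae_iff.1 H.ae_mem_iff)
  exact fun z hz h => h.2 hz

/-- The third arc lies in the closure of the right region, and an open set disjoint from a region
does not meet its closure. -/
lemma disjoint_left_network (H : StarTrio o₁ o₂ h γ₁ γ₀ γ₂ a₁ a₀ a₂) :
    Disjoint (starRegion o₁ (curvePair γ₁ γ₀ a₁ a₀)) (network γ₁ γ₀ γ₂ a₁ a₀ a₂) := by
  refine Set.disjoint_union_right.2 ⟨StarPair.starRegion_disjoint, ?_⟩
  refine (H.disjoint.closure_right H.left.isOpen_starRegion).mono_right ?_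
  exact subset_union_right.trans H.right.curvePair_subset_closure

lemma disjoint_right_network (H : StarTrio o₁ o₂ h γ₁ γ₀ γ₂ a₁ a₀ a₂) :
    Disjoint (starRegion o₂ (curvePair γ₀ γ₂ a₀ a₂)) (network γ₁ γ₀ γ₂ a₁ a₀ a₂) := by
  rw [network, union_assoc]
  refine Set.disjoint_union_right.2 ⟨?_, StarPair.starRegion_disjoint⟩
  refine (H.disjoint.symm.closure_right H.right.isOpen_starRegion).mono_right ?_
  exact subset_union_left.trans H.left.curvePair_subset_closure

lemma disjoint_exterior_network (H : StarTrio o₁ o₂ h γ₁ γ₀ γ₂ a₁ a₀ a₂) :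
    Disjoint (starCone 0 (curvePair γ₁ γ₂ a₁ a₂))ᶜ (network γ₁ γ₀ γ₂ a₁ a₀ a₂) := by
  have hX : IsOpen (starCone 0 (curvePair γ₁ γ₂ a₁ a₂))ᶜ :=
    H.outer.isCompact_starCone.isClosed.isOpen_compl
  have hd : Disjoint (starCone 0 (curvePair γ₁ γ₂ a₁ a₂))ᶜ
      (starRegion o₁ (curvePair γ₁ γ₀ a₁ a₀)) := by
    rw [Set.disjoint_iff_inter_eq_empty]
    apply (hX.inter H.left.isOpen_starRegion).eq_empty_of_measure_zero (μ := volume)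
    refine measure_mono_null ?_ (ae_iff.1 H.ae_mem_iff)
    exact fun z hz h => hz.1 (H.outer.starRegion_subset_starCone (h.1.2 (Or.inl hz.2)))
  have hc : Disjoint (starCone 0 (curvePair γ₁ γ₂ a₁ a₂))ᶜ (curvePair γ₁ γ₂ a₁ a₂) :=
    disjoint_compl_left.mono_right StarPair.curvePair_subset_starCone
  refine Set.disjoint_union_right.2 ⟨Set.disjoint_union_right.2 ⟨?_, ?_⟩, ?_⟩
  · exact hc.mono_right subset_union_left
  · exact (hd.closure_right hX).mono_right
      (subset_union_right.trans H.left.curvePair_subset_closure)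
  · exact hc.mono_right subset_union_right

/-- A point of `A` outside the outer cone has a ball around it that lies in `A`. The outward rays
from that ball never meet the network, so `A` also contains all dilates of the ball by factors `τ ≥
1`, whose areas are unbounded. -/
lemma disjoint_exterior (H : StarTrio o₁ o₂ h γ₁ γ₀ γ₂ a₁ a₀ a₂) {A : Set ℂ}
    (hA : frontier A ⊆ network γ₁ γ₀ γ₂ a₁ a₀ a₂) (hvol : volume A < ⊤) :
    Disjoint (starCone 0 (curvePair γ₁ γ₂ a₁ a₂))ᶜ A := by
  rw [Set.disjoint_left]
  intro z hz hzA
  have hX : IsOpen (starCone 0 (curvePair γ₁ γ₂ a₁ a₂))ᶜ :=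
    H.outer.isCompact_starCone.isClosed.isOpen_compl
  have hd := H.disjoint_exterior_network.mono_right hA
  obtain ⟨r, hr, hball⟩ := Metric.isOpen_iff.1 hX z hz
  have hBA : Metric.ball z r ⊆ A :=
    (convex_ball z r).isPreconnected.subset_of_disjoint_frontier (hd.mono_left hball)
      ⟨z, Metric.mem_ball_self hr, hzA⟩
  have hτ (τ : ℝ) (h1 : 1 ≤ τ) : τ • Metric.ball z r ⊆ A := by
    rintro _ ⟨w, hw, rfl⟩
    have hray : (fun τ : ℝ => τ • w) '' Ici 1 ⊆ A := by
      apply ((convex_Ici (1 : ℝ)).isPreconnected.image _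
        (by fun_prop)).subset_of_disjoint_frontier (hd.mono_left ?_)
        ⟨w, ⟨1, by simp, by simp⟩, hBA hw⟩
      rintro _ ⟨τ, hτ, rfl⟩
      simpa using StarPair.expand_notMem_starCone (hball hw) hτ
    exact hray ⟨τ, h1, rfl⟩
  have hpos : volume (Metric.ball z r) ≠ 0 := (Metric.measure_ball_pos volume z hr).ne'
  have hle (n : ℕ) : (n : ℝ≥0∞) * volume (Metric.ball z r) ≤ volume A := by
    refine le_trans ?_ (measure_mono (hτ (n + 1) (by linarith [n.cast_nonneg (α := ℝ)])))
    rw [Measure.addHaar_smul]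
    gcongr
    rw [← ENNReal.ofReal_natCast]
    apply ENNReal.ofReal_le_ofReal
    rw [Complex.finrank_real_complex, abs_of_nonneg (by positivity)]
    nlinarith [n.cast_nonneg (α := ℝ)]
  obtain ⟨n, hn⟩ := ENNReal.exists_nat_mul_gt hpos hvol.ne
  exact (hle n).not_gt hn

lemma subset_or_disjoint (_ : StarTrio o₁ o₂ h γ₁ γ₀ γ₂ a₁ a₀ a₂) {A C : Set ℂ}
    (hA : frontier A ⊆ network γ₁ γ₀ γ₂ a₁ a₀ a₂) (hC : IsPreconnected C)
    (hd : Disjoint C (network γ₁ γ₀ γ₂ a₁ a₀ a₂)) : C ⊆ A ∨ Disjoint C A := by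
  rw [or_iff_not_imp_right, Set.not_disjoint_iff_nonempty_inter]
  exact hC.subset_of_disjoint_frontier (hd.mono_right hA)

lemma ae_mem_or (H : StarTrio o₁ o₂ h γ₁ γ₀ γ₂ a₁ a₀ a₂) {A : Set ℂ}
    (hA : frontier A ⊆ network γ₁ γ₀ γ₂ a₁ a₀ a₂) (hvol : volume A < ⊤) : ∀ᵐ z, z ∈ A →
      z ∈ starRegion o₁ (curvePair γ₁ γ₀ a₁ a₀) ∨ z ∈ starRegion o₂ (curvePair γ₀ γ₂ a₀ a₂) := by
  have hn : ∀ᵐ z, z ∉ curvePair γ₁ γ₂ a₁ a₂ := measure_eq_zero_iff_ae_notMem.1 H.outer.volume_curvePair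
  filter_upwards [H.ae_mem_iff, hn] with z hz hzc hzA
  have : z ∈ starCone 0 (curvePair γ₁ γ₂ a₁ a₂) := by
    by_contra hX
    exact Set.disjoint_left.1 (H.disjoint_exterior hA hvol) hX hzA
  exact hz.1.1 ((H.outer.starCone_subset this).resolve_right hzc)

/-- A pair of disjoint chambers whose boundaries lie on the network are the enclosed regions. -/
theorem ae_eq_or_ae_eq (H : StarTrio o₁ o₂ h γ₁ γ₀ γ₂ a₁ a₀ a₂) {A B : Set ℂ}
    (hA : frontier A ⊆ network γ₁ γ₀ γ₂ a₁ a₀ a₂) (hB : frontier B ⊆ network γ₁ γ₀ γ₂ a₁ a₀ a₂)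
    (vA : volume A < ⊤) (vB : volume B < ⊤) (pA : volume A ≠ 0) (pB : volume B ≠ 0)
    (hAB : volume (A ∩ B) = 0) :
    (A =ᵐ[volume] starRegion o₁ (curvePair γ₁ γ₀ a₁ a₀) ∧
      B =ᵐ[volume] starRegion o₂ (curvePair γ₀ γ₂ a₀ a₂)) ∨
    (A =ᵐ[volume] starRegion o₂ (curvePair γ₀ γ₂ a₀ a₂) ∧
      B =ᵐ[volume] starRegion o₁ (curvePair γ₁ γ₀ a₁ a₀)) := by
  set Ω₁ := starRegion o₁ (curvePair γ₁ γ₀ a₁ a₀) with hΩ₁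
  set Ω₂ := starRegion o₂ (curvePair γ₀ γ₂ a₀ a₂) with hΩ₂
  have d₁ {C : Set ℂ} (hC : frontier C ⊆ network γ₁ γ₀ γ₂ a₁ a₀ a₂) :=
    H.subset_or_disjoint hC H.left.isPreconnected_starRegion H.disjoint_left_network
  have d₂ {C : Set ℂ} (hC : frontier C ⊆ network γ₁ γ₀ γ₂ a₁ a₀ a₂) :=
    H.subset_or_disjoint hC H.right.isPreconnected_starRegion H.disjoint_right_network
  have ne₁ : volume Ω₁ ≠ 0 :=
    (H.left.isOpen_starRegion.measure_pos volume ⟨_, H.left.center_mem⟩).ne'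
  have ne₂ : volume Ω₂ ≠ 0 :=
    (H.right.isOpen_starRegion.measure_pos volume ⟨_, H.right.center_mem⟩).ne'
  have some {C : Set ℂ} (hC : frontier C ⊆ network γ₁ γ₀ γ₂ a₁ a₀ a₂) (vC : volume C < ⊤)
      (pC : volume C ≠ 0) : Ω₁ ⊆ C ∨ Ω₂ ⊆ C := by
    by_contra! hne
    have e1 := (d₁ hC).resolve_left hne.1
    have e2 := (d₂ hC).resolve_left hne.2
    apply pC
    rw [measure_eq_zero_iff_ae_notMem]
    filter_upwards [H.ae_mem_or hC vC] with z hz hzC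
    rcases hz hzC with h1 | h1
    · exact Set.disjoint_left.1 e1 h1 hzC
    · exact Set.disjoint_left.1 e2 h1 hzC
  have excl {C : Set ℂ} (hC : volume C ≠ 0) (h1 : C ⊆ A) : ¬ C ⊆ B := fun h2 =>
    hC (measure_mono_null (subset_inter h1 h2) hAB)
  have conclude {C D E : Set ℂ} (hCD : ∀ᵐ z, z ∈ C → z ∈ D ∨ z ∈ E) (h1 : D ⊆ C)
      (h2 : Disjoint E C) : C =ᵐ[volume] D := by
    filter_upwards [hCD] with z hz
    apply propext
    exact ⟨fun hzC => (hz hzC).resolve_right fun hE => Set.disjoint_left.1 h2 hE hzC, fun hzD => h1 hzD⟩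
  have swap {C : Set ℂ} (hC : ∀ᵐ z, z ∈ C → z ∈ Ω₁ ∨ z ∈ Ω₂) : ∀ᵐ z, z ∈ C → z ∈ Ω₂ ∨ z ∈ Ω₁ := by
    filter_upwards [hC] with z hz hzC using (hz hzC).symm
  -- Each chamber contains at least one region, and no region lies in both chambers, so they pick
  -- different ones.
  rcases some hA vA pA with h1 | h1
  · have h2 := (some hB vB pB).resolve_left (excl ne₁ h1)
    refine Or.inl ⟨conclude (H.ae_mem_or hA vA) h1 ?_, conclude (swap (H.ae_mem_or hB vB)) h2 ?_⟩
    · exact (d₂ hA).resolve_left fun h3 => excl ne₂ h3 h2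
    · exact (d₁ hB).resolve_left (excl ne₁ h1)
  · have h2 := (some hB vB pB).resolve_right (excl ne₂ h1)
    refine Or.inr ⟨conclude (swap (H.ae_mem_or hA vA)) h1 ?_, conclude (H.ae_mem_or hB vB) h2 ?_⟩
    · exact (d₁ hA).resolve_left fun h3 => excl ne₁ h3 h2
    · exact (d₂ hB).resolve_left (excl ne₂ h1)

end StarTrio

/-! ### The perimeter of a star-shaped region is the length of its arcs. -/

/-- The distributional perimeter in the complex plane. -/
def perimC (A : Set ℂ) : ℝ≥0∞ :=
  ⨆ (T : ℂ → ℂ) (_ : ContDiff ℝ 1 T) (_ : HasCompactSupport T) (_ : ∀ x, ‖T x‖ ≤ 1),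
    ENNReal.ofReal (∫ x in A, divC T x)

/-- The length of an arc. -/
def arcLength (β : ℝ → ℂ) (a : ℝ) : ℝ := ∫ s in (-a)..a, ‖deriv β s‖

lemma arcLength_nonneg {β : ℝ → ℂ} {a : ℝ} (ha : 0 ≤ a) : 0 ≤ arcLength β a :=
  intervalIntegral.integral_nonneg (by linarith) fun _ _ => norm_nonneg _

lemma perimC_congr {A B : Set ℂ} (h : A =ᵐ[volume] B) : perimC A = perimC B := by
  simp only [perimC, setIntegral_congr_set h]

lemma abs_flux_le {T : ℂ → ℂ} (hT : Continuous T) (h1 : ∀ x, ‖T x‖ ≤ 1) {β : ℝ → ℂ}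
    (hβ : ContDiff ℝ 1 β) {a : ℝ} (ha : 0 ≤ a) : |flux T β (-a) a| ≤ arcLength β a := by
  have c := contDiff_deriv hβ
  have c' := hβ.continuous
  refine (intervalIntegral.abs_integral_le_integral_abs (by linarith)).trans ?_
  apply intervalIntegral.integral_mono_on (by linarith)
    ((by fun_prop : Continuous _).intervalIntegrable _ _)
    ((by fun_prop : Continuous _).intervalIntegrable _ _)
  intro s _
  refine (abs_cross_le _ _).trans ?_
  exact mul_le_of_le_one_left (norm_nonneg _) (h1 _)

lemma perimC_le {A : Set ℂ} {βl βr : ℝ → ℂ} {al ar : ℝ} (hA : HasBoundary A βl βr al ar)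
    (cl : ContDiff ℝ 1 βl) (cr : ContDiff ℝ 1 βr) (hal : 0 ≤ al) (har : 0 ≤ ar) :
    perimC A ≤ ENNReal.ofReal (arcLength βl al + arcLength βr ar) := by
  refine iSup_le fun T => iSup_le fun hT => iSup_le fun _ => iSup_le fun h1 => ?_
  apply ENNReal.ofReal_le_ofReal
  rw [hA T hT]
  have h2 := abs_le.1 (abs_flux_le hT.continuous h1 cl hal)
  have h3 := abs_le.1 (abs_flux_le hT.continuous h1 cr har)
  linarith

/-- Smooth approximation of a continuous field with values in the unit disc. -/
lemma exists_contDiff_approx {G : ℂ → ℂ} (hG : Continuous G) (h1 : ∀ z, ‖G z‖ ≤ 1) {δ : ℝ}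
    (hδ : 0 < δ) (R : ℝ) : ∃ T : ℂ → ℂ, ContDiff ℝ 1 T ∧ HasCompactSupport T ∧
      (∀ z, ‖T z‖ ≤ 1) ∧ ∀ z, ‖z‖ ≤ R → ‖T z - G z‖ ≤ δ := by
  -- Both constraints, norm at most 1 and closeness to `G`, are convex and are met locally by
  -- constants, so a smooth partition of unity meets them globally. The bump function below then
  -- makes the support compact.
  obtain ⟨g, hg⟩ := exists_contMDiffMap_forall_mem_convex_of_local_const (n := (1 : ℕ∞))
    𝓘(ℝ, ℂ) (t := fun z => Metric.closedBall (0 : ℂ) 1 ∩ Metric.closedBall (G z) δ)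
    (fun z => (convex_closedBall _ _).inter (convex_closedBall _ _)) (fun z => by
      refine ⟨G z, ?_⟩
      filter_upwards [hG.continuousAt.eventually (Metric.ball_mem_nhds (G z) hδ)] with y hy
      refine ⟨by simpa using h1 z, ?_⟩
      rw [Metric.mem_closedBall, dist_comm]
      exact (Metric.mem_ball.1 hy).le)
  let χ : ContDiffBump (0 : ℂ) := ⟨|R| + 1, |R| + 2, by positivity, by linarith⟩
  have hgs : ContDiff ℝ 1 g := g.contMDiff.contDiff
  have hχ : ContDiff ℝ 1 χ := χ.contDiff
  refine ⟨fun z => χ z • g z, hχ.smul hgs, χ.hasCompactSupport.smul_right, fun z => ?_, fun z hz => ?_⟩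
  · rw [norm_smul, Real.norm_of_nonneg χ.nonneg]
    have := (hg z).1
    rw [mem_closedBall_zero_iff] at this
    exact mul_le_one₀ χ.le_one (norm_nonneg _) this
  · have hz1 : χ z = 1 := χ.one_of_mem_closedBall (by
      rw [mem_closedBall_zero_iff]
      change ‖z‖ ≤ |R| + 1
      linarith [le_abs_self R])
    dsimp only
    rw [hz1, one_smul, ← dist_eq_norm]
    exact (hg z).2

/-- A field that is close to a unit normal except near the ends captures almost all the length. -/
lemma arcLength_le_flux {β : ℝ → ℂ} (hβ : ContDiff ℝ 1 β) {T : ℂ → ℂ} (hT : Continuous T)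
    (h1 : ∀ z, ‖T z‖ ≤ 1) {a ε δ C σ : ℝ} (hε : 0 ≤ ε) (hεa : ε ≤ a) (hσ : |σ| = 1)
    (hC : ∀ s ∈ Icc (-a) a, ‖deriv β s‖ ≤ C) (hδ : 0 ≤ δ) {N : ℝ → ℂ}
    (hN : ∀ s ∈ Icc (-a + ε) (a - ε), cross (N s) (deriv β s) = σ * ‖deriv β s‖)
    (hTN : ∀ s ∈ Icc (-a + ε) (a - ε), ‖T (β s) - N s‖ ≤ δ) :
    arcLength β a - (2 * a * δ * C + 4 * ε * C) ≤ σ * flux T β (-a) a := by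
  have c := contDiff_deriv hβ
  have c' := hβ.continuous
  have hC0 : 0 ≤ C := (norm_nonneg _).trans (hC 0 ⟨by linarith, by linarith⟩)
  have hσ2 : σ * σ = 1 := by rw [← abs_mul_abs_self, hσ, one_mul]
  let g : ℝ → ℝ := fun s => σ * cross (T (β s)) (deriv β s) - ‖deriv β s‖
  have cg : Continuous g := by fun_prop
  have ig (x y : ℝ) : IntervalIntegrable g volume x y := cg.intervalIntegrable _ _
  have e : σ * flux T β (-a) a - arcLength β a = ∫ s in (-a)..a, g s := by
    rw [flux, arcLength, ← intervalIntegral.integral_const_mul, ← intervalIntegral.integral_sub]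
    · exact (by fun_prop : Continuous _).intervalIntegrable _ _
    · exact (by fun_prop : Continuous _).intervalIntegrable _ _
  have lower {x y k : ℝ} (hxy : x ≤ y) (hk : ∀ s ∈ Icc x y, k ≤ g s) :
      k * (y - x) ≤ ∫ s in x..y, g s := by
    have := intervalIntegral.integral_mono_on hxy intervalIntegrable_const (ig x y) hk
    rw [intervalIntegral.integral_const, smul_eq_mul] at this
    linarith
  have hgen : ∀ s ∈ Icc (-a) a, -(2 * C) ≤ g s := fun s hs => by
    have h2 : |σ * cross (T (β s)) (deriv β s)| ≤ C := by
      rw [abs_mul, hσ, one_mul]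
      exact (abs_cross_le _ _).trans ((mul_le_of_le_one_left (norm_nonneg _) (h1 _)).trans (hC s hs))
    have := (abs_le.1 h2).1
    change _ ≤ σ * cross (T (β s)) (deriv β s) - ‖deriv β s‖
    linarith [hC s hs]
  have hmid : ∀ s ∈ Icc (-a + ε) (a - ε), -(δ * C) ≤ g s := fun s hs => by
    have hs' : s ∈ Icc (-a) a := ⟨by linarith [hs.1], by linarith [hs.2]⟩
    have h2 : |cross (T (β s) - N s) (deriv β s)| ≤ δ * C :=
      (abs_cross_le _ _).trans (mul_le_mul (hTN s hs) (hC s hs') (norm_nonneg _) hδ)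
    have h3 : cross (T (β s) - N s) (deriv β s) = cross (T (β s)) (deriv β s) - σ * ‖deriv β s‖ := by
      rw [← hN s hs]; simp [cross]; ring
    have h4 : |σ * cross (T (β s) - N s) (deriv β s)| ≤ δ * C := by
      rwa [abs_mul, hσ, one_mul]
    have := (abs_le.1 h4).1
    rw [h3, mul_sub, ← mul_assoc, hσ2, one_mul] at this
    exact this
  -- The integrand is at least `-2C` on the two end intervals of length `ε`, and at least `-δC` in
  -- between; this accounts for the losses `4εC` and `2aδC`.
  have l1 := lower (by linarith : -a ≤ -a + ε) (k := -(2 * C))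
    fun s hs => hgen s ⟨hs.1, by linarith [hs.2]⟩
  have l2 := lower (by linarith : -a + ε ≤ a - ε) hmid
  have l3 := lower (by linarith : a - ε ≤ a) (k := -(2 * C))
    fun s hs => hgen s ⟨by linarith [hs.1], hs.2⟩
  have split : ∫ s in (-a)..a, g s = (∫ s in (-a)..(-a + ε), g s) +
      (∫ s in (-a + ε)..(a - ε), g s) + ∫ s in (a - ε)..a, g s := by
    rw [intervalIntegral.integral_add_adjacent_intervals (ig _ _) (ig _ _),
      intervalIntegral.integral_add_adjacent_intervals (ig _ _) (ig _ _)]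
  have : 0 ≤ δ * C * ε := by positivity
  nlinarith

/-- The unit normal to a curve, pointing to the right if `σ = 1`. -/
def unitNormal (β : ℝ → ℂ) (σ : ℝ) (s : ℝ) : ℂ :=
  (σ / ‖deriv β s‖) • (-Complex.I * deriv β s)

lemma norm_unitNormal {β : ℝ → ℂ} {σ s : ℝ} (hσ : |σ| = 1) (h : deriv β s ≠ 0) :
    ‖unitNormal β σ s‖ = 1 := by
  have : ‖deriv β s‖ ≠ 0 := norm_ne_zero_iff.2 h
  rw [unitNormal, norm_smul, norm_mul, Real.norm_eq_abs, abs_div, hσ, abs_norm]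
  simp [this]

lemma cross_unitNormal {β : ℝ → ℂ} {σ s : ℝ} (h : deriv β s ≠ 0) :
    cross (unitNormal β σ s) (deriv β s) = σ * ‖deriv β s‖ := by
  have h0 : ‖deriv β s‖ ≠ 0 := norm_ne_zero_iff.2 h
  have h1 : ‖deriv β s‖ ^ 2 = (deriv β s).re ^ 2 + (deriv β s).im ^ 2 := by
    rw [← Complex.normSq_eq_norm_sq, Complex.normSq_apply]; ring
  have h2 : cross (unitNormal β σ s) (deriv β s) =
      σ / ‖deriv β s‖ * ((deriv β s).re ^ 2 + (deriv β s).im ^ 2) := by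
    simp [unitNormal, cross]; ring
  rw [h2, ← h1]
  field_simp

namespace StarPair

variable {o h al ar : ℝ} {βl βr : ℝ → ℂ}

lemma deriv_right_ne (H : StarPair o h βl βr al ar) {s : ℝ} (hs : s ∈ Icc (-ar) ar) :
    deriv βr s ≠ 0 := fun e => by
  have := H.right.cross_pos s hs
  simp [e, cross] at this

lemma deriv_left_ne (H : StarPair o h βl βr al ar) {s : ℝ} (hs : s ∈ Icc (-al) al) :
    deriv βl s ≠ 0 := fun e => by
  have := H.left_cross_neg hs
  simp [e, cross] at this

/-- The normals of the two arcs need not agree at the corners `±ih`. They are prescribed only on the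
shortened arcs, which form a closed embedded set, and extended by Tietze's theorem with values in
the unit disc. -/
lemma exists_normal_field (H : StarPair o h βl βr al ar) {ε : ℝ} (hε : 0 < ε) :
    ∃ G : ℂ → ℂ, Continuous G ∧ (∀ z, ‖G z‖ ≤ 1) ∧
      (∀ s ∈ Icc (-ar + ε) (ar - ε), G (βr s) = unitNormal βr 1 s) ∧
      ∀ s ∈ Icc (-al + ε) (al - ε), G (βl s) = unitNormal βl (-1) s := by
  have subr : Icc (-ar + ε) (ar - ε) ⊆ Ioo (-ar) ar := fun s hs =>
    ⟨by linarith [hs.1], by linarith [hs.2]⟩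
  have subl : Icc (-al + ε) (al - ε) ⊆ Ioo (-al) al := fun s hs =>
    ⟨by linarith [hs.1], by linarith [hs.2]⟩
  let e : Icc (-ar + ε) (ar - ε) ⊕ Icc (-al + ε) (al - ε) → ℂ :=
    Sum.elim (fun s => βr s) (fun s => βl s)
  have ce : Continuous e := Continuous.sumElim
    (H.right.contDiff.continuous.comp continuous_subtype_val)
    (H.left_contDiff.continuous.comp continuous_subtype_val)
  have mixed {s s' : ℝ} (hs : s ∈ Ioo (-al) al) (hs' : s' ∈ Ioo (-ar) ar) : βl s ≠ βr s' := by
    intro heq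
    have := H.mixed_eq (Ioo_subset_Icc_self hs) (Ioo_subset_Icc_self hs') one_pos one_pos
      (by rw [heq])
    rcases this.2.1 with h1 | h1
    · exact hs.2.ne h1
    · exact hs.1.ne h1.symm
  have inj : Function.Injective e := by
    rintro (⟨s, hs⟩ | ⟨s, hs⟩) (⟨s', hs'⟩ | ⟨s', hs'⟩) heq
    · have heq' : βr s = βr s' := heq
      have := (H.right.eq_of_smul_eq (Ioo_subset_Icc_self (subr hs)) (Ioo_subset_Icc_self (subr hs'))
        one_pos one_pos (by rw [heq'])).1
      subst this; rfl
    · exact absurd (Eq.symm heq) (mixed (subl hs') (subr hs))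
    · exact absurd heq (mixed (subl hs) (subr hs'))
    · have heq' : βl s = βl s' := heq
      have := (H.left_eq_of_smul_eq (Ioo_subset_Icc_self (subl hs)) (Ioo_subset_Icc_self (subl hs'))
        one_pos one_pos (by rw [heq'])).1
      subst this; rfl
  have hcl : IsClosedEmbedding e := ce.isClosedEmbedding inj
  have cN (β : ℝ → ℂ) (hβ : ContDiff ℝ 1 β) (σ x y : ℝ) (hne : ∀ s ∈ Icc x y, deriv β s ≠ 0) :
      Continuous fun s : Icc x y => unitNormal β σ s := by
    have c := contDiff_deriv hβ
    unfold unitNormal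
    have c1 : Continuous fun s : Icc x y => deriv β s := c.comp continuous_subtype_val
    refine Continuous.smul (continuous_const.div c1.norm fun s => ?_) (by fun_prop)
    exact norm_ne_zero_iff.2 (hne s s.2)
  have ner : ∀ s ∈ Icc (-ar + ε) (ar - ε), deriv βr s ≠ 0 := fun s hs =>
    H.deriv_right_ne (Ioo_subset_Icc_self (subr hs))
  have nel : ∀ s ∈ Icc (-al + ε) (al - ε), deriv βl s ≠ 0 := fun s hs =>
    H.deriv_left_ne (Ioo_subset_Icc_self (subl hs))
  have memr (s : Icc (-ar + ε) (ar - ε)) : unitNormal βr 1 s ∈ Metric.closedBall (0 : ℂ) 1 := by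
    rw [mem_closedBall_zero_iff, norm_unitNormal (by simp) (ner s s.2)]
  have meml (s : Icc (-al + ε) (al - ε)) : unitNormal βl (-1) s ∈ Metric.closedBall (0 : ℂ) 1 := by
    rw [mem_closedBall_zero_iff, norm_unitNormal (by simp) (nel s s.2)]
  let f : C(Icc (-ar + ε) (ar - ε) ⊕ Icc (-al + ε) (al - ε), Metric.closedBall (0 : ℂ) 1) :=
    ⟨Sum.elim (fun s => ⟨_, memr s⟩) (fun s => ⟨_, meml s⟩),
      Continuous.sumElim ((cN _ H.right.contDiff _ _ _ ner).subtype_mk memr)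
        ((cN _ H.left_contDiff _ _ _ nel).subtype_mk meml)⟩
  have : TietzeExtension (Metric.closedBall (0 : ℂ) 1) := Metric.instTietzeExtensionClosedBall ℂ 0 one_pos
  obtain ⟨g, hg⟩ := f.exists_extension' hcl
  refine ⟨fun z => g z, continuous_subtype_val.comp g.continuous,
    fun z => mem_closedBall_zero_iff.1 (g z).2, fun s hs => ?_, fun s hs => ?_⟩
  · exact congrArg Subtype.val (congrFun hg (Sum.inl ⟨s, hs⟩))
  · exact congrArg Subtype.val (congrFun hg (Sum.inr ⟨s, hs⟩))

/-- A smooth approximation of the normal field captures the length up to an error proportional to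
`x`, the common bound for the shortening and for the approximation error; then `x` tends to 0. -/
theorem le_perimC (H : StarPair o h βl βr al ar) :
    ENNReal.ofReal (arcLength βl al + arcLength βr ar) ≤
      perimC (starRegion o (curvePair βl βr al ar)) := by
  have hal := H.left.pos
  have har := H.right.pos
  obtain ⟨Cl, hCl⟩ := isCompact_Icc.exists_bound_of_continuousOn
    (contDiff_deriv H.left_contDiff).continuousOn (s := Icc (-al) al)
  obtain ⟨Cr, hCr⟩ := isCompact_Icc.exists_bound_of_continuousOn
    (contDiff_deriv H.right.contDiff).continuousOn (s := Icc (-ar) ar)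
  obtain ⟨R, hR⟩ := H.isCompact_curvePair.isBounded.exists_norm_le
  set L := arcLength βl al + arcLength βr ar with hL
  have key (x : ℝ) (hx : 0 < x) : ENNReal.ofReal (L - (2 * al * Cl + 4 * Cl + 2 * ar * Cr + 4 * Cr) * x)
      ≤ perimC (starRegion o (curvePair βl βr al ar)) := by
    set ε := min x (min al ar) with hε
    have hε0 : 0 < ε := by positivity
    have hεx : ε ≤ x := min_le_left _ _
    have hεl : ε ≤ al := (min_le_right _ _).trans (min_le_left _ _)
    have hεr : ε ≤ ar := (min_le_right _ _).trans (min_le_right _ _)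
    obtain ⟨G, cG, G1, Gr, Gl⟩ := H.exists_normal_field hε0
    obtain ⟨T, cT, sT, T1, TG⟩ := exists_contDiff_approx cG G1 hx R
    refine le_trans ?_ (le_iSup_of_le T (le_iSup_of_le cT (le_iSup_of_le sT (le_iSup_of_le T1 le_rfl))))
    apply ENNReal.ofReal_le_ofReal
    rw [H.hasBoundary T cT]
    have fr := arcLength_le_flux H.right.contDiff cT.continuous T1 hε0.le hεr (σ := 1) (by simp) hCr
      hx.le (N := unitNormal βr 1)
      (fun s hs => cross_unitNormal (H.deriv_right_ne ⟨by linarith [hs.1], by linarith [hs.2]⟩))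
      (fun s hs => by
        rw [← Gr s hs]
        exact TG _ (hR _ (Or.inr ⟨s, ⟨by linarith [hs.1], by linarith [hs.2]⟩, rfl⟩)))
    have fl := arcLength_le_flux H.left_contDiff cT.continuous T1 hε0.le hεl (σ := -1) (by simp) hCl
      hx.le (N := unitNormal βl (-1))
      (fun s hs => cross_unitNormal (H.deriv_left_ne ⟨by linarith [hs.1], by linarith [hs.2]⟩))
      (fun s hs => by
        rw [← Gl s hs]
        exact TG _ (hR _ (Or.inl ⟨s, ⟨by linarith [hs.1], by linarith [hs.2]⟩, rfl⟩)))
    have hCl0 : 0 ≤ Cl := (norm_nonneg _).trans (hCl 0 ⟨by linarith, by linarith⟩)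
    have hCr0 : 0 ≤ Cr := (norm_nonneg _).trans (hCr 0 ⟨by linarith, by linarith⟩)
    have := mul_le_mul_of_nonneg_right hεx hCl0
    have := mul_le_mul_of_nonneg_right hεx hCr0
    nlinarith
  set K := 2 * al * Cl + 4 * Cl + 2 * ar * Cr + 4 * Cr with hK
  have ht : Tendsto (fun x : ℝ => ENNReal.ofReal (L - K * x)) (𝓝[>] 0) (𝓝 (ENNReal.ofReal L)) := by
    have : Continuous fun x : ℝ => ENNReal.ofReal (L - K * x) :=
      ENNReal.continuous_ofReal.comp (by fun_prop)
    have h2 := this.tendsto 0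
    simp only [mul_zero, sub_zero] at h2
    exact h2.mono_left nhdsWithin_le_nhds
  exact le_of_tendsto ht (eventually_mem_nhdsWithin.mono fun x hx => key x hx)

theorem perimC_eq (H : StarPair o h βl βr al ar) :
    perimC (starRegion o (curvePair βl βr al ar)) =
      ENNReal.ofReal (arcLength βl al + arcLength βr ar) :=
  le_antisymm (perimC_le H.hasBoundary H.left_contDiff H.right.contDiff H.left.pos.le H.right.pos.le)
    H.le_perimC

end StarPair

lemma integral_divC_eq_zero {T : ℂ → ℂ} (hT : ContDiff ℝ 1 T) (hc : HasCompactSupport T) :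
    ∫ z, divC T z = 0 := by
  have cD := hT.continuous_fderiv one_ne_zero
  have key (v : ℂ) : ∫ z, fderiv ℝ T z v = 0 := by
    have hi : Integrable fun z => fderiv ℝ T z v :=
      (by fun_prop : Continuous fun z => fderiv ℝ T z v).integrable_of_hasCompactSupport
        ((hc.fderiv (𝕜 := ℝ)).comp_left (g := fun L : ℂ →L[ℝ] ℂ => L v) rfl)
    have := integral_smul_fderiv_eq_neg_fderiv_smul_of_integrable (𝕜 := ℝ) (μ := (volume : Measure ℂ))
      (f := fun _ : ℂ => (1 : ℝ)) (g := T) (v := v) (by simp) (by simpa using hi)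
      (by simpa using hT.continuous.integrable_of_hasCompactSupport hc)
      (fun x _ => differentiableAt_const _) (fun x _ => hT.differentiable one_ne_zero x)
    simpa using this
  have hi (v : ℂ) : Integrable fun z => fderiv ℝ T z v :=
      (by fun_prop : Continuous fun z => fderiv ℝ T z v).integrable_of_hasCompactSupport
        ((hc.fderiv (𝕜 := ℝ)).comp_left (g := fun L : ℂ →L[ℝ] ℂ => L v) rfl)
  have hre := integral_re (hi 1)
  have him := integral_im (hi Complex.I)
  simp only [key, map_zero] at hre him
  have h := integral_add (hi 1).re (hi Complex.I).im
  rw [hre, him, add_zero] at h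
  exact h

/-- The divergence of a compactly supported field has integral zero, so testing the complement with
`T` is testing `A` with `-T`. -/
lemma perimC_compl_le {A : Set ℂ} (hA : NullMeasurableSet A) : perimC Aᶜ ≤ perimC A := by
  refine iSup_le fun T => iSup_le fun hT => iSup_le fun hc => iSup_le fun h1 => ?_
  have hdiv : divC (-T) = fun z => - divC T z := by
    ext z
    rw [divC, divC, fderiv_neg]
    simp; ring
  have hi : Integrable (divC T) := (continuous_divC hT).integrable_of_hasCompactSupport
    ((hc.fderiv (𝕜 := ℝ)).comp_left (g := fun L : ℂ →L[ℝ] ℂ => (L 1).re + (L Complex.I).im)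
      (by simp))
  have e : ∫ z in Aᶜ, divC T z = ∫ z in A, divC (-T) z := by
    have := integral_add_compl₀ hA hi
    rw [integral_divC_eq_zero hT hc] at this
    rw [hdiv, integral_neg]
    linarith
  rw [e]
  exact le_iSup_of_le (-T) (le_iSup_of_le hT.neg (le_iSup_of_le hc.neg
    (le_iSup_of_le (fun x => by simpa using h1 x) le_rfl)))

lemma perimC_compl {A : Set ℂ} (hA : NullMeasurableSet A) : perimC Aᶜ = perimC A :=
  le_antisymm (perimC_compl_le hA) (by simpa using perimC_compl_le hA.compl)

/-! ### Similarities between `ℂ` and the plane, and the total perimeter. -/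

/-- The similarity `z ↦ v + r O z` from the complex plane to the Euclidean plane. -/
def similarity (O : ℂ ≃ₗᵢ[ℝ] Plane) (v : Plane) (r : ℝ) (hr : r ≠ 0) : ℂ ≃ₜ Plane :=
  ((Homeomorph.smulOfNeZero r hr).trans O.toHomeomorph).trans (Homeomorph.addLeft v)

section Similarity

variable {O : ℂ ≃ₗᵢ[ℝ] Plane} {v : Plane} {r : ℝ}

lemma similarity_apply (hr : r ≠ 0) (z : ℂ) : similarity O v r hr z = v + O (r • z) := rfl

lemma map_similarity (hr : 0 < r) :
    Measure.map (similarity O v r hr.ne') volume = ENNReal.ofReal (r ^ 2)⁻¹ • volume := by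
  have e : (similarity O v r hr.ne' : ℂ → Plane) = (fun x => v + x) ∘ (O ∘ fun z => r • z) := rfl
  rw [e, ← Measure.map_map (by fun_prop) (by fun_prop), ← Measure.map_map (by fun_prop) (by fun_prop),
    Measure.map_addHaar_smul volume hr.ne', Complex.finrank_real_complex, Measure.map_smul,
    Measure.map_smul, O.measurePreserving.map_eq, Measure.IsAddLeftInvariant.map_add_left_eq_self,
    abs_of_pos (by positivity)]

lemma volume_preimage_similarity (hr : 0 < r) (E : Set Plane) :
    volume E = ENNReal.ofReal (r ^ 2) * volume (similarity O v r hr.ne' ⁻¹' E) := by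
  have h := map_similarity (O := O) (v := v) hr
  have h2 : Measure.map (similarity O v r hr.ne').toMeasurableEquiv volume E =
    volume ((similarity O v r hr.ne').toMeasurableEquiv ⁻¹' E) := MeasurableEquiv.map_apply _ _
  rw [Homeomorph.toMeasurableEquiv_coe, h] at h2
  rw [← h2, Measure.smul_apply, smul_eq_mul, ← mul_assoc, ← ENNReal.ofReal_mul (by positivity),
    mul_inv_cancel₀ (by positivity), ENNReal.ofReal_one, one_mul]

lemma setIntegral_preimage_similarity (hr : 0 < r) (E : Set Plane) (f : Plane → ℝ) :
    ∫ x in E, f x = r ^ 2 * ∫ z in similarity O v r hr.ne' ⁻¹' E, f (similarity O v r hr.ne' z) := by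
  have h := setIntegral_map_equiv (μ := volume) (similarity O v r hr.ne').toMeasurableEquiv f E
  rw [Homeomorph.toMeasurableEquiv_coe, map_similarity hr, Measure.restrict_smul,
    integral_smul_measure, ENNReal.toReal_ofReal (by positivity), smul_eq_mul] at h
  rw [← h, ← mul_assoc, mul_inv_cancel₀ (by positivity), one_mul]

lemma divergence_eq_trace (T : Plane → Plane) (x : Plane) :
    divergence T x = LinearMap.trace ℝ Plane (fderiv ℝ T x : Plane →ₗ[ℝ] Plane) := by
  rw [LinearMap.trace_eq_sum_inner _ (EuclideanSpace.basisFun (Fin 2) ℝ)]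
  simp [divergence, EuclideanSpace.inner_single_left]

lemma divC_eq_trace (T : ℂ → ℂ) (z : ℂ) :
    divC T z = LinearMap.trace ℝ ℂ (fderiv ℝ T z : ℂ →ₗ[ℝ] ℂ) := by
  rw [LinearMap.trace_eq_matrix_trace ℝ Complex.basisOneI, Matrix.trace_fin_two]
  simp [divC, LinearMap.toMatrix_apply, Complex.basisOneI]

/-- The trace is invariant under conjugation by the isometry `O`, so only the scaling factor
survives. -/
lemma divC_comp_similarity (hr : r ≠ 0) {T : Plane → Plane} (hT : ContDiff ℝ 1 T) (z : ℂ) :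
    divC (fun z => O.symm (T (similarity O v r hr z))) z =
      r * divergence T (similarity O v r hr z) := by
  have hσ : HasFDerivAt (similarity O v r hr) (r • (O.toContinuousLinearEquiv : ℂ →L[ℝ] Plane)) z := by
    have : (similarity O v r hr : ℂ → Plane) =
        fun z => v + (r • (O.toContinuousLinearEquiv : ℂ →L[ℝ] Plane)) z := by
      ext1 z
      change v + O (r • z) = v + r • O z
      rw [map_smul]
    rw [this]
    exact (ContinuousLinearMap.hasFDerivAt _).const_add v
  have hd := ((O.symm.toContinuousLinearEquiv : Plane →L[ℝ] ℂ).hasFDerivAt.comp z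
    ((hT.differentiable one_ne_zero _).hasFDerivAt.comp z hσ)).fderiv
  rw [divC_eq_trace, divergence_eq_trace]
  have e : (fun z => O.symm (T (similarity O v r hr z))) =
    (O.symm.toContinuousLinearEquiv : Plane →L[ℝ] ℂ) ∘ (T ∘ similarity O v r hr) := rfl
  rw [e, hd]
  have := LinearMap.trace_conj' (R := ℝ) (fderiv ℝ T (similarity O v r hr z) : Plane →ₗ[ℝ] Plane)
    O.symm.toLinearEquiv
  rw [← this, ← smul_eq_mul, ← map_smul]
  congr 1
  ext x
  simp [LinearEquiv.conj_apply]

lemma contDiff_similarity (hr : r ≠ 0) : ContDiff ℝ 1 (similarity O v r hr) := by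
  change ContDiff ℝ 1 fun z => v + O (r • z)
  have : ContDiff ℝ 1 O := O.contDiff
  fun_prop

lemma contDiff_similarity_symm (hr : r ≠ 0) : ContDiff ℝ 1 (similarity O v r hr).symm := by
  change ContDiff ℝ 1 fun x => r⁻¹ • O.symm (-v + x)
  have : ContDiff ℝ 1 O.symm := O.symm.contDiff
  fun_prop

/-- Areas scale by `r²` and the divergence of the pulled-back field by `r`, which leaves one factor
`r`. -/
theorem perimeter_eq_perimC (hr : 0 < r) (E : Set Plane) :
    perimeter E = ENNReal.ofReal r * perimC (similarity O v r hr.ne' ⁻¹' E) := by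
  have key (T : Plane → Plane) (hT : ContDiff ℝ 1 T) : ENNReal.ofReal (∫ x in E, divergence T x) =
      ENNReal.ofReal r * ENNReal.ofReal (∫ z in similarity O v r hr.ne' ⁻¹' E,
        divC (fun z => O.symm (T (similarity O v r hr.ne' z))) z) := by
    rw [← ENNReal.ofReal_mul hr.le, setIntegral_preimage_similarity (O := O) (v := v) hr]
    simp_rw [divC_comp_similarity hr.ne' hT, integral_const_mul]
    congr 1
    ring
  apply le_antisymm
  · refine iSup_le fun T => iSup_le fun hT => iSup_le fun hc => iSup_le fun h1 => ?_
    rw [key T hT]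
    gcongr
    refine le_iSup_of_le _ (le_iSup_of_le ?_ (le_iSup_of_le ?_ (le_iSup_of_le ?_ le_rfl)))
    · exact O.symm.contDiff.comp (hT.comp (contDiff_similarity hr.ne'))
    · exact (hc.comp_homeomorph (similarity O v r hr.ne')).comp_left (map_zero O.symm)
    · intro x
      rw [O.symm.norm_map]
      exact h1 _
  · simp only [perimC, ENNReal.mul_iSup]
    refine iSup_le fun T => iSup_le fun hT => iSup_le fun hc => iSup_le fun h1 => ?_
    let T' : Plane → Plane := fun x => O (T ((similarity O v r hr.ne').symm x))
    have hT' : ContDiff ℝ 1 T' := O.contDiff.comp (hT.comp (contDiff_similarity_symm hr.ne'))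
    have := key T' hT'
    simp only [T', O.symm_apply_apply, Homeomorph.symm_apply_apply] at this
    rw [← this]
    refine le_iSup_of_le _ (le_iSup_of_le hT' (le_iSup_of_le ?_ (le_iSup_of_le ?_ le_rfl)))
    · exact (hc.comp_homeomorph (similarity O v r hr.ne').symm).comp_left (map_zero O)
    · intro x
      change ‖O _‖ ≤ 1
      rw [O.norm_map]
      exact h1 _

end Similarity

lemma perimC_union_compl {A B : Set ℂ} {Ω₁ Ω₂ Ω : Set ℂ} (hA : A =ᵐ[volume] Ω₁)
    (hB : B =ᵐ[volume] Ω₂) (h : Ω =ᵐ[volume] (Ω₁ ∪ Ω₂ : Set ℂ)) (hΩ : NullMeasurableSet Ω) :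
    perimC (A ∪ B)ᶜ = perimC Ω := by
  rw [perimC_congr (((ae_eq_set_union hA hB).trans h.symm).compl), perimC_compl hΩ]

/-- Each arc bounds exactly two of the three chambers, the exterior having the perimeter of the
outer region; halving the sum counts every arc once, whichever region belongs to which chamber. -/
theorem StarTrio.sum_perimC {o₁ o₂ h a₁ a₀ a₂ : ℝ} {γ₁ γ₀ γ₂ : ℝ → ℂ}
    (H : StarTrio o₁ o₂ h γ₁ γ₀ γ₂ a₁ a₀ a₂) {A B : Set ℂ}
    (hAB : (A =ᵐ[volume] starRegion o₁ (curvePair γ₁ γ₀ a₁ a₀) ∧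
        B =ᵐ[volume] starRegion o₂ (curvePair γ₀ γ₂ a₀ a₂)) ∨
      (A =ᵐ[volume] starRegion o₂ (curvePair γ₀ γ₂ a₀ a₂) ∧
        B =ᵐ[volume] starRegion o₁ (curvePair γ₁ γ₀ a₁ a₀))) :
    (perimC (A ∪ B)ᶜ + perimC A + perimC B) / 2 =
      ENNReal.ofReal (arcLength γ₁ a₁ + arcLength γ₀ a₀ + arcLength γ₂ a₂) := by
  have n₁ := arcLength_nonneg (β := γ₁) H.left.left.pos.le
  have n₀ := arcLength_nonneg (β := γ₀) H.left.right.pos.le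
  have n₂ := arcLength_nonneg (β := γ₂) H.right.right.pos.le
  have hΩ : starRegion 0 (curvePair γ₁ γ₂ a₁ a₂) =ᵐ[volume]
      (starRegion o₁ (curvePair γ₁ γ₀ a₁ a₀) ∪ starRegion o₂ (curvePair γ₀ γ₂ a₀ a₂) : Set ℂ) := by
    filter_upwards [H.ae_mem_iff] with z hz
    exact propext hz.1
  have total : ENNReal.ofReal (arcLength γ₁ a₁ + arcLength γ₂ a₂) +
      ENNReal.ofReal (arcLength γ₁ a₁ + arcLength γ₀ a₀) +
      ENNReal.ofReal (arcLength γ₀ a₀ + arcLength γ₂ a₂) =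
      ENNReal.ofReal (arcLength γ₁ a₁ + arcLength γ₀ a₀ + arcLength γ₂ a₂) * 2 := by
    rw [← ENNReal.ofReal_add (by positivity) (by positivity),
      ← ENNReal.ofReal_add (by positivity) (by positivity), ← ENNReal.ofReal_ofNat 2,
      ← ENNReal.ofReal_mul (by positivity)]
    congr 1
    ring
  rcases hAB with ⟨hA, hB⟩ | ⟨hA, hB⟩
  · rw [perimC_union_compl hA hB hΩ H.outer.measurableSet_starRegion.nullMeasurableSet,
      perimC_congr hA, perimC_congr hB, H.outer.perimC_eq, H.left.perimC_eq, H.right.perimC_eq,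
      total, ENNReal.mul_div_cancel_right two_ne_zero ENNReal.ofNat_ne_top]
  · rw [union_comm A B, perimC_union_compl hB hA hΩ
      H.outer.measurableSet_starRegion.nullMeasurableSet, perimC_congr hA, perimC_congr hB,
      H.outer.perimC_eq, H.left.perimC_eq, H.right.perimC_eq, add_right_comm,
      total, ENNReal.mul_div_cancel_right two_ne_zero ENNReal.ofNat_ne_top]

/-! ### Stability of star-shaped configurations -/

/-- The curves `β` and `γ` are `C¹`-close on `[-a, a]`. -/
def IsC1Close (β γ : ℝ → ℂ) (a δ : ℝ) : Prop :=
  ∀ s ∈ Icc (-a) a, ‖β s - γ s‖ ≤ δ ∧ ‖deriv β s - deriv γ s‖ ≤ δ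

lemma IsC1Close.mono {β γ : ℝ → ℂ} {a δ δ' : ℝ} (H : IsC1Close β γ a δ) (h : δ ≤ δ') :
    IsC1Close β γ a δ' := fun s hs => ⟨(H s hs).1.trans h, (H s hs).2.trans h⟩

lemma IsC1Close.refl_comp {β γ : ℝ → ℂ} {a δ : ℝ} (H : IsC1Close β γ a δ) (hβ : ContDiff ℝ 1 β)
    (hγ : ContDiff ℝ 1 γ) : IsC1Close (fun s => refl (β s)) (fun s => refl (γ s)) a δ := by
  intro s hs
  rw [deriv_refl hβ, deriv_refl hγ, ← refl_sub, ← refl_sub, norm_refl, norm_refl]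
  exact H s hs

/-- Positions and velocities along the arc form a compact subset of the open set of admissible
pairs, and a thickening of that subset is still admissible. -/
lemma IsStarArc.exists_stable {o : ℂ} {γ : ℝ → ℂ} {a : ℝ} (H : IsStarArc o γ a) :
    ∃ δ > 0, ∀ β : ℝ → ℂ, ContDiff ℝ 1 β → IsC1Close β γ a δ → IsStarArc o β a := by
  have c := contDiff_deriv H.contDiff
  have c' := H.contDiff.continuous
  let K : Set (ℂ × ℂ) := (fun s => (γ s - o, deriv γ s)) '' Icc (-a) a
  let U : Set (ℂ × ℂ) := {p | p.1 ∈ Complex.slitPlane ∧ 0 < cross p.1 p.2}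
  have hK : IsCompact K := isCompact_Icc.image ((c'.sub continuous_const).prodMk c)
  have hU : IsOpen U := (Complex.isOpen_slitPlane.preimage continuous_fst).inter
    (isOpen_lt continuous_const (continuous_cross continuous_fst continuous_snd))
  obtain ⟨δ, hδ, hsub⟩ := hK.exists_thickening_subset_open hU (by
    rintro _ ⟨s, hs, rfl⟩
    exact ⟨H.slit s hs, H.cross_pos s hs⟩)
  refine ⟨δ / 2, by positivity, fun β hβ hc => ?_⟩
  have mem (s : ℝ) (hs : s ∈ Icc (-a) a) : (β s - o, deriv β s) ∈ U := by
    apply hsub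
    rw [Metric.mem_thickening_iff]
    refine ⟨_, ⟨s, hs, rfl⟩, ?_⟩
    rw [Prod.dist_eq, max_lt_iff, dist_eq_norm, dist_eq_norm, sub_sub_sub_cancel_right]
    exact ⟨by linarith [(hc s hs).1], by linarith [(hc s hs).2]⟩
  exact ⟨hβ, H.pos, fun s hs => (mem s hs).1, fun s hs => (mem s hs).2⟩

lemma StarPair.exists_stable {o h al ar : ℝ} {γl γr : ℝ → ℂ} (H : StarPair o h γl γr al ar) :
    ∃ δ > 0, ∀ βl βr : ℝ → ℂ, ContDiff ℝ 1 βl → ContDiff ℝ 1 βr → IsC1Close βl γl al δ →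
      IsC1Close βr γr ar δ → βl al = h * Complex.I → βl (-al) = -(h * Complex.I) →
      βr ar = h * Complex.I → βr (-ar) = -(h * Complex.I) → StarPair o h βl βr al ar := by
  obtain ⟨δ₁, h₁, H₁⟩ := H.right.exists_stable
  obtain ⟨δ₂, h₂, H₂⟩ := H.left.exists_stable
  refine ⟨min δ₁ δ₂, lt_min h₁ h₂, fun βl βr cl cr hl hr lt lb rt rb => ?_⟩
  exact ⟨H.pos, H₁ _ cr (hr.mono (min_le_left _ _)),
    H₂ _ (contDiff_refl cl) ((hl.mono (min_le_right _ _)).refl_comp cl H.left_contDiff),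
    rt, rb, lt, lb⟩

lemma StarTrio.exists_stable {o₁ o₂ h a₁ a₀ a₂ : ℝ} {γ₁ γ₀ γ₂ : ℝ → ℂ}
    (H : StarTrio o₁ o₂ h γ₁ γ₀ γ₂ a₁ a₀ a₂) :
    ∃ δ > 0, ∀ β₁ β₀ β₂ : ℝ → ℂ, ContDiff ℝ 1 β₁ → ContDiff ℝ 1 β₀ → ContDiff ℝ 1 β₂ →
      IsC1Close β₁ γ₁ a₁ δ → IsC1Close β₀ γ₀ a₀ δ → IsC1Close β₂ γ₂ a₂ δ →
      β₁ a₁ = h * Complex.I → β₁ (-a₁) = -(h * Complex.I) →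
      β₀ a₀ = h * Complex.I → β₀ (-a₀) = -(h * Complex.I) →
      β₂ a₂ = h * Complex.I → β₂ (-a₂) = -(h * Complex.I) →
      StarTrio o₁ o₂ h β₁ β₀ β₂ a₁ a₀ a₂ := by
  obtain ⟨δ₁, h₁, H₁⟩ := H.left.exists_stable
  obtain ⟨δ₂, h₂, H₂⟩ := H.right.exists_stable
  obtain ⟨δ₃, h₃, H₃⟩ := H.outer.exists_stable
  refine ⟨min δ₁ (min δ₂ δ₃), by positivity,
    fun β₁ β₀ β₂ d₁ d₀ d₂ c₁ c₀ c₂ t₁ b₁ t₀ b₀ t₂ b₂ => ?_⟩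
  have l₁ : min δ₁ (min δ₂ δ₃) ≤ δ₁ := min_le_left _ _
  have l₂ : min δ₁ (min δ₂ δ₃) ≤ δ₂ := (min_le_right _ _).trans (min_le_left _ _)
  have l₃ : min δ₁ (min δ₂ δ₃) ≤ δ₃ := (min_le_right _ _).trans (min_le_right _ _)
  exact ⟨H₁ _ _ d₁ d₀ (c₁.mono l₁) (c₀.mono l₁) t₁ b₁ t₀ b₀,
    H₂ _ _ d₀ d₂ (c₀.mono l₂) (c₂.mono l₂) t₀ b₀ t₂ b₂,
    H₃ _ _ d₁ d₂ (c₁.mono l₃) (c₂.mono l₃) t₁ b₁ t₂ b₂⟩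

/-! ### Circular arcs -/

/-- The centre of the circle through `±ih` that bounds the outer arc of half-opening angle `θ`. -/
def arcCenter (h θ : ℝ) : ℝ := -(h * Real.cos θ / Real.sin θ)

/-- The radius of that circle. -/
def arcRadius (h θ : ℝ) : ℝ := h / Real.sin θ

/-- The arc from `-ih` to `ih` on the right with half-opening angle `θ`. -/
def outerArc (h θ s : ℝ) : ℂ := arcCenter h θ + arcRadius h θ * Complex.exp (s * Complex.I)

section OuterArc

variable {h θ : ℝ}

lemma arcRadius_pos (hh : 0 < h) (h0 : 0 < θ) (hπ : θ < Real.pi) : 0 < arcRadius h θ :=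
  div_pos hh (Real.sin_pos_of_pos_of_lt_pi h0 hπ)

@[simp] lemma outerArc_re (s : ℝ) : (outerArc h θ s).re =
    arcCenter h θ + arcRadius h θ * Real.cos s := by
  simp [outerArc, Complex.exp_ofReal_mul_I_re, Complex.exp_ofReal_mul_I_im]

@[simp] lemma outerArc_im (s : ℝ) : (outerArc h θ s).im = arcRadius h θ * Real.sin s := by
  simp [outerArc, Complex.exp_ofReal_mul_I_re, Complex.exp_ofReal_mul_I_im]

lemma contDiff_outerArc : ContDiff ℝ 1 (outerArc h θ) := by
  unfold outerArc
  have : ContDiff ℝ 1 fun s : ℝ => (s : ℂ) := Complex.ofRealCLM.contDiff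
  fun_prop

lemma hasDerivAt_outerArc (s : ℝ) : HasDerivAt (outerArc h θ)
    (arcRadius h θ * (Complex.exp (s * Complex.I) * Complex.I)) s := by
  have h1 : HasDerivAt (fun s : ℝ => (s : ℂ) * Complex.I) Complex.I s := by
    simpa using (Complex.ofRealCLM.hasDerivAt (x := s)).mul_const Complex.I
  exact (h1.cexp.const_mul _).const_add _

lemma deriv_outerArc (s : ℝ) : deriv (outerArc h θ) s =
    arcRadius h θ * (Complex.exp (s * Complex.I) * Complex.I) := (hasDerivAt_outerArc s).deriv

lemma outerArc_top (hs : Real.sin θ ≠ 0) : outerArc h θ θ = h * Complex.I := by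
  apply Complex.ext
  · simp [arcCenter, arcRadius]; field_simp; simp
  · simp [arcRadius]; field_simp

lemma outerArc_bot (hs : Real.sin θ ≠ 0) : outerArc h θ (-θ) = -(h * Complex.I) := by
  apply Complex.ext
  · simp [arcCenter, arcRadius]; field_simp; simp
  · simp [arcRadius]; field_simp

/-- The angular momentum about `o` is `R (R - (o - c) cos s)`, with `c` the centre and `R` the
radius; it is positive once `o` is inside the circle. -/
lemma isStarArc_outerArc (hh : 0 < h) (h0 : 0 < θ) (hπ : θ < Real.pi) {o : ℝ}
    (ho : |o - arcCenter h θ| < arcRadius h θ) : IsStarArc o (outerArc h θ) θ := by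
  have hR := arcRadius_pos hh h0 hπ
  have ho' := abs_lt.1 ho
  refine ⟨contDiff_outerArc, h0, fun s hs => ?_, fun s hs => ?_⟩
  · rw [Complex.mem_slitPlane_iff]
    rcases eq_or_ne s 0 with rfl | hs0
    · left
      simp; linarith
    · right
      simp only [Complex.sub_im, outerArc_im, Complex.ofReal_im, sub_zero]
      refine mul_ne_zero hR.ne' fun e => hs0 ?_
      exact (Real.sin_eq_zero_iff_of_lt_of_lt (by linarith [hs.1]) (by linarith [hs.2])).1 e
  · rw [deriv_outerArc]
    have e : cross (outerArc h θ s - o) (arcRadius h θ * (Complex.exp (s * Complex.I) * Complex.I)) =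
        arcRadius h θ * (arcRadius h θ - (o - arcCenter h θ) * Real.cos s) := by
      simp only [cross, Complex.sub_re, outerArc_re, Complex.ofReal_re, Complex.sub_im, outerArc_im,
        Complex.ofReal_im, Complex.mul_im, Complex.mul_re, Complex.exp_ofReal_mul_I_re,
        Complex.exp_ofReal_mul_I_im, Complex.I_re, Complex.I_im]
      linear_combination (arcRadius h θ) ^ 2 * Real.sin_sq_add_cos_sq s
    rw [e]
    refine mul_pos hR (sub_pos.2 (lt_of_le_of_lt (le_abs_self _) ?_))
    rw [abs_mul]
    exact (mul_le_of_le_one_right (abs_nonneg _) (Real.abs_cos_le_one s)).trans_lt ho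

/-- The points of the real axis inside the circle of the outer arc. -/
lemma abs_sub_arcCenter_lt (hh : 0 < h) (h0 : 0 < θ) (hπ : θ < Real.pi) {o : ℝ} (ho : 0 ≤ o)
    (ho' : o < h * Real.tan (θ / 2)) : |o - arcCenter h θ| < arcRadius h θ := by
  have s2 : 0 < Real.sin (θ / 2) := Real.sin_pos_of_pos_of_lt_pi (by linarith) (by linarith)
  have c2 : 0 < Real.cos (θ / 2) := Real.cos_pos_of_mem_Ioo ⟨by linarith, by linarith⟩
  have es : Real.sin θ = 2 * Real.sin (θ / 2) * Real.cos (θ / 2) := by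
    rw [← Real.sin_two_mul]; ring_nf
  have ec : Real.cos θ = 2 * Real.cos (θ / 2) ^ 2 - 1 := by
    rw [← Real.cos_two_mul]; ring_nf
  have e1 : arcCenter h θ + arcRadius h θ = h * Real.tan (θ / 2) := by
    rw [arcCenter, arcRadius, es, ec, Real.tan_eq_sin_div_cos]
    field_simp
    nlinarith [Real.sin_sq_add_cos_sq (θ / 2)]
  have e2 : arcCenter h θ - arcRadius h θ = -(h * Real.cos (θ / 2) / Real.sin (θ / 2)) := by
    rw [arcCenter, arcRadius, es, ec]
    field_simp
    ring
  have : 0 < h * Real.cos (θ / 2) / Real.sin (θ / 2) := by positivity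
  rw [abs_lt]
  constructor <;> linarith

end OuterArc

/-- The slope of the middle arc, as a graph over the vertical axis. -/
def midSlope (h θ y : ℝ) : ℝ :=
  -(Real.sin θ * max (-h) (min y h)) / √(h ^ 2 - (Real.sin θ * max (-h) (min y h)) ^ 2)

/-- The middle arc as a graph over the vertical axis, extended beyond the endpoints. -/
def midGraph (h θ y : ℝ) : ℝ := ∫ t in (-h)..y, midSlope h θ t

/-- The middle arc from `-ih` to `ih` with signed half-opening angle `θ`. -/
def midArc (h θ y : ℝ) : ℂ := midGraph h θ y + y * Complex.I

section MidArc

variable {h θ : ℝ}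

@[simp] lemma midArc_re (y : ℝ) : (midArc h θ y).re = midGraph h θ y := by simp [midArc]
@[simp] lemma midArc_im (y : ℝ) : (midArc h θ y).im = y := by simp [midArc]

/-- The vertical distance to the centre of the circle of the middle arc, up to scaling. -/
def midRoot (h θ y : ℝ) : ℝ := √(h ^ 2 - (Real.sin θ * y) ^ 2)

lemma midRoot_arg_pos (hh : 0 < h) (hc : 0 < Real.cos θ) {y : ℝ} (hy : y ∈ Icc (-h) h) :
    0 < h ^ 2 - (Real.sin θ * y) ^ 2 := by
  have h1 : y ^ 2 ≤ h ^ 2 := sq_le_sq' hy.1 hy.2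
  have h2 := Real.sin_sq_add_cos_sq θ
  have : 0 < (Real.cos θ * h) ^ 2 := by positivity
  nlinarith [sq_nonneg (Real.sin θ)]

lemma midRoot_pos (hh : 0 < h) (hc : 0 < Real.cos θ) {y : ℝ} (hy : y ∈ Icc (-h) h) :
    0 < midRoot h θ y := Real.sqrt_pos.2 (midRoot_arg_pos hh hc hy)

lemma midRoot_sq (hh : 0 < h) (hc : 0 < Real.cos θ) {y : ℝ} (hy : y ∈ Icc (-h) h) :
    midRoot h θ y ^ 2 = h ^ 2 - (Real.sin θ * y) ^ 2 := Real.sq_sqrt (midRoot_arg_pos hh hc hy).le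

lemma clamp_mem (hh : 0 < h) (y : ℝ) : max (-h) (min y h) ∈ Icc (-h) h :=
  ⟨le_max_left _ _, max_le (by linarith) (min_le_right _ _)⟩

lemma midSlope_eq {y : ℝ} (hy : y ∈ Icc (-h) h) :
    midSlope h θ y = -(Real.sin θ * y) / midRoot h θ y := by
  rw [midSlope, min_eq_left hy.2, max_eq_right hy.1, midRoot]

lemma continuous_midSlope (hh : 0 < h) (hc : 0 < Real.cos θ) : Continuous (midSlope h θ) := by
  unfold midSlope
  refine Continuous.div (by fun_prop) (by fun_prop) fun y => ?_
  exact (midRoot_pos hh hc (clamp_mem hh y)).ne'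

lemma hasDerivAt_midGraph (hh : 0 < h) (hc : 0 < Real.cos θ) (y : ℝ) :
    HasDerivAt (midGraph h θ) (midSlope h θ y) y :=
  (continuous_midSlope hh hc).integral_hasStrictDerivAt _ _ |>.hasDerivAt

lemma midGraph_of_sin_eq_zero (hs : Real.sin θ = 0) (y : ℝ) : midGraph h θ y = 0 := by
  simp [midGraph, midSlope, hs]

/-- The factor `sin θ` clears the denominator in the formula for a circle, so that the degenerate
case of the segment needs no separate statement. -/
lemma sin_mul_midGraph (hh : 0 < h) (hc : 0 < Real.cos θ) {y : ℝ} (hy : y ∈ Icc (-h) h) :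
    Real.sin θ * midGraph h θ y = midRoot h θ y - h * Real.cos θ := by
  have hd (t : ℝ) (ht : t ∈ Icc (-h) h) :
      HasDerivAt (midRoot h θ) (Real.sin θ * midSlope h θ t) t := by
    have h1 : HasDerivAt (fun t => h ^ 2 - (Real.sin θ * t) ^ 2)
        (-(2 * (Real.sin θ * t) * Real.sin θ)) t := by
      have := (((hasDerivAt_id t).const_mul (Real.sin θ)).pow 2).const_sub (h ^ 2)
      simpa using this
    refine (h1.sqrt (midRoot_arg_pos hh hc ht).ne').congr_deriv ?_
    rw [midSlope_eq ht, ← midRoot]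
    have := midRoot_pos hh hc ht
    field_simp
  have hsub : uIcc (-h) y ⊆ Icc (-h) h := by
    rw [uIcc_of_le hy.1]; exact Icc_subset_Icc le_rfl hy.2
  have h2 := intervalIntegral.integral_eq_sub_of_hasDerivAt (a := -h) (b := y)
    (fun t ht => hd t (hsub ht))
    ((continuous_const.mul (continuous_midSlope hh hc)).intervalIntegrable _ _)
  rw [intervalIntegral.integral_const_mul] at h2
  rw [midGraph, h2]
  congr 1
  have : h ^ 2 - (Real.sin θ * -h) ^ 2 = (h * Real.cos θ) ^ 2 := by
    nlinarith [Real.sin_sq_add_cos_sq θ]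
  rw [midRoot, this, Real.sqrt_sq (by positivity)]

lemma midRoot_end (hh : 0 < h) (hc : 0 < Real.cos θ) : midRoot h θ h = h * Real.cos θ := by
  have : h ^ 2 - (Real.sin θ * h) ^ 2 = (h * Real.cos θ) ^ 2 := by
    nlinarith [Real.sin_sq_add_cos_sq θ]
  rw [midRoot, this, Real.sqrt_sq (by positivity)]

lemma midGraph_top (hh : 0 < h) (hc : 0 < Real.cos θ) : midGraph h θ h = 0 := by
  by_cases hs : Real.sin θ = 0
  · exact midGraph_of_sin_eq_zero hs h
  · have := sin_mul_midGraph hh hc (y := h) ⟨by linarith, le_rfl⟩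
    rw [midRoot_end hh hc, sub_self] at this
    exact (mul_eq_zero.1 this).resolve_left hs

lemma midGraph_bot : midGraph h θ (-h) = 0 := by simp [midGraph]

lemma midArc_top (hh : 0 < h) (hc : 0 < Real.cos θ) : midArc h θ h = h * Complex.I := by
  simp [midArc, midGraph_top hh hc]

lemma midArc_bot : midArc h θ (-h) = -(h * Complex.I) := by
  simp [midArc, midGraph_bot]

lemma midGraph_neg (y : ℝ) : midGraph h (-θ) y = - midGraph h θ y := by
  rw [midGraph, midGraph, ← intervalIntegral.integral_neg]
  congr 1
  ext t
  simp [midSlope, neg_div]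

lemma refl_midArc (y : ℝ) : refl (midArc h θ y) = midArc h (-θ) y := by
  apply Complex.ext <;> simp [midGraph_neg]

lemma contDiff_midGraph (hh : 0 < h) (hc : 0 < Real.cos θ) : ContDiff ℝ 1 (midGraph h θ) := by
  rw [contDiff_one_iff_deriv]
  refine ⟨fun y => (hasDerivAt_midGraph hh hc y).differentiableAt, ?_⟩
  have : deriv (midGraph h θ) = midSlope h θ := funext fun y => (hasDerivAt_midGraph hh hc y).deriv
  rw [this]
  exact continuous_midSlope hh hc

lemma contDiff_midArc (hh : 0 < h) (hc : 0 < Real.cos θ) : ContDiff ℝ 1 (midArc h θ) := by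
  have := contDiff_midGraph hh hc
  have h2 : ContDiff ℝ 1 fun s : ℝ => (s : ℂ) := Complex.ofRealCLM.contDiff
  exact (h2.comp this).add (h2.mul contDiff_const)

lemma hasDerivAt_midArc (hh : 0 < h) (hc : 0 < Real.cos θ) (y : ℝ) :
    HasDerivAt (midArc h θ) (midSlope h θ y + Complex.I) y := by
  have h1 : HasDerivAt (fun s : ℝ => (s : ℂ) * Complex.I) Complex.I y := by
    simpa using (Complex.ofRealCLM.hasDerivAt (x := y)).mul_const Complex.I
  exact (hasDerivAt_midGraph hh hc y).ofReal_comp.add h1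

lemma deriv_midArc (hh : 0 < h) (hc : 0 < Real.cos θ) (y : ℝ) :
    deriv (midArc h θ) y = midSlope h θ y + Complex.I := (hasDerivAt_midArc hh hc y).deriv

lemma mul_cos_le_midRoot {y : ℝ} (hy : y ∈ Icc (-h) h) :
    h * Real.cos θ ≤ midRoot h θ y := by
  apply Real.le_sqrt_of_sq_le
  have h1 : y ^ 2 ≤ h ^ 2 := sq_le_sq' hy.1 hy.2
  nlinarith [Real.sin_sq_add_cos_sq θ, sq_nonneg (Real.sin θ)]

lemma midRoot_le (hh : 0 < h) (y : ℝ) : midRoot h θ y ≤ h := by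
  rw [midRoot, Real.sqrt_le_left hh.le]
  nlinarith [sq_nonneg (Real.sin θ * y)]

/-- The angular momentum of the graph `x = g(y)` about `o` is `g - y g' - o`, and `g - y g'` is
where the tangent line meets the real axis. For `sin θ < 0` this intercept is smallest at the
endpoints, where it equals `h tan θ`; for `sin θ ≥ 0` it is nonnegative. Both bounds exceed `o`. -/
lemma isStarArc_midArc (hh : 0 < h) (hc : 0 < Real.cos θ) {o : ℝ} (ho : o < 0)
    (ho' : o < h * Real.tan θ) : IsStarArc o (midArc h θ) h := by
  have hcross (y : ℝ) (hy : y ∈ Icc (-h) h) : 0 < midGraph h θ y - o - y * midSlope h θ y := by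
    have hQ := midRoot_pos hh hc hy
    have hQ2 := midRoot_sq hh hc hy
    have hlow := mul_cos_le_midRoot (θ := θ) hy
    have hup := midRoot_le hh (θ := θ) y
    have hg := sin_mul_midGraph hh hc hy
    rcases lt_trichotomy (Real.sin θ) 0 with hs | hs | hs
    · have hs' : Real.sin θ ≠ 0 := hs.ne
      rw [Real.tan_eq_sin_div_cos] at ho'
      have key : h * (Real.sin θ / Real.cos θ) ≤ midGraph h θ y - y * midSlope h θ y := by
        have e : midGraph h θ y = (midRoot h θ y - h * Real.cos θ) / Real.sin θ := by
          rw [eq_div_iff hs', mul_comm]; exact hg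
        rw [e, midSlope_eq hy]
        have e2 : (midRoot h θ y - h * Real.cos θ) / Real.sin θ - y * (-(Real.sin θ * y) / midRoot h θ y)
          = h * (h - Real.cos θ * midRoot h θ y) / (Real.sin θ * midRoot h θ y) := by
          field_simp
          linear_combination hQ2
        have e3 : h * (h - Real.cos θ * midRoot h θ y) / (Real.sin θ * midRoot h θ y) -
          h * (Real.sin θ / Real.cos θ) = h * (midRoot h θ y - h * Real.cos θ) /
            (-Real.sin θ * Real.cos θ * midRoot h θ y) := by
          field_simp
          linear_combination (-midRoot h θ y) * Real.sin_sq_add_cos_sq θ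
        have : 0 ≤ h * (midRoot h θ y - h * Real.cos θ) /
            (-Real.sin θ * Real.cos θ * midRoot h θ y) := by
          apply div_nonneg (mul_nonneg hh.le (by linarith))
          have : 0 < -Real.sin θ := by linarith
          positivity
        rw [e2]
        linarith
      linarith
    · rw [midGraph_of_sin_eq_zero hs, midSlope_eq hy, hs]
      simpa using ho
    · have h1 : 0 ≤ midGraph h θ y := by
        by_contra! hneg
        have := mul_neg_of_pos_of_neg hs hneg
        linarith
      have h2 : y * midSlope h θ y ≤ 0 := by
        rw [midSlope_eq hy]
        have : y * (-(Real.sin θ * y) / midRoot h θ y) = -(Real.sin θ * y ^ 2 / midRoot h θ y) := by ring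
        rw [this]
        have : 0 ≤ Real.sin θ * y ^ 2 / midRoot h θ y := by positivity
        linarith
      linarith
  refine ⟨contDiff_midArc hh hc, hh, fun s hs => ?_, fun s hs => ?_⟩
  · rw [Complex.mem_slitPlane_iff]
    rcases eq_or_ne s 0 with rfl | hs0
    · left
      have := hcross 0 hs
      simp at this ⊢
      exact this
    · right
      simpa using hs0
  · rw [deriv_midArc hh hc]
    have := hcross s hs
    simpa [cross] using this

end MidArc

/-! ### The reference configuration -/

/-- The left chamber is star-shaped with respect to `-starCenter h θ₀`. -/
def starCenter (h θ₀ : ℝ) : ℝ := h * Real.tan (Real.pi / 6 - θ₀ / 2)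

/-- The outer arc on the left. -/
def leftArc (h θ₀ s : ℝ) : ℂ := refl (outerArc h (2 * Real.pi / 3 - θ₀) s)

/-- The outer arc on the right. -/
def rightArc (h θ₀ s : ℝ) : ℂ := outerArc h (2 * Real.pi / 3 + θ₀) s

section Reference

variable {h θ₀ : ℝ}

lemma refl_leftArc : (fun s => refl (leftArc h θ₀ s)) = outerArc h (2 * Real.pi / 3 - θ₀) := by
  ext1 s; simp [leftArc]

lemma cos_pos_of_abs_lt (hθ : |θ₀| < Real.pi / 3) : 0 < Real.cos θ₀ :=
  Real.cos_pos_of_mem_Ioo ⟨by linarith [(abs_lt.1 hθ).1, Real.pi_pos],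
    by linarith [(abs_lt.1 hθ).2, Real.pi_pos]⟩

lemma starCenter_pos (hh : 0 < h) (hθ : |θ₀| < Real.pi / 3) : 0 < starCenter h θ₀ :=
  mul_pos hh (Real.tan_pos_of_pos_of_lt_pi_div_two (by linarith [(abs_lt.1 hθ).2])
    (by linarith [(abs_lt.1 hθ).1, Real.pi_pos]))

lemma isStarArc_left (hh : 0 < h) (hθ : |θ₀| < Real.pi / 3) :
    IsStarArc (starCenter h θ₀) (outerArc h (2 * Real.pi / 3 - θ₀)) (2 * Real.pi / 3 - θ₀) := by
  have hp := Real.pi_pos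
  have := abs_lt.1 hθ
  apply isStarArc_outerArc hh (by linarith) (by linarith)
  apply abs_sub_arcCenter_lt hh (by linarith) (by linarith) (starCenter_pos hh hθ).le
  refine mul_lt_mul_of_pos_left (Real.tan_lt_tan_of_lt_of_lt_pi_div_two ?_ ?_ ?_) hh <;> linarith

lemma isStarArc_outer (hh : 0 < h) {θ : ℝ} (h0 : 0 < θ) (hπ : θ < Real.pi) :
    IsStarArc ((0 : ℝ) : ℂ) (outerArc h θ) θ := by
  apply isStarArc_outerArc hh h0 hπ
  apply abs_sub_arcCenter_lt hh h0 hπ le_rfl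
  exact mul_pos hh (Real.tan_pos_of_pos_of_lt_pi_div_two (by linarith) (by linarith))

lemma isStarArc_mid (hh : 0 < h) (hθ : |θ₀| < Real.pi / 3) :
    IsStarArc ((-starCenter h θ₀ : ℝ) : ℂ) (midArc h θ₀) h := by
  have hp := Real.pi_pos
  have := abs_lt.1 hθ
  apply isStarArc_midArc hh (cos_pos_of_abs_lt hθ) (by linarith [starCenter_pos hh hθ])
  rw [starCenter, ← mul_neg, ← Real.tan_neg]
  refine mul_lt_mul_of_pos_left (Real.tan_lt_tan_of_lt_of_lt_pi_div_two ?_ ?_ ?_) hh <;> linarith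

/-- The angle in `starCenter` satisfies two comparisons of tangents: `π/6 - θ₀/2 < π/3 - θ₀/2`
places the centre inside the circle of the outer arc, and `θ₀/2 - π/6 < θ₀`, which is `θ₀ > -π/3`,
places it on the correct side of the tangents of the middle arc. The right chamber is the reflected
case of `-θ₀`. -/
lemma starTrio_reference (hh : 0 < h) (hθ : |θ₀| < Real.pi / 3) :
    StarTrio (-starCenter h θ₀) (starCenter h (-θ₀)) h (leftArc h θ₀) (midArc h θ₀) (rightArc h θ₀)
      (2 * Real.pi / 3 - θ₀) h (2 * Real.pi / 3 + θ₀) := by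
  have hp := Real.pi_pos
  have hb := abs_lt.1 hθ
  have hc := cos_pos_of_abs_lt hθ
  have hθ' : |-θ₀| < Real.pi / 3 := by rwa [abs_neg]
  have s₁ : Real.sin (2 * Real.pi / 3 - θ₀) ≠ 0 :=
    (Real.sin_pos_of_pos_of_lt_pi (by linarith) (by linarith)).ne'
  have s₂ : Real.sin (2 * Real.pi / 3 + θ₀) ≠ 0 :=
    (Real.sin_pos_of_pos_of_lt_pi (by linarith) (by linarith)).ne'
  have lt : leftArc h θ₀ (2 * Real.pi / 3 - θ₀) = h * Complex.I := by
    rw [leftArc, outerArc_top s₁, StarPair.refl_top]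
  have lb : leftArc h θ₀ (-(2 * Real.pi / 3 - θ₀)) = -(h * Complex.I) := by
    rw [leftArc, outerArc_bot s₁, StarPair.refl_bot]
  have hr : IsStarArc (starCenter h (-θ₀)) (rightArc h θ₀) (2 * Real.pi / 3 + θ₀) := by
    have := isStarArc_left hh hθ'
    rwa [sub_neg_eq_add] at this
  have hm : IsStarArc ((-starCenter h (-θ₀) : ℝ) : ℂ) (fun s => refl (midArc h θ₀ s)) h := by
    have := isStarArc_mid hh hθ'
    simp_rw [refl_midArc]
    exact this
  refine ⟨⟨hh, isStarArc_mid hh hθ, ?_, midArc_top hh hc, midArc_bot, lt, lb⟩,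
    ⟨hh, hr, hm, outerArc_top s₂, outerArc_bot s₂, midArc_top hh hc, midArc_bot⟩,
    ⟨hh, isStarArc_outer hh (by linarith) (by linarith), ?_, outerArc_top s₂, outerArc_bot s₂, lt, lb⟩⟩
  · rw [refl_leftArc, neg_neg]
    exact isStarArc_left hh hθ
  · rw [refl_leftArc, neg_zero]
    exact isStarArc_outer hh (by linarith) (by linarith)

end Reference

/-! ### The chambers of the model double bubble -/

/-- Defining function of the circle through `±ih` with normal angle `θ`. -/
def circleFun (h θ : ℝ) (z : ℂ) : ℝ :=
  Real.sin θ * (Complex.normSq z - h ^ 2) + 2 * h * Real.cos θ * z.re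

/-- The left chamber of the model double bubble; the right one is the reflection of the left one
for the opposite parameter. -/
def leftChamber (h θ : ℝ) : Set ℂ :=
  {z | circleFun h (2 * Real.pi / 3 - θ) (refl z) < 0 ∧ circleFun h θ z < 0}

@[fun_prop]
lemma continuous_circleFun (h θ : ℝ) : Continuous (circleFun h θ) := by
  unfold circleFun
  have := Complex.continuous_normSq
  fun_prop

@[fun_prop]
lemma continuous_refl : Continuous refl := by unfold refl; fun_prop

@[simp] lemma normSq_refl (z : ℂ) : Complex.normSq (refl z) = Complex.normSq z := by
  simp [Complex.normSq_apply]

lemma circleFun_refl (h θ : ℝ) (z : ℂ) : circleFun h θ (refl z) = -circleFun h (-θ) z := by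
  simp [circleFun]; ring

section

variable {h θ : ℝ}

lemma isOpen_leftChamber : IsOpen (leftChamber h θ) :=
  (isOpen_lt ((continuous_circleFun h (2 * Real.pi / 3 - θ)).comp continuous_refl)
    continuous_const).inter (isOpen_lt (continuous_circleFun h θ) continuous_const)

/-- The relation between the two circles that bound the left chamber, away from the axis. -/
lemma circleFun_combine_re (z : ℂ) : Real.sin (2 * Real.pi / 3 - θ) * circleFun h θ z -
    Real.sin θ * circleFun h (2 * Real.pi / 3 - θ) (refl z) =
      2 * h * Real.sin (2 * Real.pi / 3) * z.re := by
  have : Real.sin (2 * Real.pi / 3) = Real.sin (2 * Real.pi / 3 - θ) * Real.cos θ +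
      Real.cos (2 * Real.pi / 3 - θ) * Real.sin θ := by
    rw [← Real.sin_add, sub_add_cancel]
  rw [this]
  simp [circleFun]; ring

/-- On the middle circle this forces `|z| ≤ h` for points of the closed left chamber, and so singles
out the middle arc among the two arcs of that circle. -/
lemma circleFun_combine_normSq (z : ℂ) : Real.cos (2 * Real.pi / 3 - θ) * circleFun h θ z +
    Real.cos θ * circleFun h (2 * Real.pi / 3 - θ) (refl z) =
      Real.sin (2 * Real.pi / 3) * (Complex.normSq z - h ^ 2) := by
  have : Real.sin (2 * Real.pi / 3) = Real.sin (2 * Real.pi / 3 - θ) * Real.cos θ +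
      Real.cos (2 * Real.pi / 3 - θ) * Real.sin θ := by
    rw [← Real.sin_add, sub_add_cancel]
  rw [this]
  simp [circleFun]; ring

lemma sin_two_pi_div_three_pos : 0 < Real.sin (2 * Real.pi / 3) :=
  Real.sin_pos_of_pos_of_lt_pi (by linarith [Real.pi_pos]) (by linarith [Real.pi_pos])

lemma circleFun_eq (hs : Real.sin θ ≠ 0) (z : ℂ) : circleFun h θ z =
    Real.sin θ * (Complex.normSq (z - arcCenter h θ) - arcRadius h θ ^ 2) := by
  simp only [circleFun, arcCenter, arcRadius, Complex.normSq_apply, Complex.sub_re, Complex.sub_im,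
    Complex.ofReal_re, Complex.ofReal_im]
  field_simp
  linear_combination -h ^ 2 * (Real.sin_sq_add_cos_sq θ)

lemma circleFun_outerArc (hs : Real.sin θ ≠ 0) (s : ℝ) : circleFun h θ (outerArc h θ s) = 0 := by
  rw [circleFun_eq hs]
  have : outerArc h θ s - arcCenter h θ = arcRadius h θ * Complex.exp (s * Complex.I) := by
    simp [outerArc]
  rw [this, map_mul, Complex.normSq_eq_norm_sq (Complex.exp _), Complex.norm_exp_ofReal_mul_I,
    Complex.normSq_ofReal]
  ring

/-- The centre is `-R cos θ`, so a nonnegative real part says that the cosine of the polar angle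
about the centre is at least `cos θ`. -/
lemma mem_outerArc (hh : 0 < h) (h0 : 0 < θ) (hπ : θ < Real.pi) {z : ℂ}
    (hz : circleFun h θ z = 0) (hre : 0 ≤ z.re) : z ∈ outerArc h θ '' Icc (-θ) θ := by
  have hs := Real.sin_pos_of_pos_of_lt_pi h0 hπ
  have hR := arcRadius_pos hh h0 hπ
  rw [circleFun_eq hs.ne'] at hz
  have hn : ‖z - arcCenter h θ‖ = arcRadius h θ := by
    have := (mul_eq_zero.1 hz).resolve_left hs.ne'
    rw [Complex.normSq_eq_norm_sq] at this
    rw [← abs_of_nonneg (norm_nonneg _), ← abs_of_pos hR, ← sq_eq_sq_iff_abs_eq_abs]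
    linarith
  have e : z = outerArc h θ (z - arcCenter h θ).arg := by
    rw [outerArc, ← hn, Complex.norm_mul_exp_arg_mul_I]
    ring
  refine ⟨_, ?_, e.symm⟩
  have hre' := hre
  rw [e, outerArc_re] at hre'
  have hcos : Real.cos θ ≤ Real.cos |(z - arcCenter h θ).arg| := by
    rw [Real.cos_abs]
    have e2 : arcCenter h θ = -(arcRadius h θ * Real.cos θ) := by
      rw [arcCenter, arcRadius]; ring
    have : arcRadius h θ * Real.cos θ ≤ arcRadius h θ * Real.cos (z - arcCenter h θ).arg := by
      rw [e2] at hre' ⊢; linarith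
    exact le_of_mul_le_mul_left this hR
  rw [mem_Icc, ← abs_le]
  by_contra! hlt
  exact hcos.not_gt (Real.cos_lt_cos_of_nonneg_of_le_pi h0.le (Complex.abs_arg_le_pi _) hlt)

lemma outerArc_re_pos (hh : 0 < h) (h0 : 0 < θ) (hπ : θ < Real.pi) {s : ℝ} (hs : s ∈ Ioo (-θ) θ) :
    0 < (outerArc h θ s).re := by
  have hR := arcRadius_pos hh h0 hπ
  have e2 : arcCenter h θ = -(arcRadius h θ * Real.cos θ) := by rw [arcCenter, arcRadius]; ring
  rw [outerArc_re, e2]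
  have : Real.cos θ < Real.cos s := by
    rw [← Real.cos_abs s]
    exact Real.cos_lt_cos_of_nonneg_of_le_pi (abs_nonneg _) hπ.le (abs_lt.2 hs)
  nlinarith

lemma circleFun_midArc (hh : 0 < h) (hc : 0 < Real.cos θ) {y : ℝ} (hy : y ∈ Icc (-h) h) :
    circleFun h θ (midArc h θ y) = 0 := by
  simp only [circleFun, Complex.normSq_apply, midArc_re, midArc_im]
  by_cases hs : Real.sin θ = 0
  · simp [hs, midGraph_of_sin_eq_zero hs]
  · have h1 := sin_mul_midGraph hh hc hy
    have h2 := midRoot_sq hh hc hy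
    apply mul_left_cancel₀ hs
    have h3 : (Real.sin θ * midGraph h θ y) ^ 2 = (midRoot h θ y - h * Real.cos θ) ^ 2 := by rw [h1]
    linear_combination h3 + h2 + 2 * h * Real.cos θ * h1 - h ^ 2 * Real.sin_sq_add_cos_sq θ

/-- Inside the disc `|z| ≤ h` the equation of the circle makes `sin θ · x` nonnegative, which
selects the square root when the equation is solved for `x`. -/
lemma mem_midArc (hh : 0 < h) (hc : 0 < Real.cos θ) {z : ℂ} (hz : circleFun h θ z = 0)
    (hN : Complex.normSq z ≤ h ^ 2) : z ∈ midArc h θ '' Icc (-h) h := by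
  have hy : z.im ∈ Icc (-h) h := by
    rw [mem_Icc, ← abs_le]
    apply abs_le_of_sq_le_sq _ hh.le
    rw [Complex.normSq_apply] at hN
    nlinarith [sq_nonneg z.re]
  refine ⟨z.im, hy, Complex.ext ?_ (by simp)⟩
  rw [midArc_re]
  rw [circleFun, Complex.normSq_apply] at hz
  rw [Complex.normSq_apply] at hN
  by_cases hs : Real.sin θ = 0
  · rw [midGraph_of_sin_eq_zero hs]
    rw [hs] at hz
    have : 2 * h * Real.cos θ * z.re = 0 := by linarith
    exact ((mul_eq_zero.1 this).resolve_left (by positivity)).symm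
  · have h1 := sin_mul_midGraph hh hc hy
    have h2 := midRoot_sq hh hc hy
    have hQ := midRoot_pos hh hc hy
    apply mul_left_cancel₀ hs
    rw [h1]
    have hsx : 0 ≤ Real.sin θ * z.re := by
      have : 2 * h * Real.cos θ * (Real.sin θ * z.re) =
          Real.sin θ ^ 2 * (h ^ 2 - (z.re * z.re + z.im * z.im)) := by
        linear_combination Real.sin θ * hz
      have h3 : 0 ≤ 2 * h * Real.cos θ * (Real.sin θ * z.re) := by
        rw [this]; exact mul_nonneg (sq_nonneg _) (by linarith)
      exact nonneg_of_mul_nonneg_right h3 (by positivity)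
    have hpos : 0 < Real.sin θ * z.re + h * Real.cos θ := by positivity
    have hsq : midRoot h θ z.im ^ 2 = (Real.sin θ * z.re + h * Real.cos θ) ^ 2 := by
      rw [h2]
      linear_combination (-Real.sin θ) * hz - h ^ 2 * Real.sin_sq_add_cos_sq θ
    have := (pow_left_inj₀ hQ.le hpos.le two_ne_zero).1 hsq
    linarith

lemma normSq_midArc_lt (hh : 0 < h) (hc : 0 < Real.cos θ) {y : ℝ} (hy : y ∈ Ioo (-h) h) :
    Complex.normSq (midArc h θ y) < h ^ 2 := by
  have hy' := Ioo_subset_Icc_self hy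
  have hz := circleFun_midArc hh hc hy'
  have h1 := sin_mul_midGraph hh hc hy'
  have h2 := midRoot_sq hh hc hy'
  have hQ := midRoot_pos hh hc hy'
  have hyy : y ^ 2 < h ^ 2 := sq_lt_sq' hy.1 hy.2
  by_contra! hN
  simp only [circleFun, midArc_re] at hz
  have e : 2 * h * Real.cos θ * (Real.sin θ * midGraph h θ y) =
      -(Real.sin θ ^ 2 * (Complex.normSq (midArc h θ y) - h ^ 2)) := by
    linear_combination Real.sin θ * hz
  have h3 : Real.sin θ * midGraph h θ y ≤ 0 := by
    by_contra! hpos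
    have : 0 < 2 * h * Real.cos θ * (Real.sin θ * midGraph h θ y) := by positivity
    have : 0 ≤ Real.sin θ ^ 2 * (Complex.normSq (midArc h θ y) - h ^ 2) :=
      mul_nonneg (sq_nonneg _) (by linarith)
    linarith
  have h4 : midRoot h θ y ^ 2 ≤ (h * Real.cos θ) ^ 2 := pow_le_pow_left₀ hQ.le (by linarith) 2
  by_cases hs : Real.sin θ = 0
  · rw [Complex.normSq_apply, midArc_re, midArc_im, midGraph_of_sin_eq_zero hs] at hN
    nlinarith
  · have : 0 < Real.sin θ ^ 2 := by positivity
    nlinarith [Real.sin_sq_add_cos_sq θ]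

end

section Chambers

variable {h θ : ℝ}

lemma closure_leftChamber_subset : closure (leftChamber h θ) ⊆
    {z | circleFun h (2 * Real.pi / 3 - θ) (refl z) ≤ 0 ∧ circleFun h θ z ≤ 0} := by
  apply closure_minimal
  · exact fun z hz => ⟨hz.1.le, hz.2.le⟩
  · exact (isClosed_le ((continuous_circleFun h (2 * Real.pi / 3 - θ)).comp continuous_refl)
      continuous_const).inter (isClosed_le (continuous_circleFun h θ) continuous_const)

lemma frontier_leftChamber_subset (hh : 0 < h) (hθ : |θ| < Real.pi / 3) :
    frontier (leftChamber h θ) ⊆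
      leftArc h θ '' Icc (-(2 * Real.pi / 3 - θ)) (2 * Real.pi / 3 - θ) ∪ midArc h θ '' Icc (-h) h := by
  intro z hz
  have hp := Real.pi_pos
  have hb := abs_lt.1 hθ
  have hc := cos_pos_of_abs_lt hθ
  have hs1 : 0 < Real.sin (2 * Real.pi / 3 - θ) :=
    Real.sin_pos_of_pos_of_lt_pi (by linarith) (by linarith)
  have hs := sin_two_pi_div_three_pos
  obtain ⟨h1, h2⟩ := closure_leftChamber_subset hz.1
  have hnot : z ∉ leftChamber h θ := by
    have := hz.2
    rwa [isOpen_leftChamber.interior_eq] at this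
  have e1 := circleFun_combine_re (h := h) (θ := θ) z
  have e2 := circleFun_combine_normSq (h := h) (θ := θ) z
  rcases eq_or_lt_of_le h1 with h1' | h1'
  · left
    have hre : 0 ≤ (refl z).re := by
      rw [h1', mul_zero, sub_zero] at e1
      have h3 : 2 * h * Real.sin (2 * Real.pi / 3) * z.re ≤ 0 := by
        rw [← e1]; exact mul_nonpos_of_nonneg_of_nonpos hs1.le h2
      rw [refl_re, neg_nonneg]
      by_contra! hpos
      have : 0 < 2 * h * Real.sin (2 * Real.pi / 3) * z.re := by positivity
      linarith
    obtain ⟨s, hs, e⟩ := mem_outerArc hh (by linarith) (by linarith) h1' hre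
    exact ⟨s, hs, by rw [leftArc, e, refl_refl]⟩
  · right
    have h2' : circleFun h θ z = 0 := by
      by_contra hne
      exact hnot ⟨h1', lt_of_le_of_ne h2 hne⟩
    apply mem_midArc hh hc h2'
    rw [h2', mul_zero, zero_add] at e2
    have h3 : Real.sin (2 * Real.pi / 3) * (Complex.normSq z - h ^ 2) ≤ 0 := by
      rw [← e2]; exact mul_nonpos_of_nonneg_of_nonpos hc.le h1
    by_contra! hpos
    have : 0 < Real.sin (2 * Real.pi / 3) * (Complex.normSq z - h ^ 2) :=
      mul_pos hs (by linarith)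
    linarith

/-- The open left arc belongs to the boundary of the left chamber, and lies on the open side of the
middle circle. -/
lemma leftArc_mem_frontier (hh : 0 < h) (hθ : |θ| < Real.pi / 3) {s : ℝ}
    (hs : s ∈ Ioo (-(2 * Real.pi / 3 - θ)) (2 * Real.pi / 3 - θ)) :
    leftArc h θ s ∈ frontier (leftChamber h θ) ∧ circleFun h θ (leftArc h θ s) < 0 := by
  have hp := Real.pi_pos
  have hb := abs_lt.1 hθ
  have hs1 : 0 < Real.sin (2 * Real.pi / 3 - θ) :=
    Real.sin_pos_of_pos_of_lt_pi (by linarith) (by linarith)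
  have hs3 := sin_two_pi_div_three_pos
  have hR := arcRadius_pos hh (θ := 2 * Real.pi / 3 - θ) (by linarith) (by linarith)
  have hz : circleFun h (2 * Real.pi / 3 - θ) (refl (leftArc h θ s)) = 0 := by
    rw [leftArc, refl_refl, circleFun_outerArc hs1.ne']
  have hre : (leftArc h θ s).re < 0 := by
    rw [leftArc, refl_re]
    linarith [outerArc_re_pos hh (by linarith) (by linarith) hs]
  have hneg : circleFun h θ (leftArc h θ s) < 0 := by
    have e1 := circleFun_combine_re (h := h) (θ := θ) (leftArc h θ s)
    rw [hz, mul_zero, sub_zero] at e1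
    have h3 : 2 * h * Real.sin (2 * Real.pi / 3) * (leftArc h θ s).re < 0 :=
      mul_neg_of_pos_of_neg (by positivity) hre
    rw [← e1] at h3
    by_contra! hpos
    have : 0 ≤ Real.sin (2 * Real.pi / 3 - θ) * circleFun h θ (leftArc h θ s) := by positivity
    linarith
  refine ⟨⟨?_, fun hi => ?_⟩, hneg⟩
  · let D : Set ℂ := {z | circleFun h (2 * Real.pi / 3 - θ) (refl z) < 0}
    let U : Set ℂ := {z | circleFun h θ z < 0}
    have hU : IsOpen U := isOpen_lt (by fun_prop) continuous_const
    have hD : D = Metric.ball (refl (arcCenter h (2 * Real.pi / 3 - θ)))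
        (arcRadius h (2 * Real.pi / 3 - θ)) := by
      ext z
      change circleFun h (2 * Real.pi / 3 - θ) (refl z) < 0 ↔ _
      rw [circleFun_eq hs1.ne', ← smul_eq_mul, smul_neg_iff_of_pos_left hs1, sub_neg, Complex.normSq_eq_norm_sq,
        sq_lt_sq₀ (norm_nonneg _) hR.le, mem_ball_iff_norm, ← norm_refl, refl_sub, refl_refl]
    have hcl : leftArc h θ s ∈ closure D := by
      rw [hD, closure_ball _ hR.ne', mem_closedBall_iff_norm, leftArc, ← refl_sub, norm_refl]
      rw [outerArc, add_sub_cancel_left, norm_mul, Complex.norm_exp_ofReal_mul_I, mul_one,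
        Complex.norm_real, Real.norm_of_nonneg hR.le]
    have : leftArc h θ s ∈ closure (D ∩ U) := by
      rw [inter_comm]
      exact hU.inter_closure ⟨hneg, hcl⟩
    exact this
  · exact (interior_subset hi).1.ne hz

/-- The horizontal derivative of `circleFun` at a point of the arc is `2 midRoot`, which is
positive, so the chamber is entered by moving to the left. -/
lemma midArc_mem_frontier (hh : 0 < h) (hθ : |θ| < Real.pi / 3) {y : ℝ} (hy : y ∈ Ioo (-h) h) :
    midArc h θ y ∈ frontier (leftChamber h θ) := by
  have hc := cos_pos_of_abs_lt hθ
  have hs3 := sin_two_pi_div_three_pos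
  have hz := circleFun_midArc hh hc (Ioo_subset_Icc_self hy)
  have hN := normSq_midArc_lt hh hc hy
  set z := midArc h θ y with hzdef
  have hneg : circleFun h (2 * Real.pi / 3 - θ) (refl z) < 0 := by
    have e2 := circleFun_combine_normSq (h := h) (θ := θ) z
    rw [hz, mul_zero, zero_add] at e2
    have h3 : Real.sin (2 * Real.pi / 3) * (Complex.normSq z - h ^ 2) < 0 :=
      mul_neg_of_pos_of_neg hs3 (by linarith)
    rw [← e2] at h3
    by_contra! hpos
    have : 0 ≤ Real.cos θ * circleFun h (2 * Real.pi / 3 - θ) (refl z) := by positivity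
    linarith
  refine ⟨?_, fun hi => (interior_subset hi).2.ne hz⟩
  have hcurve : Continuous fun t : ℝ => z - (t : ℂ) := by fun_prop
  have hslope : 0 < 2 * Real.sin θ * z.re + 2 * h * Real.cos θ := by
    have h1 := sin_mul_midGraph hh hc (Ioo_subset_Icc_self hy)
    have hQ := midRoot_pos hh hc (Ioo_subset_Icc_self hy)
    rw [hzdef, midArc_re]
    linarith
  have hlin (t : ℝ) : circleFun h θ (z - t) =
      -(t * (2 * Real.sin θ * z.re + 2 * h * Real.cos θ - Real.sin θ * t)) := by
    have : circleFun h θ (z - t) = circleFun h θ z -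
        t * (2 * Real.sin θ * z.re + 2 * h * Real.cos θ - Real.sin θ * t) := by
      simp [circleFun, Complex.normSq_apply]; ring
    rw [this, hz]; ring
  have ev1 : ∀ᶠ t : ℝ in 𝓝[>] 0, circleFun h (2 * Real.pi / 3 - θ) (refl (z - t)) < 0 := by
    have hcont : Continuous fun t : ℝ => circleFun h (2 * Real.pi / 3 - θ) (refl (z - t)) := by
      fun_prop
    have := (hcont.tendsto 0).eventually_lt_const (u := 0) (by simpa using hneg)
    exact this.filter_mono nhdsWithin_le_nhds
  have ev2 : ∀ᶠ t : ℝ in 𝓝[>] 0,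
      0 < 2 * Real.sin θ * z.re + 2 * h * Real.cos θ - Real.sin θ * t := by
    have hcont : Continuous fun t : ℝ =>
      2 * Real.sin θ * z.re + 2 * h * Real.cos θ - Real.sin θ * t := by fun_prop
    have := (hcont.tendsto 0).eventually_const_lt (u := 0) (by simpa using hslope)
    exact this.filter_mono nhdsWithin_le_nhds
  have ht : Tendsto (fun t : ℝ => z - (t : ℂ)) (𝓝[>] 0) (𝓝 z) := by
    have := hcurve.tendsto 0
    simp only [Complex.ofReal_zero, sub_zero] at this
    exact this.mono_left nhdsWithin_le_nhds
  refine mem_closure_of_tendsto ht ?_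
  filter_upwards [ev1, ev2, self_mem_nhdsWithin] with t h1 h2 h3
  refine ⟨h1, ?_⟩
  rw [hlin]
  have : 0 < t * (2 * Real.sin θ * z.re + 2 * h * Real.cos θ - Real.sin θ * t) := mul_pos h3 h2
  linarith

/-- The right chamber of the model double bubble. -/
def rightChamber (h θ : ℝ) : Set ℂ := refl ⁻¹' leftChamber h (-θ)

/-- The reflection as a homeomorphism. -/
def reflHomeo : ℂ ≃ₜ ℂ where
  toFun := refl
  invFun := refl
  left_inv := refl_refl
  right_inv := refl_refl
  continuous_toFun := continuous_refl
  continuous_invFun := continuous_refl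

lemma frontier_rightChamber : frontier (rightChamber h θ) = refl ⁻¹' frontier (leftChamber h (-θ)) :=
  (reflHomeo.preimage_frontier _).symm

lemma frontier_rightChamber_subset (hh : 0 < h) (hθ : |θ| < Real.pi / 3) :
    frontier (rightChamber h θ) ⊆ midArc h θ '' Icc (-h) h ∪
      rightArc h θ '' Icc (-(2 * Real.pi / 3 + θ)) (2 * Real.pi / 3 + θ) := by
  intro z hz
  rw [frontier_rightChamber] at hz
  rcases frontier_leftChamber_subset hh (by rwa [abs_neg]) hz with ⟨s, hs, e⟩ | ⟨s, hs, e⟩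
  · right
    rw [sub_neg_eq_add] at hs
    refine ⟨s, hs, ?_⟩
    rw [← refl_refl z, ← e, leftArc, refl_refl, sub_neg_eq_add]; rfl
  · left
    refine ⟨s, hs, ?_⟩
    rw [← refl_refl z, ← e, refl_midArc, neg_neg]

lemma frontier_chambers_subset (hh : 0 < h) (hθ : |θ| < Real.pi / 3) :
    frontier (leftChamber h θ) ∪ frontier (rightChamber h θ) ⊆
      StarTrio.network (leftArc h θ) (midArc h θ) (rightArc h θ)
        (2 * Real.pi / 3 - θ) h (2 * Real.pi / 3 + θ) := by
  refine union_subset ((frontier_leftChamber_subset hh hθ).trans subset_union_left)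
    ((frontier_rightChamber_subset hh hθ).trans ?_)
  exact union_subset_union_left _ subset_union_right

/-- Interior points of the arc are strictly on one side of the middle circle, hence off the closure
of the other chamber; the endpoints follow by closure. Only this inclusion of the arc in the
interface is needed, since the regularity of `f` on the interface then restricts to the arc. -/
lemma leftArc_subset (hh : 0 < h) (hθ : |θ| < Real.pi / 3) :
    leftArc h θ '' Icc (-(2 * Real.pi / 3 - θ)) (2 * Real.pi / 3 - θ) ⊆
      closure (frontier (leftChamber h θ) \ frontier (rightChamber h θ)) := by
  have hb := abs_lt.1 hθ
  have hp := Real.pi_pos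
  have cl : Continuous (leftArc h θ) := continuous_refl.comp contDiff_outerArc.continuous
  rw [← closure_Ioo (by linarith : -(2 * Real.pi / 3 - θ) ≠ 2 * Real.pi / 3 - θ)]
  refine (image_closure_subset_closure_image cl).trans (closure_mono ?_)
  rintro _ ⟨s, hs, rfl⟩
  obtain ⟨h1, h2⟩ := leftArc_mem_frontier hh hθ hs
  refine ⟨h1, fun h3 => ?_⟩
  have h4 : refl (leftArc h θ s) ∈ closure (leftChamber h (-θ)) := by
    rw [frontier_rightChamber] at h3
    exact h3.1
  have h5 := (closure_leftChamber_subset h4).2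
  rw [circleFun_refl, neg_neg] at h5
  linarith

lemma rightArc_subset (hh : 0 < h) (hθ : |θ| < Real.pi / 3) :
    rightArc h θ '' Icc (-(2 * Real.pi / 3 + θ)) (2 * Real.pi / 3 + θ) ⊆
      closure (frontier (rightChamber h θ) \ frontier (leftChamber h θ)) := by
  have h1 := leftArc_subset hh (θ := -θ) (by rwa [abs_neg])
  rintro _ ⟨s, hs, rfl⟩
  have h2 : leftArc h (-θ) s ∈ closure (frontier (leftChamber h (-θ)) \ frontier (rightChamber h (-θ))) :=
    h1 ⟨s, by rwa [sub_neg_eq_add], rfl⟩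
  have h3 : rightArc h θ s ∈ refl ⁻¹' closure (frontier (leftChamber h (-θ)) \ frontier (rightChamber h (-θ))) := by
    rw [leftArc, sub_neg_eq_add] at h2
    exact h2
  have h4 := (reflHomeo.preimage_closure (frontier (leftChamber h (-θ)) \ frontier (rightChamber h (-θ)))).subset h3
  convert h4 using 2
  rw [preimage_sdiff]
  congr 1
  · exact frontier_rightChamber
  · rw [frontier_rightChamber, neg_neg]
    ext z
    change _ ↔ refl (refl z) ∈ frontier (leftChamber h θ)
    rw [refl_refl]

lemma midArc_subset (hh : 0 < h) (hθ : |θ| < Real.pi / 3) :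
    midArc h θ '' Icc (-h) h ⊆ frontier (leftChamber h θ) ∩ frontier (rightChamber h θ) := by
  have hc := cos_pos_of_abs_lt hθ
  rw [← (isClosed_frontier.inter isClosed_frontier).closure_eq,
    ← closure_Ioo (by linarith : -h ≠ h)]
  refine (image_closure_subset_closure_image (contDiff_midArc hh hc).continuous).trans
    (closure_mono ?_)
  rintro _ ⟨s, hs, rfl⟩
  refine ⟨midArc_mem_frontier hh hθ hs, ?_⟩
  rw [frontier_rightChamber, mem_preimage, refl_midArc]
  exact midArc_mem_frontier hh (by rwa [abs_neg]) hs

end Chambers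

/-! ### Maps of class `C^{1,1}` along curves -/

/-- An interval has full tangent span even at its endpoints, and the derivative of the curve maps it
into that of `S`. On this span the tangential gradient agrees with the derivative within `S`, so the
chain rule along curves is available. -/
lemma mem_span_tangentConeAt {F : Type*} [NormedAddCommGroup F] [NormedSpace ℝ F] {Γ : ℝ → F}
    {Γ' : F} {a s : ℝ} (ha : 0 < a) (hs : s ∈ Icc (-a) a) {S : Set F}
    (hΓ : HasDerivWithinAt Γ Γ' (Icc (-a) a) s) (hS : MapsTo Γ (Icc (-a) a) S) :
    Γ' ∈ Submodule.span ℝ (tangentConeAt ℝ S (Γ s)) := by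
  have hu := uniqueDiffOn_Icc (by linarith : -a < a) s hs
  have htop : Submodule.span ℝ (tangentConeAt ℝ (Icc (-a) a) s) = ⊤ := by
    have h1 := hu.dense_tangentConeAt
    have h2 := (Submodule.span ℝ (tangentConeAt ℝ (Icc (-a) a) s)).closed_of_finiteDimensional
    rw [← SetLike.coe_set_eq, Submodule.top_coe, ← h1.closure_eq, h2.closure_eq]
  have h3 : (1 : ℝ) ∈ Submodule.span ℝ (tangentConeAt ℝ (Icc (-a) a) s) := htop ▸ trivial
  have h4 := Submodule.mem_map_of_mem (f := (ContinuousLinearMap.toSpanSingleton ℝ Γ' : ℝ →ₗ[ℝ] F)) h3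
  rw [Submodule.map_span] at h4
  have h5 : (ContinuousLinearMap.toSpanSingleton ℝ Γ' : ℝ →ₗ[ℝ] F) 1 = Γ' := by simp
  rw [h5] at h4
  refine Submodule.span_mono ?_ h4
  rintro _ ⟨t, ht, rfl⟩
  exact tangentConeAt_mono (image_subset_iff.2 hS)
    (hΓ.hasFDerivWithinAt.mapsTo_tangent_cone ht)

lemma tangentialGradient_apply {γ : Set Plane} {u : Plane → Plane} {x w : Plane}
    (hw : w ∈ Submodule.span ℝ (tangentConeAt ℝ γ x)) :
    tangentialGradient γ u x w = fderivWithin ℝ u γ x w := by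
  rw [tangentialGradient, ContinuousLinearMap.comp_apply,
    Submodule.starProjection_eq_self_iff.2 hw]

/-- A `C^{1,1}` map that is `C¹`-close to the identity maps `C¹` curves to `C¹` curves that are
close to them. -/
lemma exists_hasDerivWithinAt_comp {S : Set Plane} {f : Plane → Plane} (hf : IsC11On S f) {η : ℝ}
    (hη : ∀ x ∈ S, ‖tangentialGradient S (fun x => f x - x) x‖ ≤ η) {Γ : ℝ → Plane}
    (hΓ : ContDiff ℝ 1 Γ) {a : ℝ} (ha : 0 < a) (hS : MapsTo Γ (Icc (-a) a) S) :
    ∃ D : ℝ → Plane, ContinuousOn D (Icc (-a) a) ∧ ∀ s ∈ Icc (-a) a,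
      HasDerivWithinAt (f ∘ Γ) (D s) (Icc (-a) a) s ∧ ‖D s - deriv Γ s‖ ≤ η * ‖deriv Γ s‖ := by
  obtain ⟨hd, K, hK⟩ := hf
  have cΓ' : Continuous (deriv Γ) := hΓ.continuous_deriv_one
  have dΓ (s : ℝ) : HasDerivAt Γ (deriv Γ s) s := (hΓ.differentiable one_ne_zero s).hasDerivAt
  have hspan (s : ℝ) (hs : s ∈ Icc (-a) a) :=
    mem_span_tangentConeAt ha hs (dΓ s).hasDerivWithinAt hS
  refine ⟨fun s => tangentialGradient S f (Γ s) (deriv Γ s), ?_, fun s hs => ?_⟩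
  · exact ContinuousOn.clm_apply (hK.continuousOn.comp hΓ.continuous.continuousOn hS)
      cΓ'.continuousOn
  · have h1 : HasDerivWithinAt (f ∘ Γ) (tangentialGradient S f (Γ s) (deriv Γ s)) (Icc (-a) a) s := by
      rw [tangentialGradient_apply (hspan s hs)]
      exact ((hd _ (hS hs)).hasFDerivWithinAt).comp_hasDerivWithinAt s (dΓ s).hasDerivWithinAt hS
    refine ⟨h1, ?_⟩
    have h2 : HasDerivWithinAt ((fun x => f x - x) ∘ Γ)
        (tangentialGradient S (fun x => f x - x) (Γ s) (deriv Γ s)) (Icc (-a) a) s := by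
      rw [tangentialGradient_apply (hspan s hs)]
      exact (((hd _ (hS hs)).sub differentiableWithinAt_id).hasFDerivWithinAt).comp_hasDerivWithinAt
        s (dΓ s).hasDerivWithinAt hS
    have h3 := h1.sub (dΓ s).hasDerivWithinAt
    -- `fderivWithin` makes separate choices for `f` and for `f - id`; uniqueness of derivatives on
    -- the interval reconciles them along the curve.
    have h4 := (uniqueDiffOn_Icc (by linarith : -a < a) s hs).eq_deriv _ h3 h2
    rw [h4]
    exact (ContinuousLinearMap.le_opNorm _ _).trans
      (mul_le_mul_of_nonneg_right (hη _ (hS hs)) (norm_nonneg _))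

/-- A `C¹` curve on an interval extends to the line. -/
lemma exists_contDiff_extension {β D : ℝ → ℂ} {a : ℝ} (ha : 0 < a) (hD : ContinuousOn D (Icc (-a) a))
    (hβ : ∀ s ∈ Icc (-a) a, HasDerivWithinAt β (D s) (Icc (-a) a) s) :
    ∃ B : ℝ → ℂ, ContDiff ℝ 1 B ∧ ∀ s ∈ Icc (-a) a, B s = β s ∧ deriv B s = D s := by
  have hle : -a ≤ a := by linarith
  let D' : ℝ → ℂ := IccExtend hle ((Icc (-a) a).domRestrict D)
  have cD' : Continuous D' := (continuousOn_iff_continuous_domRestrict.1 hD).Icc_extend'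
  have eD' (s : ℝ) (hs : s ∈ Icc (-a) a) : D' s = D s := by
    simp only [D']
    rw [IccExtend_of_mem hle _ hs]; rfl
  have hd (s : ℝ) : HasDerivAt (fun s => β (-a) + ∫ t in (-a)..s, D' t) (D' s) s :=
    ((cD'.integral_hasStrictDerivAt (-a) s).hasDerivAt).const_add _
  refine ⟨fun s => β (-a) + ∫ t in (-a)..s, D' t, ?_, fun s hs => ⟨?_, ?_⟩⟩
  · rw [contDiff_one_iff_deriv]
    exact ⟨fun s => (hd s).differentiableAt, by rwa [funext fun s => (hd s).deriv]⟩
  · have hcont : ContinuousOn β (Icc (-a) s) := fun t ht =>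
      ((hβ t ⟨ht.1, ht.2.trans hs.2⟩).continuousWithinAt).mono (Icc_subset_Icc_right hs.2)
    have := intervalIntegral.integral_eq_sub_of_hasDerivAt_of_le hs.1 hcont (f' := D')
      (fun t ht => by
        have ht' : t ∈ Ioo (-a) a := ⟨ht.1, ht.2.trans_le hs.2⟩
        rw [eD' t (Ioo_subset_Icc_self ht')]
        exact (hβ t (Ioo_subset_Icc_self ht')).hasDerivAt (Icc_mem_nhds ht'.1 ht'.2))
      (cD'.intervalIntegrable _ _)
    dsimp only
    rw [this]; ring
  · rw [(hd s).deriv, eD' s hs]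

/-! ### Standard double bubbles in complex coordinates -/

/-- Complex coordinates of the plane. -/
def planeCoord : ℂ ≃ₗᵢ[ℝ] Plane := Complex.orthonormalBasisOneI.repr

@[simp] lemma planeCoord_zero (z : ℂ) : planeCoord z 0 = z.re := by
  simp [planeCoord, Complex.orthonormalBasisOneI]

@[simp] lemma planeCoord_one (z : ℂ) : planeCoord z 1 = z.im := by
  simp [planeCoord, Complex.orthonormalBasisOneI]

lemma planeCoord_ofReal (x : ℝ) : planeCoord x = !₂[x, 0] := by
  ext i; fin_cases i <;> simp

lemma mem_ball_iff_circleFun {h θ : ℝ} (hh : 0 < h) (hs : 0 < Real.sin θ) (z : ℂ) :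
    ‖z - arcCenter h θ‖ < h / Real.sin θ ↔ circleFun h θ z < 0 := by
  rw [circleFun_eq hs.ne', ← smul_eq_mul, smul_neg_iff_of_pos_left hs, sub_neg,
    Complex.normSq_eq_norm_sq, arcRadius, sq_lt_sq₀ (norm_nonneg _) (by positivity)]

lemma mem_arcSide {h θ : ℝ} (z : ℂ) : planeCoord z ∈ arcSide h θ ↔ circleFun h θ z < 0 := by
  change Real.sin θ * (‖planeCoord z‖ ^ 2 - h ^ 2) + 2 * h * Real.cos θ * planeCoord z 0 < 0 ↔ _
  rw [planeCoord.norm_map, planeCoord_zero, circleFun, Complex.normSq_eq_norm_sq]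

lemma mem_arcOtherSide {h θ : ℝ} (z : ℂ) : planeCoord z ∈ arcOtherSide h θ ↔ 0 < circleFun h θ z := by
  change 0 < Real.sin θ * (‖planeCoord z‖ ^ 2 - h ^ 2) + 2 * h * Real.cos θ * planeCoord z 0 ↔ _
  rw [planeCoord.norm_map, planeCoord_zero, circleFun, Complex.normSq_eq_norm_sq]

lemma modelDoubleBubble_eq {h θ : ℝ} (hh : 0 < h) (hθ : |θ| < Real.pi / 3) :
    modelDoubleBubble h θ =
      (planeCoord '' leftChamber h θ, planeCoord '' rightChamber h θ) := by
  have hb := abs_lt.1 hθ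
  have hp := Real.pi_pos
  have hs1 : 0 < Real.sin (2 * Real.pi / 3 - θ) :=
    Real.sin_pos_of_pos_of_lt_pi (by linarith) (by linarith)
  have hs2 : 0 < Real.sin (2 * Real.pi / 3 + θ) :=
    Real.sin_pos_of_pos_of_lt_pi (by linarith) (by linarith)
  have img (A : Set ℂ) (B : Set Plane) (hAB : ∀ z, planeCoord z ∈ B ↔ z ∈ A) : B = planeCoord '' A := by
    ext x
    constructor
    · intro hx
      refine ⟨planeCoord.symm x, ?_, planeCoord.apply_symm_apply x⟩
      rw [← hAB, planeCoord.apply_symm_apply]; exact hx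
    · rintro ⟨z, hz, rfl⟩
      exact (hAB z).2 hz
  apply Prod.ext
  · apply img
    intro z
    refine and_congr ?_ (mem_arcSide z)
    rw [← mem_ball_iff_circleFun hh hs1, mem_ball_iff_norm, ← planeCoord_ofReal, ← map_sub,
      planeCoord.norm_map, ← norm_refl, refl_sub]
    congr! 3
    rw [refl_ofReal, arcCenter]
  · apply img
    intro z
    refine and_congr ?_ ?_
    · rw [sub_neg_eq_add, refl_refl, ← mem_ball_iff_circleFun hh hs2, mem_ball_iff_norm,
        ← planeCoord_ofReal, ← map_sub, planeCoord.norm_map, arcCenter]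
    · rw [mem_arcOtherSide, circleFun_refl, neg_neg, neg_neg_iff_pos]

/-- The model double bubble in the position given by an isometry. -/
def placed (O : ℂ ≃ₗᵢ[ℝ] Plane) (v : Plane) (h θ : ℝ) : Chambers :=
  (similarity O v 1 one_ne_zero '' leftChamber h θ, similarity O v 1 one_ne_zero '' rightChamber h θ)

/-- A surjective isometry of a real normed space is affine (Mazur–Ulam), so it splits into a
translation and a linear isometry. -/
lemma IsStandardDoubleBubble.exists_placed {E₀ : Chambers} (H : IsStandardDoubleBubble E₀) :
    ∃ (h θ : ℝ) (O : ℂ ≃ₗᵢ[ℝ] Plane) (v : Plane), 0 < h ∧ |θ| < Real.pi / 3 ∧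
      E₀ = placed O v h θ := by
  obtain ⟨h, θ, g, hh, hθ, rfl⟩ := H
  refine ⟨h, θ, planeCoord.trans g.toRealLinearIsometryEquiv, g 0, hh, hθ, ?_⟩
  rw [modelDoubleBubble_eq hh hθ, isometryImage, placed, image_image, image_image]
  congr 2 <;>
  · ext1 z
    simp [similarity_apply, IsometryEquiv.toRealLinearIsometryEquiv_apply]

/-! ### The image of the boundary under `f`, normalised by a similarity. -/

section Image

variable {O : ℂ ≃ₗᵢ[ℝ] Plane} {v : Plane}

lemma exists_image_curve {S : Set Plane} {f : Plane → Plane} (hf : IsC11On S f) {η : ℝ}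
    (h0 : ∀ x ∈ S, ‖f x - x‖ ≤ η)
    (hη : ∀ x ∈ S, ‖tangentialGradient S (fun x => f x - x) x‖ ≤ η) {γ : ℝ → ℂ}
    (hγ : ContDiff ℝ 1 γ) {a : ℝ} (ha : 0 < a)
    (hS : ∀ s ∈ Icc (-a) a, similarity O v 1 one_ne_zero (γ s) ∈ S) :
    ∃ B : ℝ → ℂ, ContDiff ℝ 1 B ∧ ∀ s ∈ Icc (-a) a,
      similarity O v 1 one_ne_zero (B s) = f (similarity O v 1 one_ne_zero (γ s)) ∧
      ‖B s - γ s‖ ≤ η ∧ ‖deriv B s - deriv γ s‖ ≤ η * ‖deriv γ s‖ := by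
  set σ := similarity O v 1 one_ne_zero with hσ
  have σ_apply (z : ℂ) : σ z = v + O z := by rw [hσ, similarity_apply, one_smul]
  have σ_symm (x : Plane) : σ.symm x = O.symm (x - v) := by
    rw [Homeomorph.symm_apply_eq, σ_apply, O.apply_symm_apply, add_sub_cancel]
  have hΓ : ContDiff ℝ 1 (σ ∘ γ) := (contDiff_similarity one_ne_zero).comp hγ
  have dΓ (s : ℝ) : deriv (σ ∘ γ) s = O (deriv γ s) := by
    have h1 : HasDerivAt (fun s => v + O (γ s)) (O (deriv γ s)) s :=
      ((O.toContinuousLinearEquiv : ℂ →L[ℝ] Plane).hasFDerivAt.comp_hasDerivAt s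
        (contDiff_hasDerivAt hγ s)).const_add v
    have h2 : σ ∘ γ = fun s => v + O (γ s) := funext fun s => σ_apply _
    rw [h2, h1.deriv]
  obtain ⟨D, cD, hD⟩ := exists_hasDerivWithinAt_comp hf hη hΓ ha hS
  obtain ⟨B, cB, hB⟩ := exists_contDiff_extension (β := fun s => O.symm (f (σ (γ s)) - v))
    (D := fun s => O.symm (D s)) ha (O.symm.continuous.comp_continuousOn cD) (fun s hs =>
      (O.symm.toContinuousLinearEquiv : Plane →L[ℝ] ℂ).hasFDerivAt.comp_hasDerivWithinAt s
        ((hD s hs).1.sub_const v))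
  refine ⟨B, cB, fun s hs => ⟨?_, ?_, ?_⟩⟩
  · rw [(hB s hs).1, σ_apply, O.apply_symm_apply, add_sub_cancel]
  · rw [(hB s hs).1, ← O.norm_map, map_sub, O.apply_symm_apply]
    have := h0 _ (hS s hs)
    rwa [σ_apply (γ s), ← sub_sub, ← σ_apply (γ s)] at this
  · rw [(hB s hs).2, ← O.norm_map, map_sub, O.apply_symm_apply, ← dΓ, ← O.norm_map (deriv γ s), ← dΓ]
    exact (hD s hs).2

/-- The similarity that maps `±ih` to `p` and `q` is close to the identity. -/
lemma norm_similarity_sub_le {h η : ℝ} (hh : 0 < h) {p q : ℂ} (hp : ‖p - h * Complex.I‖ ≤ η)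
    (hq : ‖q + h * Complex.I‖ ≤ η) :
    ‖(p - q) / (2 * (h * Complex.I)) - 1‖ ≤ η / h ∧ ‖(p + q) / 2‖ ≤ η := by
  have hne' : (h : ℂ) ≠ 0 := by exact_mod_cast hh.ne'
  have hn : ‖(h : ℂ) * Complex.I‖ = h := by simp [abs_of_pos hh]
  constructor
  · have : (p - q) / (2 * (h * Complex.I)) - 1 =
        ((p - h * Complex.I) - (q + h * Complex.I)) / (2 * (h * Complex.I)) := by
      field_simp; ring
    rw [this, norm_div, norm_mul, hn, Complex.norm_ofNat, div_le_div_iff₀ (by positivity) hh]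
    have := norm_sub_le (p - h * Complex.I) (q + h * Complex.I)
    nlinarith
  · have : (p + q) / 2 = ((p - h * Complex.I) + (q + h * Complex.I)) / 2 := by ring
    rw [this, norm_div, Complex.norm_ofNat, div_le_iff₀ two_pos]
    have := norm_add_le (p - h * Complex.I) (q + h * Complex.I)
    linarith

/-- Undoing `z ↦ w z + v₀` costs errors linear in `η`. The factor 2 bounds `|w⁻¹|`, as `η ≤ h / 2`
gives `|w - 1| ≤ 1 / 2`. -/
lemma isC1Close_normalize {h η M a : ℝ} (hh : 0 < h) (hη : 0 ≤ η) (hηh : η ≤ h / 2) {w v₀ : ℂ}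
    (hw : ‖w - 1‖ ≤ η / h) (hv : ‖v₀‖ ≤ η) {B γ : ℝ → ℂ} (hB : ContDiff ℝ 1 B)
    (h0 : ∀ s ∈ Icc (-a) a, ‖B s - γ s‖ ≤ η)
    (h1 : ∀ s ∈ Icc (-a) a, ‖deriv B s - deriv γ s‖ ≤ η * ‖deriv γ s‖)
    (hM : ∀ s ∈ Icc (-a) a, ‖γ s‖ ≤ M ∧ ‖deriv γ s‖ ≤ M) :
    IsC1Close (fun s => w⁻¹ * (B s - v₀)) γ a ((4 + 2 * M / h + 2 * M) * η) := by
  have hw2 : 1 / 2 ≤ ‖w‖ := by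
    have h2 : η / h ≤ 1 / 2 := by rw [div_le_iff₀ hh]; linarith
    have := norm_sub_norm_le (1 : ℂ) (1 - w)
    rw [norm_one, norm_sub_rev, sub_sub_cancel] at this
    linarith
  have hw0 : w ≠ 0 := fun e => by rw [e, norm_zero] at hw2; norm_num at hw2
  have hinv : ‖w⁻¹‖ ≤ 2 := by
    rw [norm_inv, inv_le_comm₀ (by linarith) two_pos]; linarith
  intro s hs
  obtain ⟨m0, m1⟩ := hM s hs
  have hM0 : 0 ≤ M := (norm_nonneg _).trans m0
  constructor
  · have e : w⁻¹ * (B s - v₀) - γ s = w⁻¹ * ((B s - γ s) - v₀ - (w - 1) * γ s) := by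
      field_simp; ring
    have n1 : ‖(w - 1) * γ s‖ ≤ η / h * M := by
      rw [norm_mul]; exact mul_le_mul hw m0 (norm_nonneg _) (by positivity)
    have n2 : ‖(B s - γ s) - v₀ - (w - 1) * γ s‖ ≤ η + η + η / h * M :=
      (norm_sub_le _ _).trans (add_le_add ((norm_sub_le _ _).trans (add_le_add (h0 s hs) hv)) n1)
    rw [e, norm_mul]
    refine (mul_le_mul hinv n2 (norm_nonneg _) two_pos.le).trans ?_
    have : 2 * (η + η + η / h * M) = (4 + 2 * M / h) * η := by ring
    nlinarith [mul_nonneg hM0 hη]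
  · have hd : HasDerivAt (fun s => w⁻¹ * (B s - v₀)) (w⁻¹ * deriv B s) s :=
      ((contDiff_hasDerivAt hB s).sub_const v₀).const_mul _
    rw [hd.deriv]
    have e : w⁻¹ * deriv B s - deriv γ s = w⁻¹ * ((deriv B s - deriv γ s) - (w - 1) * deriv γ s) := by
      field_simp; ring
    have n1 : ‖(w - 1) * deriv γ s‖ ≤ η / h * M := by
      rw [norm_mul]; exact mul_le_mul hw m1 (norm_nonneg _) (by positivity)
    have n2 : ‖(deriv B s - deriv γ s) - (w - 1) * deriv γ s‖ ≤ η * M + η / h * M :=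
      (norm_sub_le _ _).trans
        (add_le_add ((h1 s hs).trans (mul_le_mul_of_nonneg_left m1 hη)) n1)
    rw [e, norm_mul]
    refine (mul_le_mul hinv n2 (norm_nonneg _) two_pos.le).trans ?_
    have : 2 * (η * M + η / h * M) = (2 * M / h + 2 * M) * η := by ring
    nlinarith

/-- Polar decomposition of `w`: the rotation `w / |w|` is absorbed into the isometry, and the
modulus becomes the ratio of the similarity. -/
lemma similarity_comp {O : ℂ ≃ₗᵢ[ℝ] Plane} {v : Plane} {w v₀ : ℂ} (hw : w ≠ 0) :
    ∃ (O' : ℂ ≃ₗᵢ[ℝ] Plane) (v' : Plane), ∀ z, similarity O' v' ‖w‖ (norm_ne_zero_iff.2 hw) z =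
      similarity O v 1 one_ne_zero (w * z + v₀) := by
  have hn : ‖w‖ ≠ 0 := norm_ne_zero_iff.2 hw
  let c : Circle := ⟨w / ‖w‖, mem_sphere_zero_iff_norm.2 (by simp [hn])⟩
  refine ⟨(rotation c).trans O, v + O v₀, fun z => ?_⟩
  rw [similarity_apply, similarity_apply, one_smul, LinearIsometryEquiv.trans_apply, rotation_apply,
    map_add, add_assoc, add_comm (O v₀)]
  congr 3
  change w / ‖w‖ * (‖w‖ • z) = w * z
  rw [Complex.real_smul]
  have : (‖w‖ : ℂ) ≠ 0 := by exact_mod_cast hn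
  field_simp

end Image

section Placed

variable {O : ℂ ≃ₗᵢ[ℝ] Plane} {v : Plane} {h θ : ℝ}

lemma interface_placed :
    interface (placed O v h θ) 0 =
      similarity O v 1 one_ne_zero '' (frontier (leftChamber h θ) ∩ frontier (rightChamber h θ)) ∧
    interface (placed O v h θ) 1 = similarity O v 1 one_ne_zero ''
      closure (frontier (leftChamber h θ) \ frontier (rightChamber h θ)) ∧
    interface (placed O v h θ) 2 = similarity O v 1 one_ne_zero ''
      closure (frontier (rightChamber h θ) \ frontier (leftChamber h θ)) := by
  set σ := similarity O v 1 one_ne_zero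
  refine ⟨?_, ?_, ?_⟩
  · rw [image_inter σ.injective, σ.image_frontier, σ.image_frontier]; rfl
  · rw [σ.image_closure, image_sdiff σ.injective, σ.image_frontier, σ.image_frontier]; rfl
  · rw [σ.image_closure, image_sdiff σ.injective, σ.image_frontier, σ.image_frontier]; rfl

lemma boundary_placed : boundary (placed O v h θ) = similarity O v 1 one_ne_zero ''
    (frontier (leftChamber h θ) ∪ frontier (rightChamber h θ)) := by
  rw [image_union, Homeomorph.image_frontier, Homeomorph.image_frontier]; rfl

lemma interface_subset_boundary {E : Chambers} (k : Fin 3) : interface E k ⊆ boundary E := by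
  have c1 : IsClosed (frontier E.1) := isClosed_frontier
  have c2 : IsClosed (frontier E.2) := isClosed_frontier
  fin_cases k
  · exact inter_subset_left.trans subset_union_left
  · exact (closure_minimal sdiff_subset c1).trans subset_union_left
  · exact (closure_minimal sdiff_subset c2).trans subset_union_right

lemma c1Norm_lt {E : Chambers} {u : Plane → Plane} {η : ℝ} (hη : 0 < η)
    (H : c1Norm E u < ENNReal.ofReal η) : (∀ x ∈ boundary E, ‖u x‖ ≤ η) ∧
      ∀ k, ∀ x ∈ interface E k, ‖tangentialGradient (interface E k) u x‖ ≤ η := by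
  have conv {F : Type} [NormedAddCommGroup F] {y : F} (hy : ‖y‖ₑ ≤ ENNReal.ofReal η) : ‖y‖ ≤ η := by
    rwa [← ofReal_norm, ENNReal.ofReal_le_ofReal_iff hη.le] at hy
  constructor
  · intro x hx
    apply conv
    refine le_trans ?_ (le_self_add.trans H.le)
    exact le_iSup₂ (f := fun x (_ : x ∈ boundary E) => ‖u x‖ₑ) x hx
  · intro k x hx
    apply conv
    refine le_trans ?_ (le_add_self.trans H.le)
    exact le_iSup_of_le k (le_iSup₂
      (f := fun x (_ : x ∈ interface E k) => ‖tangentialGradient (interface E k) u x‖ₑ) x hx)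

end Placed

/-- The boundary of a small `C^{1,1}` deformation of a standard double bubble, up to a similarity
that is close to an isometry, consists of three curves with the same endpoints as, and close to, the
arcs of the model. -/
theorem exists_curves {h θ : ℝ} (hh : 0 < h) (hθ : |θ| < Real.pi / 3) :
    ∃ C η₀ : ℝ, 0 < C ∧ 0 < η₀ ∧ ∀ η : ℝ, 0 < η → η ≤ η₀ →
      ∀ (O : ℂ ≃ₗᵢ[ℝ] Plane) (v : Plane) (E : Chambers) (f : Plane → Plane),
      IsC11Diffeo (placed O v h θ) E f →
      c1Norm (placed O v h θ) (fun x => f x - x) < ENNReal.ofReal η →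
      ∃ (r : ℝ) (hr : 0 < r) (O' : ℂ ≃ₗᵢ[ℝ] Plane) (v' : Plane) (β₁ β₀ β₂ : ℝ → ℂ),
        |r - 1| ≤ C * η ∧ ContDiff ℝ 1 β₁ ∧ ContDiff ℝ 1 β₀ ∧ ContDiff ℝ 1 β₂ ∧
        IsC1Close β₁ (leftArc h θ) (2 * Real.pi / 3 - θ) (C * η) ∧
        IsC1Close β₀ (midArc h θ) h (C * η) ∧
        IsC1Close β₂ (rightArc h θ) (2 * Real.pi / 3 + θ) (C * η) ∧
        β₁ (2 * Real.pi / 3 - θ) = h * Complex.I ∧ β₁ (-(2 * Real.pi / 3 - θ)) = -(h * Complex.I) ∧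
        β₀ h = h * Complex.I ∧ β₀ (-h) = -(h * Complex.I) ∧
        β₂ (2 * Real.pi / 3 + θ) = h * Complex.I ∧ β₂ (-(2 * Real.pi / 3 + θ)) = -(h * Complex.I) ∧
        boundary E ⊆ similarity O' v' r hr.ne' '' StarTrio.network β₁ β₀ β₂
          (2 * Real.pi / 3 - θ) h (2 * Real.pi / 3 + θ) := by
  have hp := Real.pi_pos
  have hb := abs_lt.1 hθ
  have hc := cos_pos_of_abs_lt hθ
  have T := starTrio_reference hh hθ
  have bound (γ : ℝ → ℂ) (hγ : ContDiff ℝ 1 γ) (a : ℝ) :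
      ∃ M, ∀ s ∈ Icc (-a) a, ‖γ s‖ ≤ M ∧ ‖deriv γ s‖ ≤ M := by
    obtain ⟨M₁, h₁⟩ := isCompact_Icc.exists_bound_of_continuousOn (s := Icc (-a) a)
      hγ.continuous.continuousOn
    obtain ⟨M₂, h₂⟩ := isCompact_Icc.exists_bound_of_continuousOn (s := Icc (-a) a)
      (contDiff_deriv hγ).continuousOn
    exact ⟨max M₁ M₂, fun s hs => ⟨(h₁ s hs).trans (le_max_left _ _),
      (h₂ s hs).trans (le_max_right _ _)⟩⟩
  have d₁ := T.left.left_contDiff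
  have d₀ := T.left.right.contDiff
  have d₂ := T.right.right.contDiff
  obtain ⟨M₁, hM₁⟩ := bound _ d₁ (2 * Real.pi / 3 - θ)
  obtain ⟨M₀, hM₀⟩ := bound _ d₀ h
  obtain ⟨M₂, hM₂⟩ := bound _ d₂ (2 * Real.pi / 3 + θ)
  set M := max (max |M₁| |M₀|) |M₂| with hM
  have l₁ : M₁ ≤ M := (le_abs_self _).trans ((le_max_left _ _).trans (le_max_left _ _))
  have l₀ : M₀ ≤ M := (le_abs_self _).trans ((le_max_right _ _).trans (le_max_left _ _))
  have l₂ : M₂ ≤ M := (le_abs_self _).trans (le_max_right _ _)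
  have hMnn : 0 ≤ M := (abs_nonneg _).trans (le_max_right _ _)
  set C₀ := 4 + 2 * M / h + 2 * M with hC₀
  -- `C₀` controls the normalised curves and `1 / h` the ratio; the bound `η ≤ h / 2` keeps `w` away
  -- from 0.
  refine ⟨C₀ + 1 / h, h / 2, by positivity, by positivity, ?_⟩
  intro η hη hηh O v E f hf hnorm
  obtain ⟨n0, n1⟩ := c1Norm_lt hη hnorm
  obtain ⟨-, hbij, hC11, -⟩ := hf
  set σ := similarity O v 1 one_ne_zero with hσ
  obtain ⟨i0, i1, i2⟩ := interface_placed (O := O) (v := v) (h := h) (θ := θ)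
  have curve (k : Fin 3) (γ : ℝ → ℂ) (hγ : ContDiff ℝ 1 γ) (a : ℝ) (ha : 0 < a)
      (hmem : σ '' (γ '' Icc (-a) a) ⊆ interface (placed O v h θ) k) :=
    exists_image_curve (O := O) (v := v) (hC11 k) (fun x hx => n0 x (interface_subset_boundary k hx))
      (n1 k) hγ ha fun s hs => hmem ⟨_, ⟨s, hs, rfl⟩, rfl⟩
  obtain ⟨B₁, cB₁, hB₁⟩ := curve 1 _ d₁ _ (by linarith : 0 < 2 * Real.pi / 3 - θ)
    (by rw [i1]; exact image_mono (leftArc_subset hh hθ))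
  obtain ⟨B₀, cB₀, hB₀⟩ := curve 0 _ d₀ _ hh
    (by rw [i0]; exact image_mono (midArc_subset hh hθ))
  obtain ⟨B₂, cB₂, hB₂⟩ := curve 2 _ d₂ _ (by linarith : 0 < 2 * Real.pi / 3 + θ)
    (by rw [i2]; exact image_mono (rightArc_subset hh hθ))
  set p := σ.symm (f (σ (h * Complex.I))) with hpdef
  set q := σ.symm (f (σ (-(h * Complex.I)))) with hqdef
  have top {B γ : ℝ → ℂ} {a : ℝ} (ha : 0 < a) (hB : ∀ s ∈ Icc (-a) a, σ (B s) = f (σ (γ s)) ∧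
      ‖B s - γ s‖ ≤ η ∧ ‖deriv B s - deriv γ s‖ ≤ η * ‖deriv γ s‖) (ht : γ a = h * Complex.I) :
      B a = p := by
    rw [hpdef, Homeomorph.eq_symm_apply, (hB a ⟨by linarith, le_rfl⟩).1, ht]
  have bot {B γ : ℝ → ℂ} {a : ℝ} (ha : 0 < a) (hB : ∀ s ∈ Icc (-a) a, σ (B s) = f (σ (γ s)) ∧
      ‖B s - γ s‖ ≤ η ∧ ‖deriv B s - deriv γ s‖ ≤ η * ‖deriv γ s‖) (ht : γ (-a) = -(h * Complex.I)) :
      B (-a) = q := by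
    rw [hqdef, Homeomorph.eq_symm_apply, (hB (-a) ⟨le_rfl, by linarith⟩).1, ht]
  have t₀ := top hh hB₀ T.left.right_top
  have b₀ := bot hh hB₀ T.left.right_bot
  have t₁ := top T.left.left.pos hB₁ T.left.left_top
  have b₁ := bot T.left.left.pos hB₁ T.left.left_bot
  have t₂ := top T.right.right.pos hB₂ T.right.right_top
  have b₂ := bot T.right.right.pos hB₂ T.right.right_bot
  have hpη : ‖p - h * Complex.I‖ ≤ η := by
    have := (hB₀ h ⟨by linarith, le_rfl⟩).2.1
    rwa [t₀, T.left.right_top] at this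
  have hqη : ‖q + h * Complex.I‖ ≤ η := by
    have := (hB₀ (-h) ⟨le_rfl, by linarith⟩).2.1
    rwa [b₀, T.left.right_bot, sub_neg_eq_add] at this
  obtain ⟨hw, hv⟩ := norm_similarity_sub_le hh hpη hqη
  -- The map `z ↦ w z + v₀` sends `ih` and `-ih` to the images `p` and `q` of the two vertices.
  set w := (p - q) / (2 * (h * Complex.I)) with hwdef
  set v₀ := (p + q) / 2 with hv₀
  have hηh' : η / h ≤ 1 / 2 := by rw [div_le_iff₀ hh]; linarith
  have hw0 : w ≠ 0 := fun e => by
    rw [e, zero_sub, norm_neg, norm_one] at hw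
    linarith
  have hne : (h : ℂ) ≠ 0 := by exact_mod_cast hh.ne'
  have ep : w⁻¹ * (p - v₀) = h * Complex.I := by
    have h2 : w * (h * Complex.I) = p - v₀ := by
      rw [hwdef, hv₀]; field_simp; ring
    rw [← h2, inv_mul_cancel_left₀ hw0]
  have eq' : w⁻¹ * (q - v₀) = -(h * Complex.I) := by
    have h2 : w * -(h * Complex.I) = q - v₀ := by
      rw [hwdef, hv₀]; field_simp; ring
    rw [← h2, inv_mul_cancel_left₀ hw0]
  obtain ⟨O', v', hO'⟩ := similarity_comp (O := O) (v := v) (v₀ := v₀) hw0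
  have close {B γ : ℝ → ℂ} {a M' : ℝ} (hM' : M' ≤ M) (cB : ContDiff ℝ 1 B)
      (hB : ∀ s ∈ Icc (-a) a, σ (B s) = f (σ (γ s)) ∧
      ‖B s - γ s‖ ≤ η ∧ ‖deriv B s - deriv γ s‖ ≤ η * ‖deriv γ s‖)
      (hb : ∀ s ∈ Icc (-a) a, ‖γ s‖ ≤ M' ∧ ‖deriv γ s‖ ≤ M') :
      IsC1Close (fun s => w⁻¹ * (B s - v₀)) γ a ((C₀ + 1 / h) * η) := by
    refine (isC1Close_normalize hh hη.le hηh hw hv cB (fun s hs => (hB s hs).2.1)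
      (fun s hs => (hB s hs).2.2) (M := M) fun s hs => ⟨(hb s hs).1.trans hM', (hb s hs).2.trans hM'⟩).mono ?_
    have : 0 ≤ 1 / h * η := by positivity
    rw [add_mul]
    linarith
  have smooth {B : ℝ → ℂ} (cB : ContDiff ℝ 1 B) : ContDiff ℝ 1 fun s => w⁻¹ * (B s - v₀) :=
    contDiff_const.mul (cB.sub contDiff_const)
  refine ⟨‖w‖, norm_pos_iff.2 hw0, O', v', fun s => w⁻¹ * (B₁ s - v₀), fun s => w⁻¹ * (B₀ s - v₀),
    fun s => w⁻¹ * (B₂ s - v₀), ?_, smooth cB₁, smooth cB₀, smooth cB₂, close l₁ cB₁ hB₁ hM₁,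
    close l₀ cB₀ hB₀ hM₀, close l₂ cB₂ hB₂ hM₂, by simp only [t₁, ep], by simp only [b₁, eq'],
    by simp only [t₀, ep], by simp only [b₀, eq'], by simp only [t₂, ep], by simp only [b₂, eq'], ?_⟩
  · have := abs_norm_sub_norm_le w 1
    rw [norm_one] at this
    refine this.trans (hw.trans ?_)
    have : 0 ≤ C₀ * η := by positivity
    rw [add_mul, one_div_mul_eq_div]
    linarith
  · rw [← hbij.image_eq, boundary_placed]
    rintro _ ⟨_, ⟨z, hz, rfl⟩, rfl⟩
    have mem {B γ : ℝ → ℂ} {a : ℝ} (hB : ∀ s ∈ Icc (-a) a, σ (B s) = f (σ (γ s)) ∧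
        ‖B s - γ s‖ ≤ η ∧ ‖deriv B s - deriv γ s‖ ≤ η * ‖deriv γ s‖) {s : ℝ} (hs : s ∈ Icc (-a) a) :
        similarity O' v' ‖w‖ (norm_ne_zero_iff.2 hw0) (w⁻¹ * (B s - v₀)) = f (σ (γ s)) := by
      rw [hO', mul_inv_cancel_left₀ hw0, sub_add_cancel, (hB s hs).1]
    rcases frontier_chambers_subset hh hθ hz with (⟨s, hs, rfl⟩ | ⟨s, hs, rfl⟩) | ⟨s, hs, rfl⟩
    · exact ⟨_, Or.inl (Or.inl ⟨s, hs, rfl⟩), mem hB₁ hs⟩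
    · exact ⟨_, Or.inl (Or.inr ⟨s, hs, rfl⟩), mem hB₀ hs⟩
    · exact ⟨_, Or.inr ⟨s, hs, rfl⟩, mem hB₂ hs⟩

/-! ### Inequalities for integrals on an interval -/

/-- The quadratic polynomial `t ↦ ∫ (t f + g)²` is nonnegative, so its discriminant is not positive.
-/
lemma sq_integral_mul_le {f g : ℝ → ℝ} (hf : Continuous f) (hg : Continuous g) {a b : ℝ}
    (hab : a ≤ b) : (∫ s in a..b, f s * g s) ^ 2 ≤ (∫ s in a..b, f s ^ 2) * ∫ s in a..b, g s ^ 2 := by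
  have key (t : ℝ) : 0 ≤ (∫ s in a..b, f s ^ 2) * (t * t) + (2 * ∫ s in a..b, f s * g s) * t +
      ∫ s in a..b, g s ^ 2 := by
    have h0 : 0 ≤ ∫ s in a..b, (t * f s + g s) ^ 2 :=
      intervalIntegral.integral_nonneg hab fun _ _ => sq_nonneg _
    have e : ∫ s in a..b, (t * f s + g s) ^ 2 = ∫ s in a..b,
        ((t * t) * f s ^ 2 + (2 * t) * (f s * g s) + g s ^ 2) := by
      congr 1; ext s; ring
    rw [e, intervalIntegral.integral_add ((by fun_prop : Continuous _).intervalIntegrable _ _)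
      ((by fun_prop : Continuous _).intervalIntegrable _ _),
      intervalIntegral.integral_add ((by fun_prop : Continuous _).intervalIntegrable _ _)
      ((by fun_prop : Continuous _).intervalIntegrable _ _),
      intervalIntegral.integral_const_mul, intervalIntegral.integral_const_mul] at h0
    linarith
  have := discrim_le_zero key
  rw [discrim] at this
  linarith

lemma deriv_continuous_real {f : ℝ → ℝ} (hf : ContDiff ℝ 1 f) : Continuous (deriv f) :=
  hf.continuous_deriv_one

lemma hasDerivAt_real {f : ℝ → ℝ} (hf : ContDiff ℝ 1 f) (s : ℝ) : HasDerivAt f (deriv f s) s :=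
  (hf.differentiable one_ne_zero s).hasDerivAt

/-- The one-dimensional Poincaré inequality. -/
lemma sq_le_integral_deriv_sq {f : ℝ → ℝ} (hf : ContDiff ℝ 1 f) {a : ℝ} (h0 : f (-a) = 0) {s : ℝ}
    (hs : s ∈ Icc (-a) a) : f s ^ 2 ≤ 2 * a * ∫ t in (-a)..a, deriv f t ^ 2 := by
  have c := deriv_continuous_real hf
  have e : ∫ t in (-a)..s, 1 * deriv f t = f s := by
    simp only [one_mul]
    rw [intervalIntegral.integral_deriv_eq_sub' f rfl
      (fun x _ => (hasDerivAt_real hf x).differentiableAt) c.continuousOn, h0, sub_zero]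
  have h1 := sq_integral_mul_le (f := fun _ => 1) continuous_const c hs.1
  rw [e] at h1
  simp only [one_pow, intervalIntegral.integral_const, smul_eq_mul, mul_one] at h1
  have h2 : ∫ t in (-a)..s, deriv f t ^ 2 ≤ ∫ t in (-a)..a, deriv f t ^ 2 := by
    apply intervalIntegral.integral_mono_interval le_rfl hs.1 hs.2
    · exact Eventually.of_forall fun t => sq_nonneg _
    · exact (by fun_prop : Continuous _).intervalIntegrable _ _
  have h3 : 0 ≤ ∫ t in (-a)..s, deriv f t ^ 2 :=
    intervalIntegral.integral_nonneg hs.1 fun _ _ => sq_nonneg _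
  refine h1.trans ?_
  exact mul_le_mul (by linarith [hs.2]) h2 h3 (by linarith [hs.1, hs.2])

lemma integral_sq_le {f : ℝ → ℝ} (hf : ContDiff ℝ 1 f) {a : ℝ} (ha : 0 ≤ a) (h0 : f (-a) = 0) :
    ∫ t in (-a)..a, f t ^ 2 ≤ 4 * a ^ 2 * ∫ t in (-a)..a, deriv f t ^ 2 := by
  have c := hf.continuous
  have h1 := intervalIntegral.integral_mono_on (by linarith : -a ≤ a)
    ((by fun_prop : Continuous fun t => f t ^ 2).intervalIntegrable _ _)
    (intervalIntegrable_const (μ := volume) (c := 2 * a * ∫ t in (-a)..a, deriv f t ^ 2))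
    fun s hs => sq_le_integral_deriv_sq hf h0 hs
  refine h1.trans (le_of_eq ?_)
  simp only [intervalIntegral.integral_const, smul_eq_mul]
  ring

lemma integral_abs_le {f : ℝ → ℝ} (hf : ContDiff ℝ 1 f) {a : ℝ} (ha : 0 ≤ a) (h0 : f (-a) = 0) :
    ∫ t in (-a)..a, |f t| ≤ 2 * a * √(2 * a * ∫ t in (-a)..a, deriv f t ^ 2) := by
  have c := hf.continuous
  have h1 := intervalIntegral.integral_mono_on (by linarith : -a ≤ a)
    ((by fun_prop : Continuous fun t => |f t|).intervalIntegrable _ _)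
    (intervalIntegrable_const (μ := volume) (c := √(2 * a * ∫ t in (-a)..a, deriv f t ^ 2)))
    fun s hs => Real.abs_le_sqrt (sq_le_integral_deriv_sq hf h0 hs)
  refine h1.trans (le_of_eq ?_)
  simp only [intervalIntegral.integral_const, smul_eq_mul]
  ring

/-- Wirtinger's inequality for periodic functions of mean zero. -/
theorem wirtinger {f : ℝ → ℝ} (hf : ContDiff ℝ 1 f) {a b : ℝ} (hab : a < b) (hper : f a = f b)
    (hmean : ∫ t in a..b, f t = 0) :
    (2 * Real.pi) ^ 2 * ∫ t in a..b, f t ^ 2 ≤ (b - a) ^ 2 * ∫ t in a..b, deriv f t ^ 2 := by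
  have c := hf.continuous
  have c' := deriv_continuous_real hf
  have memLp (g : ℝ → ℝ) (hg : Continuous g) :
      MemLp (fun t => (g t : ℂ)) 2 (volume.restrict (Ioc a b)) := by
    have hc : Continuous fun t => (g t : ℂ) := by fun_prop
    obtain ⟨C, hC⟩ := isCompact_Icc.exists_bound_of_continuousOn (s := Icc a b) hc.continuousOn
    exact MemLp.of_bound hc.aestronglyMeasurable C
      (ae_restrict_of_forall_mem measurableSet_Ioc fun t ht => hC t (Ioc_subset_Icc_self ht))
  have s1 := hasSum_sq_fourierCoeffOn hab (memLp f c)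
  have s2 := hasSum_sq_fourierCoeffOn hab (memLp _ c')
  simp only [Complex.norm_real, Real.norm_eq_abs, sq_abs, smul_eq_mul] at s1 s2
  -- Periodicity removes the boundary term, so differentiation multiplies the modulus of the `n`-th
  -- coefficient by `2π|n| / (b - a)`, and `|n| ≥ 1`. The coefficient with `n = 0` vanishes by the
  -- mean value condition.
  have term (n : ℤ) : (2 * Real.pi) ^ 2 * ‖fourierCoeffOn hab (fun t => (f t : ℂ)) n‖ ^ 2 ≤
      (b - a) ^ 2 * ‖fourierCoeffOn hab (fun t => ((deriv f t : ℝ) : ℂ)) n‖ ^ 2 := by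
    rcases eq_or_ne n 0 with rfl | hn
    · have : fourierCoeffOn hab (fun t => (f t : ℂ)) 0 = 0 := by
        rw [fourierCoeffOn_eq_integral]
        simp [intervalIntegral.integral_ofReal, hmean]
      rw [this]
      simp; positivity
    · have h := fourierCoeffOn_of_hasDerivAt hab hn (f := fun t => (f t : ℂ))
        (f' := fun t => ((deriv f t : ℝ) : ℂ))
        (fun x _ => (hasDerivAt_real hf x).ofReal_comp)
        ((by fun_prop : Continuous fun t => ((deriv f t : ℝ) : ℂ)).intervalIntegrable _ _)
      rw [hper, sub_self, mul_zero, zero_sub] at h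
      have hn2 : (1 : ℝ) ≤ |(n : ℝ)| := by exact_mod_cast Int.one_le_abs hn
      have e : ‖fourierCoeffOn hab (fun t => ((deriv f t : ℝ) : ℂ)) n‖ * (b - a) =
          ‖fourierCoeffOn hab (fun t => (f t : ℂ)) n‖ * (2 * Real.pi * |(n : ℝ)|) := by
        rw [h]
        have hba : ‖((b : ℂ) - a)‖ = b - a := by
          rw [← Complex.ofReal_sub, Complex.norm_real, Real.norm_of_nonneg (by linarith)]
        simp only [norm_mul, norm_div, norm_neg, norm_one, Complex.norm_ofNat, Complex.norm_real,
          Complex.norm_I, Complex.norm_intCast, Real.norm_of_nonneg Real.pi_pos.le, mul_one, hba]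
        have := Real.pi_pos
        field_simp
      have h3 : ‖fourierCoeffOn hab (fun t => (f t : ℂ)) n‖ * (2 * Real.pi) ≤
          ‖fourierCoeffOn hab (fun t => ((deriv f t : ℝ) : ℂ)) n‖ * (b - a) := by
        rw [e]
        have := Real.pi_pos
        exact mul_le_mul_of_nonneg_left (le_mul_of_one_le_right (by positivity) hn2) (norm_nonneg _)
      have h4 := pow_le_pow_left₀ (by have := Real.pi_pos; positivity) h3 2
      nlinarith
  have h := hasSum_le term (s1.mul_left _) (s2.mul_left _)
  have hba : 0 < b - a := by linarith
  have h5 := mul_le_mul_of_nonneg_left h hba.le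
  field_simp at h5
  linarith

/-! ### The quadratic form of an outer arc -/

lemma sin_sub_mul_cos_pos {θ : ℝ} (h0 : 0 < θ) (hπ : θ < Real.pi) : 0 < Real.sin θ - θ * Real.cos θ := by
  have hs := Real.sin_pos_of_pos_of_lt_pi h0 hπ
  rcases lt_or_ge θ (Real.pi / 2) with h | h
  · have hc : 0 < Real.cos θ := Real.cos_pos_of_mem_Ioo ⟨by linarith, h⟩
    have := Real.lt_tan h0 h
    rw [Real.tan_eq_sin_div_cos, lt_div_iff₀ hc] at this
    linarith
  · have : Real.cos θ ≤ 0 := Real.cos_nonpos_of_pi_div_two_le_of_le h (by linarith)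
    nlinarith

/-- The second variation of the length of an outer arc, in the direction of its area. -/
def outerLambda (θ : ℝ) : ℝ := Real.cos θ / (2 * (Real.sin θ - θ * Real.cos θ))

/-- The function `ψ = cos s - cos θ` solves `ψ'' + ψ = -cos θ`. In the form `∫ v'ψ' - ∫ vψ` it is
therefore orthogonal to every `v` of mean zero that vanishes at the endpoints. -/
lemma integral_deriv_mul_sin {v : ℝ → ℝ} (hv : ContDiff ℝ 1 v) {θ : ℝ} (h1 : v (-θ) = 0)
    (h2 : v θ = 0) : (∫ s in (-θ)..θ, deriv v s * -Real.sin s) -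
      (∫ s in (-θ)..θ, v s * (Real.cos s - Real.cos θ)) = Real.cos θ * ∫ s in (-θ)..θ, v s := by
  have c := hv.continuous
  have c' := deriv_continuous_real hv
  have h := intervalIntegral.integral_deriv_mul_eq_sub (a := -θ) (b := θ) (u := v)
    (v := fun s => -Real.sin s) (u' := deriv v) (v' := fun s => -Real.cos s)
    (fun x _ => hasDerivAt_real hv x) (fun x _ => (Real.hasDerivAt_sin x).neg)
    (c'.intervalIntegrable _ _) ((by fun_prop : Continuous _).intervalIntegrable _ _)
  rw [h1, h2, zero_mul, zero_mul, sub_zero] at h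
  rw [intervalIntegral.integral_add ((by fun_prop : Continuous _).intervalIntegrable _ _)
    ((by fun_prop : Continuous _).intervalIntegrable _ _)] at h
  have e : ∫ s in (-θ)..θ, v s * (Real.cos s - Real.cos θ) =
      -(∫ s in (-θ)..θ, v s * -Real.cos s) - Real.cos θ * ∫ s in (-θ)..θ, v s := by
    rw [← intervalIntegral.integral_neg, ← intervalIntegral.integral_const_mul,
      ← intervalIntegral.integral_sub ((by fun_prop : Continuous _).intervalIntegrable _ _)
        ((by fun_prop : Continuous _).intervalIntegrable _ _)]
    congr 1; ext s; ring
  rw [e]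
  linarith

lemma integral_cos_sub (θ : ℝ) : ∫ s in (-θ)..θ, (Real.cos s - Real.cos θ) =
    2 * (Real.sin θ - θ * Real.cos θ) := by
  rw [intervalIntegral.integral_sub (Real.continuous_cos.intervalIntegrable _ _)
    intervalIntegrable_const, integral_cos, intervalIntegral.integral_const]
  simp; ring

-- Write `ρ = κψ + v` with `ψ = cos s - cos θ` and `v` of mean zero. The mixed terms vanish, since
-- `ψ` solves the Euler–Lagrange equation. On `v`, Wirtinger's inequality on an interval of length
-- `2θ < 2π` leaves the positive fraction `1 - (θ/π)²` of `∫ v'²`. On `κψ` the form equals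
-- `outerLambda θ` times the square of the integral.
set_option maxHeartbeats 1000000 in
theorem outer_quadratic_form {θ : ℝ} (h0 : 0 < θ) (hπ : θ < Real.pi) {ε : ℝ} (hε : 0 < ε) :
    ∃ c > 0, ∀ ρ : ℝ → ℝ, ContDiff ℝ 1 ρ → ρ (-θ) = 0 → ρ θ = 0 →
      (outerLambda θ - ε) * (∫ s in (-θ)..θ, ρ s) ^ 2 + c * ∫ s in (-θ)..θ, deriv ρ s ^ 2 ≤
        (∫ s in (-θ)..θ, deriv ρ s ^ 2) - ∫ s in (-θ)..θ, ρ s ^ 2 := by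
  set I := 2 * (Real.sin θ - θ * Real.cos θ) with hI
  have hI0 : 0 < I := by have := sin_sub_mul_cos_pos h0 hπ; positivity
  set Pψ := ∫ s in (-θ)..θ, Real.sin s ^ 2 with hP
  have hP0 : 0 ≤ Pψ := intervalIntegral.integral_nonneg (by linarith) fun _ _ => sq_nonneg _
  set k := 1 - (θ / Real.pi) ^ 2 with hk
  have hk0 : 0 < k := by
    have : θ / Real.pi < 1 := (div_lt_one Real.pi_pos).2 hπ
    have h2 : 0 < θ / Real.pi := div_pos h0 Real.pi_pos
    have : (θ / Real.pi) ^ 2 < 1 := pow_lt_one₀ h2.le this two_ne_zero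
    linarith
  -- Here `∫ ρ'² ≤ 2 ∫ v'² + 2κ² ∫ sin²`. The first entry charges the `v` part to the Wirtinger gap,
  -- the second charges the `ψ` part to the surplus `ε (∫ ρ)²`.
  refine ⟨min (k / 2) (ε * I ^ 2 / (2 * (Pψ + 1))), by positivity, fun ρ hρ hl hr => ?_⟩
  set m := ∫ s in (-θ)..θ, ρ s with hm
  set κ := m / I with hκ
  have hmκ : m = κ * I := by rw [hκ]; field_simp
  let ψ : ℝ → ℝ := fun s => Real.cos s - Real.cos θ
  have cψ : ContDiff ℝ 1 ψ := Real.contDiff_cos.sub contDiff_const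
  have dψ (s : ℝ) : deriv ψ s = -Real.sin s := ((Real.hasDerivAt_cos s).sub_const _).deriv
  let v : ℝ → ℝ := fun s => ρ s - κ * ψ s
  have cv : ContDiff ℝ 1 v := hρ.sub (contDiff_const.mul cψ)
  have dv (s : ℝ) : deriv v s = deriv ρ s + κ * Real.sin s := by
    have := ((hasDerivAt_real hρ s).sub ((hasDerivAt_real cψ s).const_mul κ)).deriv
    rw [dψ] at this
    exact this.trans (by ring)
  have c := hρ.continuous
  have c' := deriv_continuous_real hρ
  have cc := cv.continuous
  have cc' := deriv_continuous_real cv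
  have vl : v (-θ) = 0 := by simp [v, ψ, hl]
  have vr : v θ = 0 := by simp [v, ψ, hr]
  have vm : ∫ s in (-θ)..θ, v s = 0 := by
    rw [intervalIntegral.integral_sub (c.intervalIntegrable _ _)
      ((by fun_prop : Continuous _).intervalIntegrable _ _), intervalIntegral.integral_const_mul,
      integral_cos_sub, ← hI, ← hm, hmκ, sub_self]
  have w := wirtinger cv (by linarith : -θ < θ) (vl.trans vr.symm) vm
  have hw : k * (∫ s in (-θ)..θ, deriv v s ^ 2) ≤
      (∫ s in (-θ)..θ, deriv v s ^ 2) - ∫ s in (-θ)..θ, v s ^ 2 := by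
    have hp := Real.pi_pos
    have : (∫ s in (-θ)..θ, v s ^ 2) ≤ (θ / Real.pi) ^ 2 * ∫ s in (-θ)..θ, deriv v s ^ 2 := by
      rw [div_pow, div_mul_eq_mul_div, le_div_iff₀ (by positivity)]
      nlinarith
    rw [hk, sub_mul, one_mul]
    linarith
  have x1 := integral_deriv_mul_sin hρ hl hr
  have x2 := integral_deriv_mul_sin (θ := θ) cψ (by simp [ψ]) (by simp [ψ])
  rw [integral_cos_sub, ← hI] at x2
  have i1 : ∫ s in (-θ)..θ, deriv ψ s * -Real.sin s = Pψ := by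
    rw [hP]; congr 1; ext s; rw [dψ]; ring
  have i2 : ∫ s in (-θ)..θ, ψ s * (Real.cos s - Real.cos θ) = ∫ s in (-θ)..θ, ψ s ^ 2 := by
    congr 1; ext s; simp only [ψ]; ring
  rw [i1, i2] at x2
  have e1 : ∫ s in (-θ)..θ, deriv v s ^ 2 = (∫ s in (-θ)..θ, deriv ρ s ^ 2) -
      (2 * κ) * (∫ s in (-θ)..θ, deriv ρ s * -Real.sin s) + κ ^ 2 * Pψ := by
    rw [hP, ← intervalIntegral.integral_const_mul, ← intervalIntegral.integral_const_mul,
      ← intervalIntegral.integral_sub ((by fun_prop : Continuous _).intervalIntegrable _ _)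
        ((by fun_prop : Continuous _).intervalIntegrable _ _),
      ← intervalIntegral.integral_add ((by fun_prop : Continuous _).intervalIntegrable _ _)
        ((by fun_prop : Continuous _).intervalIntegrable _ _)]
    congr 1; ext s; rw [dv]; ring
  have e2 : ∫ s in (-θ)..θ, v s ^ 2 = (∫ s in (-θ)..θ, ρ s ^ 2) -
      (2 * κ) * (∫ s in (-θ)..θ, ρ s * (Real.cos s - Real.cos θ)) +
      κ ^ 2 * ∫ s in (-θ)..θ, ψ s ^ 2 := by
    have cψ' := cψ.continuous
    rw [← intervalIntegral.integral_const_mul, ← intervalIntegral.integral_const_mul,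
      ← intervalIntegral.integral_sub ((by fun_prop : Continuous _).intervalIntegrable _ _)
        ((by fun_prop : Continuous _).intervalIntegrable _ _),
      ← intervalIntegral.integral_add ((by fun_prop : Continuous _).intervalIntegrable _ _)
        ((by fun_prop : Continuous _).intervalIntegrable _ _)]
    congr 1; ext s; simp only [v, ψ]; ring
  have e3 : ∫ s in (-θ)..θ, deriv ρ s ^ 2 ≤
      2 * (∫ s in (-θ)..θ, deriv v s ^ 2) + 2 * κ ^ 2 * Pψ := by
    rw [hP, ← intervalIntegral.integral_const_mul, ← intervalIntegral.integral_const_mul,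
      ← intervalIntegral.integral_add ((by fun_prop : Continuous _).intervalIntegrable _ _)
        ((by fun_prop : Continuous _).intervalIntegrable _ _)]
    apply intervalIntegral.integral_mono_on (by linarith)
      ((by fun_prop : Continuous _).intervalIntegrable _ _)
      ((by fun_prop : Continuous _).intervalIntegrable _ _)
    intro s _
    rw [dv]
    nlinarith [sq_nonneg (deriv ρ s + 2 * (κ * Real.sin s))]
  set D := ∫ s in (-θ)..θ, deriv v s ^ 2 with hD
  set A := ∫ s in (-θ)..θ, deriv ρ s ^ 2 with hA
  have hA0 : 0 ≤ A := intervalIntegral.integral_nonneg (by linarith) fun _ _ => sq_nonneg _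
  have hD0 : 0 ≤ D := intervalIntegral.integral_nonneg (by linarith) fun _ _ => sq_nonneg _
  have hlam : outerLambda θ * m ^ 2 = κ ^ 2 * (Real.cos θ * I) := by
    rw [outerLambda, ← hI, hmκ]; field_simp
  set c₁ := min (k / 2) (ε * I ^ 2 / (2 * (Pψ + 1))) with hc₁
  have hc0 : 0 < c₁ := by positivity
  have hcA : c₁ * A ≤ k * D + ε * m ^ 2 := by
    have b1 : c₁ * (2 * D) ≤ k * D := by
      have h3 : c₁ * 2 ≤ k := by linarith [min_le_left (k / 2) (ε * I ^ 2 / (2 * (Pψ + 1)))]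
      rw [← mul_assoc]
      exact mul_le_mul_of_nonneg_right h3 hD0
    have b2 : c₁ * (2 * κ ^ 2 * Pψ) ≤ ε * m ^ 2 := by
      have h3 : c₁ ≤ ε * I ^ 2 / (2 * (Pψ + 1)) := min_le_right _ _
      rw [le_div_iff₀ (by positivity)] at h3
      have h4 := mul_le_mul_of_nonneg_right h3 (sq_nonneg κ)
      have h5 := mul_nonneg hc0.le (sq_nonneg κ)
      rw [hmκ]
      linarith
    have b3 := mul_le_mul_of_nonneg_left e3 hc0.le
    linarith
  have hsum : (A - ∫ s in (-θ)..θ, ρ s ^ 2) = (D - ∫ s in (-θ)..θ, v s ^ 2) +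
      κ ^ 2 * (Real.cos θ * I) := by
    rw [e1, e2]
    linear_combination 2 * κ * x1 - κ ^ 2 * x2 + 2 * κ * Real.cos θ * hmκ
  rw [hsum, sub_mul, hlam]
  linarith

/-! ### Areas and reparametrisations -/

/-- The signed area between an arc and the vertical axis. -/
def areaFlux (β : ℝ → ℂ) (a : ℝ) : ℝ := ∫ s in (-a)..a, (β s).re * (deriv β s).im

lemma areaFlux_eq_flux (β : ℝ → ℂ) (a : ℝ) :
    areaFlux β a = flux (fun z => (z.re : ℂ)) β (-a) a := by
  simp [areaFlux, flux, cross]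

/-- The horizontal field `z ↦ Re z` has divergence 1. -/
lemma HasBoundary.volume_real {A : Set ℂ} {βl βr : ℝ → ℂ} {al ar : ℝ}
    (hA : HasBoundary A βl βr al ar) : volume.real A = areaFlux βr ar - areaFlux βl al := by
  have hT : ContDiff ℝ 1 fun z : ℂ => (z.re : ℂ) :=
    Complex.ofRealCLM.contDiff.comp Complex.reCLM.contDiff
  have hd (z : ℂ) : divC (fun z : ℂ => (z.re : ℂ)) z = 1 := by
    have : HasFDerivAt (fun z : ℂ => (z.re : ℂ)) (Complex.ofRealCLM.comp Complex.reCLM) z :=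
      (Complex.ofRealCLM.comp Complex.reCLM).hasFDerivAt
    simp [divC, this.fderiv]
  have h := hA _ hT
  simp_rw [hd] at h
  rw [areaFlux_eq_flux, areaFlux_eq_flux, ← h]
  simp

lemma areaFlux_refl {β : ℝ → ℂ} (hβ : ContDiff ℝ 1 β) (a : ℝ) :
    areaFlux (fun s => refl (β s)) a = -areaFlux β a := by
  simp_rw [areaFlux, deriv_refl hβ, refl_re, refl_im, neg_mul]
  rw [intervalIntegral.integral_neg]

lemma arcLength_refl {β : ℝ → ℂ} (hβ : ContDiff ℝ 1 β) (a : ℝ) :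
    arcLength (fun s => refl (β s)) a = arcLength β a := by
  simp_rw [arcLength, deriv_refl hβ, norm_refl]

lemma deriv_smul_curve {β : ℝ → ℂ} (hβ : ContDiff ℝ 1 β) (q s : ℝ) :
    deriv (fun s => q • β s) s = q • deriv β s := ((contDiff_hasDerivAt hβ s).const_smul q).deriv

lemma deriv_comp_real {β : ℝ → ℂ} (hβ : ContDiff ℝ 1 β) {φ : ℝ → ℝ} (hφ : ContDiff ℝ 1 φ) (s : ℝ) :
    deriv (β ∘ φ) s = deriv φ s • deriv β (φ s) :=
  ((contDiff_hasDerivAt hβ (φ s)).scomp s (hasDerivAt_real hφ s)).deriv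

/-- Only the values of `φ` at the endpoints matter: the substitution rule requires no monotonicity.
-/
lemma flux_comp {T : ℂ → ℂ} (hT : Continuous T) {β : ℝ → ℂ} (hβ : ContDiff ℝ 1 β) {φ : ℝ → ℝ}
    (hφ : ContDiff ℝ 1 φ) {a : ℝ} (h1 : φ a = a) (h2 : φ (-a) = -a) :
    flux T (β ∘ φ) (-a) a = flux T β (-a) a := by
  have c := contDiff_deriv hβ
  have c' := hβ.continuous
  have h := intervalIntegral.integral_comp_mul_deriv (a := -a) (b := a) (f := φ) (f' := deriv φ)
    (g := fun s => cross (T (β s)) (deriv β s)) (fun x _ => hasDerivAt_real hφ x)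
    (deriv_continuous_real hφ).continuousOn (by fun_prop)
  rw [h1, h2] at h
  rw [flux, flux, ← h]
  congr 1
  ext s
  rw [deriv_comp_real hβ hφ, cross_smul_right, mul_comm]
  rfl

lemma HasBoundary.comp {A : Set ℂ} {βl βr : ℝ → ℂ} {al ar : ℝ} (hA : HasBoundary A βl βr al ar)
    (cl : ContDiff ℝ 1 βl) (cr : ContDiff ℝ 1 βr) {φl φr : ℝ → ℝ} (hl : ContDiff ℝ 1 φl)
    (hr : ContDiff ℝ 1 φr) (l1 : φl al = al) (l2 : φl (-al) = -al) (r1 : φr ar = ar)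
    (r2 : φr (-ar) = -ar) : HasBoundary A (βl ∘ φl) (βr ∘ φr) al ar := by
  intro T hT
  rw [hA T hT, flux_comp hT.continuous cl hl l1 l2, flux_comp hT.continuous cr hr r1 r2]

lemma HasBoundary.preimage_smul {A : Set ℂ} {βl βr : ℝ → ℂ} {al ar : ℝ}
    (hA : HasBoundary A βl βr al ar) (cl : ContDiff ℝ 1 βl) (cr : ContDiff ℝ 1 βr) {r : ℝ}
    (hr : 0 < r) : HasBoundary ((fun z => r • z) ⁻¹' A) (fun s => r⁻¹ • βl s)
      (fun s => r⁻¹ • βr s) al ar := by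
  intro T hT
  have hT' : ContDiff ℝ 1 fun w => T (r⁻¹ • w) := hT.comp (contDiff_const_smul r⁻¹)
  have hdiv (w : ℂ) : divC (fun w => T (r⁻¹ • w)) w = r⁻¹ * divC T (r⁻¹ • w) := by
    have h1 : HasFDerivAt (fun w : ℂ => r⁻¹ • w) (r⁻¹ • ContinuousLinearMap.id ℝ ℂ) w :=
      (hasFDerivAt_id w).const_smul r⁻¹
    have h2 := ((hT.differentiable one_ne_zero (r⁻¹ • w)).hasFDerivAt.comp w h1).fderiv
    rw [divC, divC]
    change (fderiv ℝ (T ∘ fun w => r⁻¹ • w) w 1).re + (fderiv ℝ (T ∘ fun w => r⁻¹ • w) w Complex.I).im = _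
    rw [h2]
    simp only [ContinuousLinearMap.comp_apply, smul_apply,
      ContinuousLinearMap.id_apply, map_smul, Complex.smul_re, Complex.smul_im, smul_eq_mul]
    ring
  have h1 := Measure.setIntegral_comp_smul_of_pos volume (fun w => divC T (r⁻¹ • w))
    ((fun z => r • z) ⁻¹' A) hr
  simp only [inv_smul_smul₀ hr.ne', Complex.finrank_real_complex] at h1
  have h2 : r • (fun z => r • z) ⁻¹' A = A := by
    rw [preimage_smul₀ hr.ne', smul_inv_smul₀ hr.ne']
  rw [h1, h2]
  have h3 := hA _ hT'
  simp_rw [hdiv, integral_const_mul] at h3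
  have hflux (β : ℝ → ℂ) (hβ : ContDiff ℝ 1 β) (a : ℝ) :
      flux T (fun s => r⁻¹ • β s) (-a) a = r⁻¹ * flux (fun w => T (r⁻¹ • w)) β (-a) a := by
    rw [flux, flux, ← intervalIntegral.integral_const_mul]
    congr 1
    ext s
    rw [deriv_smul_curve hβ, cross_smul_right]
  rw [hflux _ cl, hflux _ cr, ← mul_sub, ← h3, smul_eq_mul]
  field_simp

lemma volume_sweptRegion_le {β₀ β₁ : ℝ → ℂ} (h₀ : ContDiff ℝ 1 β₀) (h₁ : ContDiff ℝ 1 β₁) {a : ℝ}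
    (ha : 0 ≤ a) {g : ℝ → ℝ} (hg : Continuous g) (H : ∀ s ∈ Icc (-a) a, ∀ t ∈ Icc (0 : ℝ) 1,
      |cross (β₁ s - β₀ s) (homotopyDeriv β₀ β₁ s t)| ≤ g s) :
    volume (sweptRegion β₀ β₁ a) ≤ ENNReal.ofReal (∫ s in (-a)..a, g s) :=
  volume_image_homotopyMap_le h₀ h₁ (by linarith) hg H

lemma volume_sweptRegion_smul_le {γ : ℝ → ℂ} (hγ : ContDiff ℝ 1 γ) {a M : ℝ} (ha : 0 ≤ a)
    (hM : ∀ s ∈ Icc (-a) a, ‖γ s‖ ≤ M ∧ ‖deriv γ s‖ ≤ M) {q : ℝ} (hq : |q - 1| ≤ 1) :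
    volume (sweptRegion γ (fun s => q • γ s) a) ≤ ENNReal.ofReal (4 * a * M ^ 2 * |q - 1|) := by
  have hM0 : 0 ≤ M := (norm_nonneg _).trans (hM 0 ⟨by linarith, ha⟩).1
  have hq' : ContDiff ℝ 1 fun s => q • γ s := hγ.const_smul q
  have key : ∀ s ∈ Icc (-a) a, ∀ t ∈ Icc (0 : ℝ) 1,
      |cross (q • γ s - γ s) (homotopyDeriv γ (fun s => q • γ s) s t)| ≤ 2 * M ^ 2 * |q - 1| := by
    intro s hs t ht
    have e1 : q • γ s - γ s = (q - 1) • γ s := by rw [sub_smul, one_smul]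
    have e2 : homotopyDeriv γ (fun s => q • γ s) s t = (1 + t * (q - 1)) • deriv γ s := by
      rw [homotopyDeriv, deriv_smul_curve hγ]
      simp only [Complex.real_smul, Complex.ofReal_add, Complex.ofReal_mul, Complex.ofReal_sub,
        Complex.ofReal_one]
      ring
    rw [e1, e2]
    obtain ⟨h1, h2⟩ := hM s hs
    have h3 : |1 + t * (q - 1)| ≤ 2 := by
      refine (abs_add_le _ _).trans ?_
      rw [abs_one, abs_mul, abs_of_nonneg ht.1]
      have := mul_le_mul ht.2 hq (abs_nonneg _) zero_le_one
      linarith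
    refine (abs_cross_le _ _).trans ?_
    rw [norm_smul, norm_smul, Real.norm_eq_abs, Real.norm_eq_abs]
    have h4 : |q - 1| * ‖γ s‖ ≤ |q - 1| * M := mul_le_mul_of_nonneg_left h1 (abs_nonneg _)
    have h5 : |1 + t * (q - 1)| * ‖deriv γ s‖ ≤ 2 * M :=
      mul_le_mul h3 h2 (norm_nonneg _) two_pos.le
    refine (mul_le_mul h4 h5 (mul_nonneg (abs_nonneg _) (norm_nonneg _))
      (mul_nonneg (abs_nonneg _) hM0)).trans (le_of_eq ?_)
    ring
  have h := volume_sweptRegion_le hγ hq' ha (g := fun _ => 2 * M ^ 2 * |q - 1|) continuous_const key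
  rw [intervalIntegral.integral_const, smul_eq_mul] at h
  refine h.trans (le_of_eq ?_)
  congr 1
  ring

/-- Quantitative stability of the length of an arc under small deformations with fixed endpoints,
in terms of the area `B` that is gained: `κ` is the curvature, `Λ` the second variation. The number
`G` controls the area between the arc and its deformation. -/
def ArcStable (γ : ℝ → ℂ) (a κ Λ : ℝ) : Prop :=
  ∀ ε > 0, ∃ δ > 0, ∃ c > 0, ∀ β : ℝ → ℂ, ContDiff ℝ 1 β → IsC1Close β γ a δ → β a = γ a →
    β (-a) = γ (-a) → ∃ G, 0 ≤ G ∧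
      arcLength γ a + κ * (areaFlux β a - areaFlux γ a) +
        (Λ - ε) / 2 * (areaFlux β a - areaFlux γ a) ^ 2 + c * G ^ 2 ≤ arcLength β a ∧
      ∃ φ : ℝ → ℝ, ContDiff ℝ 1 φ ∧ φ a = a ∧ φ (-a) = -a ∧
        volume (sweptRegion (γ ∘ φ) β a) ≤ ENNReal.ofReal G

/-- The reflection as a linear isometry. -/
def reflIsometry : ℂ ≃ₗᵢ[ℝ] ℂ := Complex.conjLIE.trans (LinearIsometryEquiv.neg ℝ)

lemma reflIsometry_apply (z : ℂ) : reflIsometry z = refl z := rfl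

lemma volume_image_refl (A : Set ℂ) : volume (refl '' A) = volume A := by
  have h := reflIsometry.measurePreserving.measure_preimage_equiv (f := reflIsometry.toMeasurableEquiv) A
  have e : refl '' A = reflIsometry ⁻¹' A := by
    ext z
    constructor
    · rintro ⟨w, hw, rfl⟩
      change refl (refl w) ∈ A
      rwa [refl_refl]
    · intro hz
      exact ⟨refl z, hz, refl_refl z⟩
  rw [e]
  exact h

lemma sweptRegion_refl (β₀ β₁ : ℝ → ℂ) (a : ℝ) :
    sweptRegion (fun s => refl (β₀ s)) (fun s => refl (β₁ s)) a = refl '' sweptRegion β₀ β₁ a := by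
  rw [sweptRegion, sweptRegion, image_image]
  congr 1
  ext1 z
  simp only [homotopyMap, homotopy, refl_add, refl_smul, refl_sub]

/-- The reflection changes the sign of signed areas, hence of the curvature, but leaves lengths,
swept areas and the term of second order unchanged. -/
lemma ArcStable.refl_comp {γ : ℝ → ℂ} {a κ Λ : ℝ} (hγ : ContDiff ℝ 1 γ) (H : ArcStable γ a κ Λ) :
    ArcStable (fun s => refl (γ s)) a (-κ) Λ := by
  intro ε hε
  obtain ⟨δ, hδ, c, hc, h⟩ := H ε hε
  refine ⟨δ, hδ, c, hc, fun β hβ hclose h1 h2 => ?_⟩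
  have e : β = fun s => refl (refl (β s)) := by ext1 s; rw [refl_refl]
  have hβ' := contDiff_refl hβ
  obtain ⟨G, hG, hlen, φ, cφ, φ1, φ2, hsw⟩ := h (fun s => refl (β s)) hβ'
    (by
      have := hclose.refl_comp hβ (contDiff_refl hγ)
      simp only [refl_refl] at this
      exact this)
    (by simp only [h1, refl_refl]) (by simp only [h2, refl_refl])
  refine ⟨G, hG, ?_, φ, cφ, φ1, φ2, ?_⟩
  · rw [arcLength_refl hβ, areaFlux_refl hβ] at hlen
    rw [arcLength_refl hγ, areaFlux_refl hγ]
    refine le_trans (le_of_eq ?_) hlen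
    ring
  · rw [e]
    change volume (sweptRegion (fun s => refl ((γ ∘ φ) s)) (fun s => refl (refl (β s))) a) ≤ _
    rw [sweptRegion_refl, volume_image_refl]
    exact hsw

/-! ### Stability of the outer arcs -/

/-- Logarithmic polar coordinates about the centre. With `Z = ρ + iσ` the speed is `R e^ρ √((1 +
σ')² + ρ'²)`, the area density is `R² e^{2ρ} (1 + σ') / 2`, and fixed endpoints mean that `Z`
vanishes at `±θ`. -/
lemma exists_log_coord {h θ : ℝ} (hh : 0 < h) (h0 : 0 < θ) (hπ : θ < Real.pi) {t : ℝ} (ht : 0 < t) :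
    ∃ δ > 0, ∀ β : ℝ → ℂ, ContDiff ℝ 1 β → IsC1Close β (outerArc h θ) θ δ →
      β θ = outerArc h θ θ → β (-θ) = outerArc h θ (-θ) →
      ∃ Z : ℝ → ℂ, ContDiff ℝ 1 Z ∧ Z θ = 0 ∧ Z (-θ) = 0 ∧ ∀ s ∈ Icc (-θ) θ,
        β s = arcCenter h θ + arcRadius h θ * Complex.exp (Z s + s * Complex.I) ∧
        deriv β s = arcRadius h θ * (Complex.exp (Z s + s * Complex.I) * (deriv Z s + Complex.I)) ∧
        ‖Z s‖ ≤ t ∧ ‖deriv Z s‖ ≤ t := by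
  have hR := arcRadius_pos hh h0 hπ
  set R := arcRadius h θ with hRdef
  set c := arcCenter h θ with hcdef
  have hRc : (R : ℂ) ≠ 0 := by exact_mod_cast hR.ne'
  -- With `d` the minimum, the quotient `q = e^Z` is within `d ≤ 1/2` of 1, so its logarithm is
  -- defined and at most `3d/2`. Moreover `|q'| ≤ 2d` and `|q| ≥ 1/2`, whence `|Z'| ≤ 4d ≤ t`.
  refine ⟨R * min (t / 4) (1 / 2), by positivity, fun β hβ hclose e1 e2 => ?_⟩
  set d := min (t / 4) (1 / 2) with hd
  have hd0 : 0 < d := by positivity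
  have hdt : d ≤ t / 4 := min_le_left _ _
  have hd2 : d ≤ 1 / 2 := min_le_right _ _
  let e : ℝ → ℂ := fun s => Complex.exp (-(s * Complex.I))
  have ne (s : ℝ) : ‖e s‖ = 1 := by
    have : -((s : ℂ) * Complex.I) = ((-s : ℝ) : ℂ) * Complex.I := by push_cast; ring
    simp only [e]
    rw [this, Complex.norm_exp_ofReal_mul_I]
  have ee (s : ℝ) : e s * Complex.exp (s * Complex.I) = 1 := by
    simp only [e]
    rw [← Complex.exp_add, neg_add_cancel, Complex.exp_zero]
  have de (s : ℝ) : HasDerivAt e (e s * -Complex.I) s := by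
    have h1 : HasDerivAt (fun s : ℝ => -((s : ℂ) * Complex.I)) (-Complex.I) s := by
      have h2 : HasDerivAt (fun s : ℝ => (s : ℂ) * Complex.I) Complex.I s := by
        simpa using (Complex.ofRealCLM.hasDerivAt (x := s)).mul_const Complex.I
      exact h2.fun_neg
    exact h1.cexp
  have hγ (s : ℝ) : (outerArc h θ s - c) / R * e s = 1 := by
    rw [outerArc, add_sub_cancel_left, mul_div_cancel_left₀ _ hRc, mul_comm]; exact ee s
  have hγ' (s : ℝ) : deriv (outerArc h θ) s / R * e s = Complex.I := by
    rw [deriv_outerArc, mul_div_cancel_left₀ _ hRc]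
    linear_combination Complex.I * ee s
  let q : ℝ → ℂ := fun s => (β s - c) / R * e s
  have dq (s : ℝ) : HasDerivAt q (deriv β s / R * e s - Complex.I * q s) s := by
    refine ((((contDiff_hasDerivAt hβ s).sub_const (c : ℂ)).div_const (R : ℂ)).mul (de s)).congr_deriv ?_
    simp only [q]; ring
  have q1 (s : ℝ) (hs : s ∈ Icc (-θ) θ) : ‖q s - 1‖ ≤ d := by
    have : q s - 1 = (β s - outerArc h θ s) / R * e s := by rw [← hγ s]; simp only [q]; ring
    rw [this, norm_mul, ne, mul_one, norm_div, Complex.norm_real, Real.norm_of_nonneg hR.le,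
      div_le_iff₀ hR, mul_comm]
    exact (hclose s hs).1
  have q2 (s : ℝ) (hs : s ∈ Icc (-θ) θ) : ‖deriv β s / R * e s - Complex.I * q s‖ ≤ 2 * d := by
    have e3 : deriv β s / R * e s - Complex.I * q s =
        (deriv β s - deriv (outerArc h θ) s) / R * e s - Complex.I * (q s - 1) := by
      linear_combination hγ' s
    have e4 : ‖(deriv β s - deriv (outerArc h θ) s) / R * e s‖ ≤ d := by
      rw [norm_mul, ne, mul_one, norm_div, Complex.norm_real, Real.norm_of_nonneg hR.le,
        div_le_iff₀ hR, mul_comm]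
      exact (hclose s hs).2
    rw [e3]
    refine (norm_sub_le _ _).trans ?_
    rw [norm_mul Complex.I, Complex.norm_I, one_mul]
    linarith [q1 s hs]
  have qslit (s : ℝ) (hs : s ∈ Icc (-θ) θ) : q s ∈ Complex.slitPlane := by
    have : q s = 1 + (q s - 1) := by ring
    rw [this]
    exact Complex.mem_slitPlane_of_norm_lt_one (by linarith [q1 s hs])
  have qn (s : ℝ) (hs : s ∈ Icc (-θ) θ) : 1 / 2 ≤ ‖q s‖ := by
    have := norm_sub_norm_le (1 : ℂ) (1 - q s)
    rw [norm_one, sub_sub_cancel, norm_sub_rev] at this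
    linarith [q1 s hs]
  have q0 (s : ℝ) (hs : s ∈ Icc (-θ) θ) : q s ≠ 0 := Complex.slitPlane_ne_zero (qslit s hs)
  have cβ' := contDiff_deriv hβ
  have cβ := hβ.continuous
  have ce : Continuous e := by simp only [e]; fun_prop
  have cq : Continuous q := by simp only [q]; fun_prop
  obtain ⟨Z, cZ, hZ⟩ := exists_contDiff_extension (β := fun s => Complex.log (q s))
    (D := fun s => (deriv β s / R * e s - Complex.I * q s) / q s) h0
    (ContinuousOn.div (by fun_prop) cq.continuousOn q0)
    (fun s hs => ((dq s).clog_real (qslit s hs)).hasDerivWithinAt)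
  have hexp (s : ℝ) (hs : s ∈ Icc (-θ) θ) : Complex.exp (Z s + s * Complex.I) = (β s - c) / R := by
    rw [(hZ s hs).1, Complex.exp_add, Complex.exp_log (q0 s hs)]
    simp only [q]
    rw [mul_assoc, ee, mul_one]
  refine ⟨Z, cZ, ?_, ?_, fun s hs => ⟨?_, ?_, ?_, ?_⟩⟩
  · rw [(hZ θ ⟨by linarith, le_rfl⟩).1]
    simp only [q]
    rw [e1, hγ, Complex.log_one]
  · rw [(hZ (-θ) ⟨le_rfl, by linarith⟩).1]
    simp only [q]
    rw [e2, hγ, Complex.log_one]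
  · rw [hexp s hs]; field_simp; ring
  · rw [hexp s hs, (hZ s hs).2]
    have hq := q0 s hs
    have e3 : (β s - c) / R = q s * Complex.exp (s * Complex.I) := by
      simp only [q]; rw [mul_assoc, ee, mul_one]
    have e4 : (deriv β s / R * e s - Complex.I * q s) / q s + Complex.I = deriv β s / R * e s / q s := by
      field_simp; ring
    rw [e3, e4]
    have : q s * Complex.exp (s * Complex.I) * (deriv β s / R * e s / q s) =
        deriv β s / R * (e s * Complex.exp (s * Complex.I)) := by field_simp
    rw [this, ee]
    field_simp
  · rw [(hZ s hs).1]
    have : q s = 1 + (q s - 1) := by ring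
    rw [this]
    refine (Complex.norm_log_one_add_half_le_self ((q1 s hs).trans hd2)).trans ?_
    linarith [q1 s hs]
  · rw [(hZ s hs).2, norm_div, div_le_iff₀ (by linarith [qn s hs])]
    have := qn s hs
    nlinarith [q2 s hs]

lemma sqrt_sq_add_sq_ge {t a p : ℝ} (ht : 0 ≤ t) (ht1 : t ≤ 1 / 10) (ha : |a - 1| ≤ t) (hp : |p| ≤ t) :
    a + (1 - 3 * t) / 2 * p ^ 2 ≤ √(a ^ 2 + p ^ 2) := by
  apply Real.le_sqrt_of_sq_le
  have h1 := abs_le.1 ha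
  have hp2 : p ^ 2 ≤ t ^ 2 := sq_le_sq' (abs_le.1 hp).1 (abs_le.1 hp).2
  have hk : 0 ≤ (1 - 3 * t) / 2 := by linarith
  have key : 2 * a * ((1 - 3 * t) / 2) + ((1 - 3 * t) / 2) ^ 2 * p ^ 2 ≤ 1 := by
    have : ((1 - 3 * t) / 2) ^ 2 * p ^ 2 ≤ 1 / 4 * t ^ 2 := by
      apply mul_le_mul _ hp2 (sq_nonneg _) (by norm_num)
      nlinarith
    nlinarith
  nlinarith [mul_le_mul_of_nonneg_right key (sq_nonneg p)]

lemma abs_exp_sub_one_le' {t x : ℝ} (ht1 : t ≤ 1 / 10) (hx : |x| ≤ t) :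
    |Real.exp x - 1| ≤ (1 + t) * |x| ∧ |(Real.exp (2 * x) - 1) / 2 - x| ≤ 2 * t * |x| := by
  have h1 := Real.abs_exp_sub_one_sub_id_le (x := x) (by linarith)
  have h2 := Real.abs_exp_sub_one_sub_id_le (x := 2 * x) (by rw [abs_mul, abs_two]; linarith)
  have hxx : x ^ 2 ≤ t * |x| := by
    rw [← sq_abs, sq]; exact mul_le_mul_of_nonneg_right hx (abs_nonneg _)
  constructor
  · have : Real.exp x - 1 = (Real.exp x - 1 - x) + x := by ring
    rw [this]
    refine (abs_add_le _ _).trans ?_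
    linarith
  · have : (Real.exp (2 * x) - 1) / 2 - x = (Real.exp (2 * x) - 1 - 2 * x) / 2 := by ring
    rw [this, abs_div, abs_two]
    nlinarith

section OuterLength

variable {θ t : ℝ} {ρ σ : ℝ → ℝ}

/-- The length of the curve `e^{is + ρ + iσ}`, up to second order. -/
lemma outer_length_expansion (h0 : 0 < θ) (ht : 0 ≤ t) (ht1 : t ≤ 1 / 10) (hρ : ContDiff ℝ 1 ρ)
    (hσ : ContDiff ℝ 1 σ) (σl : σ (-θ) = 0) (σr : σ θ = 0)
    (H : ∀ s ∈ Icc (-θ) θ, |ρ s| ≤ t ∧ |deriv ρ s| ≤ t ∧ |deriv σ s| ≤ t) :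
    2 * θ + (∫ s in (-θ)..θ, (Real.exp (2 * ρ s) - 1) / 2 * (1 + deriv σ s)) +
      ((1 - 4 * t) / 2 * ∫ s in (-θ)..θ, deriv ρ s ^ 2) -
      (1 + 4 * t) / 2 * (∫ s in (-θ)..θ, ρ s ^ 2) ≤
    ∫ s in (-θ)..θ, Real.exp (ρ s) * √((1 + deriv σ s) ^ 2 + deriv ρ s ^ 2) := by
  have c := hρ.continuous
  have c' := deriv_continuous_real hρ
  have d' := deriv_continuous_real hσ
  have e0 : ∫ s in (-θ)..θ, (1 + deriv σ s) = 2 * θ := by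
    rw [intervalIntegral.integral_add intervalIntegrable_const (d'.intervalIntegrable _ _),
      intervalIntegral.integral_deriv_eq_sub' σ rfl (fun x _ => (hasDerivAt_real hσ x).differentiableAt)
        d'.continuousOn, σl, σr, intervalIntegral.integral_const]
    simp; ring
  have I {f : ℝ → ℝ} (hf : Continuous f) : IntervalIntegrable f volume (-θ) θ :=
    hf.intervalIntegrable _ _
  have cs : Continuous fun s => √((1 + deriv σ s) ^ 2 + deriv ρ s ^ 2) := by fun_prop
  rw [← e0, ← intervalIntegral.integral_const_mul, ← intervalIntegral.integral_const_mul,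
    ← intervalIntegral.integral_add (I (by fun_prop)) (I (by fun_prop)),
    ← intervalIntegral.integral_add (I (by fun_prop)) (I (by fun_prop)),
    ← intervalIntegral.integral_sub (I (by fun_prop)) (I (by fun_prop))]
  apply intervalIntegral.integral_mono_on (by linarith) (I (by fun_prop)) (I (by fun_prop))
  intro s hs
  obtain ⟨h1, h2, h3⟩ := H s hs
  have k1 := sqrt_sq_add_sq_ge ht ht1 (a := 1 + deriv σ s) (p := deriv ρ s) (by simpa using h3) h2
  have k2 := (abs_exp_sub_one_le' ht1 h1).1
  set x := Real.exp (ρ s) with hx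
  have hx0 : 0 < x := Real.exp_pos _
  have hx2 : Real.exp (2 * ρ s) = x ^ 2 := by rw [hx, ← Real.exp_nat_mul]; norm_num
  have hx1 : 1 - t ≤ x := by
    have := Real.add_one_le_exp (ρ s)
    linarith [(abs_le.1 h1).1]
  have hA := abs_le.1 h3
  have m1 := mul_le_mul_of_nonneg_left k1 hx0.le
  have hp := sq_nonneg (deriv ρ s)
  have m2 : (1 - 4 * t) / 2 * deriv ρ s ^ 2 ≤ x * ((1 - 3 * t) / 2 * deriv ρ s ^ 2) := by
    rw [← mul_assoc]
    apply mul_le_mul_of_nonneg_right _ hp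
    nlinarith
  -- With `x = e^ρ` one has `x - 1 = (x² - 1) / 2 - (x - 1)² / 2`. The first term gives the area
  -- gain exactly; the second is the loss estimated here by `ρ²`.
  have m3 : (1 + deriv σ s) * (x - 1) ^ 2 ≤ (1 + 4 * t) * ρ s ^ 2 := by
    have a1 : (x - 1) ^ 2 ≤ (1 + t) ^ 2 * ρ s ^ 2 := by
      rw [← sq_abs, ← sq_abs (ρ s), ← mul_pow]
      exact pow_le_pow_left₀ (abs_nonneg _) k2 2
    have a2 : (1 + deriv σ s) * (x - 1) ^ 2 ≤ (1 + t) * ((1 + t) ^ 2 * ρ s ^ 2) :=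
      mul_le_mul (by linarith) a1 (sq_nonneg _) (by linarith)
    have a3 : (1 + t) * (1 + t) ^ 2 ≤ 1 + 4 * t := by nlinarith [mul_nonneg ht ht]
    nlinarith [mul_le_mul_of_nonneg_right a3 (sq_nonneg (ρ s))]
  rw [hx2]
  nlinarith

/-- The exact area gain differs from its linearisation `∫ ρ` by a small multiple of `∫ |ρ|`;
Cauchy–Schwarz converts the resulting error for the squares into `∫ ρ²`. -/
lemma outer_area_expansion (h0 : 0 < θ) (ht : 0 ≤ t) (ht1 : t ≤ 1 / 10) (hρ : ContDiff ℝ 1 ρ)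
    (hσ : ContDiff ℝ 1 σ) (H : ∀ s ∈ Icc (-θ) θ, |ρ s| ≤ t ∧ |deriv ρ s| ≤ t ∧ |deriv σ s| ≤ t) :
    |(∫ s in (-θ)..θ, (Real.exp (2 * ρ s) - 1) / 2 * (1 + deriv σ s)) ^ 2 -
      (∫ s in (-θ)..θ, ρ s) ^ 2| ≤ 20 * t * θ * ∫ s in (-θ)..θ, ρ s ^ 2 := by
  have c := hρ.continuous
  have d' := deriv_continuous_real hσ
  have I {f : ℝ → ℝ} (hf : Continuous f) : IntervalIntegrable f volume (-θ) θ :=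
    hf.intervalIntegrable _ _
  have hle : -θ ≤ θ := by linarith
  set b := ∫ s in (-θ)..θ, (Real.exp (2 * ρ s) - 1) / 2 * (1 + deriv σ s) with hb
  set m := ∫ s in (-θ)..θ, ρ s with hm
  set A := ∫ s in (-θ)..θ, |ρ s| with hA
  have hA0 : 0 ≤ A := intervalIntegral.integral_nonneg hle fun _ _ => abs_nonneg _
  have hmA : |m| ≤ A := intervalIntegral.abs_integral_le_integral_abs hle
  have hbm : |b - m| ≤ 4 * t * A := by
    rw [hb, hm, ← intervalIntegral.integral_sub (I (by fun_prop)) (I (by fun_prop)), hA,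
      ← intervalIntegral.integral_const_mul]
    refine (intervalIntegral.abs_integral_le_integral_abs hle).trans ?_
    apply intervalIntegral.integral_mono_on hle (I (by fun_prop)) (I (by fun_prop))
    intro s hs
    obtain ⟨h1, -, h3⟩ := H s hs
    have k2 := (abs_exp_sub_one_le' ht1 h1).2
    have e : (Real.exp (2 * ρ s) - 1) / 2 * (1 + deriv σ s) - ρ s =
        ((Real.exp (2 * ρ s) - 1) / 2 - ρ s) * (1 + deriv σ s) + ρ s * deriv σ s := by ring
    rw [e]
    refine (abs_add_le _ _).trans ?_
    rw [abs_mul, abs_mul]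
    have a1 : |1 + deriv σ s| ≤ 1 + t := (abs_add_le _ _).trans (by rw [abs_one]; linarith)
    have a2 := mul_le_mul k2 a1 (abs_nonneg _) (by positivity)
    have a3 := mul_le_mul_of_nonneg_left h3 (abs_nonneg (ρ s))
    have a4 : t * (t * |ρ s|) ≤ 1 / 10 * (t * |ρ s|) :=
      mul_le_mul_of_nonneg_right ht1 (by positivity)
    have a5 : 0 ≤ t * |ρ s| := by positivity
    nlinarith
  have hA2 : A ^ 2 ≤ 2 * θ * ∫ s in (-θ)..θ, ρ s ^ 2 := by
    have := sq_integral_mul_le (f := fun _ => 1) (g := fun s => |ρ s|) continuous_const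
      (by fun_prop) hle
    simp only [one_mul, one_pow, sq_abs, intervalIntegral.integral_const, smul_eq_mul, mul_one] at this
    rw [← hA] at this
    linarith
  have e : b ^ 2 - m ^ 2 = (b - m) * ((b - m) + 2 * m) := by ring
  rw [e, abs_mul]
  have h5 : |b - m + 2 * m| ≤ 4 * t * A + 2 * A := by
    refine (abs_add_le _ _).trans ?_
    rw [abs_mul, abs_two]
    linarith
  have h6 := mul_le_mul hbm h5 (abs_nonneg _) (by positivity)
  have h7 : 4 * t * A * (4 * t * A + 2 * A) ≤ 10 * t * A ^ 2 := by
    have : 0 ≤ t * A ^ 2 := by positivity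
    nlinarith
  have h8 := mul_le_mul_of_nonneg_left hA2 (by positivity : 0 ≤ 10 * t)
  linarith

end OuterLength

/-- The length of a curve `e^{is + ρ + iσ}` close to an arc of the unit circle. -/
theorem outer_length_ge {θ : ℝ} (h0 : 0 < θ) (hπ : θ < Real.pi) {ε : ℝ} (hε : 0 < ε) :
    ∃ t > 0, ∃ c > 0, t ≤ 1 / 10 ∧ ∀ ρ σ : ℝ → ℝ, ContDiff ℝ 1 ρ → ContDiff ℝ 1 σ →
      ρ (-θ) = 0 → ρ θ = 0 → σ (-θ) = 0 → σ θ = 0 →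
      (∀ s ∈ Icc (-θ) θ, |ρ s| ≤ t ∧ |deriv ρ s| ≤ t ∧ |deriv σ s| ≤ t) →
      2 * θ + (∫ s in (-θ)..θ, (Real.exp (2 * ρ s) - 1) / 2 * (1 + deriv σ s)) +
        (outerLambda θ - ε) / 2 *
          (∫ s in (-θ)..θ, (Real.exp (2 * ρ s) - 1) / 2 * (1 + deriv σ s)) ^ 2 +
        c * (∫ s in (-θ)..θ, deriv ρ s ^ 2) ≤
      ∫ s in (-θ)..θ, Real.exp (ρ s) * √((1 + deriv σ s) ^ 2 + deriv ρ s ^ 2) := by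
  obtain ⟨c, hc, hq⟩ := outer_quadratic_form h0 hπ hε
  set L := |outerLambda θ - ε| with hL
  -- After doubling the estimate, the errors are `4t ∫ ρ'²`, `4t ∫ ρ²` and `20 L t θ ∫ ρ²`. The
  -- Poincaré factor `4θ²` turns the last two into the second and third terms of `K`.
  set K := 4 + 16 * θ ^ 2 + 80 * L * θ ^ 3 with hK
  have hL0 : 0 ≤ L := abs_nonneg _
  have hK0 : 0 < K := by positivity
  set t := min (1 / 10) (c / (2 * K)) with ht
  have ht0 : 0 < t := by positivity
  have ht1 : t ≤ 1 / 10 := min_le_left _ _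
  have htK : t * (2 * K) ≤ c := by
    rw [← le_div_iff₀ (by positivity)]; exact min_le_right _ _
  refine ⟨t, ht0, c / 4, by positivity, ht1, fun ρ σ hρ hσ ρl ρr σl σr H => ?_⟩
  have x1 := outer_length_expansion h0 ht0.le ht1 hρ hσ σl σr H
  have x2 := outer_area_expansion h0 ht0.le ht1 hρ hσ H
  have x3 := hq ρ hρ ρl ρr
  have x4 := integral_sq_le hρ h0.le ρl
  set b := ∫ s in (-θ)..θ, (Real.exp (2 * ρ s) - 1) / 2 * (1 + deriv σ s)
  set m := ∫ s in (-θ)..θ, ρ s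
  set S := ∫ s in (-θ)..θ, ρ s ^ 2
  set D := ∫ s in (-θ)..θ, deriv ρ s ^ 2
  set Len := ∫ s in (-θ)..θ, Real.exp (ρ s) * √((1 + deriv σ s) ^ 2 + deriv ρ s ^ 2)
  have hD0 : 0 ≤ D := intervalIntegral.integral_nonneg (by linarith) fun _ _ => sq_nonneg _
  have x5 : (outerLambda θ - ε) * b ^ 2 ≤ (outerLambda θ - ε) * m ^ 2 + L * (20 * t * θ * S) := by
    have h1 : (outerLambda θ - ε) * (b ^ 2 - m ^ 2) ≤ L * |b ^ 2 - m ^ 2| := by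
      rw [hL, ← abs_mul]; exact le_abs_self _
    have h2 := mul_le_mul_of_nonneg_left x2 hL0
    linarith
  have x6 : L * (20 * t * θ * S) ≤ L * (20 * t * θ * (4 * θ ^ 2 * D)) := by gcongr
  have x7 : 4 * t * S ≤ 4 * t * (4 * θ ^ 2 * D) := by gcongr
  have x8 : t * (2 * K) * D ≤ c * D := mul_le_mul_of_nonneg_right htK hD0
  have x9 : t * K * D = 4 * t * D + 4 * t * (4 * θ ^ 2 * D) + L * (20 * t * θ * (4 * θ ^ 2 * D)) := by
    rw [hK]; ring
  linarith

/-- The signed area in terms of the angular momentum around a point of the axis. -/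
lemma areaFlux_eq_cross {β : ℝ → ℂ} (hβ : ContDiff ℝ 1 β) {a h : ℝ} (c : ℝ)
    (h1 : β a = h * Complex.I) (h2 : β (-a) = -(h * Complex.I)) :
    areaFlux β a = (∫ s in (-a)..a, cross (β s - c) (deriv β s) / 2) + c * h := by
  have cb := hβ.continuous
  have cb' := contDiff_deriv hβ
  have hre (s : ℝ) : HasDerivAt (fun s => (β s).re) (deriv β s).re s :=
    Complex.reCLM.hasFDerivAt.comp_hasDerivAt s (contDiff_hasDerivAt hβ s)
  have him (s : ℝ) : HasDerivAt (fun s => (β s).im) (deriv β s).im s :=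
    Complex.imCLM.hasFDerivAt.comp_hasDerivAt s (contDiff_hasDerivAt hβ s)
  have cre : Continuous fun s => (β s).re := Complex.continuous_re.comp cb
  have cim : Continuous fun s => (β s).im := Complex.continuous_im.comp cb
  have cre' : Continuous fun s => (deriv β s).re := Complex.continuous_re.comp cb'
  have cim' : Continuous fun s => (deriv β s).im := Complex.continuous_im.comp cb'
  have hd (s : ℝ) := ((hre s).mul (him s)).add ((him s).const_mul c)
  have h3 := intervalIntegral.integral_eq_sub_of_hasDerivAt (a := -a) (b := a) (fun s _ => hd s)
    ((by fun_prop : Continuous _).intervalIntegrable _ _)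
  have e : areaFlux β a = ∫ s in (-a)..a, (cross (β s - c) (deriv β s) / 2 + 1 / 2 *
      ((deriv β s).re * (β s).im + (β s).re * (deriv β s).im + c * (deriv β s).im)) := by
    rw [areaFlux]
    congr 1
    ext s
    simp [cross]; ring
  rw [e, intervalIntegral.integral_add ((by fun_prop : Continuous _).intervalIntegrable _ _)
    ((by fun_prop : Continuous _).intervalIntegrable _ _), intervalIntegral.integral_const_mul, h3]
  simp [h1, h2]; ring

/-- In logarithmic polar coordinates lengths carry the factor `R` and areas the factor `R²`. This
turns the estimate on the unit circle into curvature `1 / R` and second variation `outerLambda θ /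
R³`, with `ε` rescaled by `R³`. -/
theorem arcStable_outerArc {h θ : ℝ} (hh : 0 < h) (h0 : 0 < θ) (hπ : θ < Real.pi) :
    ArcStable (outerArc h θ) θ (arcRadius h θ)⁻¹ (outerLambda θ / arcRadius h θ ^ 3) := by
  have hR := arcRadius_pos hh h0 hπ
  have hs := (Real.sin_pos_of_pos_of_lt_pi h0 hπ).ne'
  intro ε hε
  set R := arcRadius h θ with hRdef
  set c := arcCenter h θ with hcdef
  obtain ⟨t, ht, c₁, hc₁, ht1, key⟩ := outer_length_ge h0 hπ (ε := ε * R ^ 3) (by positivity)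
  obtain ⟨δ, hδ, hZ⟩ := exists_log_coord hh h0 hπ ht
  refine ⟨δ, hδ, R * c₁ / ((8 * R ^ 2 * (2 * θ)) ^ 2 * (2 * θ)), by positivity,
    fun β hβ hclose e1 e2 => ?_⟩
  obtain ⟨Z, cZ, Zr, Zl, HZ⟩ := hZ β hβ hclose e1 e2
  have cre : ContDiff ℝ 1 fun s => (Z s).re := Complex.reCLM.contDiff.comp cZ
  have cim : ContDiff ℝ 1 fun s => (Z s).im := Complex.imCLM.contDiff.comp cZ
  have dre (s : ℝ) : deriv (fun s => (Z s).re) s = (deriv Z s).re :=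
    (Complex.reCLM.hasFDerivAt.comp_hasDerivAt s (contDiff_hasDerivAt cZ s)).deriv
  have dim (s : ℝ) : deriv (fun s => (Z s).im) s = (deriv Z s).im :=
    (Complex.imCLM.hasFDerivAt.comp_hasDerivAt s (contDiff_hasDerivAt cZ s)).deriv
  have bounds (s : ℝ) (hs : s ∈ Icc (-θ) θ) : |(Z s).re| ≤ t ∧ |deriv (fun s => (Z s).re) s| ≤ t ∧
      |deriv (fun s => (Z s).im) s| ≤ t := by
    rw [dre, dim]
    exact ⟨(Complex.abs_re_le_norm _).trans (HZ s hs).2.2.1,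
      (Complex.abs_re_le_norm _).trans (HZ s hs).2.2.2,
      (Complex.abs_im_le_norm _).trans (HZ s hs).2.2.2⟩
  have x1 := key _ _ cre cim (by simp [Zl]) (by simp [Zr]) (by simp [Zl]) (by simp [Zr]) bounds
  have hle : -θ ≤ θ := by linarith
  have hlen : arcLength β θ = R * ∫ s in (-θ)..θ, Real.exp ((Z s).re) *
      √((1 + deriv (fun s => (Z s).im) s) ^ 2 + deriv (fun s => (Z s).re) s ^ 2) := by
    rw [arcLength, ← intervalIntegral.integral_const_mul]
    apply intervalIntegral.integral_congr
    intro s hs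
    rw [uIcc_of_le hle] at hs
    simp only [(HZ s hs).2.1]
    rw [norm_mul, norm_mul, Complex.norm_real, Real.norm_of_nonneg hR.le, Complex.norm_exp, dre, dim,
      Complex.norm_eq_sqrt_sq_add_sq]
    simp only [Complex.add_re, Complex.add_im, Complex.mul_re, Complex.ofReal_re, Complex.ofReal_im,
      Complex.I_re, Complex.I_im]
    congr 2
    · ring_nf
    · ring_nf
  have hγlen : arcLength (outerArc h θ) θ = R * (2 * θ) := by
    have : ∀ s, ‖deriv (outerArc h θ) s‖ = R := fun s => by
      rw [deriv_outerArc, norm_mul, norm_mul, Complex.norm_exp_ofReal_mul_I, Complex.norm_I,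
        Complex.norm_real, Real.norm_of_nonneg hR.le, mul_one, mul_one]
    simp_rw [arcLength, this]
    rw [intervalIntegral.integral_const, smul_eq_mul]; ring
  have hγarea : areaFlux (outerArc h θ) θ = R ^ 2 * θ + c * h := by
    rw [areaFlux_eq_cross contDiff_outerArc c (outerArc_top hs) (outerArc_bot hs)]
    have : ∀ s, cross (outerArc h θ s - c) (deriv (outerArc h θ) s) / 2 = R ^ 2 / 2 := fun s => by
      rw [deriv_outerArc, outerArc, add_sub_cancel_left]
      simp only [cross, Complex.mul_re, Complex.mul_im, Complex.ofReal_re, Complex.ofReal_im,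
        Complex.exp_ofReal_mul_I_re, Complex.exp_ofReal_mul_I_im, Complex.I_re, Complex.I_im]
      linear_combination R ^ 2 / 2 * Real.sin_sq_add_cos_sq s
    simp_rw [this]
    rw [intervalIntegral.integral_const, smul_eq_mul]; ring
  set b := ∫ s in (-θ)..θ, (Real.exp (2 * (Z s).re) - 1) / 2 * (1 + deriv (fun s => (Z s).im) s) with hb
  have hβarea : areaFlux β θ = R ^ 2 * (b + θ) + c * h := by
    rw [areaFlux_eq_cross hβ c (e1.trans (outerArc_top hs)) (e2.trans (outerArc_bot hs))]
    have d1 := (deriv_continuous_real cim)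
    have d2 := cre.continuous
    have e0 : ∫ s in (-θ)..θ, (1 + deriv (fun s => (Z s).im) s) / 2 = θ := by
      rw [intervalIntegral.integral_div, intervalIntegral.integral_add intervalIntegrable_const
        (d1.intervalIntegrable _ _), intervalIntegral.integral_deriv_eq_sub' (fun s => (Z s).im) rfl
        (fun x _ => (hasDerivAt_real cim x).differentiableAt) d1.continuousOn]
      simp [Zl, Zr]
    have e3 : b + θ = ∫ s in (-θ)..θ, Real.exp (2 * (Z s).re) / 2 * (1 + deriv (fun s => (Z s).im) s) := by
      conv_lhs => rw [← e0]
      rw [hb, ← intervalIntegral.integral_add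
        ((by fun_prop : Continuous _).intervalIntegrable _ _)
        ((by fun_prop : Continuous _).intervalIntegrable _ _)]
      congr 1; ext s; ring
    rw [e3, ← intervalIntegral.integral_const_mul]
    congr 1
    apply intervalIntegral.integral_congr
    intro s hs
    rw [uIcc_of_le hle] at hs
    simp only [(HZ s hs).2.1]
    rw [(HZ s hs).1, add_sub_cancel_left, dim]
    have hsq : Real.exp (2 * (Z s).re) = Real.exp (Z s).re ^ 2 := by
      rw [← Real.exp_nat_mul]; norm_num
    rw [hsq]
    have hexp : Complex.exp (Z s + s * Complex.I) = Real.exp (Z s).re * (Real.cos ((Z s).im + s) +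
        Real.sin ((Z s).im + s) * Complex.I) := by
      rw [Complex.exp_eq_exp_re_mul_sin_add_cos]
      simp
    rw [hexp]
    simp only [cross, Complex.mul_re, Complex.mul_im, Complex.ofReal_re, Complex.ofReal_im,
      Complex.add_re, Complex.add_im, Complex.I_re, Complex.I_im]
    linear_combination (R ^ 2 * Real.exp (Z s).re ^ 2 / 2 * (1 + (deriv Z s).im)) *
      Real.sin_sq_add_cos_sq ((Z s).im + s)
  set D := ∫ s in (-θ)..θ, deriv (fun s => (Z s).re) s ^ 2 with hD
  have hD0 : 0 ≤ D := intervalIntegral.integral_nonneg hle fun _ _ => sq_nonneg _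
  -- Reparametrised by `s + Im Z`, the arc has at each `s` the polar angle of `β`, so the homotopy
  -- is radial. Its Jacobian is at most `8 R² |ρ|`, whose integral is controlled by the Poincaré
  -- inequality.
  refine ⟨8 * R ^ 2 * (2 * θ * √(2 * θ * D)), by positivity, ?_, fun s => s + (Z s).im,
    contDiff_id.add cim, by simp [Zr], by simp [Zl], ?_⟩
  · rw [hβarea, hγarea, hγlen, hlen]
    have hG : R * c₁ / ((8 * R ^ 2 * (2 * θ)) ^ 2 * (2 * θ)) * (8 * R ^ 2 * (2 * θ * √(2 * θ * D))) ^ 2 =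
        R * (c₁ * D) := by
      have : (8 * R ^ 2 * (2 * θ * √(2 * θ * D))) ^ 2 = (8 * R ^ 2 * (2 * θ)) ^ 2 * (2 * θ * D) := by
        rw [← Real.sq_sqrt (by positivity : 0 ≤ 2 * θ * D)]
        simp only [Real.sqrt_sq (Real.sqrt_nonneg _)]
        ring
      rw [this]
      field_simp
    rw [hG]
    refine le_trans (le_of_eq ?_) (mul_le_mul_of_nonneg_left x1 hR.le)
    field_simp
    ring
  · have cφ : ContDiff ℝ 1 fun s : ℝ => s + (Z s).im := contDiff_id.add cim
    have dφ (s : ℝ) : deriv (fun s : ℝ => s + (Z s).im) s = 1 + (deriv Z s).im := by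
      rw [← dim]
      exact ((hasDerivAt_id s).add (hasDerivAt_real cim s)).deriv
    have cc := cre.continuous
    refine (volume_sweptRegion_le (contDiff_outerArc.comp cφ) hβ h0.le
      (g := fun s => 8 * R ^ 2 * |(Z s).re|) (by fun_prop) fun s hs τ hτ => ?_).trans ?_
    · rw [homotopyDeriv, deriv_comp_real contDiff_outerArc cφ, dφ, deriv_outerArc, (HZ s hs).2.1,
        (HZ s hs).1]
      have hexp : Complex.exp (Z s + s * Complex.I) = Real.exp (Z s).re * (Real.cos (s + (Z s).im) +
          Real.sin (s + (Z s).im) * Complex.I) := by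
        rw [Complex.exp_eq_exp_re_mul_sin_add_cos]
        simp [add_comm]
      have e4 : Complex.exp (((s + (Z s).im : ℝ) : ℂ) * Complex.I) = Real.cos (s + (Z s).im) +
          Real.sin (s + (Z s).im) * Complex.I := by
        rw [Complex.exp_mul_I, ← Complex.ofReal_cos, ← Complex.ofReal_sin]
      have e5 : (outerArc h θ ∘ fun s => s + (Z s).im) s = c + R * (Real.cos (s + (Z s).im) +
          Real.sin (s + (Z s).im) * Complex.I) := by
        rw [Function.comp_apply, outerArc, e4]
      rw [e5, e4, hexp]
      set x := Real.exp (Z s).re with hx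
      set C := Real.cos (s + (Z s).im)
      set S := Real.sin (s + (Z s).im)
      have hCS : S ^ 2 + C ^ 2 = 1 := Real.sin_sq_add_cos_sq _
      obtain ⟨b1, b2, b3⟩ := bounds s hs
      rw [dre] at b2
      rw [dim] at b3
      have k := (abs_exp_sub_one_le' ht1 b1).1
      rw [← hx] at k
      have e6 : cross (↑c + ↑R * (↑x * (↑C + ↑S * Complex.I)) - (↑c + ↑R * (↑C + ↑S * Complex.I)))
          ((1 + (deriv Z s).im) • (↑R * ((↑C + ↑S * Complex.I) * Complex.I)) +
            τ • (↑R * (↑x * (↑C + ↑S * Complex.I) * (deriv Z s + Complex.I)) -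
              (1 + (deriv Z s).im) • (↑R * ((↑C + ↑S * Complex.I) * Complex.I)))) =
          R ^ 2 * (x - 1) * ((1 + (deriv Z s).im) * (1 + τ * (x - 1))) := by
        simp only [cross, Complex.mul_re, Complex.mul_im, Complex.ofReal_re, Complex.ofReal_im,
          Complex.add_re, Complex.add_im, Complex.sub_re, Complex.sub_im, Complex.I_re, Complex.I_im,
          Complex.smul_re, Complex.smul_im, smul_eq_mul]
        linear_combination (R ^ 2 * (x - 1) * ((1 + (deriv Z s).im) * (1 + τ * (x - 1)))) * hCS
      rw [e6, abs_mul, abs_mul, abs_mul, abs_of_nonneg (sq_nonneg R)]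
      have y1 : |x - 1| ≤ 2 * |(Z s).re| := k.trans (by
        apply mul_le_mul_of_nonneg_right _ (abs_nonneg _); linarith)
      have y2 : |1 + (deriv Z s).im| ≤ 2 := (abs_add_le _ _).trans (by rw [abs_one]; linarith)
      have y3 : |1 + τ * (x - 1)| ≤ 2 := by
        refine (abs_add_le _ _).trans ?_
        rw [abs_one, abs_mul, abs_of_nonneg hτ.1]
        have : |x - 1| ≤ 1 := y1.trans (by linarith)
        have := mul_le_mul hτ.2 this (abs_nonneg _) zero_le_one
        linarith
      have y4 := mul_le_mul y2 y3 (abs_nonneg _) two_pos.le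
      have y5 := mul_le_mul_of_nonneg_left y1 (sq_nonneg R)
      refine (mul_le_mul y5 y4 (by positivity) (by positivity)).trans (le_of_eq (by ring))
    · rw [intervalIntegral.integral_const_mul]
      apply ENNReal.ofReal_le_ofReal
      apply mul_le_mul_of_nonneg_left _ (by positivity)
      exact integral_abs_le cre h0.le (by simp [Zl])

/-! ### Stability of the middle arc -/

section MidArc

variable {h θ : ℝ}

/-- The speed of the middle arc. -/
def midSpeed (h θ y : ℝ) : ℝ := √(1 + midSlope h θ y ^ 2)

lemma one_le_midSpeed (y : ℝ) : 1 ≤ midSpeed h θ y :=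
  Real.le_sqrt_of_sq_le (by nlinarith [sq_nonneg (midSlope h θ y)])

lemma midSpeed_pos (y : ℝ) : 0 < midSpeed h θ y := zero_lt_one.trans_le (one_le_midSpeed y)

lemma midSpeed_sq (y : ℝ) : midSpeed h θ y ^ 2 = 1 + midSlope h θ y ^ 2 :=
  Real.sq_sqrt (by positivity)

lemma continuous_midSpeed (hh : 0 < h) (hc : 0 < Real.cos θ) : Continuous (midSpeed h θ) := by
  have := continuous_midSlope hh hc
  unfold midSpeed
  fun_prop

lemma midSpeed_eq (hh : 0 < h) (hc : 0 < Real.cos θ) {y : ℝ} (hy : y ∈ Icc (-h) h) :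
    midSpeed h θ y = h / midRoot h θ y := by
  have hQ := midRoot_pos hh hc hy
  have : 1 + midSlope h θ y ^ 2 = (h / midRoot h θ y) ^ 2 := by
    rw [midSlope_eq hy]
    field_simp
    linear_combination midRoot_sq hh hc hy
  rw [midSpeed, this, Real.sqrt_sq (by positivity)]

lemma midSlope_eq_mul_midSpeed (hh : 0 < h) (hc : 0 < Real.cos θ) {y : ℝ} (hy : y ∈ Icc (-h) h) :
    midSlope h θ y = -(Real.sin θ / h * y) * midSpeed h θ y := by
  have hQ := midRoot_pos hh hc hy
  rw [midSpeed_eq hh hc hy, midSlope_eq hy]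
  field_simp

lemma midSpeed_le (hh : 0 < h) (hc : 0 < Real.cos θ) {y : ℝ} (hy : y ∈ Icc (-h) h) :
    midSpeed h θ y ≤ (Real.cos θ)⁻¹ := by
  have hQ := midRoot_pos hh hc hy
  rw [midSpeed_eq hh hc hy, div_le_iff₀ hQ, inv_mul_eq_div, le_div_iff₀ hc]
  exact mul_cos_le_midRoot hy

lemma norm_deriv_midArc (hh : 0 < h) (hc : 0 < Real.cos θ) (y : ℝ) :
    ‖deriv (midArc h θ) y‖ = midSpeed h θ y := by
  rw [deriv_midArc hh hc, Complex.norm_eq_sqrt_sq_add_sq, midSpeed]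
  congr 1
  simp [add_comm]

lemma arcLength_midArc_eq (hh : 0 < h) (hc : 0 < Real.cos θ) :
    arcLength (midArc h θ) h = ∫ y in (-h)..h, midSpeed h θ y := by
  simp_rw [arcLength, norm_deriv_midArc hh hc]

lemma areaFlux_midArc_eq (hh : 0 < h) (hc : 0 < Real.cos θ) :
    areaFlux (midArc h θ) h = ∫ y in (-h)..h, midGraph h θ y := by
  simp [areaFlux, deriv_midArc hh hc]

/-- The inverse of the second variation of the length of the middle arc with respect to the area. -/
def midMoment (h θ : ℝ) : ℝ := ∫ y in (-h)..h, y ^ 2 * midSpeed h θ y ^ 3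

lemma midMoment_pos (hh : 0 < h) (hc : 0 < Real.cos θ) : 0 < midMoment h θ := by
  have hN := continuous_midSpeed hh hc
  have h1 : (∫ y in (-h)..h, y ^ 2) ≤ midMoment h θ := by
    apply intervalIntegral.integral_mono_on (by linarith)
      ((by fun_prop : Continuous _).intervalIntegrable _ _)
      ((by fun_prop : Continuous _).intervalIntegrable _ _)
    intro y _
    have : 1 ≤ midSpeed h θ y ^ 3 := one_le_pow₀ (one_le_midSpeed y)
    nlinarith [sq_nonneg y]
  have h2 : 0 < ∫ y in (-h)..h, y ^ 2 := by
    rw [integral_pow]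
    have : 0 < h ^ 3 := by positivity
    norm_num
    nlinarith
  linarith

/-- Coordinates `(w, Y)` of a curve near the middle arc: `w` is the horizontal displacement from the
point of height `Y`. -/
lemma exists_graph_coord (hh : 0 < h) (hc : 0 < Real.cos θ) {t : ℝ} (ht : 0 < t) (ht1 : t ≤ 1 / 2) :
    ∃ δ > 0, ∀ β : ℝ → ℂ, ContDiff ℝ 1 β → IsC1Close β (midArc h θ) h δ →
      β h = midArc h θ h → β (-h) = midArc h θ (-h) →
      ∃ w Y : ℝ → ℝ, ContDiff ℝ 1 w ∧ ContDiff ℝ 1 Y ∧ w h = 0 ∧ w (-h) = 0 ∧ Y h = h ∧ Y (-h) = -h ∧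
        (∀ s, β s = midArc h θ (Y s) + w s) ∧
        ∀ s ∈ Icc (-h) h, Y s ∈ Icc (-h) h ∧ |deriv w s| ≤ t ∧ |deriv Y s - 1| ≤ t := by
  have cS := continuous_midSlope hh hc
  obtain ⟨M, hM⟩ := isCompact_Icc (a := -h) (b := h) |>.exists_bound_of_continuousOn cS.continuousOn
  have hM0 : 0 ≤ M := (norm_nonneg _).trans (hM 0 ⟨by linarith, hh.le⟩)
  have huc := isCompact_Icc (a := -h) (b := h) |>.uniformContinuousOn_of_continuous cS.continuousOn
  obtain ⟨δ₁, hδ₁, H₁⟩ := Metric.uniformContinuousOn_iff.1 huc (t / 3) (by positivity)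
  -- With `X`, `Y` the coordinates of `β` and `g` the graph of the arc, `w' = X' - g'(Y) Y'` is the
  -- sum of the error of `X'`, the variation of the slope between `s` and `Y s`, and the slope times
  -- the error of `Y'`. Each of the three is made at most `t / 3`.
  refine ⟨min (δ₁ / 2) (min (t / 3) (t / (3 * (M + 1)))), by positivity, fun β hβ hcl e1 e2 => ?_⟩
  set δ := min (δ₁ / 2) (min (t / 3) (t / (3 * (M + 1)))) with hδ
  have d1 : δ ≤ δ₁ / 2 := min_le_left _ _
  have d2 : δ ≤ t / 3 := (min_le_right _ _).trans (min_le_left _ _)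
  have d3 : M * δ ≤ t / 3 := by
    have : δ ≤ t / (3 * (M + 1)) := (min_le_right _ _).trans (min_le_right _ _)
    rw [le_div_iff₀ (by positivity)] at this
    have : 0 < δ := by positivity
    nlinarith
  have cX : ContDiff ℝ 1 fun s => (β s).re := Complex.reCLM.contDiff.comp hβ
  have cY : ContDiff ℝ 1 fun s => (β s).im := Complex.imCLM.contDiff.comp hβ
  have dX (s : ℝ) : deriv (fun s => (β s).re) s = (deriv β s).re :=
    (Complex.reCLM.hasFDerivAt.comp_hasDerivAt s (contDiff_hasDerivAt hβ s)).deriv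
  have dY (s : ℝ) : deriv (fun s => (β s).im) s = (deriv β s).im :=
    (Complex.imCLM.hasFDerivAt.comp_hasDerivAt s (contDiff_hasDerivAt hβ s)).deriv
  have cg := contDiff_midGraph hh hc
  have Yt : (β h).im = h := by rw [e1]; simp
  have Yb : (β (-h)).im = -h := by rw [e2]; simp
  have bY' (s : ℝ) (hs : s ∈ Icc (-h) h) : |deriv (fun s => (β s).im) s - 1| ≤ δ := by
    have := (Complex.abs_im_le_norm _).trans (hcl s hs).2
    rw [dY]
    simpa [deriv_midArc hh hc] using this
  have bX' (s : ℝ) (hs : s ∈ Icc (-h) h) : |deriv (fun s => (β s).re) s - midSlope h θ s| ≤ δ := by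
    have := (Complex.abs_re_le_norm _).trans (hcl s hs).2
    rw [dX]
    simpa [deriv_midArc hh hc] using this
  have bY (s : ℝ) (hs : s ∈ Icc (-h) h) : |(β s).im - s| ≤ δ := by
    simpa using (Complex.abs_im_le_norm _).trans (hcl s hs).1
  have mono : MonotoneOn (fun s => (β s).im) (Icc (-h) h) := by
    apply monotoneOn_of_deriv_nonneg (convex_Icc _ _) cY.continuous.continuousOn
      (cY.differentiable one_ne_zero).differentiableOn
    intro s hs
    have := abs_le.1 (bY' s (interior_subset hs))
    linarith
  have mem (s : ℝ) (hs : s ∈ Icc (-h) h) : (β s).im ∈ Icc (-h) h := by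
    have h1 := mono (left_mem_Icc.2 (by linarith)) hs hs.1
    have h2 := mono hs (right_mem_Icc.2 (by linarith)) hs.2
    simp only [Yt, Yb] at h1 h2
    exact ⟨h1, h2⟩
  refine ⟨fun s => (β s).re - midGraph h θ (β s).im, fun s => (β s).im, cX.sub (cg.comp cY), cY,
    ?_, ?_, Yt, Yb, fun s => ?_, fun s hs => ⟨mem s hs, ?_, (bY' s hs).trans (by linarith)⟩⟩
  · simp only [e1]; simp
  · simp only [e2]; simp
  · apply Complex.ext <;> simp
  · have dw : deriv (fun s => (β s).re - midGraph h θ (β s).im) s =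
        deriv (fun s => (β s).re) s - midSlope h θ (β s).im * deriv (fun s => (β s).im) s :=
      ((hasDerivAt_real cX s).sub
        ((hasDerivAt_midGraph hh hc _).comp s (hasDerivAt_real cY s))).deriv
    rw [dw]
    have h1 : |midSlope h θ s - midSlope h θ (β s).im| ≤ t / 3 := by
      refine le_of_lt (H₁ s hs _ (mem s hs) ?_)
      rw [dist_comm, Real.dist_eq]
      exact (bY s hs).trans_lt (by linarith)
    have h2 : |midSlope h θ (β s).im * (1 - deriv (fun s => (β s).im) s)| ≤ M * δ := by
      rw [abs_mul]
      refine mul_le_mul (hM _ (mem s hs)) ?_ (abs_nonneg _) hM0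
      rw [abs_sub_comm]
      exact bY' s hs
    have e : deriv (fun s => (β s).re) s - midSlope h θ (β s).im * deriv (fun s => (β s).im) s =
      (deriv (fun s => (β s).re) s - midSlope h θ s) + (midSlope h θ s - midSlope h θ (β s).im) +
        midSlope h θ (β s).im * (1 - deriv (fun s => (β s).im) s) := by ring
    rw [e]
    refine (abs_add_three _ _ _).trans ?_
    linarith [bX' s hs]

lemma sqrt_sq_add_sq_ge_of_near {ε t A u z : ℝ} (hε : ε ≤ 1) (ht : 0 ≤ t)
    (hte : 3 * t ≤ ε) (hA : 1 / 2 ≤ A) (hu : |u - A| ≤ t) (hz : |z| ≤ t) :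
    u + (1 - ε) * (z ^ 2 / A) / 2 ≤ √(u ^ 2 + z ^ 2) := by
  have hA0 : 0 < A := by linarith
  apply Real.le_sqrt_of_sq_le
  have hz2 : z ^ 2 ≤ t ^ 2 := sq_le_sq' (abs_le.1 hz).1 (abs_le.1 hz).2
  have h1 : u / A ≤ 1 + 2 * t := by
    rw [div_le_iff₀ hA0]
    nlinarith [(abs_le.1 hu).2]
  have h2 : z ^ 2 / A ^ 2 ≤ 4 * t ^ 2 := by
    rw [div_le_iff₀ (by positivity)]
    have : 1 / 4 ≤ A ^ 2 := by nlinarith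
    nlinarith [sq_nonneg t]
  have hk : 0 ≤ 1 - ε := by linarith
  have key : (1 - ε) * (u / A) + (1 - ε) ^ 2 * (z ^ 2 / A ^ 2) / 4 ≤ 1 := by
    have a1 := mul_le_mul_of_nonneg_left h1 hk
    have a2 := mul_le_mul_of_nonneg_left h2 (sq_nonneg (1 - ε))
    have a3 : (1 - ε) ^ 2 * t ^ 2 ≤ (1 - ε) * t := by
      have : (1 - ε) * t ≤ 1 := by nlinarith
      nlinarith [mul_nonneg hk ht]
    nlinarith
  have e : (u + (1 - ε) * (z ^ 2 / A) / 2) ^ 2 =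
      u ^ 2 + ((1 - ε) * (u / A) + (1 - ε) ^ 2 * (z ^ 2 / A ^ 2) / 4) * z ^ 2 := by
    field_simp
    ring
  rw [e]
  nlinarith [mul_le_mul_of_nonneg_right key (sq_nonneg z)]

/-- The velocity `(p y' + w', y')` is resolved along the unit tangent `(p, 1) / N` of the middle arc
and its normal. The tangential component is `y' N + p w' / N`, the normal one `w' / N`, and the
latter enters quadratically. -/
lemma mid_speed_ge {ε t N p y' w' : ℝ} (hε : ε ≤ 1) (ht : 0 ≤ t) (hte : 3 * t ≤ ε)
    (hN : 1 ≤ N) (hp : N ^ 2 = 1 + p ^ 2) (hy : |y' - 1| ≤ t) (hw : |w'| ≤ t) :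
    y' * N + p / N * w' + (1 - ε) * (w' ^ 2 / (y' * N ^ 3)) / 2 ≤ √((p * y' + w') ^ 2 + y' ^ 2) := by
  have hN0 : 0 < N := by linarith
  have hy0 : 1 / 2 ≤ y' := by linarith [(abs_le.1 hy).1]
  have hpN : |p / N| ≤ 1 := by
    rw [abs_div, abs_of_pos hN0, div_le_one hN0]
    exact abs_le_of_sq_le_sq (by linarith) hN0.le
  have e1 : (p * y' + w') ^ 2 + y' ^ 2 = (y' * N + p / N * w') ^ 2 + (w' / N) ^ 2 := by
    field_simp
    linear_combination (w' ^ 2 - N ^ 2 * y' ^ 2) * hp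
  have e2 : w' ^ 2 / (y' * N ^ 3) = (w' / N) ^ 2 / (y' * N) := by
    field_simp
  rw [e1, e2]
  refine sqrt_sq_add_sq_ge_of_near hε ht hte (by nlinarith) ?_ ?_
  · rw [add_sub_cancel_left, abs_mul]
    nlinarith [abs_nonneg w', abs_nonneg (p / N)]
  · rw [abs_div, abs_of_pos hN0, div_le_iff₀ hN0]
    nlinarith

/-- In graph coordinates the area gain is `B = ∫ w Y' = -∫ Y w'`. Since slope over speed is `-(sin θ
/ h) Y`, the linear part of the length is exactly `(sin θ / h) B`. The quadratic part is half of `J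
= ∫ w'² / (Y' N³)` up to the factor `1 - e`, and Cauchy–Schwarz gives `B² ≤ J ∫ y² N³`, whence the
second variation is the inverse of `midMoment`. -/
theorem arcStable_midArc (hh : 0 < h) (hc : 0 < Real.cos θ) :
    ArcStable (midArc h θ) h (Real.sin θ / h) (midMoment h θ)⁻¹ := by
  intro ε hε
  set K := midMoment h θ with hK
  have hK0 : 0 < K := midMoment_pos hh hc
  -- Of the available weight `(1 - e) / 2` of `J`, the part `(1 - 2e) / 2` pays for the term in
  -- `B²`, because `2e / K ≤ ε`, and the part `e / 2` pays for the swept area.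
  set e := min (ε * K / 2) (1 / 4) with he
  have he0 : 0 < e := by positivity
  have he1 : e ≤ ε * K / 2 := min_le_left _ _
  have he2 : e ≤ 1 / 4 := min_le_right _ _
  obtain ⟨δ, hδ, key⟩ := exists_graph_coord hh hc (t := e / 3) (by positivity) (by linarith)
  set C := Real.cos θ with hC
  refine ⟨δ, hδ, e / 4 * (C ^ 3 / (32 * h ^ 3)), by positivity, fun β hβ hcl e1 e2 => ?_⟩
  obtain ⟨w, Y, cw, cY, wt, wb, Yt, Yb, hβe, H⟩ := key β hβ hcl e1 e2
  have cN := continuous_midSpeed hh hc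
  have cS := continuous_midSlope hh hc
  have cg := contDiff_midGraph hh hc
  have cw' := deriv_continuous_real cw
  have cY' := deriv_continuous_real cY
  have kw := cw.continuous
  have kY := cY.continuous
  have kg := cg.continuous
  have hle : -h ≤ h := by linarith
  have hdβ (s : ℝ) : deriv β s = ((midSlope h θ (Y s) * deriv Y s + deriv w s : ℝ) : ℂ) +
      (deriv Y s : ℝ) * Complex.I := by
    have h1 : HasDerivAt β (deriv Y s • deriv (midArc h θ) (Y s) + ((deriv w s : ℝ) : ℂ)) s := by
      have : β = fun s => midArc h θ (Y s) + (w s : ℂ) := funext hβe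
      rw [this]
      exact ((contDiff_hasDerivAt (contDiff_midArc hh hc) _).scomp s (hasDerivAt_real cY s)).add
        (hasDerivAt_real cw s).ofReal_comp
    rw [h1.deriv, deriv_midArc hh hc]
    apply Complex.ext <;> simp [mul_comm]
  -- This equals `Y'` on the interval and is bounded below everywhere, which makes `F` continuous on
  -- the whole line.
  let m : ℝ → ℝ := fun s => max (deriv Y s) (1 / 2)
  have cm : Continuous m := by fun_prop
  have hm0 (s : ℝ) : 0 < m s := lt_of_lt_of_le (by norm_num) (le_max_right _ _)
  have hm (s : ℝ) (hs : s ∈ Icc (-h) h) : m s = deriv Y s :=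
    max_eq_left (by linarith [(abs_le.1 (H s hs).2.2).1])
  have hN0 (s : ℝ) : 0 < m s * midSpeed h θ (Y s) ^ 3 := mul_pos (hm0 s) (pow_pos (midSpeed_pos _) 3)
  let F : ℝ → ℝ := fun s => deriv w s ^ 2 / (m s * midSpeed h θ (Y s) ^ 3)
  have cF : Continuous F := by
    refine Continuous.div (by fun_prop) (by fun_prop) fun s => (hN0 s).ne'
  set J := ∫ s in (-h)..h, F s with hJ
  have hchange (g : ℝ → ℝ) (hg : Continuous g) :
      ∫ s in (-h)..h, g (Y s) * deriv Y s = ∫ y in (-h)..h, g y := by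
    have := intervalIntegral.integral_comp_mul_deriv (a := -h) (b := h)
      (fun s _ => hasDerivAt_real cY s) cY'.continuousOn hg
    rwa [Yt, Yb] at this
  -- the area
  have hB : areaFlux β h - areaFlux (midArc h θ) h = ∫ s in (-h)..h, w s * deriv Y s := by
    rw [areaFlux_midArc_eq hh hc, ← hchange _ kg, areaFlux, ← intervalIntegral.integral_sub
      (by simp_rw [hdβ, hβe]; simp; exact (by fun_prop : Continuous _).intervalIntegrable _ _)
      ((by fun_prop : Continuous _).intervalIntegrable _ _)]
    apply intervalIntegral.integral_congr
    intro s _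
    simp only [hdβ, hβe]
    simp
    ring
  have hparts : ∫ s in (-h)..h, Y s * deriv w s = -∫ s in (-h)..h, w s * deriv Y s := by
    rw [intervalIntegral.integral_mul_deriv_eq_deriv_mul (fun s _ => hasDerivAt_real cY s)
      (fun s _ => hasDerivAt_real cw s) (cY'.intervalIntegrable _ _) (cw'.intervalIntegrable _ _),
      wt, wb]
    simp [mul_comm]
  set B := areaFlux β h - areaFlux (midArc h θ) h with hBdef
  have hBK : B ^ 2 ≤ K * J := by
    have h1 := sq_integral_mul_le (f := fun s => Y s * √(m s * midSpeed h θ (Y s) ^ 3))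
      (g := fun s => deriv w s / √(m s * midSpeed h θ (Y s) ^ 3)) (by fun_prop)
      (by refine Continuous.div (by fun_prop) (by fun_prop) fun s => (Real.sqrt_pos.2 (hN0 s)).ne') hle
    have h2 : ∫ s in (-h)..h, (Y s * √(m s * midSpeed h θ (Y s) ^ 3)) *
        (deriv w s / √(m s * midSpeed h θ (Y s) ^ 3)) = -B := by
      rw [hB, ← hparts]
      congr 1; ext s
      have := (Real.sqrt_pos.2 (hN0 s)).ne'
      field_simp
    have h3 : ∫ s in (-h)..h, (Y s * √(m s * midSpeed h θ (Y s) ^ 3)) ^ 2 = K := by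
      rw [hK, midMoment, ← hchange (fun y => y ^ 2 * midSpeed h θ y ^ 3) (by fun_prop)]
      apply intervalIntegral.integral_congr
      intro s hs
      rw [uIcc_of_le hle] at hs
      simp only
      rw [mul_pow, Real.sq_sqrt (hN0 s).le, hm s hs]
      ring
    have h4 : ∫ s in (-h)..h, (deriv w s / √(m s * midSpeed h θ (Y s) ^ 3)) ^ 2 = J := by
      rw [hJ]
      congr 1; ext s
      rw [div_pow, Real.sq_sqrt (hN0 s).le]
    rw [h2, h3, h4] at h1
    linarith [neg_sq B]
  -- the length
  have hlen : arcLength (midArc h θ) h + Real.sin θ / h * B + (1 - e) / 2 * J ≤ arcLength β h := by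
    have h1 : ∫ s in (-h)..h, (midSpeed h θ (Y s) * deriv Y s + (-(Real.sin θ / h)) * (Y s * deriv w s) +
        (1 - e) / 2 * F s) ≤ arcLength β h := by
      refine intervalIntegral.integral_mono_on hle
        ((by fun_prop : Continuous _).intervalIntegrable _ _)
        ((hβ.continuous_deriv_one).norm.intervalIntegrable _ _) fun s hs => ?_
      obtain ⟨a1, a2, a3⟩ := H s hs
      have := mid_speed_ge (by linarith) (by positivity) (by linarith : 3 * (e / 3) ≤ e)
        (one_le_midSpeed _) (midSpeed_sq (h := h) (θ := θ) (Y s)) a3 a2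
      rw [hdβ, Complex.norm_eq_sqrt_sq_add_sq]
      refine le_trans (le_of_eq ?_) (this.trans (le_of_eq ?_))
      · have hp : midSlope h θ (Y s) / midSpeed h θ (Y s) = -(Real.sin θ / h * Y s) := by
          rw [midSlope_eq_mul_midSpeed hh hc a1, mul_div_cancel_right₀ _ (midSpeed_pos _).ne']
        rw [hp]
        simp only [F, hm s hs]
        ring
      · simp
    rw [intervalIntegral.integral_add ((by fun_prop : Continuous _).intervalIntegrable _ _)
      ((by fun_prop : Continuous _).intervalIntegrable _ _),
      intervalIntegral.integral_add ((by fun_prop : Continuous _).intervalIntegrable _ _)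
      ((by fun_prop : Continuous _).intervalIntegrable _ _), intervalIntegral.integral_const_mul,
      intervalIntegral.integral_const_mul, hparts, hchange _ cN, ← arcLength_midArc_eq hh hc, ← hB] at h1
    linarith
  set D := ∫ s in (-h)..h, deriv w s ^ 2 with hD
  have hD0 : 0 ≤ D := intervalIntegral.integral_nonneg hle fun _ _ => sq_nonneg _
  have hDJ : C ^ 3 / 2 * D ≤ J := by
    rw [hD, hJ, ← intervalIntegral.integral_const_mul]
    refine intervalIntegral.integral_mono_on hle ((by fun_prop : Continuous _).intervalIntegrable _ _)
      (cF.intervalIntegrable _ _) fun s hs => ?_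
    obtain ⟨a1, a2, a3⟩ := H s hs
    simp only [F]
    rw [le_div_iff₀ (hN0 s)]
    have b1 : C * midSpeed h θ (Y s) ≤ 1 := by
      have := mul_le_mul_of_nonneg_left (midSpeed_le hh hc a1) hc.le
      rwa [mul_inv_cancel₀ hc.ne'] at this
    have b2 : m s ≤ 2 := by rw [hm s hs]; linarith [(abs_le.1 a3).2]
    have b3 : (C * midSpeed h θ (Y s)) ^ 3 ≤ 1 := pow_le_one₀ (mul_pos hc (midSpeed_pos _)).le b1
    have b4 : (C * midSpeed h θ (Y s)) ^ 3 * m s ≤ 1 * 2 :=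
      mul_le_mul b3 b2 (hm0 s).le zero_le_one
    nlinarith [sq_nonneg (deriv w s)]
  refine ⟨2 * (2 * h * √(2 * h * D)), by positivity, ?_, Y, cY, Yt, Yb, ?_⟩
  · have hG : e / 4 * (C ^ 3 / (32 * h ^ 3)) * (2 * (2 * h * √(2 * h * D))) ^ 2 = e / 2 * (C ^ 3 / 2 * D) := by
      have : (2 * (2 * h * √(2 * h * D))) ^ 2 = 32 * h ^ 3 * D := by
        rw [mul_pow, mul_pow, Real.sq_sqrt (by positivity)]; ring
      rw [this]
      field_simp
      ring
    rw [hG]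
    have h5 : (K⁻¹ - ε) / 2 * B ^ 2 ≤ (1 - 2 * e) / 2 * J := by
      have : K⁻¹ - ε ≤ (1 - 2 * e) * K⁻¹ := by
        have : 2 * e * K⁻¹ ≤ ε := by
          rw [mul_inv_le_iff₀ hK0]; linarith
        linarith
      calc (K⁻¹ - ε) / 2 * B ^ 2 ≤ ((1 - 2 * e) * K⁻¹) / 2 * B ^ 2 := by
            apply mul_le_mul_of_nonneg_right _ (sq_nonneg _); linarith
        _ ≤ ((1 - 2 * e) * K⁻¹) / 2 * (K * J) := by
            apply mul_le_mul_of_nonneg_left hBK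
            have : 0 ≤ 1 - 2 * e := by linarith
            positivity
        _ = _ := by field_simp
    nlinarith
  · refine (volume_sweptRegion_le ((contDiff_midArc hh hc).comp cY) hβ hh.le
      (g := fun s => 2 * |w s|) (by fun_prop) fun s hs τ hτ => ?_).trans ?_
    · rw [homotopyDeriv, deriv_comp_real (contDiff_midArc hh hc) cY, deriv_midArc hh hc, hdβ]
      have e3 : β s - (midArc h θ ∘ Y) s = w s := by rw [hβe]; simp
      rw [e3]
      have e4 : ∀ z : ℂ, cross (w s : ℂ) z = w s * z.im := fun z => by simp [cross]
      rw [e4]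
      have e5 : (deriv Y s • ((midSlope h θ (Y s) : ℂ) + Complex.I) +
          τ • (((midSlope h θ (Y s) * deriv Y s + deriv w s : ℝ) : ℂ) + (deriv Y s : ℝ) * Complex.I -
            deriv Y s • ((midSlope h θ (Y s) : ℂ) + Complex.I))).im = deriv Y s := by
        simp
      rw [e5, abs_mul, mul_comm]
      apply mul_le_mul_of_nonneg_right _ (abs_nonneg _)
      have := abs_le.1 (H s hs).2.2
      rw [abs_le]; constructor <;> linarith
    · rw [intervalIntegral.integral_const_mul]
      apply ENNReal.ofReal_le_ofReal
      apply mul_le_mul_of_nonneg_left _ (by positivity)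
      exact integral_abs_le cw hh.le wb

end MidArc

/-! ### Circular segments -/

/-- The area of the circular segment with half-opening angle `θ` over a chord of length `2`. -/
def segmentArea (θ : ℝ) : ℝ := (θ - Real.sin θ * Real.cos θ) / Real.sin θ ^ 2

/-- The derivative of `segmentArea`. -/
def segmentSlope (θ : ℝ) : ℝ :=
  if θ = 0 then 2 / 3 else 2 * (Real.sin θ - θ * Real.cos θ) / Real.sin θ ^ 3

lemma segmentArea_neg (θ : ℝ) : segmentArea (-θ) = -segmentArea θ := by
  simp [segmentArea]; ring

@[simp] lemma segmentArea_zero : segmentArea 0 = 0 := by simp [segmentArea]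

lemma segmentSlope_neg (θ : ℝ) : segmentSlope (-θ) = segmentSlope θ := by
  simp only [segmentSlope, neg_eq_zero, Real.sin_neg, Real.cos_neg]
  split_ifs
  · rfl
  · rw [← neg_div_neg_eq]; congr 1 <;> ring

lemma segmentSlope_abs (θ : ℝ) : segmentSlope |θ| = segmentSlope θ := by
  rcases abs_choice θ with h | h <;> rw [h]
  exact segmentSlope_neg θ

lemma sin_ne_zero_of_abs_lt {θ : ℝ} (h0 : θ ≠ 0) (hπ : |θ| < Real.pi) : Real.sin θ ≠ 0 := by
  have := abs_lt.1 hπ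
  rcases h0.lt_or_gt with h | h
  · exact (Real.sin_neg_of_neg_of_neg_pi_lt h this.1).ne
  · exact (Real.sin_pos_of_pos_of_lt_pi h this.2).ne'

/-- This form has no denominator and also holds for the segment. Together with the ordering and
positivity of the slopes it is all that the computation of the determinant uses. -/
lemma sin_mul_segmentSlope {θ : ℝ} (hπ : |θ| < Real.pi) :
    Real.sin θ * segmentSlope θ = 2 * (Real.sin θ - Real.cos θ * segmentArea θ) := by
  rcases eq_or_ne θ 0 with rfl | h0
  · simp
  · have hs := sin_ne_zero_of_abs_lt h0 hπ
    rw [segmentSlope, if_neg h0, segmentArea]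
    field_simp
    linear_combination (-Real.sin θ) * Real.sin_sq_add_cos_sq θ

lemma hasDerivAt_segmentArea {θ : ℝ} (h0 : θ ≠ 0) (hπ : |θ| < Real.pi) :
    HasDerivAt segmentArea (segmentSlope θ) θ := by
  have hs := sin_ne_zero_of_abs_lt h0 hπ
  have h1 := ((hasDerivAt_id θ).sub ((Real.hasDerivAt_sin θ).mul (Real.hasDerivAt_cos θ))).div
    ((Real.hasDerivAt_sin θ).pow 2) (pow_ne_zero 2 hs)
  refine h1.congr_deriv ?_
  rw [segmentSlope, if_neg h0]
  simp
  field_simp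
  linear_combination Real.sin θ * Real.sin_sq_add_cos_sq θ

lemma segmentArea_pos {θ : ℝ} (h0 : 0 < θ) (hπ : θ < Real.pi) : 0 < segmentArea θ := by
  have hs := Real.sin_pos_of_pos_of_lt_pi h0 hπ
  refine div_pos ?_ (by positivity)
  have h1 := Real.sin_lt h0
  nlinarith [Real.cos_le_one θ]

lemma segmentArea_le {θ : ℝ} (h0 : 0 ≤ θ) (hπ : θ < Real.pi / 2) : segmentArea θ ≤ θ := by
  rcases h0.eq_or_lt with rfl | h0
  · simp
  · have hp := Real.pi_pos
    have hs := Real.sin_pos_of_pos_of_lt_pi h0 (by linarith)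
    have hc := Real.cos_pos_of_mem_Ioo ⟨by linarith, hπ⟩
    have := sin_sub_mul_cos_pos h0 (by linarith)
    rw [segmentArea, div_le_iff₀ (by positivity)]
    nlinarith [Real.sin_sq_add_cos_sq θ]

lemma abs_segmentArea_le {θ : ℝ} (hθ : |θ| < Real.pi / 2) : |segmentArea θ| ≤ |θ| := by
  have hp := Real.pi_pos
  have key {θ : ℝ} (h0 : 0 ≤ θ) (hπ : θ < Real.pi / 2) : |segmentArea θ| ≤ θ := by
    rw [abs_of_nonneg]
    · exact segmentArea_le h0 hπ
    · rcases h0.eq_or_lt with rfl | h0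
      · simp
      · exact (segmentArea_pos h0 (by linarith)).le
  rcases le_total 0 θ with h | h
  · rw [abs_of_nonneg h] at *; exact key h hθ
  · rw [abs_of_nonpos h] at *
    have := key (by linarith) hθ
    rwa [segmentArea_neg, abs_neg] at this

lemma continuousAt_segmentArea {θ : ℝ} (hπ : |θ| < Real.pi) : ContinuousAt segmentArea θ := by
  rcases eq_or_ne θ 0 with rfl | h0
  · rw [ContinuousAt, segmentArea_zero]
    refine squeeze_zero_norm' (a := fun θ => |θ|) ?_ (by simpa using (continuous_abs.tendsto (0 : ℝ)))
    have : ∀ᶠ θ : ℝ in 𝓝 0, |θ| < Real.pi / 2 :=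
      (continuous_abs.tendsto (0 : ℝ)).eventually_lt_const (by simp [Real.pi_pos])
    exact this.mono fun θ hθ => abs_segmentArea_le hθ
  · exact (hasDerivAt_segmentArea h0 hπ).continuousAt

lemma sin_mul_cos_lt {θ : ℝ} (h0 : 0 < θ) (hπ : θ < Real.pi) : Real.sin θ * Real.cos θ < θ := by
  have hs := Real.sin_pos_of_pos_of_lt_pi h0 hπ
  nlinarith [Real.cos_le_one θ, Real.sin_lt h0]

/-- The derivative has the sign of `x (1 + 2 cos² x) - 3 sin x cos x`, which vanishes at 0 and has
the positive derivative `4 sin x (sin x - x cos x)`. -/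
lemma strictMonoOn_segmentSlope_Ioo : StrictMonoOn segmentSlope (Ioo 0 Real.pi) := by
  have aux {x : ℝ} (hx : x ∈ Ioo 0 Real.pi) :
      0 < x * (1 + 2 * Real.cos x ^ 2) - 3 * (Real.sin x * Real.cos x) := by
    let f : ℝ → ℝ := fun x => x * (1 + 2 * Real.cos x ^ 2) - 3 * (Real.sin x * Real.cos x)
    have hd (x : ℝ) : HasDerivAt f (4 * Real.sin x * (Real.sin x - x * Real.cos x)) x := by
      refine ((((hasDerivAt_id x).mul ((((Real.hasDerivAt_cos x).pow 2).const_mul 2).const_add 1))).sub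
        (((Real.hasDerivAt_sin x).mul (Real.hasDerivAt_cos x)).const_mul 3)).congr_deriv ?_
      simp
      linear_combination -(Real.sin_sq_add_cos_sq x)
    have mono : StrictMonoOn f (Icc 0 Real.pi) := by
      apply strictMonoOn_of_deriv_pos (convex_Icc _ _)
        fun x _ => (hd x).continuousAt.continuousWithinAt
      intro x hx
      rw [interior_Icc] at hx
      rw [(hd x).deriv]
      have := Real.sin_pos_of_mem_Ioo hx
      have := sin_sub_mul_cos_pos hx.1 hx.2
      positivity
    have := mono ⟨le_rfl, Real.pi_pos.le⟩ ⟨hx.1.le, hx.2.le⟩ hx.1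
    simpa [f] using this
  have hd {x : ℝ} (hx : x ∈ Ioo 0 Real.pi) : HasDerivAt segmentSlope
      (2 * (x * (1 + 2 * Real.cos x ^ 2) - 3 * (Real.sin x * Real.cos x)) / Real.sin x ^ 4) x := by
    have hs := Real.sin_pos_of_mem_Ioo hx
    have h1 := (((Real.hasDerivAt_sin x).sub ((hasDerivAt_id x).mul (Real.hasDerivAt_cos x))).const_mul
      2).div ((Real.hasDerivAt_sin x).pow 3) (pow_ne_zero 3 hs.ne')
    refine (h1.congr_deriv ?_).congr_of_eventuallyEq ?_
    · simp
      field_simp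
      linear_combination x * Real.sin_sq_add_cos_sq x
    · filter_upwards [isOpen_Ioo.mem_nhds hx] with y hy
      rw [segmentSlope, if_neg hy.1.ne']
      simp
  apply strictMonoOn_of_deriv_pos (convex_Ioo _ _)
    fun x hx => (hd hx).continuousAt.continuousWithinAt
  intro x hx
  rw [interior_Ioo] at hx
  rw [(hd hx).deriv]
  have := Real.sin_pos_of_mem_Ioo hx
  have := aux hx
  positivity

/-- This joins the monotonicity to the value at the removable singularity without a continuity
argument: `sin x - x cos x - sin³ x / 3` vanishes at 0 and has derivative `sin x (x - sin x cos x) >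
0`. -/
lemma two_thirds_lt_segmentSlope {θ : ℝ} (h0 : 0 < θ) (hπ : θ < Real.pi) : 2 / 3 < segmentSlope θ := by
  let f : ℝ → ℝ := fun x => Real.sin x - x * Real.cos x - Real.sin x ^ 3 / 3
  have hd (x : ℝ) : HasDerivAt f (Real.sin x * (x - Real.sin x * Real.cos x)) x := by
    refine (((Real.hasDerivAt_sin x).sub ((hasDerivAt_id x).mul (Real.hasDerivAt_cos x))).sub
      (((Real.hasDerivAt_sin x).pow 3).div_const 3)).congr_deriv ?_
    simp
    ring
  have mono : StrictMonoOn f (Icc 0 Real.pi) := by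
    apply strictMonoOn_of_deriv_pos (convex_Icc _ _)
      fun x _ => (hd x).continuousAt.continuousWithinAt
    intro x hx
    rw [interior_Icc] at hx
    rw [(hd x).deriv]
    have := Real.sin_pos_of_mem_Ioo hx
    have := sin_mul_cos_lt hx.1 hx.2
    have : 0 < x - Real.sin x * Real.cos x := by linarith
    positivity
  have h1 := mono ⟨le_rfl, Real.pi_pos.le⟩ ⟨h0.le, hπ.le⟩ h0
  have hs := Real.sin_pos_of_pos_of_lt_pi h0 hπ
  simp only [f, Real.sin_zero, zero_mul] at h1
  rw [segmentSlope, if_neg h0.ne', lt_div_iff₀ (by positivity)]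
  norm_num at h1
  linarith

lemma segmentSlope_lt {a b : ℝ} (h : |a| < b) (hb : b < Real.pi) : segmentSlope a < segmentSlope b := by
  rw [← segmentSlope_abs]
  rcases (abs_nonneg a).eq_or_lt with h0 | h0
  · rw [← h0] at h ⊢
    simpa [segmentSlope] using two_thirds_lt_segmentSlope h hb
  · exact strictMonoOn_segmentSlope_Ioo ⟨h0, h.trans hb⟩ ⟨h0.trans h, hb⟩ h

lemma segmentSlope_pos {θ : ℝ} (hπ : |θ| < Real.pi) : 0 < segmentSlope θ := by
  rw [← segmentSlope_abs]
  rcases (abs_nonneg θ).eq_or_lt with h0 | h0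
  · rw [← h0]; simp [segmentSlope]
  · linarith [two_thirds_lt_segmentSlope h0 hπ]

/-! ### Lengths and areas of the reference arcs -/

/-- The length `2hθ / sin θ` is written so that the same expression serves for the middle arc,
including the segment, and the sine and cosine relations of the 120 degree condition can act on it.
-/
lemma arcLength_outerArc {h θ : ℝ} (hh : 0 < h) (h0 : 0 < θ) (hπ : θ < Real.pi) :
    arcLength (outerArc h θ) θ = 2 * h * (Real.sin θ * segmentArea θ + Real.cos θ) := by
  have hR := arcRadius_pos hh h0 hπ
  have hs := (Real.sin_pos_of_pos_of_lt_pi h0 hπ).ne'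
  have : ∀ s, ‖deriv (outerArc h θ) s‖ = arcRadius h θ := fun s => by
    rw [deriv_outerArc, norm_mul, norm_mul, Complex.norm_exp_ofReal_mul_I, Complex.norm_I,
      Complex.norm_real, Real.norm_of_nonneg hR.le, mul_one, mul_one]
  simp_rw [arcLength, this]
  rw [intervalIntegral.integral_const, smul_eq_mul, arcRadius, segmentArea]
  field_simp
  ring

lemma areaFlux_outerArc {h θ : ℝ} (h0 : 0 < θ) (hπ : θ < Real.pi) :
    areaFlux (outerArc h θ) θ = h ^ 2 * segmentArea θ := by
  have hs := (Real.sin_pos_of_pos_of_lt_pi h0 hπ).ne'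
  rw [areaFlux_eq_cross contDiff_outerArc (arcCenter h θ) (outerArc_top hs) (outerArc_bot hs)]
  have : ∀ s, cross (outerArc h θ s - arcCenter h θ) (deriv (outerArc h θ) s) / 2 =
      arcRadius h θ ^ 2 / 2 := fun s => by
    rw [deriv_outerArc, outerArc, add_sub_cancel_left]
    simp only [cross, Complex.mul_re, Complex.mul_im, Complex.ofReal_re, Complex.ofReal_im,
      Complex.exp_ofReal_mul_I_re, Complex.exp_ofReal_mul_I_im, Complex.I_re, Complex.I_im]
    linear_combination arcRadius h θ ^ 2 / 2 * Real.sin_sq_add_cos_sq s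
  simp_rw [this]
  rw [intervalIntegral.integral_const, smul_eq_mul, arcRadius, arcCenter, segmentArea]
  field_simp
  ring

section MidArc

variable {h θ : ℝ}

lemma hasDerivAt_arcsin_div (hh : 0 < h) (hc : 0 < Real.cos θ) {y : ℝ} (hy : y ∈ Icc (-h) h) :
    HasDerivAt (fun y => Real.arcsin (Real.sin θ * y / h)) (Real.sin θ / midRoot h θ y) y := by
  have hQ := midRoot_pos hh hc hy
  have h1 := midRoot_arg_pos hh hc hy
  have h2 : (Real.sin θ * y / h) ^ 2 < 1 := by
    rw [div_pow, div_lt_one (by positivity)]; linarith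
  have h3 := abs_lt.1 ((sq_lt_one_iff_abs_lt_one _).1 h2)
  have h4 : √(1 - (Real.sin θ * y / h) ^ 2) = midRoot h θ y / h := by
    rw [Real.sqrt_eq_iff_eq_sq (by linarith) (by positivity), div_pow, div_pow, midRoot_sq hh hc hy]
    field_simp
  have h5 : HasDerivAt (fun y => Real.sin θ * y / h) (Real.sin θ / h) y := by
    simpa using ((hasDerivAt_id y).const_mul (Real.sin θ)).div_const h
  refine ((Real.hasDerivAt_arcsin h3.1.ne' h3.2.ne).comp y h5).congr_deriv ?_
  rw [h4]
  field_simp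

lemma hasDerivAt_midRoot (hh : 0 < h) (hc : 0 < Real.cos θ) {y : ℝ} (hy : y ∈ Icc (-h) h) :
    HasDerivAt (midRoot h θ) (-(Real.sin θ ^ 2 * y) / midRoot h θ y) y := by
  have h1 : HasDerivAt (fun t => h ^ 2 - (Real.sin θ * t) ^ 2)
      (-(2 * (Real.sin θ * y) * Real.sin θ)) y := by
    have := (((hasDerivAt_id y).const_mul (Real.sin θ)).pow 2).const_sub (h ^ 2)
    simpa using this
  refine (h1.sqrt (midRoot_arg_pos hh hc hy).ne').congr_deriv ?_
  rw [← midRoot]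
  have := midRoot_pos hh hc hy
  field_simp

lemma arcsin_top (hh : 0 < h) (hθ : |θ| < Real.pi / 2) : Real.arcsin (Real.sin θ * h / h) = θ := by
  rw [mul_div_cancel_right₀ _ hh.ne']
  exact Real.arcsin_sin (by linarith [(abs_lt.1 hθ).1]) (abs_lt.1 hθ).2.le

lemma arcsin_bot (hh : 0 < h) (hθ : |θ| < Real.pi / 2) :
    Real.arcsin (Real.sin θ * -h / h) = -θ := by
  rw [mul_neg, neg_div, Real.arcsin_neg, arcsin_top hh hθ]

lemma midRoot_bot (hh : 0 < h) (hc : 0 < Real.cos θ) : midRoot h θ (-h) = h * Real.cos θ := by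
  rw [← midRoot_end hh hc, midRoot, midRoot, mul_neg, neg_sq]

lemma midSpeed_of_sin_eq_zero (hs : Real.sin θ = 0) (y : ℝ) : midSpeed h θ y = 1 := by
  simp [midSpeed, midSlope, hs]

lemma arcLength_midArc (hh : 0 < h) (hθ : |θ| < Real.pi / 2) :
    arcLength (midArc h θ) h = 2 * h * (Real.sin θ * segmentArea θ + Real.cos θ) := by
  have hc := Real.cos_pos_of_mem_Ioo (abs_lt.1 hθ)
  rw [arcLength_midArc_eq hh hc]
  rcases eq_or_ne θ 0 with rfl | h0
  · simp [midSpeed_of_sin_eq_zero Real.sin_zero]; ring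
  have hs := sin_ne_zero_of_abs_lt h0 (hθ.trans (by linarith [Real.pi_pos]))
  have := intervalIntegral.integral_eq_sub_of_hasDerivAt (a := -h) (b := h)
    (f := fun y => h / Real.sin θ * Real.arcsin (Real.sin θ * y / h)) (f' := midSpeed h θ)
    (fun y hy => by
      rw [uIcc_of_le (by linarith)] at hy
      refine ((hasDerivAt_arcsin_div hh hc hy).const_mul (h / Real.sin θ)).congr_deriv ?_
      rw [midSpeed_eq hh hc hy]
      field_simp) ((continuous_midSpeed hh hc).intervalIntegrable _ _)
  rw [this, arcsin_top hh hθ, arcsin_bot hh hθ, segmentArea]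
  field_simp
  ring

lemma areaFlux_midArc (hh : 0 < h) (hθ : |θ| < Real.pi / 2) :
    areaFlux (midArc h θ) h = h ^ 2 * segmentArea θ := by
  have hc := Real.cos_pos_of_mem_Ioo (abs_lt.1 hθ)
  rw [areaFlux_midArc_eq hh hc]
  rcases eq_or_ne θ 0 with rfl | h0
  · simp [midGraph_of_sin_eq_zero Real.sin_zero]
  have hs := sin_ne_zero_of_abs_lt h0 (hθ.trans (by linarith [Real.pi_pos]))
  have := intervalIntegral.integral_eq_sub_of_hasDerivAt (a := -h) (b := h)
    (f := fun y => (y * midRoot h θ y / 2 + h ^ 2 / (2 * Real.sin θ) *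
      Real.arcsin (Real.sin θ * y / h) - h * Real.cos θ * y) / Real.sin θ) (f' := midGraph h θ)
    (fun y hy => by
      rw [uIcc_of_le (by linarith)] at hy
      have hQ := midRoot_pos hh hc hy
      refine ((((((hasDerivAt_id y).mul (hasDerivAt_midRoot hh hc hy)).div_const 2).add
        ((hasDerivAt_arcsin_div hh hc hy).const_mul (h ^ 2 / (2 * Real.sin θ)))).sub
        ((hasDerivAt_id y).const_mul (h * Real.cos θ))).div_const (Real.sin θ)).congr_deriv ?_
      rw [div_eq_iff hs, mul_comm (midGraph h θ y), sin_mul_midGraph hh hc hy]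
      simp
      field_simp
      linear_combination -(midRoot_sq hh hc hy)) ((contDiff_midGraph hh hc).continuous.intervalIntegrable _ _)
  rw [this, arcsin_top hh hθ, arcsin_bot hh hθ, segmentArea, midRoot_end hh hc, midRoot_bot hh hc]
  field_simp
  ring

/-- With `outerLambda_div` this brings the second variations of all three arcs to the same form `cos
θ / (h³ segmentSlope θ)`. -/
lemma midMoment_eq (hh : 0 < h) (hθ : |θ| < Real.pi / 2) :
    midMoment h θ = h ^ 3 * segmentSlope θ / Real.cos θ := by
  have hc := Real.cos_pos_of_mem_Ioo (abs_lt.1 hθ)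
  rw [midMoment]
  rcases eq_or_ne θ 0 with rfl | h0
  · simp [midSpeed_of_sin_eq_zero Real.sin_zero, segmentSlope]; ring
  have hs := sin_ne_zero_of_abs_lt h0 (hθ.trans (by linarith [Real.pi_pos]))
  have cN := continuous_midSpeed hh hc
  have := intervalIntegral.integral_eq_sub_of_hasDerivAt (a := -h) (b := h)
    (f := fun y => h ^ 3 * (y / midRoot h θ y / Real.sin θ ^ 2 -
      Real.arcsin (Real.sin θ * y / h) / Real.sin θ ^ 3)) (f' := fun y => y ^ 2 * midSpeed h θ y ^ 3)
    (fun y hy => by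
      rw [uIcc_of_le (by linarith)] at hy
      have hQ := midRoot_pos hh hc hy
      refine (((((hasDerivAt_id y).div (hasDerivAt_midRoot hh hc hy) hQ.ne').div_const
        (Real.sin θ ^ 2)).sub ((hasDerivAt_arcsin_div hh hc hy).div_const (Real.sin θ ^ 3))).const_mul
        (h ^ 3)).congr_deriv ?_
      rw [midSpeed_eq hh hc hy]
      simp
      field_simp
      ring) ((by fun_prop : Continuous fun y => y ^ 2 * midSpeed h θ y ^ 3).intervalIntegrable _ _)
  rw [this, arcsin_top hh hθ, arcsin_bot hh hθ, segmentSlope, if_neg h0, midRoot_end hh hc,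
    midRoot_bot hh hc]
  field_simp
  ring

end MidArc

lemma outerLambda_div {h θ : ℝ} (h0 : 0 < θ) (hπ : θ < Real.pi) :
    outerLambda θ / arcRadius h θ ^ 3 = Real.cos θ / (h ^ 3 * segmentSlope θ) := by
  have hs := (Real.sin_pos_of_pos_of_lt_pi h0 hπ).ne'
  have := (sin_sub_mul_cos_pos h0 hπ).ne'
  rw [outerLambda, arcRadius, segmentSlope, if_neg h0.ne']
  field_simp

/-! ### The second variation under the area constraints -/

/-- `S` and `c` stand for signed sines and cosines, `F` for signed segment areas and `W` for their
slopes. The left side is the determinant of the second variation with the denominators `W` cleared;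
the two balance relations and the identities for the slopes make it factorise. -/
lemma det_identity {S₀ S₁ S₂ c₀ c₁ c₂ F₀ F₁ F₂ W₀ W₁ W₂ : ℝ} (hS : S₀ + S₁ + S₂ = 0)
    (hc : c₀ + c₁ + c₂ = 0) (h₀ : S₀ * W₀ = 2 * (S₀ - c₀ * F₀)) (h₁ : S₁ * W₁ = 2 * (S₁ - c₁ * F₁))
    (h₂ : S₂ * W₂ = 2 * (S₂ - c₂ * F₂)) :
    (S₀ * F₀ * (W₁ * W₂) + S₁ * F₁ * (W₀ * W₂) + S₂ * F₂ * (W₀ * W₁)) *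
        (c₀ * (W₁ * W₂) + c₁ * (W₀ * W₂) + c₂ * (W₀ * W₁)) -
      (S₀ * (W₁ * W₂) + S₁ * (W₀ * W₂) + S₂ * (W₀ * W₁)) ^ 2 =
      W₀ * W₁ * W₂ * ((S₁ * c₂ - S₂ * c₁) *
        (W₀ * (F₁ - F₂) + W₁ * (F₂ - F₀) + W₂ * (F₀ - F₁))) := by
  grind

/-- The smaller eigenvalue of a positive definite form is at least determinant over trace. -/
lemma quadratic_form_ge {A B C : ℝ} (hA : 0 < A) (hd : B ^ 2 < A * C) :
    ∃ c > 0, ∀ x y : ℝ, c * (x ^ 2 + y ^ 2) ≤ A * x ^ 2 + 2 * B * (x * y) + C * y ^ 2 := by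
  have hC : 0 < C := by
    by_contra! h
    nlinarith [sq_nonneg B]
  refine ⟨(A * C - B ^ 2) / (A + C), div_pos (by linarith) (by linarith), fun x y => ?_⟩
  rw [div_mul_eq_mul_div, div_le_iff₀ (by linarith)]
  nlinarith [sq_nonneg (A * x + B * y), sq_nonneg (B * x + C * y)]

lemma sum_sq_bound (f₀ f₁ f₂ x y : ℝ) :
    x ^ 2 + ((f₀ * x + y) ^ 2 + (f₁ * x - y) ^ 2 + (f₂ * x + y) ^ 2) ≤
      6 * (1 + f₀ ^ 2 + f₁ ^ 2 + f₂ ^ 2) * (x ^ 2 + y ^ 2) := by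
  have h : 0 ≤ (f₀ * x - y) ^ 2 + (f₁ * x + y) ^ 2 + (f₂ * x - y) ^ 2 + 5 * x ^ 2 +
    4 * ((f₀ * x) ^ 2 + (f₁ * x) ^ 2 + (f₂ * x) ^ 2) +
    6 * ((f₀ * y) ^ 2 + (f₁ * y) ^ 2 + (f₂ * y) ^ 2) := by positivity
  linarith

/-- In terms of `y = a - F₀ x` the three area gains, up to sign, are `F₀ x + y`, `F₁ x - y` and `F₂
x + y`, and the form becomes `A x² + 2B x y + C y²`. By `det_identity`, `AC - B²` has the sign of
`-(s₁c₂ + s₂c₁)` times a combination, with the positive weights `F₁ + F₀` and `F₂ - F₀`, of the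
differences `W₂ - W₀` and `W₁ - W₀`. No sign of an individual cosine is needed. -/
lemma second_variation_pos {s₀ s₁ s₂ c₀ c₁ c₂ F₀ F₁ F₂ W₀ W₁ W₂ : ℝ} (hs : s₀ = s₁ - s₂)
    (hc : c₀ + c₁ + c₂ = 0) (h₀ : s₀ * W₀ = 2 * (s₀ - c₀ * F₀)) (h₁ : s₁ * W₁ = 2 * (s₁ - c₁ * F₁))
    (h₂ : s₂ * W₂ = 2 * (s₂ - c₂ * F₂)) (w₀ : 0 < W₀) (w₁ : W₀ < W₁) (w₂ : W₀ < W₂)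
    (p₀ : 0 ≤ s₀ * F₀) (p₁ : 0 < s₁ * F₁) (p₂ : 0 < s₂ * F₂) (hk : s₁ * c₂ + s₂ * c₁ < 0)
    (m₁ : 0 < F₁ + F₀) (m₂ : 0 < F₂ - F₀) :
    ∃ c > 0, ∀ x a : ℝ, c * (x ^ 2 + (a ^ 2 + ((F₁ + F₀) * x - a) ^ 2 + ((F₂ - F₀) * x + a) ^ 2)) ≤
      (s₁ * (F₁ + F₀) + s₂ * (F₂ - F₀)) / 2 * x ^ 2 + c₁ / W₁ * ((F₁ + F₀) * x - a) ^ 2 +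
        c₀ / W₀ * a ^ 2 + c₂ / W₂ * ((F₂ - F₀) * x + a) ^ 2 := by
  have w₁' : 0 < W₁ := w₀.trans w₁
  have w₂' : 0 < W₂ := w₀.trans w₂
  set A := s₀ * F₀ / W₀ + s₁ * F₁ / W₁ + s₂ * F₂ / W₂ with hA
  set B := s₀ / W₀ - s₁ / W₁ + s₂ / W₂ with hB
  set C := c₀ / W₀ + c₁ / W₁ + c₂ / W₂ with hC
  have hA0 : 0 < A := by positivity
  have hdet : B ^ 2 < A * C := by
    have key := det_identity (S₀ := s₀) (S₁ := -s₁) (S₂ := s₂) (c₀ := c₀) (c₁ := c₁) (c₂ := c₂)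
      (F₀ := F₀) (F₁ := -F₁) (F₂ := F₂) (W₀ := W₀) (W₁ := W₁) (W₂ := W₂) (by linarith) hc h₀
      (by linarith) h₂
    have e : (A * C - B ^ 2) * (W₀ * W₁ * W₂) = (s₁ * c₂ + s₂ * c₁) *
        -((F₁ + F₀) * (W₂ - W₀) + (F₂ - F₀) * (W₁ - W₀)) := by
      have : (A * C - B ^ 2) * (W₀ * W₁ * W₂) ^ 2 = (W₀ * W₁ * W₂) * ((s₁ * c₂ + s₂ * c₁) *
        -((F₁ + F₀) * (W₂ - W₀) + (F₂ - F₀) * (W₁ - W₀))) := by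
        rw [hA, hB, hC]
        field_simp
        linear_combination key
      have h3 : W₀ * W₁ * W₂ ≠ 0 := by positivity
      apply mul_left_cancel₀ h3
      rw [← this]; ring
    have h4 : 0 < (s₁ * c₂ + s₂ * c₁) * -((F₁ + F₀) * (W₂ - W₀) + (F₂ - F₀) * (W₁ - W₀)) := by
      apply mul_pos_of_neg_of_neg hk
      have := mul_pos m₁ (sub_pos.2 w₂)
      have := mul_pos m₂ (sub_pos.2 w₁)
      linarith
    rw [← e] at h4
    have := (mul_pos_iff_of_pos_right (by positivity)).1 h4
    linarith
  obtain ⟨c, hc0, hq⟩ := quadratic_form_ge hA0 hdet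
  set M := 1 + F₀ ^ 2 + F₁ ^ 2 + F₂ ^ 2 with hM
  have hM1 : 1 ≤ M := by rw [hM]; nlinarith [sq_nonneg F₀, sq_nonneg F₁, sq_nonneg F₂]
  refine ⟨c / (6 * M), by positivity, fun x a => ?_⟩
  have h5 := hq x (a - F₀ * x)
  have e : A * x ^ 2 + 2 * B * (x * (a - F₀ * x)) + C * (a - F₀ * x) ^ 2 =
      (s₁ * (F₁ + F₀) + s₂ * (F₂ - F₀)) / 2 * x ^ 2 + c₁ / W₁ * ((F₁ + F₀) * x - a) ^ 2 +
        c₀ / W₀ * a ^ 2 + c₂ / W₂ * ((F₂ - F₀) * x + a) ^ 2 := by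
    have g₀ : s₀ / W₀ = s₀ / 2 + c₀ / W₀ * F₀ := by field_simp; linarith
    have g₁ : s₁ / W₁ = s₁ / 2 + c₁ / W₁ * F₁ := by field_simp; linarith
    have g₂ : s₂ / W₂ = s₂ / 2 + c₂ / W₂ * F₂ := by field_simp; linarith
    have hA' : A = s₀ / W₀ * F₀ + s₁ / W₁ * F₁ + s₂ / W₂ * F₂ := by rw [hA]; ring
    rw [hA', hB, hC, g₀, g₁, g₂]
    rw [hs]
    ring
  rw [← e]
  refine le_trans ?_ h5
  rw [div_mul_eq_mul_div, div_le_iff₀ (by positivity)]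
  set y := a - F₀ * x with hy
  have ha : a = F₀ * x + y := by rw [hy]; ring
  have b : x ^ 2 + (a ^ 2 + ((F₁ + F₀) * x - a) ^ 2 + ((F₂ - F₀) * x + a) ^ 2) ≤
      6 * M * (x ^ 2 + y ^ 2) := by
    have e1 : (F₁ + F₀) * x - a = F₁ * x - y := by rw [ha]; ring
    have e2 : (F₂ - F₀) * x + a = F₂ * x + y := by rw [ha]; ring
    rw [e1, e2, ha, hM]
    exact sum_sq_bound F₀ F₁ F₂ x y
  calc c * _ ≤ c * (6 * M * (x ^ 2 + y ^ 2)) := mul_le_mul_of_nonneg_left b hc0.le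
    _ = _ := by ring

/-! ### The areas of the chambers -/

/-- The area of the left chamber; the area of the right one is `chamberArea h (-θ)`. -/
def chamberArea (h θ : ℝ) : ℝ := h ^ 2 * (segmentArea (2 * Real.pi / 3 - θ) + segmentArea θ)

lemma chamberArea_neg (h θ : ℝ) :
    chamberArea h (-θ) = h ^ 2 * (segmentArea (2 * Real.pi / 3 + θ) - segmentArea θ) := by
  rw [chamberArea, segmentArea_neg, sub_neg_eq_add, sub_eq_add_neg]

/-- The derivative is the slope at `θ` minus the slope at `2π/3 - θ`, negative because `|θ| < 2π/3 -
θ`. It has been computed for nonzero `θ` only, so the two halves are glued at 0 by continuity. -/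
lemma strictAntiOn_segmentArea_add :
    StrictAntiOn (fun θ => segmentArea (2 * Real.pi / 3 - θ) + segmentArea θ)
      (Ioo (-(Real.pi / 3)) (Real.pi / 3)) := by
  have hp := Real.pi_pos
  have habs {θ : ℝ} (hθ : θ ∈ Ioo (-(Real.pi / 3)) (Real.pi / 3)) :
      |θ| < Real.pi ∧ |2 * Real.pi / 3 - θ| < Real.pi ∧ |θ| < 2 * Real.pi / 3 - θ := by
    refine ⟨abs_lt.2 ⟨by linarith [hθ.1], by linarith [hθ.2]⟩,
      abs_lt.2 ⟨by linarith [hθ.2], by linarith [hθ.1]⟩, abs_lt.2 ⟨by linarith, by linarith [hθ.2]⟩⟩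
  have hcont : ContinuousOn (fun θ => segmentArea (2 * Real.pi / 3 - θ) + segmentArea θ)
      (Ioo (-(Real.pi / 3)) (Real.pi / 3)) := fun θ hθ =>
    ((ContinuousAt.comp (f := fun θ => 2 * Real.pi / 3 - θ) (continuousAt_segmentArea (habs hθ).2.1)
      (by fun_prop)).add (continuousAt_segmentArea (habs hθ).1)).continuousWithinAt
  have hd {θ : ℝ} (hθ : θ ∈ Ioo (-(Real.pi / 3)) (Real.pi / 3)) (h0 : θ ≠ 0) :
      deriv (fun θ => segmentArea (2 * Real.pi / 3 - θ) + segmentArea θ) θ < 0 := by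
    obtain ⟨h1, h2, h3⟩ := habs hθ
    have hne : 2 * Real.pi / 3 - θ ≠ 0 := ((abs_nonneg θ).trans_lt h3).ne'
    have d1 := (hasDerivAt_segmentArea hne h2).comp θ ((hasDerivAt_id θ).const_sub (2 * Real.pi / 3))
    have d2 : HasDerivAt (fun θ => segmentArea (2 * Real.pi / 3 - θ) + segmentArea θ) _ θ :=
      d1.add (hasDerivAt_segmentArea h0 h1)
    rw [d2.deriv]
    have := segmentSlope_lt h3 (abs_lt.1 h2).2
    linarith
  have left : StrictAntiOn (fun θ => segmentArea (2 * Real.pi / 3 - θ) + segmentArea θ)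
      (Ioc (-(Real.pi / 3)) 0) := by
    apply strictAntiOn_of_deriv_neg (convex_Ioc _ _) (hcont.mono (Ioc_subset_Ioo_right (by linarith)))
    intro x hx
    rw [interior_Ioc] at hx
    exact hd ⟨hx.1, by linarith [hx.2]⟩ hx.2.ne
  have right : StrictAntiOn (fun θ => segmentArea (2 * Real.pi / 3 - θ) + segmentArea θ)
      (Ico 0 (Real.pi / 3)) := by
    apply strictAntiOn_of_deriv_neg (convex_Ico _ _) (hcont.mono (Ico_subset_Ioo_left (by linarith)))
    intro x hx
    rw [interior_Ico] at hx
    exact hd ⟨by linarith [hx.1], hx.2⟩ hx.1.ne'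
  have h1 : IsGreatest (Ioc (-(Real.pi / 3)) 0) (0 : ℝ) := isGreatest_Ioc (by linarith)
  have h2 : IsLeast (Ico 0 (Real.pi / 3)) (0 : ℝ) := isLeast_Ico (by linarith)
  have := left.union right h1 h2
  rwa [Ioc_union_Ico_eq_Ioo (by linarith) (by linarith)] at this

section

variable {h θ : ℝ}

/-- By monotonicity the value exceeds that at the larger angle `(π/3 + θ) / 2`, where both summands
are positive. -/
lemma segmentArea_add_pos (hθ : |θ| < Real.pi / 3) :
    0 < segmentArea (2 * Real.pi / 3 - θ) + segmentArea θ := by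
  have hp := Real.pi_pos
  obtain ⟨h1, h2⟩ := abs_lt.1 hθ
  have hm : (Real.pi / 3 + θ) / 2 ∈ Ioo (-(Real.pi / 3)) (Real.pi / 3) :=
    ⟨by linarith, by linarith⟩
  have := strictAntiOn_segmentArea_add (show θ ∈ Ioo (-(Real.pi / 3)) (Real.pi / 3) from ⟨h1, h2⟩) hm
    (by linarith)
  have h3 := segmentArea_pos (θ := (Real.pi / 3 + θ) / 2) (by linarith) (by linarith)
  have h4 := segmentArea_pos (θ := 2 * Real.pi / 3 - (Real.pi / 3 + θ) / 2) (by linarith) (by linarith)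
  simp only at this
  linarith

lemma chamberArea_pos (hh : 0 < h) (hθ : |θ| < Real.pi / 3) : 0 < chamberArea h θ :=
  mul_pos (by positivity) (segmentArea_add_pos hθ)

/-- If the angle grew, the area of the left chamber would shrink relative to `h²` and that of the
right one would grow; equal areas would then require both `h < h'` and `h' < h`. -/
lemma le_of_chamberArea_eq {h' θ' : ℝ} (hh : 0 < h) (hθ : |θ| < Real.pi / 3) (hh' : 0 < h')
    (hθ' : |θ'| < Real.pi / 3) (e₁ : chamberArea h θ = chamberArea h' θ')
    (e₂ : chamberArea h (-θ) = chamberArea h' (-θ')) : θ' ≤ θ := by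
  by_contra! hlt
  have mem {x : ℝ} (hx : |x| < Real.pi / 3) : x ∈ Ioo (-(Real.pi / 3)) (Real.pi / 3) := abs_lt.1 hx
  have h1 := strictAntiOn_segmentArea_add (mem hθ) (mem hθ') hlt
  have h2 := strictAntiOn_segmentArea_add (mem (by rwa [abs_neg])) (mem (by rwa [abs_neg]))
    (neg_lt_neg hlt)
  have p1 := segmentArea_add_pos hθ'
  have p2 := segmentArea_add_pos (θ := -θ) (by rwa [abs_neg])
  have sq {a b x y : ℝ} (e : a ^ 2 * x = b ^ 2 * y) (hxy : y < x) (hy : 0 < y) (hb : 0 < b) :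
      a ^ 2 < b ^ 2 := by
    by_contra! hab
    have := mul_le_mul_of_nonneg_right hab hy.le
    have := mul_lt_mul_of_pos_left hxy (lt_of_lt_of_le (by positivity) hab : 0 < a ^ 2)
    linarith
  have a1 := sq e₁ h1 p1 hh'
  have a2 := sq e₂.symm h2 p2 hh
  linarith

lemma eq_of_chamberArea_eq {h' θ' : ℝ} (hh : 0 < h) (hθ : |θ| < Real.pi / 3) (hh' : 0 < h')
    (hθ' : |θ'| < Real.pi / 3) (e₁ : chamberArea h θ = chamberArea h' θ')
    (e₂ : chamberArea h (-θ) = chamberArea h' (-θ')) : h = h' ∧ θ = θ' := by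
  have e : θ = θ' := le_antisymm (le_of_chamberArea_eq hh' hθ' hh hθ e₁.symm e₂.symm)
    (le_of_chamberArea_eq hh hθ hh' hθ' e₁ e₂)
  subst e
  refine ⟨?_, rfl⟩
  have := mul_right_cancel₀ (segmentArea_add_pos hθ).ne' e₁
  exact (sq_eq_sq₀ hh.le hh'.le).1 this

lemma eq_zero_of_chamberArea_eq (hh : 0 < h) (hθ : |θ| < Real.pi / 3)
    (e : chamberArea h θ = chamberArea h (-θ)) : θ = 0 := by
  have := (eq_of_chamberArea_eq hh hθ hh (by rwa [abs_neg]) e (by rw [neg_neg]; exact e.symm)).2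
  linarith

/-! ### The second variation of the double bubble -/

lemma arcLength_leftArc (hh : 0 < h) (hθ : |θ| < Real.pi / 3) :
    arcLength (leftArc h θ) (2 * Real.pi / 3 - θ) = 2 * h *
      (Real.sin (2 * Real.pi / 3 - θ) * segmentArea (2 * Real.pi / 3 - θ) +
        Real.cos (2 * Real.pi / 3 - θ)) := by
  have hp := Real.pi_pos
  obtain ⟨h1, h2⟩ := abs_lt.1 hθ
  rw [← arcLength_outerArc hh (by linarith) (by linarith)]
  exact arcLength_refl contDiff_outerArc _

lemma areaFlux_leftArc (hθ : |θ| < Real.pi / 3) :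
    areaFlux (leftArc h θ) (2 * Real.pi / 3 - θ) = -(h ^ 2 * segmentArea (2 * Real.pi / 3 - θ)) := by
  have hp := Real.pi_pos
  obtain ⟨h1, h2⟩ := abs_lt.1 hθ
  rw [← areaFlux_outerArc (by linarith) (by linarith)]
  exact areaFlux_refl contDiff_outerArc _

/-- The total length of the reference arcs. -/
def referenceLength (h θ : ℝ) : ℝ :=
  arcLength (leftArc h θ) (2 * Real.pi / 3 - θ) + arcLength (midArc h θ) h +
    arcLength (rightArc h θ) (2 * Real.pi / 3 + θ)

lemma sin_relation (θ : ℝ) :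
    Real.sin θ = Real.sin (2 * Real.pi / 3 - θ) - Real.sin (2 * Real.pi / 3 + θ) := by
  have hc : Real.cos (2 * Real.pi / 3) = -(1 / 2) := by
    rw [show 2 * Real.pi / 3 = Real.pi - Real.pi / 3 by ring, Real.cos_pi_sub, Real.cos_pi_div_three]
  rw [Real.sin_sub, Real.sin_add, hc]; ring

lemma cos_relation (θ : ℝ) :
    Real.cos θ + Real.cos (2 * Real.pi / 3 - θ) + Real.cos (2 * Real.pi / 3 + θ) = 0 := by
  have hc : Real.cos (2 * Real.pi / 3) = -(1 / 2) := by
    rw [show 2 * Real.pi / 3 = Real.pi - Real.pi / 3 by ring, Real.cos_pi_sub, Real.cos_pi_div_three]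
  rw [Real.cos_sub, Real.cos_add, hc]; ring

/-- The length is twice the sum of pressure times area, the pressures being the curvatures `sin / h`
of the outer arcs. The sine relation balances the curvatures and the cosine relation the tangents at
the vertices. -/
lemma referenceLength_eq (hh : 0 < h) (hθ : |θ| < Real.pi / 3) :
    referenceLength h θ = 2 * (Real.sin (2 * Real.pi / 3 - θ) / h * chamberArea h θ +
      Real.sin (2 * Real.pi / 3 + θ) / h * chamberArea h (-θ)) := by
  have hp := Real.pi_pos
  obtain ⟨h1, h2⟩ := abs_lt.1 hθ
  rw [referenceLength, arcLength_leftArc hh hθ, arcLength_midArc hh (by linarith), chamberArea_neg]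
  have : arcLength (rightArc h θ) (2 * Real.pi / 3 + θ) = _ :=
    arcLength_outerArc hh (by linarith) (by linarith)
  rw [this, chamberArea]
  have r1 := sin_relation θ
  have r2 := cos_relation θ
  generalize 2 * Real.pi / 3 - θ = θ₁ at *
  generalize 2 * Real.pi / 3 + θ = θ₂ at *
  field_simp
  linear_combination r2 + segmentArea θ * r1

/-- The quadratic form that governs the length of the double bubble to second order, under the area
constraints. -/
theorem exists_second_variation_ge (hh : 0 < h) (hθ : |θ| < Real.pi / 3) :
    ∃ c > 0, ∀ x a : ℝ, c * (x ^ 2 + (a ^ 2 + (a - chamberArea h θ * x) ^ 2 +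
        (a + chamberArea h (-θ) * x) ^ 2)) ≤
      referenceLength h θ / 4 * x ^ 2 +
        (outerLambda (2 * Real.pi / 3 - θ) / arcRadius h (2 * Real.pi / 3 - θ) ^ 3) *
          (a - chamberArea h θ * x) ^ 2 + (midMoment h θ)⁻¹ * a ^ 2 +
        (outerLambda (2 * Real.pi / 3 + θ) / arcRadius h (2 * Real.pi / 3 + θ) ^ 3) *
          (a + chamberArea h (-θ) * x) ^ 2 := by
  have hp := Real.pi_pos
  obtain ⟨h1, h2⟩ := abs_lt.1 hθ
  have hπ : |θ| < Real.pi := by linarith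
  have q1 : |2 * Real.pi / 3 - θ| < Real.pi := abs_lt.2 ⟨by linarith, by linarith⟩
  have q2 : |2 * Real.pi / 3 + θ| < Real.pi := abs_lt.2 ⟨by linarith, by linarith⟩
  have l1 : |θ| < 2 * Real.pi / 3 - θ := abs_lt.2 ⟨by linarith, by linarith⟩
  have l2 : |θ| < 2 * Real.pi / 3 + θ := abs_lt.2 ⟨by linarith, by linarith⟩
  have hc := cos_pos_of_abs_lt hθ
  have s1 : 0 < Real.sin (2 * Real.pi / 3 - θ) := Real.sin_pos_of_pos_of_lt_pi (by linarith) (by linarith)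
  have s2 : 0 < Real.sin (2 * Real.pi / 3 + θ) := Real.sin_pos_of_pos_of_lt_pi (by linarith) (by linarith)
  have p0 : 0 ≤ Real.sin θ * segmentArea θ := by
    rcases lt_trichotomy θ 0 with h | h | h
    · have a1 := Real.sin_neg_of_neg_of_neg_pi_lt h (by linarith)
      have a2 := segmentArea_pos (θ := -θ) (by linarith) (by linarith)
      rw [segmentArea_neg] at a2
      exact mul_nonneg_of_nonpos_of_nonpos a1.le (by linarith)
    · simp [h]
    · exact mul_nonneg (Real.sin_pos_of_pos_of_lt_pi h (by linarith)).le
        (segmentArea_pos h (by linarith)).le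
  have hk : Real.sin (2 * Real.pi / 3 - θ) * Real.cos (2 * Real.pi / 3 + θ) +
      -- The sum of the two outer angles is `4π/3`, whatever `θ` is.
      Real.sin (2 * Real.pi / 3 + θ) * Real.cos (2 * Real.pi / 3 - θ) < 0 := by
    have : Real.sin (2 * Real.pi / 3 - θ + (2 * Real.pi / 3 + θ)) < 0 := by
      rw [show 2 * Real.pi / 3 - θ + (2 * Real.pi / 3 + θ) = Real.pi / 3 + Real.pi by ring,
        Real.sin_add_pi, neg_neg_iff_pos]
      exact Real.sin_pos_of_pos_of_lt_pi (by linarith) (by linarith)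
    rw [Real.sin_add] at this
    linarith
  have m2 := segmentArea_add_pos (θ := -θ) (by rwa [abs_neg])
  rw [segmentArea_neg, sub_neg_eq_add, ← sub_eq_add_neg] at m2
  obtain ⟨c, hc0, H⟩ := second_variation_pos (sin_relation θ) (cos_relation θ)
    (sin_mul_segmentSlope hπ) (sin_mul_segmentSlope q1) (sin_mul_segmentSlope q2)
    (segmentSlope_pos hπ) (segmentSlope_lt l1 (abs_lt.1 q1).2) (segmentSlope_lt l2 (abs_lt.1 q2).2) p0
    (mul_pos s1 (segmentArea_pos (by linarith) (by linarith)))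
    (mul_pos s2 (segmentArea_pos (by linarith) (by linarith))) hk (segmentArea_add_pos hθ) m2
  have w0 := segmentSlope_pos hπ
  have w1 := segmentSlope_pos q1
  have w2 := segmentSlope_pos q2
  -- Areas are measured in units of `h²`, so the normalised form is applied to `a / h²`; the
  -- denominator `1 + h⁴` pays for the change of unit in the squares.
  refine ⟨h * c / (1 + h ^ 4), by positivity, fun x a => ?_⟩
  have key := mul_le_mul_of_nonneg_left (H x (a / h ^ 2)) hh.le
  have hL : referenceLength h θ = 2 * h * (Real.sin (2 * Real.pi / 3 - θ) *
      (segmentArea (2 * Real.pi / 3 - θ) + segmentArea θ) + Real.sin (2 * Real.pi / 3 + θ) *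
      (segmentArea (2 * Real.pi / 3 + θ) - segmentArea θ)) := by
    rw [referenceLength_eq hh hθ, chamberArea_neg, chamberArea]
    field_simp
  rw [hL, outerLambda_div (by linarith) (by linarith), outerLambda_div (by linarith) (by linarith),
    midMoment_eq hh (by linarith), chamberArea_neg, chamberArea]
  set F₁ := segmentArea (2 * Real.pi / 3 - θ) + segmentArea θ
  set F₂ := segmentArea (2 * Real.pi / 3 + θ) - segmentArea θ
  set W₀ := segmentSlope θ
  set W₁ := segmentSlope (2 * Real.pi / 3 - θ)
  set W₂ := segmentSlope (2 * Real.pi / 3 + θ)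
  refine (?_ : _ ≤ _).trans (key.trans (le_of_eq ?_))
  · have e : a ^ 2 + (a - h ^ 2 * F₁ * x) ^ 2 + (a + h ^ 2 * F₂ * x) ^ 2 =
        h ^ 4 * ((a / h ^ 2) ^ 2 + (F₁ * x - a / h ^ 2) ^ 2 + (F₂ * x + a / h ^ 2) ^ 2) := by
      field_simp
      ring
    rw [e]
    set Q := (a / h ^ 2) ^ 2 + (F₁ * x - a / h ^ 2) ^ 2 + (F₂ * x + a / h ^ 2) ^ 2 with hQ
    have hQ0 : 0 ≤ Q := by positivity
    rw [div_mul_eq_mul_div, div_le_iff₀ (by positivity)]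
    have : x ^ 2 + h ^ 4 * Q ≤ (x ^ 2 + Q) * (1 + h ^ 4) := by
      have : 0 ≤ h ^ 4 * x ^ 2 := by positivity
      linarith
    calc h * c * (x ^ 2 + h ^ 4 * Q) ≤ h * c * ((x ^ 2 + Q) * (1 + h ^ 4)) :=
          mul_le_mul_of_nonneg_left this (by positivity)
      _ = _ := by ring
  · field_simp
    ring

end

/-! ### The stability estimate for networks -/

/-- Up to a reparametrization, the linear homotopy from `γ` to `β` sweeps an area of at most `G`. -/
def SweptAreaLE (γ β : ℝ → ℂ) (a G : ℝ) : Prop :=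
  ∃ φ : ℝ → ℝ, ContDiff ℝ 1 φ ∧ φ a = a ∧ φ (-a) = -a ∧
    volume (sweptRegion (γ ∘ φ) β a) ≤ ENNReal.ofReal G

/-- With `x = r⁻² - 1` the expansion is `r (1 + x / 2) - 1 = x² / 8 + O(x³)`. The cubic error is
absorbed by `ε`. -/
lemma scaling_gain {L ε r : ℝ} (hL : 0 ≤ L) (hr : |r - 1| ≤ 1 / 4) (hε : (4 * L) * |r - 1| ≤ ε) :
    r * ((L / 4 - ε) * (r⁻¹ ^ 2 - 1) ^ 2 / 2) ≤ r * (L + L / 2 * (r⁻¹ ^ 2 - 1)) - L := by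
  have hr' := abs_le.1 hr
  have r0 : 0 < r := by linarith
  have e : r * (L + L / 2 * (r⁻¹ ^ 2 - 1)) - L - r * ((L / 4 - ε) * (r⁻¹ ^ 2 - 1) ^ 2 / 2) =
      (r - 1) ^ 2 / (8 * r ^ 3) * (L * ((r - 1) * (3 * r + 1)) + 4 * ε * (1 + r) ^ 2) := by
    field_simp
    ring
  have h1 : 0 ≤ L * ((r - 1) * (3 * r + 1)) + 4 * ε * (1 + r) ^ 2 := by
    have hε0 : 0 ≤ ε := le_trans (by positivity) hε
    have a1 : -|r - 1| ≤ r - 1 := neg_abs_le _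
    have a2 : L * -(|r - 1| * (3 * r + 1)) ≤ L * ((r - 1) * (3 * r + 1)) := by
      apply mul_le_mul_of_nonneg_left _ hL
      nlinarith
    have a3 : L * (|r - 1| * (3 * r + 1)) ≤ 4 * ε * (1 + r) ^ 2 := by
      have : 0 ≤ L * |r - 1| := by positivity
      nlinarith
    linarith
  have h2 : 0 ≤ (r - 1) ^ 2 / (8 * r ^ 3) * (L * ((r - 1) * (3 * r + 1)) + 4 * ε * (1 + r) ^ 2) :=
    mul_nonneg (by positivity) h1
  linarith

lemma sq_sub_one_le {r : ℝ} (hr : |r - 1| ≤ 1 / 4) : |r - 1| ^ 2 ≤ (r⁻¹ ^ 2 - 1) ^ 2 := by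
  have hr' := abs_le.1 hr
  have r0 : 0 < r := by linarith
  have e : (r⁻¹ ^ 2 - 1) ^ 2 = (r - 1) ^ 2 * ((1 + r) / r ^ 2) ^ 2 := by
    field_simp
    ring
  have : 1 ≤ (1 + r) / r ^ 2 := by
    rw [le_div_iff₀ (by positivity)]; nlinarith
  rw [e, sq_abs]
  exact le_mul_of_one_le_right (sq_nonneg _) (one_le_pow₀ this)

lemma add_four_sq_le (a b c d : ℝ) : (a + b + c + d) ^ 2 ≤ 4 * (a ^ 2 + b ^ 2 + c ^ 2 + d ^ 2) := by
  have : 0 ≤ (a - b) ^ 2 + (a - c) ^ 2 + (a - d) ^ 2 + (b - c) ^ 2 + (b - d) ^ 2 + (c - d) ^ 2 := by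
    positivity
  linarith

/-- The three arc estimates are added with `ε = q / 2`. Of the resulting gain `q x² / 2`, one half
stays with `-L x² / 8`, the combination that `scaling_gain` compensates, and the other half survives
to control `|r - 1|`. -/
lemma length_sum_ge {L x q m B u v κ₁ κ₀ κ₂ Λ₁ Λ₀ Λ₂ c₁ c₀ c₂ G₁ G₀ G₂ ℓ₁ ℓ₀ ℓ₂ l₁ l₀ l₂ : ℝ} (hq : 0 ≤ q)
    (m₁ : m ≤ c₁) (m₀ : m ≤ c₀) (m₂ : m ≤ c₂) (hL : L = ℓ₁ + ℓ₀ + ℓ₂)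
    (K₁ : ℓ₁ + κ₁ * u + (Λ₁ - q / 2) / 2 * u ^ 2 + c₁ * G₁ ^ 2 ≤ l₁)
    (K₀ : ℓ₀ + κ₀ * B + (Λ₀ - q / 2) / 2 * B ^ 2 + c₀ * G₀ ^ 2 ≤ l₀)
    (K₂ : ℓ₂ + κ₂ * v + (Λ₂ - q / 2) / 2 * v ^ 2 + c₂ * G₂ ^ 2 ≤ l₂)
    (hfirst : κ₁ * u + κ₀ * B + κ₂ * v = L / 2 * x)
    (key : q * (x ^ 2 + (B ^ 2 + u ^ 2 + v ^ 2)) ≤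
      L / 4 * x ^ 2 + Λ₁ * u ^ 2 + Λ₀ * B ^ 2 + Λ₂ * v ^ 2) :
    L + L / 2 * x + (q / 2 - L / 4) / 2 * x ^ 2 + q / 4 * x ^ 2 + m * (G₁ ^ 2 + G₀ ^ 2 + G₂ ^ 2) ≤
      l₁ + l₀ + l₂ := by
  have n₁ := mul_le_mul_of_nonneg_right m₁ (sq_nonneg G₁)
  have n₀ := mul_le_mul_of_nonneg_right m₀ (sq_nonneg G₀)
  have n₂ := mul_le_mul_of_nonneg_right m₂ (sq_nonneg G₂)
  have n₃ : 0 ≤ q * (B ^ 2 + u ^ 2 + v ^ 2) := by positivity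
  linarith

/-- The length of a network of arcs that is close to the reference network and encloses the same
areas, up to the factor `r⁻²`. -/
theorem exists_length_ge {h θ : ℝ} (hh : 0 < h) (hθ : |θ| < Real.pi / 3) :
    ∃ δ > 0, ∃ c > 0, ∀ (r : ℝ) (β₁ β₀ β₂ : ℝ → ℂ), |r - 1| ≤ δ →
      ContDiff ℝ 1 β₁ → ContDiff ℝ 1 β₀ → ContDiff ℝ 1 β₂ →
      IsC1Close β₁ (leftArc h θ) (2 * Real.pi / 3 - θ) δ → IsC1Close β₀ (midArc h θ) h δ →
      IsC1Close β₂ (rightArc h θ) (2 * Real.pi / 3 + θ) δ →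
      β₁ (2 * Real.pi / 3 - θ) = h * Complex.I → β₁ (-(2 * Real.pi / 3 - θ)) = -(h * Complex.I) →
      β₀ h = h * Complex.I → β₀ (-h) = -(h * Complex.I) →
      β₂ (2 * Real.pi / 3 + θ) = h * Complex.I → β₂ (-(2 * Real.pi / 3 + θ)) = -(h * Complex.I) →
      areaFlux β₀ h - areaFlux β₁ (2 * Real.pi / 3 - θ) = chamberArea h θ * r⁻¹ ^ 2 →
      areaFlux β₂ (2 * Real.pi / 3 + θ) - areaFlux β₀ h = chamberArea h (-θ) * r⁻¹ ^ 2 →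
      ∃ G₁ G₀ G₂, 0 ≤ G₁ ∧ 0 ≤ G₀ ∧ 0 ≤ G₂ ∧
        SweptAreaLE (leftArc h θ) β₁ (2 * Real.pi / 3 - θ) G₁ ∧ SweptAreaLE (midArc h θ) β₀ h G₀ ∧
        SweptAreaLE (rightArc h θ) β₂ (2 * Real.pi / 3 + θ) G₂ ∧
        c * (|r - 1| + G₁ + G₀ + G₂) ^ 2 ≤ r * (arcLength β₁ (2 * Real.pi / 3 - θ) + arcLength β₀ h +
          arcLength β₂ (2 * Real.pi / 3 + θ)) - referenceLength h θ := by
  have hp := Real.pi_pos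
  obtain ⟨b1, b2⟩ := abs_lt.1 hθ
  have hc := cos_pos_of_abs_lt hθ
  have T := starTrio_reference hh hθ
  obtain ⟨q, hq, Q⟩ := exists_second_variation_ge hh hθ
  have S₁ : ArcStable (leftArc h θ) _ _ _ := (arcStable_outerArc (θ := 2 * Real.pi / 3 - θ) hh
    (by linarith) (by linarith)).refl_comp contDiff_outerArc
  have S₀ := arcStable_midArc hh hc
  have S₂ : ArcStable (rightArc h θ) _ _ _ :=
    arcStable_outerArc (θ := 2 * Real.pi / 3 + θ) hh (by linarith) (by linarith)
  obtain ⟨δ₁, hδ₁, c₁, hc₁, H₁⟩ := S₁ (q / 2) (by positivity)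
  obtain ⟨δ₀, hδ₀, c₀, hc₀, H₀⟩ := S₀ (q / 2) (by positivity)
  obtain ⟨δ₂, hδ₂, c₂, hc₂, H₂⟩ := S₂ (q / 2) (by positivity)
  have hL : 0 ≤ referenceLength h θ := add_nonneg (add_nonneg (arcLength_nonneg T.left.left.pos.le)
    (arcLength_nonneg hh.le)) (arcLength_nonneg T.right.right.pos.le)
  set L := referenceLength h θ with hLdef
  set m := min (q / 4) (min c₁ (min c₀ c₂)) with hm
  have hm0 : 0 < m := by positivity
  have m0 : m ≤ q / 4 := min_le_left _ _
  have m1 : m ≤ c₁ := (min_le_right _ _).trans (min_le_left _ _)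
  have m2 : m ≤ c₀ := (min_le_right _ _).trans ((min_le_right _ _).trans (min_le_left _ _))
  have m3 : m ≤ c₂ := (min_le_right _ _).trans ((min_le_right _ _).trans (min_le_right _ _))
  refine ⟨min (min δ₁ (min δ₀ δ₂)) (min (1 / 4) (q / 2 / (4 * (L + 1)))), by positivity, m / 8,
    by positivity, ?_⟩
  intro r β₁ β₀ β₂ hr d₁ d₀ d₂ l₁ l₀ l₂ t₁ u₁ t₀ u₀ t₂ u₂ a₁ a₂
  have hr4 : |r - 1| ≤ 1 / 4 := hr.trans ((min_le_right _ _).trans (min_le_left _ _))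
  have hrq : 4 * L * |r - 1| ≤ q / 2 := by
    have : |r - 1| ≤ q / 2 / (4 * (L + 1)) := hr.trans ((min_le_right _ _).trans (min_le_right _ _))
    rw [le_div_iff₀ (by positivity)] at this
    nlinarith [abs_nonneg (r - 1)]
  obtain ⟨G₁, g₁, K₁, W₁⟩ := H₁ β₁ d₁ (l₁.mono ((min_le_left _ _).trans (min_le_left _ _)))
    (t₁.trans T.left.left_top.symm) (u₁.trans T.left.left_bot.symm)
  obtain ⟨G₀, g₀, K₀, W₀⟩ := H₀ β₀ d₀
    (l₀.mono ((min_le_left _ _).trans ((min_le_right _ _).trans (min_le_left _ _))))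
    (t₀.trans T.left.right_top.symm) (u₀.trans T.left.right_bot.symm)
  obtain ⟨G₂, g₂, K₂, W₂⟩ := H₂ β₂ d₂
    (l₂.mono ((min_le_left _ _).trans ((min_le_right _ _).trans (min_le_right _ _))))
    (t₂.trans T.right.right_top.symm) (u₂.trans T.right.right_bot.symm)
  refine ⟨G₁, G₀, G₂, g₁, g₀, g₂, W₁, W₀, W₂, ?_⟩
  have r0 : 3 / 4 ≤ r := by linarith [(abs_le.1 hr4).1]
  have A₁ := areaFlux_leftArc (h := h) hθ
  have A₀ := areaFlux_midArc hh (θ := θ) (by linarith)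
  have A₂ : areaFlux (rightArc h θ) (2 * Real.pi / 3 + θ) = _ :=
    areaFlux_outerArc (by linarith) (by linarith)
  set x := r⁻¹ ^ 2 - 1 with hx
  set B := areaFlux β₀ h - areaFlux (midArc h θ) h with hB
  have e₁ : areaFlux β₁ (2 * Real.pi / 3 - θ) - areaFlux (leftArc h θ) (2 * Real.pi / 3 - θ) =
      B - chamberArea h θ * x := by
    have : chamberArea h θ = areaFlux (midArc h θ) h - areaFlux (leftArc h θ) (2 * Real.pi / 3 - θ) := by
      rw [A₀, A₁, chamberArea]; ring
    rw [hB, hx]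
    linear_combination -this - a₁
  have e₂ : areaFlux β₂ (2 * Real.pi / 3 + θ) - areaFlux (rightArc h θ) (2 * Real.pi / 3 + θ) =
      B + chamberArea h (-θ) * x := by
    have : chamberArea h (-θ) = areaFlux (rightArc h θ) (2 * Real.pi / 3 + θ) -
        areaFlux (midArc h θ) h := by
      rw [A₀, A₂, chamberArea_neg]; ring
    rw [hB, hx]
    linear_combination a₂ + this
  rw [e₁] at K₁
  rw [e₂] at K₂
  have key := Q x B
  have hκ : (arcRadius h (2 * Real.pi / 3 - θ))⁻¹ = Real.sin (2 * Real.pi / 3 - θ) / h := by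
    rw [arcRadius, inv_div]
  have hκ' : (arcRadius h (2 * Real.pi / 3 + θ))⁻¹ = Real.sin (2 * Real.pi / 3 + θ) / h := by
    rw [arcRadius, inv_div]
  clear_value x B m L
  -- The terms in `B` cancel by the balance of curvatures, and those in `x` add up to half the
  -- reference length.
  have hfirst : -(arcRadius h (2 * Real.pi / 3 - θ))⁻¹ * (B - chamberArea h θ * x) +
      Real.sin θ / h * B + (arcRadius h (2 * Real.pi / 3 + θ))⁻¹ * (B + chamberArea h (-θ) * x) =
      L / 2 * x := by
    rw [hLdef, referenceLength_eq hh hθ, hκ, hκ', sin_relation θ]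
    ring
  have hsum : L + L / 2 * x + (q / 2 - L / 4) / 2 * x ^ 2 + q / 4 * x ^ 2 + m * (G₁ ^ 2 + G₀ ^ 2 + G₂ ^ 2) ≤
      arcLength β₁ (2 * Real.pi / 3 - θ) + arcLength β₀ h + arcLength β₂ (2 * Real.pi / 3 + θ) :=
    length_sum_ge hq.le m1 m2 m3 hLdef K₁ K₀ K₂ hfirst key
  have hgain := scaling_gain hL hr4 hrq
  rw [← hx] at hgain
  have hx2 : |r - 1| ^ 2 ≤ x ^ 2 := by rw [hx]; exact sq_sub_one_le hr4
  have hmul := mul_le_mul_of_nonneg_left hsum (by linarith : 0 ≤ r)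
  have hG : 0 ≤ G₁ ^ 2 + G₀ ^ 2 + G₂ ^ 2 := by positivity
  have h1 : 3 / 4 * (m * (x ^ 2 + (G₁ ^ 2 + G₀ ^ 2 + G₂ ^ 2))) ≤
      r * (q / 4 * x ^ 2 + m * (G₁ ^ 2 + G₀ ^ 2 + G₂ ^ 2)) := by
    apply mul_le_mul r0 _ (by positivity) (by linarith)
    have := mul_le_mul_of_nonneg_right m0 (sq_nonneg x)
    linarith
  have h2 : (|r - 1| + G₁ + G₀ + G₂) ^ 2 ≤ 4 * (x ^ 2 + (G₁ ^ 2 + G₀ ^ 2 + G₂ ^ 2)) := by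
    exact (add_four_sq_le _ _ _ _).trans (by linarith)
  have h3 := mul_le_mul_of_nonneg_left h2 hm0.le
  have h4 : 0 ≤ m * (x ^ 2 + (G₁ ^ 2 + G₀ ^ 2 + G₂ ^ 2)) := by positivity
  linarith

/-! ### The reference chambers -/

lemma HasBoundary.congr {A B : Set ℂ} {βl βr : ℝ → ℂ} {al ar : ℝ} (H : HasBoundary A βl βr al ar)
    (h : A =ᵐ[volume] B) : HasBoundary B βl βr al ar := fun T hT => by
  rw [← setIntegral_congr_set h, H T hT]

section Model

variable {h θ : ℝ}

/-- By the addition formulas both defining functions take the value `-(h / cos u)² sin (π/3)` at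
this point. -/
lemma center_mem_leftChamber (hh : 0 < h) (hθ : |θ| < Real.pi / 3) :
    ((-starCenter h θ : ℝ) : ℂ) ∈ leftChamber h θ := by
  have hp := Real.pi_pos
  obtain ⟨b1, b2⟩ := abs_lt.1 hθ
  set u := Real.pi / 6 - θ / 2 with hu
  have hcu : 0 < Real.cos u := Real.cos_pos_of_mem_Ioo ⟨by rw [hu]; linarith, by rw [hu]; linarith⟩
  have hs : 0 < Real.sin (Real.pi / 3) := Real.sin_pos_of_pos_of_lt_pi (by linarith) (by linarith)
  have key (φ : ℝ) (x : ℝ) (hx : x = h * Real.tan u ∨ x = -(h * Real.tan u)) :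
      circleFun h φ x = -(h / Real.cos u) ^ 2 *
        (Real.sin φ * Real.cos (2 * u) - 2 * Real.cos φ * (x / h) * Real.cos u ^ 2) := by
    have e : x ^ 2 = (h * Real.tan u) ^ 2 := by rcases hx with rfl | rfl <;> ring
    have e2 : Complex.normSq x = x ^ 2 := by rw [Complex.normSq_ofReal]; ring
    rw [circleFun, e2, e, Complex.ofReal_re, Real.cos_two_mul', Real.tan_eq_sin_div_cos]
    field_simp
    ring
  have hneg {y : ℝ} (hy : y = Real.sin (Real.pi / 3)) : -(h / Real.cos u) ^ 2 * y < 0 := by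
    rw [hy]
    have : 0 < (h / Real.cos u) ^ 2 := by positivity
    nlinarith
  have hsc : starCenter h θ = h * Real.tan u := rfl
  rw [hsc]
  refine ⟨?_, ?_⟩
  · rw [show refl ((-(h * Real.tan u) : ℝ) : ℂ) = ((h * Real.tan u : ℝ) : ℂ) by
      apply Complex.ext <;> simp, key _ _ (Or.inl rfl)]
    apply hneg
    have : Real.pi / 3 = 2 * Real.pi / 3 - θ - 2 * u := by rw [hu]; ring
    rw [this, Real.sin_sub (2 * Real.pi / 3 - θ), Real.sin_two_mul, Real.tan_eq_sin_div_cos]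
    field_simp
  · rw [key _ _ (Or.inr rfl)]
    apply hneg
    have : Real.pi / 3 = θ + 2 * u := by rw [hu]; ring
    rw [this, Real.sin_add, Real.sin_two_mul, Real.tan_eq_sin_div_cos]
    field_simp
    ring

lemma center_mem_rightChamber (hh : 0 < h) (hθ : |θ| < Real.pi / 3) :
    ((starCenter h (-θ) : ℝ) : ℂ) ∈ rightChamber h θ := by
  have := center_mem_leftChamber hh (θ := -θ) (by rwa [abs_neg])
  change refl _ ∈ leftChamber h (-θ)
  convert this using 1
  apply Complex.ext <;> simp

lemma isBounded_leftChamber (hh : 0 < h) (hθ : |θ| < Real.pi / 3) :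
    Bornology.IsBounded (leftChamber h θ) := by
  have hp := Real.pi_pos
  obtain ⟨b1, b2⟩ := abs_lt.1 hθ
  have hs : 0 < Real.sin (2 * Real.pi / 3 - θ) :=
    Real.sin_pos_of_pos_of_lt_pi (by linarith) (by linarith)
  refine isBounded_iff_forall_norm_le.2 ⟨‖(arcCenter h (2 * Real.pi / 3 - θ) : ℂ)‖ +
    h / Real.sin (2 * Real.pi / 3 - θ), fun z hz => ?_⟩
  have h1 := (mem_ball_iff_circleFun hh hs (refl z)).2 hz.1
  rw [← norm_refl z]
  linarith [norm_le_norm_add_norm_sub' (refl z) (arcCenter h (2 * Real.pi / 3 - θ) : ℂ)]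

lemma rightChamber_eq_image : rightChamber h θ = refl '' leftChamber h (-θ) := by
  ext z
  constructor
  · intro hz
    exact ⟨refl z, hz, refl_refl z⟩
  · rintro ⟨w, hw, rfl⟩
    change refl (refl w) ∈ leftChamber h (-θ)
    rwa [refl_refl]

lemma isBounded_rightChamber (hh : 0 < h) (hθ : |θ| < Real.pi / 3) :
    Bornology.IsBounded (rightChamber h θ) := by
  rw [rightChamber_eq_image]
  obtain ⟨M, hM⟩ := isBounded_iff_forall_norm_le.1
    (isBounded_leftChamber hh (θ := -θ) (by rwa [abs_neg]))
  refine isBounded_iff_forall_norm_le.2 ⟨M, ?_⟩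
  rintro _ ⟨w, hw, rfl⟩
  rw [norm_refl]
  exact hM w hw

lemma isOpen_rightChamber : IsOpen (rightChamber h θ) :=
  isOpen_leftChamber.preimage continuous_refl

lemma disjoint_chambers : Disjoint (leftChamber h θ) (rightChamber h θ) := by
  rw [Set.disjoint_left]
  rintro z ⟨_, h1⟩ ⟨_, h2⟩
  rw [circleFun_refl, neg_neg, neg_neg_iff_pos] at h2
  exact h1.not_gt h2

/-- The classification of chambers bounded by a network applies to the model itself. The exchanged
alternative is excluded because the left chamber and the left region are open and share the point
`-starCenter h θ`. -/
lemma chambers_ae_eq (hh : 0 < h) (hθ : |θ| < Real.pi / 3) :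
    leftChamber h θ =ᵐ[volume] starRegion (-starCenter h θ)
      (curvePair (leftArc h θ) (midArc h θ) (2 * Real.pi / 3 - θ) h) ∧
    rightChamber h θ =ᵐ[volume] starRegion (starCenter h (-θ))
      (curvePair (midArc h θ) (rightArc h θ) h (2 * Real.pi / 3 + θ)) := by
  have T := starTrio_reference hh hθ
  have hf := union_subset_iff.1 (frontier_chambers_subset hh hθ)
  refine (T.ae_eq_or_ae_eq hf.1 hf.2 (isBounded_leftChamber hh hθ).measure_lt_top
    (isBounded_rightChamber hh hθ).measure_lt_top
    (isOpen_leftChamber.measure_pos volume ⟨_, center_mem_leftChamber hh hθ⟩).ne'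
    (isOpen_rightChamber.measure_pos volume ⟨_, center_mem_rightChamber hh hθ⟩).ne'
    (by rw [disjoint_chambers.inter_eq]; exact measure_empty)).resolve_right ?_
  rintro ⟨h1, -⟩
  have hopen := isOpen_leftChamber (h := h) (θ := θ) |>.inter T.left.isOpen_starRegion
  have hpos := hopen.measure_pos volume ⟨_, center_mem_leftChamber hh hθ, T.left.center_mem⟩
  have e := measure_congr (ae_eq_set_inter h1 (ae_eq_refl (starRegion (-starCenter h θ)
    (curvePair (leftArc h θ) (midArc h θ) (2 * Real.pi / 3 - θ) h))))
  rw [T.disjoint.symm.inter_eq, measure_empty] at e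
  exact hpos.ne' e

lemma hasBoundary_leftChamber (hh : 0 < h) (hθ : |θ| < Real.pi / 3) :
    HasBoundary (leftChamber h θ) (leftArc h θ) (midArc h θ) (2 * Real.pi / 3 - θ) h :=
  (starTrio_reference hh hθ).left.hasBoundary.congr (chambers_ae_eq hh hθ).1.symm

lemma hasBoundary_rightChamber (hh : 0 < h) (hθ : |θ| < Real.pi / 3) :
    HasBoundary (rightChamber h θ) (midArc h θ) (rightArc h θ) h (2 * Real.pi / 3 + θ) :=
  (starTrio_reference hh hθ).right.hasBoundary.congr (chambers_ae_eq hh hθ).2.symm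

lemma volume_leftChamber (hh : 0 < h) (hθ : |θ| < Real.pi / 3) :
    volume (leftChamber h θ) = ENNReal.ofReal (chamberArea h θ) := by
  have hp := Real.pi_pos
  obtain ⟨b1, b2⟩ := abs_lt.1 hθ
  have := (hasBoundary_leftChamber hh hθ).volume_real
  rw [areaFlux_leftArc hθ, areaFlux_midArc hh (by linarith)] at this
  rw [← ENNReal.ofReal_toReal (isBounded_leftChamber hh hθ).measure_lt_top.ne]
  congr 1
  change volume.real _ = _
  rw [this, chamberArea]
  ring

lemma volume_rightChamber (hh : 0 < h) (hθ : |θ| < Real.pi / 3) :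
    volume (rightChamber h θ) = ENNReal.ofReal (chamberArea h (-θ)) := by
  rw [rightChamber_eq_image, volume_image_refl, volume_leftChamber hh (by rwa [abs_neg])]

end Model

/-! ### Double bubbles bounded by the image of a network -/

section Similarity

variable {O : ℂ ≃ₗᵢ[ℝ] Plane} {v : Plane} {r : ℝ}

lemma totalPerimeter_eq (hr : 0 < r) (E : Chambers) :
    totalPerimeter E = ENNReal.ofReal r *
      ((perimC (similarity O v r hr.ne' ⁻¹' E.1 ∪ similarity O v r hr.ne' ⁻¹' E.2)ᶜ +
        perimC (similarity O v r hr.ne' ⁻¹' E.1) + perimC (similarity O v r hr.ne' ⁻¹' E.2)) / 2) := by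
  rw [totalPerimeter, exterior, perimeter_eq_perimC (O := O) (v := v) hr,
    perimeter_eq_perimC (O := O) (v := v) hr, perimeter_eq_perimC (O := O) (v := v) hr, ← mul_add,
    ← mul_add, mul_div_assoc, preimage_compl, preimage_union]

lemma totalPerimeter_placed {h θ : ℝ} (hh : 0 < h) (hθ : |θ| < Real.pi / 3) :
    totalPerimeter (placed O v h θ) = ENNReal.ofReal (referenceLength h θ) := by
  rw [totalPerimeter_eq (O := O) (v := v) one_pos, ENNReal.ofReal_one, one_mul]
  have T := starTrio_reference hh hθ
  have := T.sum_perimC (Or.inl (chambers_ae_eq hh hθ))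
  rw [placed, preimage_image_eq _ (similarity O v 1 one_ne_zero).injective,
    preimage_image_eq _ (similarity O v 1 one_ne_zero).injective, this, referenceLength]

lemma vol_placed {h θ : ℝ} (hh : 0 < h) (hθ : |θ| < Real.pi / 3) :
    vol (placed O v h θ) =
      (ENNReal.ofReal (chamberArea h θ), ENNReal.ofReal (chamberArea h (-θ))) := by
  rw [vol, placed, volume_preimage_similarity (O := O) (v := v) one_pos,
    volume_preimage_similarity (O := O) (v := v) one_pos]
  simp only [preimage_image_eq _ (similarity O v 1 one_ne_zero).injective, one_pow,
    ENNReal.ofReal_one, one_mul]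
  rw [volume_leftChamber hh hθ, volume_rightChamber hh hθ]

end Similarity

/-- The symmetric difference of a region with a rescaling of a reference region. -/
lemma exists_volume_symmDiff_smul_le {A : Set ℂ} {γl γr : ℝ → ℂ} {al ar : ℝ} (hal : 0 ≤ al)
    (har : 0 ≤ ar) (hA : MeasurableSet A) (bA : Bornology.IsBounded A) (cl : ContDiff ℝ 1 γl)
    (cr : ContDiff ℝ 1 γr) (bdA : HasBoundary A γl γr al ar) (top : γl al = γr ar)
    (bot : γl (-al) = γr (-ar)) :
    ∃ K > 0, ∀ (B : Set ℂ) (βl βr : ℝ → ℂ) (r Gl Gr : ℝ), MeasurableSet B →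
      Bornology.IsBounded B → ContDiff ℝ 1 βl → ContDiff ℝ 1 βr → HasBoundary B βl βr al ar →
      βl al = βr ar → βl (-al) = βr (-ar) → |r - 1| ≤ 1 / 4 → 0 ≤ Gl → 0 ≤ Gr →
      SweptAreaLE γl βl al Gl → SweptAreaLE γr βr ar Gr →
      volume (B ∆ ((fun z => r • z) ⁻¹' A)) ≤ ENNReal.ofReal (K * |r - 1| + Gl + Gr) := by
  have bound (γ : ℝ → ℂ) (hγ : ContDiff ℝ 1 γ) (a : ℝ) :
      ∃ M, ∀ s ∈ Icc (-a) a, ‖γ s‖ ≤ M ∧ ‖deriv γ s‖ ≤ M := by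
    obtain ⟨M₁, h₁⟩ := isCompact_Icc.exists_bound_of_continuousOn (s := Icc (-a) a)
      hγ.continuous.continuousOn
    obtain ⟨M₂, h₂⟩ := isCompact_Icc.exists_bound_of_continuousOn (s := Icc (-a) a)
      hγ.continuous_deriv_one.continuousOn
    exact ⟨max M₁ M₂, fun s hs => ⟨(h₁ s hs).trans (le_max_left _ _),
      (h₂ s hs).trans (le_max_right _ _)⟩⟩
  obtain ⟨Ml, hMl⟩ := bound γl cl al
  obtain ⟨Mr, hMr⟩ := bound γr cr ar
  refine ⟨1 + 8 * al * Ml ^ 2 + 8 * ar * Mr ^ 2, by positivity, ?_⟩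
  intro B βl βr r Gl Gr hB bB dl dr bdB tβ lβ hr gl gr ⟨φl, cφl, φl1, φl2, hl⟩ ⟨φr, cφr, φr1, φr2, hr'⟩
  have r0 : 3 / 4 ≤ r := by linarith [(abs_le.1 hr).1]
  have rpos : 0 < r := by linarith
  have hinv : |r⁻¹ - 1| ≤ 2 * |r - 1| := by
    have : r⁻¹ - 1 = -(r - 1) * r⁻¹ := by field_simp; ring
    rw [this, abs_mul, abs_neg, abs_of_pos (inv_pos.2 rpos), mul_comm]
    apply mul_le_mul_of_nonneg_right _ (abs_nonneg _)
    rw [inv_le_comm₀ rpos two_pos]; linarith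
  have hinv1 : |r⁻¹ - 1| ≤ 1 := hinv.trans (by linarith)
  have cont : Continuous fun z : ℂ => r • z := continuous_const_smul r
  have bA' : Bornology.IsBounded ((fun z : ℂ => r • z) ⁻¹' A) := by
    obtain ⟨M, hM⟩ := isBounded_iff_forall_norm_le.1 bA
    refine isBounded_iff_forall_norm_le.2 ⟨r⁻¹ * M, fun z hz => ?_⟩
    have := hM _ hz
    rw [norm_smul, Real.norm_of_nonneg rpos.le] at this
    rw [inv_mul_eq_div, le_div_iff₀ rpos]
    linarith
  -- Triangle inequality through `A`: first `B` against `A`, whose arcs are reparametrised to match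
  -- the sweeps, then `A` against its dilate.
  have h1 := volume_symmDiff_le hal har hA hB bA bB (cl.comp cφl) (cr.comp cφr) dl dr
    (bdA.comp cl cr cφl cφr φl1 φl2 φr1 φr2) bdB (by simp [φl1, φr1, top]) tβ
    (by simp [φl2, φr2, bot]) lβ
  have h2 := volume_symmDiff_le hal har hA (hA.preimage cont.measurable) bA bA' cl cr
    (cl.const_smul r⁻¹) (cr.const_smul r⁻¹) bdA (bdA.preimage_smul cl cr rpos) top
    (by simp [top]) bot (by simp [bot])
  have h3 := volume_sweptRegion_smul_le cl hal hMl hinv1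
  have h4 := volume_sweptRegion_smul_le cr har hMr hinv1
  calc volume (B ∆ ((fun z => r • z) ⁻¹' A))
      ≤ volume (B ∆ A) + volume (A ∆ ((fun z => r • z) ⁻¹' A)) := measure_symmDiff_le _ _ _
    _ ≤ (ENNReal.ofReal Gl + ENNReal.ofReal Gr) + (ENNReal.ofReal (4 * al * Ml ^ 2 * |r⁻¹ - 1|) +
        ENNReal.ofReal (4 * ar * Mr ^ 2 * |r⁻¹ - 1|)) := by
      rw [symmDiff_comm]
      exact add_le_add (h1.trans (add_le_add hl hr')) (h2.trans (add_le_add h3 h4))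
    _ ≤ _ := by
      rw [← ENNReal.ofReal_add gl gr, ← ENNReal.ofReal_add (by positivity) (by positivity),
        ← ENNReal.ofReal_add (by positivity) (by positivity)]
      apply ENNReal.ofReal_le_ofReal
      have e1 := mul_le_mul_of_nonneg_left hinv (by positivity : 0 ≤ 4 * al * Ml ^ 2)
      have e2 := mul_le_mul_of_nonneg_left hinv (by positivity : 0 ≤ 4 * ar * Mr ^ 2)
      linarith [abs_nonneg (r - 1)]

/-! ### The areas of nearby networks -/

lemma exists_areaFlux_close {γ : ℝ → ℂ} (hγ : ContDiff ℝ 1 γ) {a : ℝ} (ha : 0 ≤ a) {ε : ℝ} (hε : 0 < ε) :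
    ∃ δ > 0, ∀ β : ℝ → ℂ, ContDiff ℝ 1 β → IsC1Close β γ a δ →
      |areaFlux β a - areaFlux γ a| ≤ ε := by
  obtain ⟨M₁, h₁⟩ := isCompact_Icc.exists_bound_of_continuousOn (s := Icc (-a) a)
    hγ.continuous.continuousOn
  obtain ⟨M₂, h₂⟩ := isCompact_Icc.exists_bound_of_continuousOn (s := Icc (-a) a)
    hγ.continuous_deriv_one.continuousOn
  have z : (0 : ℝ) ∈ Icc (-a) a := ⟨by linarith, ha⟩
  have p₁ := (norm_nonneg _).trans (h₁ 0 z)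
  have p₂ := (norm_nonneg _).trans (h₂ 0 z)
  set δ := min 1 (ε / ((M₁ + M₂ + 1) * (2 * a + 1))) with hδ
  have hδ0 : 0 < δ := by positivity
  refine ⟨δ, hδ0, fun β hβ H => ?_⟩
  have c₁ := hγ.continuous
  have c₂ := hγ.continuous_deriv_one
  have c₃ := hβ.continuous
  have c₄ := hβ.continuous_deriv_one
  rw [areaFlux, areaFlux, ← intervalIntegral.integral_sub
    ((by fun_prop : Continuous _).intervalIntegrable _ _)
    ((by fun_prop : Continuous _).intervalIntegrable _ _)]
  have hb := intervalIntegral.norm_integral_le_of_norm_le_const (a := -a) (b := a)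
    (f := fun s => (β s).re * (deriv β s).im - (γ s).re * (deriv γ s).im) (C := (M₁ + M₂ + 1) * δ)
    (fun s hs => by
      rw [uIoc_of_le (by linarith)] at hs
      have hs' : s ∈ Icc (-a) a := ⟨hs.1.le, hs.2⟩
      obtain ⟨k₁, k₂⟩ := H s hs'
      have e : (β s).re * (deriv β s).im - (γ s).re * (deriv γ s).im =
          (β s - γ s).re * (deriv β s - deriv γ s).im + (β s - γ s).re * (deriv γ s).im +
            (γ s).re * (deriv β s - deriv γ s).im := by
        simp only [Complex.sub_re, Complex.sub_im]; ring
      rw [e, Real.norm_eq_abs]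
      refine (abs_add_three _ _ _).trans ?_
      rw [abs_mul, abs_mul, abs_mul]
      have x₁ := (Complex.abs_re_le_norm _).trans k₁
      have x₂ := (Complex.abs_im_le_norm _).trans k₂
      have x₃ := (Complex.abs_im_le_norm _).trans (h₂ s hs')
      have x₄ := (Complex.abs_re_le_norm _).trans (h₁ s hs')
      have y₁ := mul_le_mul x₁ x₂ (abs_nonneg _) hδ0.le
      have y₂ := mul_le_mul x₁ x₃ (abs_nonneg _) hδ0.le
      have y₃ := mul_le_mul x₄ x₂ (abs_nonneg _) p₁
      have : δ * δ ≤ 1 * δ := mul_le_mul_of_nonneg_right (min_le_left _ _) hδ0.le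
      linarith)
  rw [← Real.norm_eq_abs]
  refine hb.trans ?_
  have hδ2 : δ ≤ ε / ((M₁ + M₂ + 1) * (2 * a + 1)) := min_le_right _ _
  rw [le_div_iff₀ (by positivity)] at hδ2
  rw [sub_neg_eq_add, abs_of_nonneg (by linarith)]
  have : 0 ≤ δ * (M₁ + M₂ + 1) := by positivity
  linarith

lemma abs_inv_sq_sub_one_le {r : ℝ} (hr : |r - 1| ≤ 1 / 4) : |r⁻¹ ^ 2 - 1| ≤ 4 * |r - 1| := by
  have hr' := abs_le.1 hr
  have r0 : 0 < r := by linarith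
  have e : r⁻¹ ^ 2 - 1 = -(r - 1) * ((1 + r) / r ^ 2) := by
    field_simp
    ring
  rw [e, abs_mul, abs_neg, mul_comm, abs_of_pos (by positivity : 0 < (1 + r) / r ^ 2)]
  apply mul_le_mul_of_nonneg_right _ (abs_nonneg _)
  rw [div_le_iff₀ (by positivity)]
  nlinarith

/-- If the chambers can be exchanged by a small deformation, then the double bubble is symmetric. -/
lemma exists_eq_zero_of_swap {h θ : ℝ} (hh : 0 < h) (hθ : |θ| < Real.pi / 3) :
    ∃ δ > 0, ∀ (r : ℝ) (β₀ β₂ : ℝ → ℂ), |r - 1| ≤ δ → ContDiff ℝ 1 β₀ → ContDiff ℝ 1 β₂ →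
      IsC1Close β₀ (midArc h θ) h δ → IsC1Close β₂ (rightArc h θ) (2 * Real.pi / 3 + θ) δ →
      areaFlux β₂ (2 * Real.pi / 3 + θ) - areaFlux β₀ h = chamberArea h θ * r⁻¹ ^ 2 → θ = 0 := by
  have hp := Real.pi_pos
  obtain ⟨b1, b2⟩ := abs_lt.1 hθ
  by_cases hM : chamberArea h θ = chamberArea h (-θ)
  · exact ⟨1, one_pos, fun _ _ _ _ _ _ _ _ _ => eq_zero_of_chamberArea_eq hh hθ hM⟩
  have T := starTrio_reference hh hθ
  have hA := chamberArea_pos hh hθ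
  set d := |chamberArea h θ - chamberArea h (-θ)| with hd
  have hd0 : 0 < d := abs_pos.2 (sub_ne_zero.2 hM)
  obtain ⟨δ₀, k₀, H₀⟩ := exists_areaFlux_close T.left.right.contDiff hh.le (ε := d / 4) (by positivity)
  obtain ⟨δ₂, k₂, H₂⟩ := exists_areaFlux_close T.right.right.contDiff T.right.right.pos.le (ε := d / 4)
    (by positivity)
  -- Three errors of size `d / 4`, two from the areas of the arcs and one from the factor `r⁻²`,
  -- cannot bridge the difference `d` of the two chamber areas.
  refine ⟨min (min δ₀ δ₂) (min (1 / 4) (d / (16 * chamberArea h θ))), by positivity,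
    fun r β₀ β₂ hr c₀ c₂ l₀ l₂ e => ?_⟩
  exfalso
  have n₀ := abs_le.1 (H₀ β₀ c₀ (l₀.mono ((min_le_left _ _).trans (min_le_left _ _))))
  have n₂ := abs_le.1 (H₂ β₂ c₂ (l₂.mono ((min_le_left _ _).trans (min_le_right _ _))))
  have hr1 : |r - 1| ≤ 1 / 4 := hr.trans ((min_le_right _ _).trans (min_le_left _ _))
  have hr2 : |r - 1| ≤ d / (16 * chamberArea h θ) :=
    hr.trans ((min_le_right _ _).trans (min_le_right _ _))
  have hx := abs_inv_sq_sub_one_le hr1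
  rw [le_div_iff₀ (by positivity)] at hr2
  have hv : areaFlux (rightArc h θ) (2 * Real.pi / 3 + θ) - areaFlux (midArc h θ) h =
      chamberArea h (-θ) := by
    have A₂ : areaFlux (rightArc h θ) (2 * Real.pi / 3 + θ) = _ :=
      areaFlux_outerArc (by linarith) (by linarith)
    rw [A₂, areaFlux_midArc hh (by linarith), chamberArea_neg]
    ring
  have hxM : |chamberArea h θ * (r⁻¹ ^ 2 - 1)| ≤ d / 4 := by
    rw [abs_mul, abs_of_pos hA]
    have := mul_le_mul_of_nonneg_left hx hA.le
    linarith
  have hxM' := abs_le.1 hxM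
  have : d ≤ 3 / 4 * d := by
    conv_lhs => rw [hd]
    rw [abs_le]
    constructor <;> linarith [n₀.1, n₀.2, n₂.1, n₂.2]
  linarith

/-! ### Transport of the estimates to the plane -/

lemma exists_isometryEquiv (O O' : ℂ ≃ₗᵢ[ℝ] Plane) (v v' : Plane) :
    ∃ g : Plane ≃ᵢ Plane, ∀ z, g (similarity O v 1 one_ne_zero z) = similarity O' v' 1 one_ne_zero z := by
  refine ⟨((IsometryEquiv.addLeft (-v)).trans (O.symm.trans O').toIsometryEquiv).trans
    (IsometryEquiv.addLeft v'), fun z => ?_⟩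
  simp [similarity_apply]

lemma volume_symmDiff_similarity {O : ℂ ≃ₗᵢ[ℝ] Plane} {v : Plane} {r : ℝ} (hr : 0 < r) (E : Set Plane)
    (X : Set ℂ) : volume (E ∆ (similarity O v 1 one_ne_zero '' X)) = ENNReal.ofReal (r ^ 2) *
      volume ((similarity O v r hr.ne' ⁻¹' E) ∆ ((fun z => r • z) ⁻¹' X)) := by
  have e : similarity O v r hr.ne' ⁻¹' (similarity O v 1 one_ne_zero '' X) = (fun z => r • z) ⁻¹' X := by
    ext z
    simp only [mem_preimage]
    rw [show similarity O v r hr.ne' z = similarity O v 1 one_ne_zero (r • z) by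
      simp [similarity_apply], (similarity O v 1 one_ne_zero).injective.mem_set_image]
  rw [volume_preimage_similarity (O := O) (v := v) hr, preimage_symmDiff, e]

lemma asymmetry_nonneg (E₀ E : Chambers) : 0 ≤ asymmetry E₀ E :=
  Real.iInf_nonneg fun _ => add_nonneg (div_nonneg measureReal_nonneg measureReal_nonneg)
    (div_nonneg measureReal_nonneg measureReal_nonneg)

lemma asymmetry_le (E₀ E : Chambers) (g : Plane ≃ᵢ Plane) :
    asymmetry E₀ E ≤ bubbleDist E (isometryImage g E₀) :=
  ciInf_le ⟨0, by
    rintro _ ⟨g, rfl⟩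
    exact add_nonneg (div_nonneg measureReal_nonneg measureReal_nonneg)
      (div_nonneg measureReal_nonneg measureReal_nonneg)⟩ g

lemma rightChamber_zero (h : ℝ) : refl '' leftChamber h 0 = rightChamber h 0 := by
  rw [rightChamber_eq_image, neg_zero]

lemma refl_image_rightChamber_zero (h : ℝ) : refl '' rightChamber h 0 = leftChamber h 0 := by
  rw [← rightChamber_zero, image_image]
  simp

/-- Both regions of a network close to the reference network are compared with the rescaled
reference chambers. -/
lemma asymmetry_placed_le {h θ : ℝ} {O O' : ℂ ≃ₗᵢ[ℝ] Plane} {v v' : Plane} {r : ℝ}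
    (hr : 0 < r) {E : Chambers} {Ω₁ Ω₂ : Set ℂ}
    (hΩ : (similarity O' v' r hr.ne' ⁻¹' E.1 =ᵐ[volume] Ω₁ ∧
        similarity O' v' r hr.ne' ⁻¹' E.2 =ᵐ[volume] Ω₂) ∨
      (θ = 0 ∧ similarity O' v' r hr.ne' ⁻¹' E.1 =ᵐ[volume] Ω₂ ∧
        similarity O' v' r hr.ne' ⁻¹' E.2 =ᵐ[volume] Ω₁))
    {V₁ V₂ M₁ M₂ : ℝ} (p₁ : 0 ≤ V₁) (p₂ : 0 ≤ V₂) (q₁ : 0 < M₁) (q₂ : 0 < M₂)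
    (hV₁ : volume (Ω₁ ∆ ((fun z => r • z) ⁻¹' leftChamber h θ)) ≤ ENNReal.ofReal V₁)
    (hV₂ : volume (Ω₂ ∆ ((fun z => r • z) ⁻¹' rightChamber h θ)) ≤ ENNReal.ofReal V₂)
    (m₁ : volume.real E.1 = M₁) (m₂ : volume.real E.2 = M₂) :
    asymmetry (placed O v h θ) E ≤ r ^ 2 * ((V₁ + V₂) * (M₁⁻¹ + M₂⁻¹)) := by
  have bound {F : Set Plane} {Ω X : Set ℂ} {V : ℝ} (p : 0 ≤ V)
      (hF : similarity O' v' r hr.ne' ⁻¹' F =ᵐ[volume] Ω)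
      (hV : volume (Ω ∆ ((fun z => r • z) ⁻¹' X)) ≤ ENNReal.ofReal V) :
      volume.real (F ∆ (similarity O' v' 1 one_ne_zero '' X)) ≤ r ^ 2 * V := by
    refine ENNReal.toReal_le_of_le_ofReal (by positivity) ?_
    have e := measure_congr (ae_eq_set_symmDiff hF (ae_eq_refl ((fun z => r • z) ⁻¹' X)))
    rw [volume_symmDiff_similarity hr, ENNReal.ofReal_mul (by positivity)]
    gcongr
    exact e.trans_le hV
  have final {D₁ D₂ : ℝ} (hD : (D₁ ≤ r ^ 2 * V₁ ∧ D₂ ≤ r ^ 2 * V₂) ∨ (D₁ ≤ r ^ 2 * V₂ ∧ D₂ ≤ r ^ 2 * V₁)) :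
      D₁ / M₁ + D₂ / M₂ ≤ r ^ 2 * ((V₁ + V₂) * (M₁⁻¹ + M₂⁻¹)) := by
    have i₁ := inv_pos.2 q₁
    have i₂ := inv_pos.2 q₂
    have hr2 : 0 ≤ r ^ 2 := sq_nonneg r
    have w₁ := mul_nonneg hr2 p₁
    have w₂ := mul_nonneg hr2 p₂
    rw [div_eq_mul_inv, div_eq_mul_inv]
    have k₁ : D₁ ≤ r ^ 2 * V₁ + r ^ 2 * V₂ := by rcases hD with h | h <;> linarith [h.1]
    have k₂ : D₂ ≤ r ^ 2 * V₁ + r ^ 2 * V₂ := by rcases hD with h | h <;> linarith [h.2]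
    have t₁ := mul_le_mul_of_nonneg_right k₁ i₁.le
    have t₂ := mul_le_mul_of_nonneg_right k₂ i₂.le
    linarith
  rcases hΩ with ⟨h₁, h₂⟩ | ⟨rfl, h₁, h₂⟩
  · obtain ⟨g, hg⟩ := exists_isometryEquiv O O' v v'
    refine (asymmetry_le _ _ g).trans ?_
    rw [bubbleDist, isometryImage, placed, image_image, image_image, m₁, m₂]
    simp_rw [hg]
    exact final (Or.inl ⟨bound p₁ h₁ hV₁, bound p₂ h₂ hV₂⟩)
  -- For `θ = 0` the reflection exchanges the model chambers, so composing with it gives an isometry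
  -- that matches the exchanged regions.
  · obtain ⟨g, hg⟩ := exists_isometryEquiv O (reflIsometry.trans O') v v'
    have hg' (z : ℂ) : g (similarity O v 1 one_ne_zero z) = similarity O' v' 1 one_ne_zero (refl z) := by
      rw [hg]
      simp [similarity_apply, reflIsometry_apply]
    refine (asymmetry_le _ _ g).trans ?_
    rw [bubbleDist, isometryImage, placed, image_image, image_image, m₁, m₂]
    simp_rw [hg']
    rw [← image_image (similarity O' v' 1 one_ne_zero) refl, rightChamber_zero,
      ← image_image (similarity O' v' 1 one_ne_zero) refl, refl_image_rightChamber_zero]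
    exact final (Or.inr ⟨bound p₂ h₁ hV₂, bound p₁ h₂ hV₁⟩)

lemma measureReal_eq_mul_of_volume_eq {O : ℂ ≃ₗᵢ[ℝ] Plane} {v : Plane} {r M : ℝ} (hr : 0 < r)
    (hM : 0 ≤ M) {F : Set Plane} (hF : volume F = ENNReal.ofReal M) :
    volume.real (similarity O v r hr.ne' ⁻¹' F) = M * r⁻¹ ^ 2 := by
  have h := congrArg ENNReal.toReal (volume_preimage_similarity (O := O) (v := v) hr F)
  rw [hF, ENNReal.toReal_mul, ENNReal.toReal_ofReal hM, ENNReal.toReal_ofReal (by positivity)] at h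
  rw [h, Measure.real]
  field_simp

/-- A double bubble bounded by the image of a network under a similarity consists of the images of
the two regions of the network. -/
lemma StarTrio.preimage_ae_eq {o₁ o₂ h a₁ a₀ a₂ : ℝ} {γ₁ γ₀ γ₂ : ℝ → ℂ}
    (H : StarTrio o₁ o₂ h γ₁ γ₀ γ₂ a₁ a₀ a₂) {O : ℂ ≃ₗᵢ[ℝ] Plane} {v : Plane} {r : ℝ} (hr : 0 < r)
    {E : Chambers} (hE : IsDoubleBubble E)
    (hb : boundary E ⊆ similarity O v r hr.ne' '' network γ₁ γ₀ γ₂ a₁ a₀ a₂) :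
    (similarity O v r hr.ne' ⁻¹' E.1 =ᵐ[volume] starRegion o₁ (curvePair γ₁ γ₀ a₁ a₀) ∧
        similarity O v r hr.ne' ⁻¹' E.2 =ᵐ[volume] starRegion o₂ (curvePair γ₀ γ₂ a₀ a₂)) ∨
      (similarity O v r hr.ne' ⁻¹' E.1 =ᵐ[volume] starRegion o₂ (curvePair γ₀ γ₂ a₀ a₂) ∧
        similarity O v r hr.ne' ⁻¹' E.2 =ᵐ[volume] starRegion o₁ (curvePair γ₁ γ₀ a₁ a₀)) := by
  have hr2 : ENNReal.ofReal (r ^ 2) ≠ 0 := (ENNReal.ofReal_pos.2 (by positivity)).ne'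
  have front {F : Set Plane} (hF : frontier F ⊆ boundary E) :
      frontier (similarity O v r hr.ne' ⁻¹' F) ⊆ network γ₁ γ₀ γ₂ a₁ a₀ a₂ := by
    rw [← Homeomorph.preimage_frontier]
    intro z hz
    obtain ⟨w, hw, e⟩ := hb (hF hz)
    rwa [← (similarity O v r hr.ne').injective e]
  have vol (F : Set Plane) := volume_preimage_similarity (O := O) (v := v) hr F
  have lt_top {F : Set Plane} (hF : volume F < ⊤) : volume (similarity O v r hr.ne' ⁻¹' F) < ⊤ := by
    rw [vol] at hF
    exact ENNReal.lt_top_of_mul_ne_top_right hF.ne hr2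
  have ne_zero {F : Set Plane} (hF : 0 < volume F) : volume (similarity O v r hr.ne' ⁻¹' F) ≠ 0 := by
    rw [vol] at hF
    exact right_ne_zero_of_mul hF.ne'
  refine H.ae_eq_or_ae_eq (front subset_union_left) (front subset_union_right) (lt_top hE.area₁_lt_top)
    (lt_top hE.area₂_lt_top) (ne_zero hE.area₁_pos) (ne_zero hE.area₂_pos) ?_
  have := hE.area_inter
  rw [vol, preimage_inter] at this
  exact (mul_eq_zero.1 this).resolve_left hr2

/-- Stability of the standard double bubble with given parameters, in any position. -/
theorem exists_stability_placed {h θ : ℝ} (hh : 0 < h) (hθ : |θ| < Real.pi / 3) :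
    ∃ κ η : ℝ, 0 < κ ∧ 0 < η ∧ ∀ (O : ℂ ≃ₗᵢ[ℝ] Plane) (v : Plane) (E : Chambers), IsDoubleBubble E →
      vol E = vol (placed O v h θ) → ∀ f : Plane → Plane, IsC11Diffeo (placed O v h θ) E f →
      c1Norm (placed O v h θ) (fun x => f x - x) < ENNReal.ofReal η →
      κ * asymmetry (placed O v h θ) E ^ 2 ≤ deficit (placed O v h θ) E := by
  have T := starTrio_reference hh hθ
  obtain ⟨C, η₀, hC, hη₀, curves⟩ := exists_curves hh hθ
  obtain ⟨δ₁, hδ₁, stable⟩ := T.exists_stable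
  obtain ⟨δ₂, hδ₂, c, hc, length⟩ := exists_length_ge hh hθ
  obtain ⟨δ₃, hδ₃, swap⟩ := exists_eq_zero_of_swap hh hθ
  obtain ⟨K₁, hK₁, diff₁⟩ := exists_volume_symmDiff_smul_le T.left.left.pos.le T.left.right.pos.le
    isOpen_leftChamber.measurableSet (isBounded_leftChamber hh hθ) T.left.left_contDiff
    T.left.right.contDiff (hasBoundary_leftChamber hh hθ)
    (T.left.left_top.trans T.left.right_top.symm) (T.left.left_bot.trans T.left.right_bot.symm)
  obtain ⟨K₂, hK₂, diff₂⟩ := exists_volume_symmDiff_smul_le T.right.left.pos.le T.right.right.pos.le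
    isOpen_rightChamber.measurableSet (isBounded_rightChamber hh hθ) T.right.left_contDiff
    T.right.right.contDiff (hasBoundary_rightChamber hh hθ)
    (T.right.left_top.trans T.right.right_top.symm) (T.right.left_bot.trans T.right.right_bot.symm)
  have M₁ := chamberArea_pos hh hθ
  have M₂ := chamberArea_pos hh (θ := -θ) (by rwa [abs_neg])
  set L := referenceLength h θ with hLdef
  have hL : 0 < L := by
    have hp := Real.pi_pos
    obtain ⟨b1, b2⟩ := abs_lt.1 hθ
    have s1 := Real.sin_pos_of_pos_of_lt_pi (x := 2 * Real.pi / 3 - θ) (by linarith) (by linarith)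
    have s2 := Real.sin_pos_of_pos_of_lt_pi (x := 2 * Real.pi / 3 + θ) (by linarith) (by linarith)
    rw [hLdef, referenceLength_eq hh hθ]
    positivity
  -- The factor 4 bounds `r²`; the 2 is there because the area swept by the middle arc enters the
  -- differences of both chambers.
  set Q := 4 * (K₁ + K₂ + 2) * ((chamberArea h θ)⁻¹ + (chamberArea h (-θ))⁻¹) with hQ
  have hQ0 : 0 < Q := by positivity
  set δ := min (min δ₁ δ₂) (min δ₃ (1 / 4)) with hδ
  have hδ0 : 0 < δ := by positivity
  have l₁ : δ ≤ δ₁ := (min_le_left _ _).trans (min_le_left _ _)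
  have l₂ : δ ≤ δ₂ := (min_le_left _ _).trans (min_le_right _ _)
  have l₃ : δ ≤ δ₃ := (min_le_right _ _).trans (min_le_left _ _)
  have l₄ : δ ≤ 1 / 4 := (min_le_right _ _).trans (min_le_right _ _)
  refine ⟨c / (L * Q ^ 2), min η₀ (δ / C), by positivity, by positivity, ?_⟩
  intro O v E hE hvol f hf hnorm
  obtain ⟨r, hr, O', v', β₁, β₀, β₂, hr1, d₁, d₀, d₂, n₁, n₀, n₂, t₁, u₁, t₀, u₀, t₂, u₂, hb⟩ :=
    curves _ (by positivity) (min_le_left _ _) O v E f hf hnorm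
  have hCδ : C * min η₀ (δ / C) ≤ δ := by
    have := mul_le_mul_of_nonneg_left (min_le_right η₀ (δ / C)) hC.le
    rwa [mul_div_cancel₀ _ hC.ne'] at this
  replace hr1 := hr1.trans hCδ
  replace n₁ := n₁.mono hCδ
  replace n₀ := n₀.mono hCδ
  replace n₂ := n₂.mono hCδ
  have T' := stable β₁ β₀ β₂ d₁ d₀ d₂ (n₁.mono l₁) (n₀.mono l₁) (n₂.mono l₁) t₁ u₁ t₀ u₀ t₂ u₂
  have hae := T'.preimage_ae_eq hr hE hb
  rw [vol_placed hh hθ] at hvol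
  have v₁ : volume E.1 = _ := congrArg Prod.fst hvol
  have v₂ : volume E.2 = _ := congrArg Prod.snd hvol
  have w₁ := measureReal_eq_mul_of_volume_eq (O := O') (v := v') hr M₁.le v₁
  have w₂ := measureReal_eq_mul_of_volume_eq (O := O') (v := v') hr M₂.le v₂
  have f₁ := T'.left.hasBoundary.volume_real
  have f₂ := T'.right.hasBoundary.volume_real
  have hperim := T'.sum_perimC hae
  set Ω₁ := starRegion (-starCenter h θ) (curvePair β₁ β₀ (2 * Real.pi / 3 - θ) h) with hΩ₁
  set Ω₂ := starRegion (starCenter h (-θ)) (curvePair β₀ β₂ h (2 * Real.pi / 3 + θ)) with hΩ₂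
  have hΩ : ((similarity O' v' r hr.ne' ⁻¹' E.1 =ᵐ[volume] Ω₁ ∧
        similarity O' v' r hr.ne' ⁻¹' E.2 =ᵐ[volume] Ω₂) ∨
      (θ = 0 ∧ similarity O' v' r hr.ne' ⁻¹' E.1 =ᵐ[volume] Ω₂ ∧
        similarity O' v' r hr.ne' ⁻¹' E.2 =ᵐ[volume] Ω₁)) := by
    refine hae.imp_right fun H => ⟨?_, H⟩
    refine swap r β₀ β₂ (hr1.trans l₃) d₀ d₂ (n₀.mono l₃) (n₂.mono l₃) ?_
    rw [← f₂, ← measureReal_congr H.1, w₁]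
  have areas : volume.real Ω₁ = chamberArea h θ * r⁻¹ ^ 2 ∧
      volume.real Ω₂ = chamberArea h (-θ) * r⁻¹ ^ 2 := by
    rcases hΩ with ⟨h1, h2⟩ | ⟨h0, h1, h2⟩
    · exact ⟨by rw [← measureReal_congr h1, w₁], by rw [← measureReal_congr h2, w₂]⟩
    · have e : chamberArea h θ = chamberArea h (-θ) := by rw [h0, neg_zero]
      exact ⟨by rw [← measureReal_congr h2, w₂, e], by rw [← measureReal_congr h1, w₁, e]⟩
  obtain ⟨G₁, G₀, G₂, g₁, g₀, g₂, s₁, s₀, s₂, hlen⟩ := length r β₁ β₀ β₂ (hr1.trans l₂) d₁ d₀ d₂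
    (n₁.mono l₂) (n₀.mono l₂) (n₂.mono l₂) t₁ u₁ t₀ u₀ t₂ u₂ (by rw [← f₁, areas.1])
    (by rw [← f₂, areas.2])
  have hr4 : |r - 1| ≤ 1 / 4 := hr1.trans l₄
  have D₁ := diff₁ Ω₁ β₁ β₀ r G₁ G₀ T'.left.measurableSet_starRegion T'.left.isBounded_starRegion d₁ d₀
    T'.left.hasBoundary (t₁.trans t₀.symm) (u₁.trans u₀.symm) hr4 g₁ g₀ s₁ s₀
  have D₂ := diff₂ Ω₂ β₀ β₂ r G₀ G₂ T'.right.measurableSet_starRegion T'.right.isBounded_starRegion d₀ d₂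
    T'.right.hasBoundary (t₀.trans t₂.symm) (u₀.trans u₂.symm) hr4 g₀ g₂ s₀ s₂
  have hasym := asymmetry_placed_le (O := O) (v := v) hr hΩ (by positivity) (by positivity) M₁ M₂ D₁ D₂
    (by rw [Measure.real, v₁, ENNReal.toReal_ofReal M₁.le])
    (by rw [Measure.real, v₂, ENNReal.toReal_ofReal M₂.le])
  set S := |r - 1| + G₁ + G₀ + G₂ with hS
  have hasym' : asymmetry (placed O v h θ) E ≤ Q * S := by
    refine hasym.trans ?_
    have hr2 : r ^ 2 ≤ 4 := by
      have := (abs_le.1 hr4).2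
      nlinarith
    have hsum : K₁ * |r - 1| + G₁ + G₀ + (K₂ * |r - 1| + G₀ + G₂) ≤ (K₁ + K₂ + 2) * S := by
      have : 0 ≤ (K₁ + K₂) * (G₁ + G₀ + G₂) := by positivity
      have := abs_nonneg (r - 1)
      rw [hS]
      linarith
    have hi : 0 ≤ (chamberArea h θ)⁻¹ + (chamberArea h (-θ))⁻¹ := by positivity
    calc _ ≤ 4 * ((K₁ + K₂ + 2) * S * ((chamberArea h θ)⁻¹ + (chamberArea h (-θ))⁻¹)) :=
          mul_le_mul hr2 (mul_le_mul_of_nonneg_right hsum hi) (by positivity) (by norm_num)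
      _ = Q * S := by rw [hQ]; ring
  have hlen0 : 0 ≤ arcLength β₁ (2 * Real.pi / 3 - θ) + arcLength β₀ h +
      arcLength β₂ (2 * Real.pi / 3 + θ) := add_nonneg (add_nonneg (arcLength_nonneg T.left.left.pos.le)
    (arcLength_nonneg hh.le)) (arcLength_nonneg T.right.right.pos.le)
  rw [deficit, totalPerimeter_placed hh hθ, totalPerimeter_eq (O := O') (v := v') hr, hperim,
    ENNReal.toReal_mul, ENNReal.toReal_ofReal hr.le, ENNReal.toReal_ofReal hlen0,
    ENNReal.toReal_ofReal hL.le]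
  have hsq : asymmetry (placed O v h θ) E ^ 2 ≤ (Q * S) ^ 2 :=
    pow_le_pow_left₀ (asymmetry_nonneg _ _) hasym' 2
  calc c / (L * Q ^ 2) * asymmetry (placed O v h θ) E ^ 2 ≤ c / (L * Q ^ 2) * (Q * S) ^ 2 :=
        mul_le_mul_of_nonneg_left hsq (by positivity)
    _ = c * S ^ 2 / L := by field_simp
    _ ≤ _ := by
      rw [div_sub_one hL.ne']
      exact div_le_div_of_nonneg_right hlen hL.le

/-- Stability of the standard double bubble among small `C^{1,1}` deformations. -/
theorem exists_stability {m₁ m₂ : ℝ} (hm₁ : 0 < m₁) (hm₁₂ : m₁ ≤ m₂) :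
    ∃ κ η : ℝ, 0 < κ ∧ 0 < η ∧
      ∀ E₀ : Chambers, IsStandardDoubleBubble E₀ →
        vol E₀ = (ENNReal.ofReal m₁, ENNReal.ofReal m₂) →
        ∀ E : Chambers, IsDoubleBubble E →
          vol E = vol E₀ →
          (∃ f : Plane → Plane,
            IsC11Diffeo E₀ E f ∧
            c1Norm E₀ (fun x => f x - x) < ENNReal.ofReal η) →
          κ * asymmetry E₀ E ^ 2 ≤ deficit E₀ E := by
  have hm₂ : 0 < m₂ := hm₁.trans_le hm₁₂
  have areas {h θ : ℝ} {O : ℂ ≃ₗᵢ[ℝ] Plane} {v : Plane} (hh : 0 < h) (hθ : |θ| < Real.pi / 3)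
      (e : vol (placed O v h θ) = (ENNReal.ofReal m₁, ENNReal.ofReal m₂)) :
      chamberArea h θ = m₁ ∧ chamberArea h (-θ) = m₂ := by
    rw [vol_placed hh hθ, Prod.mk.injEq] at e
    exact ⟨(ENNReal.ofReal_eq_ofReal_iff (chamberArea_pos hh hθ).le hm₁.le).1 e.1,
      (ENNReal.ofReal_eq_ofReal_iff (chamberArea_pos hh (by rwa [abs_neg])).le hm₂.le).1 e.2⟩
  -- The areas fix the parameters, and with them the constants. If no parameters realise these
  -- areas, the claim is vacuous and any constants do.
  by_cases hex : ∃ h θ : ℝ, 0 < h ∧ |θ| < Real.pi / 3 ∧ chamberArea h θ = m₁ ∧ chamberArea h (-θ) = m₂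
  · obtain ⟨h, θ, hh, hθ, e₁, e₂⟩ := hex
    obtain ⟨κ, η, hκ, hη, H⟩ := exists_stability_placed hh hθ
    refine ⟨κ, η, hκ, hη, ?_⟩
    rintro E₀ hE₀ hvol E hE hvolE ⟨f, hf, hnorm⟩
    obtain ⟨h', θ', O, v, hh', hθ', rfl⟩ := hE₀.exists_placed
    obtain ⟨e₁', e₂'⟩ := areas hh' hθ' hvol
    obtain ⟨rfl, rfl⟩ := eq_of_chamberArea_eq hh hθ hh' hθ' (e₁.trans e₁'.symm) (e₂.trans e₂'.symm)
    exact H O v E hE hvolE f hf hnorm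
  · refine ⟨1, 1, one_pos, one_pos, fun E₀ hE₀ hvol => ?_⟩
    obtain ⟨h, θ, O, v, hh, hθ, rfl⟩ := hE₀.exists_placed
    exact absurd ⟨h, θ, hh, hθ, areas hh hθ hvol⟩ hex

end PlanarBubble

end

theorem theorem2p1 (m₁ m₂ : ℝ) (hm₁ : 0 < m₁) (hm₁₂ : m₁ ≤ m₂) :
    ∃ κ η : ℝ, 0 < κ ∧ 0 < η ∧
      ∀ E₀ : PlanarBubble.Chambers, PlanarBubble.IsStandardDoubleBubble E₀ →
        PlanarBubble.vol E₀ = (ENNReal.ofReal m₁, ENNReal.ofReal m₂) →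
        ∀ E : PlanarBubble.Chambers, PlanarBubble.IsDoubleBubble E →
          PlanarBubble.vol E = PlanarBubble.vol E₀ →
          (∃ f : PlanarBubble.Plane → PlanarBubble.Plane,
            PlanarBubble.IsC11Diffeo E₀ E f ∧
            PlanarBubble.c1Norm E₀ (fun x => f x - x) < ENNReal.ofReal η) →
          κ * PlanarBubble.asymmetry E₀ E ^ 2 ≤ PlanarBubble.deficit E₀ E :=
  PlanarBubble.exists_stability hm₁ hm₁₂
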